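/- **Conventions.** All registers are finite-dimensional; $\phi^+$ denotes the maximally entangled state; a function of the security parameter $n$ is negligible if it is $o(n^{-c})$ for every $c$; $\|\cdot\|_\diamond$ is the diamond norm. A symmetric-key quantum encryption scheme $\Pi$ consists, for each $n$, of a key $k$ uniform on a finite set $\mathcal K$, channels $\mathsf{Enc}_k: M\to C$ and channels $\mathsf{Dec}_k: C\to M\oplus\mathbb C|\bot\rangle$ with $\|\mathsf{Dec}_k\circ\mathsf{Enc}_k-\mathrm{id}_M\oplus 0_\bot\|_\diamond\le \mathrm{negl}(n)$ for all $k$. Below (in the effective map and as an oracle), each decryption is immediately followed by the measurement $\{|\bot\rangle\langle\bot|,\mathbb 1-|\bot\rangle\langle\bot|\}$. Encryption is implemented as $\mathsf{Enc}_k(X)=\sum_r p_k(r)\,\mathsf{Enc}_{k;r}(X)$, $\mathsf{Enc}_{k;r}(X)=V_k(X\otimes|\psi^{(k,r)}\rangle\langle\psi^{(k,r)}|_T)V_k^\dagger$, with $V_k: M T\to C$ unitary, $p_k$ a probability distribution and $(\psi^{(k,r)})_r$ an orthonormal basis of $T$. The notions QCA and QAE refer to this implementation. **QCA.** $\Pi$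 is one-time ciphertext authenticating (QCA) if for every family of channels $\Lambda_{CB\to C\tilde B}$ there is a family of completely positive maps $\Lambda^{\rm rej}_{B\to\tilde B}$ such that $\Lambda^{\rm acc}+\Lambda^{\rm rej}$ is trace preserving and $$\bigl\|\mathbb E_k[\mathsf{Dec}_k\circ\Lambda\circ\mathsf{Enc}_k]-(\mathrm{id}_M\otimes\Lambda^{\rm acc}+|\bot\rangle\langle\bot|\otimes\Lambda^{\rm rej}\circ\mathrm{Tr}_M)\bigr\|_\diamond\le\mathrm{negl}(n),$$ where $\Lambda^{\rm acc}(Z)=\mathbb E_{k,r}\bigl[\langle\Phi_{k,r}|V_k^\dagger\,\Lambda(\mathsf{Enc}_{k;r}(\phi^+_{MM'})\otimes Z_B)\,V_k|\Phi_{k,r}\rangle\bigr]$ and $|\Phi_{k,r}\rangle=|\phi^+\rangle_{MM'}\otimes|\psi^{(k,r)}\rangle_T$. **QAE.** In the real experiment a key $k$ is drawn and the adversary has oracle access to $\mathsf{Enc}_k$ and $\mathsf{Dec}_k$. In the ideal experiment a key $k$ is drawn and the oracles are as follows. Encryption of a register $M$: prepare $\phi^+_{M'M''}$, sample $r\leftarrow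 p_k$, store $(r,M'',M)$, and return $\mathsf{Enc}_{k;r}$ applied to $M'$. Decryption of a register $C$: apply $V_k^\dagger$ to obtain $M'T$; for each stored $(r,M'',M)$ in turn, measure $\{|\psi^{(k,r)}\rangle\langle\psi^{(k,r)}|,\ \mathbb 1-|\psi^{(k,r)}\rangle\langle\psi^{(k,r)}|\}$ on $T$ and, on the first outcome, measure $\{\phi^+,\mathbb 1-\phi^+\}$ on $M'M''$; if the first outcome occurs again, return the stored register $M$ (its place in the entry being taken by $M'$) and stop; if no entry leads to a return, return $\bot$. In both experiments the adversary finally outputs a bit. $\Pi$ satisfies quantum authenticated encryption (QAE) if for every adversary making polynomially many oracle queries (with no bound on its computing power; in particular for every quantum polynomial-time adversary) the probabilities of outputting $1$ in the two experiments differ by at most $\mathrm{negl}(n)$. **Theorem.** Let $\Pi$ be a QCA symmetric-key quantum encryption scheme whose plaintext register has dimension at least $2$ for all sufficiently large $n$. Let $\Pi^F$ be the following scheme: the key is a uniformly random function $F:\{0,1\}^n\to\mathcal K$; encryption of $\rho$ outputs $|s\rangle\langle s|\otimes\mathsf{Enc}_{F(s)}(\rho)$ for fresh uniformly random $s\in\{0,1\}^n$;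 decryption measures the first register in the computational basis and applies $\mathsf{Dec}_{F(s)}$ to the second for the outcome $s$. Implement its encryption with tag register $RT$, $R=\{0,1\}^n$, randomness $(s,r)$ of probability $2^{-n}p_{F(s)}(r)$, tag states $|s\rangle\otimes|\psi^{(F(s),r)}\rangle$ and unitary $\sum_s|s\rangle\langle s|\otimes V_{F(s)}$. Then $\Pi^F$ satisfies the correctness condition of a symmetric-key quantum encryption scheme and is QAE. -/

import Mathlib

open Matrix Filter Asymptotics
open scoped ENNReal ComplexOrder

noncomputable section

/-! ### Finite-dimensional quantum information

A register is given by a finite type `a` indexing its computational basis; operators on it are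
`Matrix a a ℂ`, and the composite of registers `a` and `b` has basis `a × b`. -/

/-- Operators on a register. -/
abbrev Op (a : Type) : Type := Matrix a a ℂ

/-- The trace norm: the sum of the singular values. -/
def traceNorm {a : Type} [Fintype a] [DecidableEq a] (X : Op a) : ℝ :=
  ∑ i, Real.sqrt ((isHermitian_conjTranspose_mul_self X).eigenvalues i)

/-- `Φ ⊗ id_r`. -/
def ampl {a b : Type} (Φ : Op a →ₗ[ℂ] Op b) (r : Type) : Op (a × r) →ₗ[ℂ] Op (b × r) where
  toFun X := Matrix.of fun p q =>
    Φ (X.submatrix (fun i => (i, p.2)) (fun i => (i, q.2))) p.1 q.1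
  map_add' X Y := by
    ext p q
    simp [Matrix.submatrix_add]
  map_smul' c X := by
    ext p q
    simp [Matrix.submatrix_smul]

/-- The diamond norm: the supremum of `‖(Φ ⊗ id_R)(X)‖₁` over all finite-dimensional reference
systems `R` and all `X` with `‖X‖₁ ≤ 1`. -/
def diamondNorm {a b : Type} [Fintype a] [DecidableEq a] [Fintype b] [DecidableEq b]
    (Φ : Op a →ₗ[ℂ] Op b) : ℝ≥0∞ :=
  ⨆ (d : ℕ) (X : Op (a × Fin d)) (_ : traceNorm X ≤ 1),
    ENNReal.ofReal (traceNorm (ampl Φ (Fin d) X))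

/-- Complete positivity, through an operator-sum (Kraus) representation. -/
def IsCP {a b : Type} [Fintype a] (Φ : Op a →ₗ[ℂ] Op b) : Prop :=
  ∃ (ι : Type) (_ : Fintype ι) (A : ι → Matrix b a ℂ),
    ∀ X, Φ X = ∑ i, A i * X * (A i)ᴴ

/-- Trace preservation. -/
def IsTP {a b : Type} [Fintype a] [Fintype b] (Φ : Op a →ₗ[ℂ] Op b) : Prop :=
  ∀ X, (Φ X).trace = X.trace

/-- A quantum channel: a completely positive trace-preserving map. -/
structure Channel (a b : Type) [Fintype a] [Fintype b] where
  map : Op a →ₗ[ℂ] Op b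
  cp : IsCP map
  tp : IsTP map

/-- The maximally entangled vector `|φ⁺⟩ = (dim a)^{-1/2} ∑ₓ |x⟩|x⟩`. -/
def bellVec (a : Type) [Fintype a] [DecidableEq a] : a × a → ℂ :=
  fun p => if p.1 = p.2 then ((Real.sqrt (Fintype.card a) : ℝ) : ℂ)⁻¹ else 0

/-- The maximally entangled state `φ⁺ = |φ⁺⟩⟨φ⁺|`. -/
def bell (a : Type) [Fintype a] [DecidableEq a] : Op (a × a) :=
  vecMulVec (bellVec a) (star (bellVec a))

/-- Negligible functions of the security parameter. -/
def Negligible (f : ℕ → ℝ) : Prop :=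
  SuperpolynomialDecay atTop (fun n : ℕ => (n : ℝ)) f

/-! ### Symmetric-key quantum encryption -/

/-- The algorithms of a symmetric-key quantum encryption scheme at one value of the security
parameter.  The key is uniform on `K`.  The register `Option M` is the direct sum of `M` with one
extra dimension; its basis vector `none` is the reject symbol `⊥`. -/
structure QScheme where
  K : Type
  M : Type
  C : Type
  [fintypeK : Fintype K]
  [nonemptyK : Nonempty K]
  [fintypeM : Fintype M]
  [decEqM : DecidableEq M]
  [fintypeC : Fintype C]
  [decEqC : DecidableEq C]
  enc : K → Channel M C
  dec : K → Channel C (Option M)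

attribute [instance] QScheme.fintypeK QScheme.nonemptyK QScheme.fintypeM QScheme.decEqM
  QScheme.fintypeC QScheme.decEqC

/-- `X ↦ X ⊕ 0_⊥`. -/
def embedBot (M : Type) : Op M →ₗ[ℂ] Op (Option M) where
  toFun X := Matrix.of fun i j =>
    match i, j with
    | some m, some m' => X m m'
    | _, _ => 0
  map_add' X Y := by
    ext i j
    cases i <;> cases j <;> simp
  map_smul' c X := by
    ext i j
    cases i <;> cases j <;> simp

/-- The measurement `{|⊥⟩⟨⊥|, 𝟙 - |⊥⟩⟨⊥|}` that honest parties apply immediately after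
decryption, keeping the post-measurement state. -/
def measureBot (M : Type) : Op (Option M) →ₗ[ℂ] Op (Option M) where
  toFun X := Matrix.of fun i j => if i.isSome = j.isSome then X i j else 0
  map_add' X Y := by
    ext i j
    by_cases h : i.isSome = j.isSome <;> simp [h]
  map_smul' c X := by
    ext i j
    by_cases h : i.isSome = j.isSome <;> simp [h]

/-- Decryption followed by the measurement of `⊥`. -/
def QScheme.decMeas (S : QScheme) (k : S.K) : Op S.C →ₗ[ℂ] Op (Option S.M) :=
  measureBot S.M ∘ₗ (S.dec k).map

/-- Correctness of a family of schemes: `‖Dec_k ∘ Enc_k - 𝟙_M ⊕ 0_⊥‖_⋄ ≤ negl(n)` for all keys. -/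
def IsCorrect (Pi : ℕ → QScheme) : Prop :=
  ∃ ε : ℕ → ℝ, Negligible ε ∧ ∀ (n : ℕ) (k : (Pi n).K),
    diamondNorm (((Pi n).dec k).map ∘ₗ ((Pi n).enc k).map - embedBot (Pi n).M)
      ≤ ENNReal.ofReal (ε n)

/-- `X ↦ V (X ⊗ |ψ⟩⟨ψ|) V†`. -/
def encWith {M T C : Type} [Fintype M] [Fintype T] (V : Matrix C (M × T) ℂ) (ψ : T → ℂ) :
    Op M →ₗ[ℂ] Op C where
  toFun X := V * (kroneckerMap (· * ·) X (vecMulVec ψ (star ψ))) * Vᴴ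
  map_add' X Y := by
    rw [kroneckerMap_add_left _ (fun _ _ _ => add_mul _ _ _), Matrix.mul_add, Matrix.add_mul]
  map_smul' c X := by
    rw [kroneckerMap_smul_left _ _ (fun _ _ => by simp [mul_assoc])]
    simp

/-- An implementation of encryption by a unitary and classical randomness: `Enc_k` samples `r`
from `p_k` and applies `Enc_{k;r}(X) = V_k (X ⊗ |ψ^{(k,r)}⟩⟨ψ^{(k,r)}|) V_k†`, where the
`ψ^{(k,r)}` form an orthonormal basis of the register `T`. -/
structure Decomposition (S : QScheme) where
  T : Type
  [fintypeT : Fintype T]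
  [decEqT : DecidableEq T]
  V : S.K → Matrix S.C (S.M × T) ℂ
  V_isometry : ∀ k, (V k)ᴴ * V k = 1
  V_coisometry : ∀ k, V k * (V k)ᴴ = 1
  p : S.K → T → ℝ
  p_nonneg : ∀ k r, 0 ≤ p k r
  p_sum : ∀ k, ∑ r, p k r = 1
  ψ : S.K → T → T → ℂ
  ψ_orthonormal : ∀ k r r', star (ψ k r) ⬝ᵥ ψ k r' = if r = r' then 1 else 0
  enc_eq : ∀ k X, (S.enc k).map X = ∑ r, ((p k r : ℝ) : ℂ) • encWith (V k) (ψ k r) X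

attribute [instance] Decomposition.fintypeT Decomposition.decEqT

/-- `Enc_{k;r}`. -/
def Decomposition.encR {S : QScheme} (D : Decomposition S) (k : S.K) (r : D.T) :
    Op S.M →ₗ[ℂ] Op S.C :=
  encWith (D.V k) (D.ψ k r)

/-- `Enc_{k;r}` applied to the first half of the maximally entangled state, an operator on
`C M'`. -/
def Decomposition.encBell {S : QScheme} (D : Decomposition S) (k : S.K) (r : D.T) :
    Op (S.C × S.M) :=
  ampl (D.encR k r) S.M (bell S.M)

/-- The vector `V_k |Φ_{k,r}⟩` on `C M'`, where `|Φ_{k,r}⟩ = |φ⁺⟩_{MM'} ⊗ |ψ^{(k,r)}⟩_T`. -/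
def Decomposition.phiVec {S : QScheme} (D : Decomposition S) (k : S.K) (r : D.T) :
    S.C × S.M → ℂ :=
  fun q => ∑ x : S.M × D.T, D.V k q.1 x * (bellVec S.M (x.1, q.2) * D.ψ k r x.2)

/-! ### One-time ciphertext authentication -/

/-- The averaged effective plaintext map `𝔼_k [Dec_k ∘ Λ ∘ Enc_k]` of an attack `Λ`. -/
def effectiveMap (S : QScheme) {B B' : Type} (Λ : Op (S.C × B) →ₗ[ℂ] Op (S.C × B')) :
    Op (S.M × B) →ₗ[ℂ] Op (Option S.M × B') :=
  ((Fintype.card S.K : ℂ)⁻¹) •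
    ∑ k : S.K, ampl (S.decMeas k) B' ∘ₗ Λ ∘ₗ ampl (S.enc k).map B

/-- For an operator `Y` on `C M'`, the map `Z_B ↦ Y ⊗ Z_B`, with output ordered as `(C B) M'`. -/
def attachOp {c m : Type} (Y : Op (c × m)) (B : Type) :
    Op B →ₗ[ℂ] Op ((c × B) × m) where
  toFun Z := Matrix.of fun p q => Y (p.1.1, p.2) (q.1.1, q.2) * Z p.1.2 q.1.2
  map_add' X Y := by
    ext p q
    simp [mul_add]
  map_smul' c X := by
    ext p q
    simp only [Matrix.of_apply, Matrix.smul_apply, smul_eq_mul, RingHom.id_apply]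
    ring

/-- For a vector `v` on `C M'`, the map `X_{(CB)M'} ↦ ⟨v| X |v⟩`, an operator on `B`. -/
def sandwich {c m : Type} [Fintype c] [Fintype m] (v : c × m → ℂ) (B : Type) :
    Op ((c × B) × m) →ₗ[ℂ] Op B where
  toFun X := Matrix.of fun b b' =>
    ∑ p : c × m, ∑ q : c × m, star (v p) * X ((p.1, b), p.2) ((q.1, b'), q.2) * v q
  map_add' X Y := by
    ext b b'
    simp [mul_add, add_mul, Finset.sum_add_distrib]
  map_smul' c X := by
    ext b b'
    simp only [Matrix.of_apply, Matrix.smul_apply, smul_eq_mul, RingHom.id_apply,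
      Finset.mul_sum]
    refine Finset.sum_congr rfl fun p _ => Finset.sum_congr rfl fun q _ => ?_
    ring

/-- The accepting part of the simulator,
`Λ^acc(Z) = 𝔼_{k,r} ⟨Φ_{k,r}| V_k† Λ(Enc_{k;r}(φ⁺_{MM'} ⊗ Z)) V_k |Φ_{k,r}⟩`. -/
def accMap {S : QScheme} (D : Decomposition S) {B B' : Type}
    (Λ : Op (S.C × B) →ₗ[ℂ] Op (S.C × B')) : Op B →ₗ[ℂ] Op B' :=
  ((Fintype.card S.K : ℂ)⁻¹) • ∑ k : S.K, ∑ r : D.T, ((D.p k r : ℝ) : ℂ) •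
    (sandwich (D.phiVec k r) B' ∘ₗ ampl Λ S.M ∘ₗ attachOp (D.encBell k r) B)

/-- The simulator `id_M ⊗ Λ^acc + |⊥⟩⟨⊥| ⊗ Λ^rej` (in the second term the input `M` is traced
out). -/
def simulator (M : Type) [Fintype M] {B B' : Type} (acc rej : Op B →ₗ[ℂ] Op B') :
    Op (M × B) →ₗ[ℂ] Op (Option M × B') where
  toFun X := Matrix.of fun p q =>
    match p, q with
    | (some m, b), (some m', b') => acc (X.submatrix (fun i => (m, i)) (fun i => (m', i))) b b'
    | (none, b), (none, b') =>
        rej (∑ m : M, X.submatrix (fun i => (m, i)) (fun i => (m, i))) b b'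
    | (some _, _), (none, _) => 0
    | (none, _), (some _, _) => 0
  map_add' X Y := by
    ext ⟨i, b⟩ ⟨j, b'⟩
    cases i <;> cases j <;> simp [Matrix.submatrix_add, Finset.sum_add_distrib]
  map_smul' c X := by
    ext ⟨i, b⟩ ⟨j, b'⟩
    cases i <;> cases j <;> simp [Matrix.submatrix_smul, ← Finset.smul_sum]

/-- One-time ciphertext authentication (QCA) of a family of schemes, with respect to an
implementation of its encryption by unitaries and classical randomness: for every attack there is
a completely positive `Λ^rej`, with `Λ^acc + Λ^rej` trace preserving, such that the effective map
is negligibly close to the simulator in diamond norm. -/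
def IsQCA (Pi : ℕ → QScheme) (D : ∀ n, Decomposition (Pi n)) : Prop :=
  ∀ (B B' : ℕ → Type) [∀ n, Fintype (B n)] [∀ n, DecidableEq (B n)]
    [∀ n, Fintype (B' n)] [∀ n, DecidableEq (B' n)]
    (Λ : ∀ n, Channel ((Pi n).C × B n) ((Pi n).C × B' n)),
    ∃ rej : ∀ n, Op (B n) →ₗ[ℂ] Op (B' n),
      (∀ n, IsCP (rej n)) ∧
      (∀ n, IsTP (accMap (D n) (Λ n).map + rej n)) ∧
      ∃ ε : ℕ → ℝ, Negligible ε ∧ ∀ n,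
        diamondNorm (effectiveMap (Pi n) (Λ n).map
          - simulator (Pi n).M (accMap (D n) (Λ n).map) (rej n)) ≤ ENNReal.ofReal (ε n)

/-! ### Quantum authenticated encryption -/

/-- One oracle query of an adversary with workspace `W`: it prepares the query register out of its
workspace, calls the oracle, and absorbs the answer into its workspace. -/
inductive Query (M C W : Type) [Fintype M] [Fintype C] [Fintype W] : Type
  | enc (pre : Channel W (M × W)) (post : Channel (C × W) W) : Query M C W
  | dec (pre : Channel W (C × W)) (post : Channel (Option M × W) W) : Query M C W

/-- An adversary with access to an encryption and a decryption oracle, at one value of the security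
parameter: a workspace, an initial state, a list of queries, and a final two-outcome measurement
`{effect, 𝟙 - effect}` whose first outcome means `real`. -/
structure Adversary (M C : Type) [Fintype M] [Fintype C] where
  W : Type
  [fintypeW : Fintype W]
  [decEqW : DecidableEq W]
  init : Op W
  init_pos : init.PosSemidef
  init_trace : init.trace = 1
  queries : List (Query M C W)
  effect : Op W
  effect_pos : effect.PosSemidef
  effect_le : (1 - effect).PosSemidef

attribute [instance] Adversary.fintypeW Adversary.decEqW

/-- Remaining part of the real experiment with key `k`: the probability of outputting `real` when
the workspace is in state `ρ`. -/
def realRun (S : QScheme) (k : S.K) {W : Type} [Fintype W] (effect : Op W) :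
    List (Query S.M S.C W) → Op W → ℝ
  | [], ρ => (effect * ρ).trace.re
  | .enc pre post :: qs, ρ =>
      realRun S k effect qs (post.map (ampl (S.enc k).map W (pre.map ρ)))
  | .dec pre post :: qs, ρ =>
      realRun S k effect qs (post.map (ampl (S.decMeas k) W (pre.map ρ)))

/-- The probability that the real experiment outputs `real`. -/
def qaeReal (S : QScheme) (A : Adversary S.M S.C) : ℝ :=
  (Fintype.card S.K : ℝ)⁻¹ * ∑ k : S.K, realRun S k A.effect A.queries A.init

/-- The quantum memory of the challenger after `j` encryption queries: for each of them the pair of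
registers `(M'', M)`. -/
abbrev Mem (M : Type) (j : ℕ) : Type := Fin j → M × M

/-- The ideal encryption oracle with randomness `r`: a maximally entangled state on `M' M''` is
prepared, the queried register `M` is stored together with `M''`, and `Enc_{k;r}` of `M'` is
returned. -/
def idealEnc {S : QScheme} (D : Decomposition S) (k : S.K) (r : D.T) {W : Type} {j : ℕ}
    (ρ : Op ((S.M × W) × Mem S.M j)) : Op ((S.C × W) × Mem S.M (j + 1)) :=
  Matrix.of fun x y =>
    D.encBell k r (x.1.1, (x.2 (Fin.last j)).1) (y.1.1, (y.2 (Fin.last j)).1) *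
      ρ (((x.2 (Fin.last j)).2, x.1.2), fun i => x.2 i.castSucc)
        (((y.2 (Fin.last j)).2, y.1.2), fun i => y.2 i.castSucc)

/-- The projector `|ψ⟩⟨ψ|` on the register `T`, as an operator on all registers. -/
def tagProj {M T W : Type} [DecidableEq M] [DecidableEq W] {j : ℕ} (ψ : T → ℂ) :
    Op (((M × T) × W) × Mem M j) :=
  Matrix.of fun x y =>
    if x.1.1.1 = y.1.1.1 ∧ x.1.2 = y.1.2 ∧ x.2 = y.2 then ψ x.1.1.2 * star (ψ y.1.1.2) else 0

/-- The projector `Π⁺` onto the maximally entangled state of `M'` and the register `M''` of the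
entry `i`, as an operator on all registers. -/
def bellProj {M T W : Type} [Fintype M] [DecidableEq M] [DecidableEq T] [DecidableEq W] {j : ℕ}
    (i : Fin j) : Op (((M × T) × W) × Mem M j) :=
  Matrix.of fun x y =>
    if x.1.1.2 = y.1.1.2 ∧ x.1.2 = y.1.2 ∧ (x.2 i).2 = (y.2 i).2 ∧
        (∀ l, l ≠ i → x.2 l = y.2 l) then
      bell M (x.1.1.1, (x.2 i).1) (y.1.1.1, (y.2 i).1)
    else 0

/-- Return the register `M` of the entry `i` to the adversary and discard `T`.  The register `M'`
takes the place of `M` in the entry. -/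
def returnEntry {M T W : Type} [Fintype T] {j : ℕ} (i : Fin j)
    (σ : Op (((M × T) × W) × Mem M j)) : Op ((Option M × W) × Mem M j) :=
  Matrix.of fun x y =>
    match x, y with
    | ((some m, w), μ), ((some m', w'), μ') =>
        ∑ t : T, σ ((((μ i).2, t), w), Function.update μ i ((μ i).1, m))
          ((((μ' i).2, t), w'), Function.update μ' i ((μ' i).1, m'))
    | _, _ => 0

/-- Return `|⊥⟩⟨⊥|` to the adversary and discard `M' T`. -/
def returnBot {M T W : Type} [Fintype M] [Fintype T] {j : ℕ}
    (σ : Op (((M × T) × W) × Mem M j)) : Op ((Option M × W) × Mem M j) :=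
  Matrix.of fun x y =>
    match x, y with
    | ((none, w), μ), ((none, w'), μ') => ∑ z : M × T, σ ((z, w), μ) ((z, w'), μ')
    | _, _ => 0

/-- The loop of the ideal decryption oracle over a list of entries.  For each entry the tag
measurement `{Π, 𝟙 - Π}` is applied; if the outcome is the first one, `{Π⁺, 𝟙 - Π⁺}` is applied; if
that outcome is the first one too, the stored plaintext is returned, and otherwise the loop goes
on.  The operators are unnormalized, and the branches are summed. -/
def decLoop {M T W : Type} [Fintype M] [DecidableEq M] [Fintype T] [DecidableEq T]
    [Fintype W] [DecidableEq W] {j : ℕ} (ψ : Fin j → T → ℂ) :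
    List (Fin j) → Op (((M × T) × W) × Mem M j) → Op ((Option M × W) × Mem M j)
  | [], σ => returnBot σ
  | i :: is, σ =>
      let P : Op (((M × T) × W) × Mem M j) := tagProj (ψ i)
      let Q : Op (((M × T) × W) × Mem M j) := bellProj i
      returnEntry i (Q * (P * σ * P) * Q) +
        decLoop ψ is ((1 - P) * σ * (1 - P) + (1 - Q) * (P * σ * P) * (1 - Q))

/-- `Y_C ↦ V† Y V`, with output register `M' T`. -/
def undoV {M T C : Type} [Fintype C] (V : Matrix C (M × T) ℂ) :
    Op C →ₗ[ℂ] Op (M × T) where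
  toFun Y := Vᴴ * Y * V
  map_add' X Y := by rw [Matrix.mul_add, Matrix.add_mul]
  map_smul' c X := by simp

/-- The ideal decryption oracle, when the encryption queries so far used the randomness `r`. -/
def idealDec {S : QScheme} (D : Decomposition S) (k : S.K) {W : Type} [Fintype W] [DecidableEq W]
    {j : ℕ} (r : Fin j → D.T) (ρ : Op ((S.C × W) × Mem S.M j)) :
    Op ((Option S.M × W) × Mem S.M j) :=
  decLoop (fun i => D.ψ k (r i)) (List.finRange j)
    (ampl (ampl (undoV (D.V k)) W) (Mem S.M j) ρ)

/-- Remaining part of the ideal experiment with key `k`, after `j` encryption queries that used the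
randomness `r`: the probability of outputting `real` when the adversary's workspace and the
challenger's memory are in the joint state `ρ`. -/
def idealRun {S : QScheme} (D : Decomposition S) (k : S.K) {W : Type} [Fintype W]
    [DecidableEq W] (effect : Op W) :
    List (Query S.M S.C W) → (j : ℕ) → (Fin j → D.T) → Op (W × Mem S.M j) → ℝ
  | [], _, _, ρ => (kroneckerMap (· * ·) effect 1 * ρ).trace.re
  | .enc pre post :: qs, j, r, ρ =>
      ∑ t : D.T, D.p k t *
        idealRun D k effect qs (j + 1) (Fin.snoc r t)
          (ampl post.map (Mem S.M (j + 1)) (idealEnc D k t (ampl pre.map (Mem S.M j) ρ)))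
  | .dec pre post :: qs, j, r, ρ =>
      idealRun D k effect qs j r
        (ampl post.map (Mem S.M j) (idealDec D k r (ampl pre.map (Mem S.M j) ρ)))

/-- The probability that the ideal experiment outputs `real`. -/
def qaeIdeal {S : QScheme} (D : Decomposition S) (A : Adversary S.M S.C) : ℝ :=
  (Fintype.card S.K : ℝ)⁻¹ * ∑ k : S.K,
    idealRun D k A.effect A.queries 0 Fin.elim0 (A.init.submatrix Prod.fst Prod.fst)

/-- Quantum authenticated encryption (QAE), against all adversaries that make polynomially many
oracle queries, with no bound on their computing power. -/
def IsQAE (Pi : ℕ → QScheme) (D : ∀ n, Decomposition (Pi n)) : Prop :=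
  ∀ A : ∀ n, Adversary (Pi n).M (Pi n).C,
    (∃ q : Polynomial ℕ, ∀ n, (A n).queries.length ≤ q.eval n) →
      Negligible fun n => |qaeReal (Pi n) (A n) - qaeIdeal (D n) (A n)|

/-! ### The scheme with a random function -/

/-- `X ↦ |R|⁻¹ ∑ₛ |s⟩⟨s| ⊗ Φₛ(X)`. -/
def saltedEnc {R a b : Type} [Fintype R] [DecidableEq R]
    (Φ : R → Op a →ₗ[ℂ] Op b) : Op a →ₗ[ℂ] Op (R × b) where
  toFun X := Matrix.of fun x y =>
    if x.1 = y.1 then (Fintype.card R : ℂ)⁻¹ * Φ x.1 X x.2 y.2 else 0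
  map_add' X Y := by
    ext x y
    by_cases h : x.1 = y.1 <;> simp [h, mul_add]
  map_smul' c X := by
    ext x y
    by_cases h : x.1 = y.1 <;> simp [h, mul_left_comm]

/-- `Y ↦ ∑ₛ Φₛ(⟨s| Y |s⟩)`: measure the register `R` and apply `Φₛ` for the outcome `s`. -/
def saltedDec {R a b : Type} [Fintype R]
    (Φ : R → Op a →ₗ[ℂ] Op b) : Op (R × a) →ₗ[ℂ] Op b where
  toFun Y := ∑ s : R, Φ s (Y.submatrix (fun i => (s, i)) (fun i => (s, i)))
  map_add' X Y := by simp [Matrix.submatrix_add, Finset.sum_add_distrib]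
  map_smul' c X := by simp [Matrix.submatrix_smul, Finset.smul_sum]

theorem saltedEnc_cp {R a b : Type} [Fintype R] [DecidableEq R] [Fintype a]
    {Φ : R → Op a →ₗ[ℂ] Op b} (h : ∀ s, IsCP (Φ s)) : IsCP (saltedEnc Φ) := by
  choose ι hι A hA using h
  refine ⟨Σ s, ι s, inferInstance, fun z => Matrix.of fun x m =>
    if x.1 = z.1 then ((Real.sqrt (Fintype.card R : ℝ)⁻¹ : ℝ) : ℂ) * A z.1 z.2 x.2 m else 0, ?_⟩
  have hc : ((Real.sqrt (Fintype.card R : ℝ)⁻¹ : ℝ) : ℂ) * ((Real.sqrt (Fintype.card R : ℝ)⁻¹ : ℝ) : ℂ)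
      = (Fintype.card R : ℂ)⁻¹ := by
    rw [← Complex.ofReal_mul, Real.mul_self_sqrt (by positivity)]
    simp
  intro X
  ext ⟨s, c⟩ ⟨s', c'⟩
  rw [Matrix.sum_apply, Fintype.sum_sigma]
  rw [Finset.sum_eq_single s]
  · by_cases h : s = s'
    · subst h
      simp only [saltedEnc, LinearMap.coe_mk, AddHom.coe_mk, Matrix.of_apply, if_true, hA,
        Matrix.sum_apply, Finset.mul_sum]
      refine Finset.sum_congr rfl fun i _ => ?_
      simp only [Matrix.mul_apply, Matrix.conjTranspose_apply, Matrix.of_apply, if_true,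
        Finset.sum_mul, Finset.mul_sum, star_mul']
      refine Finset.sum_congr rfl fun u _ => Finset.sum_congr rfl fun v _ => ?_
      rw [← hc]
      simp only [Complex.star_def, Complex.conj_ofReal]
      ring
    · simp [saltedEnc, Matrix.mul_apply, h, Ne.symm h]
  · intro z _ hz
    refine Finset.sum_eq_zero fun i _ => ?_
    simp [Matrix.mul_apply, Ne.symm hz]
  · simp

theorem saltedEnc_tp {R a b : Type} [Fintype R] [DecidableEq R] [Nonempty R] [Fintype a]
    [Fintype b] {Φ : R → Op a →ₗ[ℂ] Op b} (h : ∀ s, IsTP (Φ s)) : IsTP (saltedEnc Φ) := by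
  intro X
  have h' : ∀ s, ∑ c, Φ s X c c = X.trace := fun s => h s X
  simp [saltedEnc, Matrix.trace, Fintype.sum_prod_type, ← Finset.mul_sum, h']

theorem saltedDec_cp {R a b : Type} [Fintype R] [DecidableEq R] [Fintype a]
    {Φ : R → Op a →ₗ[ℂ] Op b} (h : ∀ s, IsCP (Φ s)) : IsCP (saltedDec Φ) := by
  choose ι hι A hA using h
  refine ⟨Σ s, ι s, inferInstance, fun z => Matrix.of fun x m =>
    if m.1 = z.1 then A z.1 z.2 x m.2 else 0, ?_⟩
  intro X
  ext c c'
  rw [Matrix.sum_apply, Fintype.sum_sigma]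
  simp only [saltedDec, LinearMap.coe_mk, AddHom.coe_mk, hA, Matrix.sum_apply]
  refine Finset.sum_congr rfl fun s _ => Finset.sum_congr rfl fun i _ => ?_
  simp [Matrix.mul_apply, Fintype.sum_prod_type, apply_ite star, ite_mul,
    Finset.sum_ite_irrel]

theorem saltedDec_tp {R a b : Type} [Fintype R] [Fintype a]
    [Fintype b] {Φ : R → Op a →ₗ[ℂ] Op b} (h : ∀ s, IsTP (Φ s)) : IsTP (saltedDec Φ) := by
  intro X
  simp only [saltedDec, LinearMap.coe_mk, AddHom.coe_mk, Matrix.trace_sum, h _ _]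
  simp [Matrix.trace, Fintype.sum_prod_type]

/-- The scheme `Π^F` for a uniformly random function `F : R → K`: the key is `F`; encryption
outputs `|s⟩⟨s| ⊗ Enc_{F(s)}(ρ)` for uniformly random `s`; decryption measures the first register
and applies `Dec_{F(s)}` for the outcome `s`. -/
def QScheme.withRandomFunction (S : QScheme) (R : Type) [Fintype R] [DecidableEq R] [Nonempty R] :
    QScheme where
  K := R → S.K
  M := S.M
  C := R × S.C
  enc F := ⟨saltedEnc fun s => (S.enc (F s)).map, saltedEnc_cp fun s => (S.enc (F s)).cp,
    saltedEnc_tp fun s => (S.enc (F s)).tp⟩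
  dec F := ⟨saltedDec fun s => (S.dec (F s)).map, saltedDec_cp fun s => (S.dec (F s)).cp,
    saltedDec_tp fun s => (S.dec (F s)).tp⟩

/-- The controlled matrix `∑ₛ |s⟩⟨s| ⊗ Vₛ`, with columns ordered as `M (R T)`. -/
def controlled {R m t c : Type} [DecidableEq R] (V : R → Matrix c (m × t) ℂ) :
    Matrix (R × c) (m × (R × t)) ℂ :=
  Matrix.of fun x y => if x.1 = y.2.1 then V x.1 x.2 (y.1, y.2.2) else 0

theorem controlled_isometry {R m t c : Type} [Fintype R] [DecidableEq R] [DecidableEq m]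
    [DecidableEq t] [Fintype c] {V : R → Matrix c (m × t) ℂ}
    (h : ∀ s, (V s)ᴴ * V s = 1) : (controlled V)ᴴ * controlled V = 1 := by
  ext ⟨x, s, u⟩ ⟨x', s', u'⟩
  have h' := congrFun (congrFun (h s) (x, u)) (x', u')
  simp only [Matrix.mul_apply, Matrix.conjTranspose_apply] at h'
  rw [Matrix.mul_apply, Fintype.sum_prod_type, Finset.sum_eq_single s]
  · by_cases hs : s = s'
    · subst hs
      simp only [controlled, Matrix.conjTranspose_apply, Matrix.of_apply, if_true, h']
      simp [Matrix.one_apply]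
    · simp [controlled, hs]
  · intro z _ hz
    simp [controlled, hz]
  · simp

theorem controlled_coisometry {R m t c : Type} [Fintype R] [DecidableEq R] [Fintype m]
    [Fintype t] [DecidableEq c] {V : R → Matrix c (m × t) ℂ}
    (h : ∀ s, V s * (V s)ᴴ = 1) : controlled V * (controlled V)ᴴ = 1 := by
  ext ⟨s, u⟩ ⟨s', u'⟩
  have h' := congrFun (congrFun (h s) u) u'
  simp only [Matrix.mul_apply, Matrix.conjTranspose_apply, Fintype.sum_prod_type] at h'
  simp only [Matrix.mul_apply, Fintype.sum_prod_type, Matrix.conjTranspose_apply]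
  by_cases hs : s = s'
  · subst hs
    have : ∀ x : m, ∑ z : R, ∑ y : t, controlled V (s, u) (x, z, y) *
        star (controlled V (s, u') (x, z, y)) = ∑ y : t, V s u (x, y) * star (V s u' (x, y)) := by
      intro x
      rw [Finset.sum_eq_single s]
      · simp [controlled]
      · intro z _ hz
        simp [controlled, Ne.symm hz]
      · simp
    simp only [this, h']
    simp [Matrix.one_apply]
  · have : ∀ (x : m) (z : R) (y : t), controlled V (s, u) (x, z, y) *
        star (controlled V (s', u') (x, z, y)) = 0 := by
      intro x z y
      by_cases h1 : s = z
      · subst h1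
        simp [controlled, Ne.symm hs]
      · simp [controlled, h1]
    simp only [this]
    simp [hs]

/-- The vector `|s⟩ ⊗ |ψ⟩`. -/
def saltedVec {R t : Type} [DecidableEq R] (s : R) (ψ : t → ℂ) : R × t → ℂ :=
  fun w => if w.1 = s then ψ w.2 else 0

theorem saltedVec_dot {R t : Type} [Fintype R] [DecidableEq R] [Fintype t] (s s' : R)
    (ψ ψ' : t → ℂ) :
    star (saltedVec s ψ) ⬝ᵥ saltedVec s' ψ' = if s = s' then star ψ ⬝ᵥ ψ' else 0 := by
  simp only [dotProduct, Fintype.sum_prod_type, Pi.star_apply]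
  rw [Finset.sum_eq_single s]
  · by_cases hs : s = s' <;> simp [saltedVec, hs]
  · intro z _ hz
    simp [saltedVec, hz]
  · simp

theorem encWith_apply {m t c : Type} [Fintype m] [Fintype t] (V : Matrix c (m × t) ℂ)
    (ψ : t → ℂ) (X : Op m) (i j : c) :
    encWith V ψ X i j = ∑ a, ∑ b, (∑ u, V i (a, u) * ψ u) * X a b *
      star (∑ u, V j (b, u) * ψ u) := by
  have h1 : encWith V ψ X i j = ∑ b, ∑ v, ∑ a, ∑ u,
      V i (a, u) * (X a b * (ψ u * star (ψ v))) * star (V j (b, v)) := by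
    simp only [encWith, LinearMap.coe_mk, AddHom.coe_mk, Matrix.mul_apply, kroneckerMap_apply,
      vecMulVec_apply, Matrix.conjTranspose_apply, Fintype.sum_prod_type, Finset.sum_mul,
      Pi.star_apply]
  have h2 : ∀ a b, (∑ u, V i (a, u) * ψ u) * X a b * star (∑ u, V j (b, u) * ψ u) =
      ∑ v, ∑ u, V i (a, u) * (X a b * (ψ u * star (ψ v))) * star (V j (b, v)) := by
    intro a b
    simp only [star_sum, Finset.mul_sum, Finset.sum_mul, star_mul']
    refine Finset.sum_congr rfl fun v _ => Finset.sum_congr rfl fun u _ => ?_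
    ring
  simp only [h1, h2]
  rw [Finset.sum_comm (s := Finset.univ (α := m)) (t := Finset.univ (α := m))]
  refine Finset.sum_congr rfl fun b _ => ?_
  rw [Finset.sum_comm]

theorem encWith_controlled {R m t c : Type} [Fintype R] [DecidableEq R] [Fintype m] [Fintype t]
    (V : R → Matrix c (m × t) ℂ) (s : R) (ψ : t → ℂ) (X : Op m) (x y : R × c) :
    encWith (controlled V) (saltedVec s ψ) X x y =
      if x.1 = s ∧ y.1 = s then encWith (V s) ψ X x.2 y.2 else 0 := by
  have key : ∀ (z : R × c) (a : m), ∑ u, controlled V z (a, u) * saltedVec s ψ u =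
      if z.1 = s then ∑ u, V s z.2 (a, u) * ψ u else 0 := by
    intro z a
    rw [Fintype.sum_prod_type, Finset.sum_eq_single s]
    · by_cases hz : z.1 = s <;> simp [controlled, saltedVec, hz]
    · intro w _ hw
      simp [saltedVec, hw]
    · simp
  simp only [encWith_apply, key]
  by_cases hx : x.1 = s <;> by_cases hy : y.1 = s <;> simp [hx, hy]

theorem saltedEnc_eq {R m t c : Type} [Fintype R] [DecidableEq R] [Fintype m] [Fintype t]
    {Φ : R → Op m →ₗ[ℂ] Op c} {V : R → Matrix c (m × t) ℂ} {p : R → t → ℝ} {ψ : R → t → t → ℂ}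
    (h : ∀ s X, Φ s X = ∑ r, ((p s r : ℝ) : ℂ) • encWith (V s) (ψ s r) X) (X : Op m) :
    saltedEnc Φ X = ∑ z : R × t, (((Fintype.card R : ℝ)⁻¹ * p z.1 z.2 : ℝ) : ℂ) •
      encWith (controlled V) (saltedVec z.1 (ψ z.1 z.2)) X := by
  ext ⟨s, c⟩ ⟨s', c'⟩
  rw [Matrix.sum_apply, Fintype.sum_prod_type, Finset.sum_eq_single s]
  · simp only [Matrix.smul_apply, encWith_controlled]
    by_cases hs : s = s'
    · subst hs
      simp [saltedEnc, h, Matrix.sum_apply, Finset.mul_sum, mul_assoc]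
    · simp [saltedEnc, hs, Ne.symm hs]
  · intro z _ hz
    refine Finset.sum_eq_zero fun r _ => ?_
    simp [encWith_controlled, Ne.symm hz]
  · simp

/-- The implementation of the encryption of `Π^F` that is induced by one of `Π`: the tag register
is `R T`, the randomness is a pair `(s, r)` with `s` uniform and `r` distributed according to
`p_{F(s)}`, the tag state is `|s⟩ ⊗ |ψ^{(F(s),r)}⟩`, and the unitary applies `V_{F(s)}` controlled
on `s`. -/
def Decomposition.withRandomFunction {S : QScheme} (D : Decomposition S) (R : Type) [Fintype R]
    [DecidableEq R] [Nonempty R] : Decomposition (S.withRandomFunction R) where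
  T := R × D.T
  V F := controlled fun s => D.V (F s)
  V_isometry F := controlled_isometry fun s => D.V_isometry (F s)
  V_coisometry F := controlled_coisometry fun s => D.V_coisometry (F s)
  p F z := (Fintype.card R : ℝ)⁻¹ * D.p (F z.1) z.2
  p_nonneg F z := mul_nonneg (by positivity) (D.p_nonneg _ _)
  p_sum F := by
    simp [Fintype.sum_prod_type, ← Finset.mul_sum, D.p_sum]
  ψ F z := saltedVec z.1 (D.ψ (F z.1) z.2)
  ψ_orthonormal F z z' := by
    obtain ⟨s, r⟩ := z
    obtain ⟨s', r'⟩ := z'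
    rw [saltedVec_dot]
    by_cases hs : s = s'
    · subst hs
      simp [D.ψ_orthonormal]
    · simp [hs]
  enc_eq F X := saltedEnc_eq (fun s => D.enc_eq (F s)) X

end

noncomputable section

open scoped Kronecker

/-! ### Trace norm -/

section TraceNorm

/-! QCA compares a one-time attack with a simulator that has two useful features: whenever it
accepts, it leaves the plaintext register untouched, and its accepting part is the weight with which
the ciphertext is found in the state `V_k |Φ_{k,r}⟩`. Everything is first extracted from these two
features for a single key, and then carried to `Π^F`, where every new salt acts like a fresh key.

Single key. A test on plaintext and reference that has outcome zero on the input is unlikely to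
succeed after an accepting decryption (`QCABound.test`). Hence a forgery without a ciphertext is
unlikely, because its decryption would have to agree with two different plaintexts
(`QCABound.forge`). Two acceptances after one encryption are unlikely as well, because one reference
would be maximally entangled with both answers (`bell_monogamy`, `QCABound.bell_double`); a coherent
control bit extends this to arbitrary plaintexts (`QCABound.double`). A game with one encryption and
`q` decryptions is therefore determined, up to `O(q²ε)`, by its terms with at most one acceptance.
In these terms half of `φ⁺` may be encrypted while the plaintext is stored and returned on
acceptance (`QCABound.hiding`, `QCABound.slot`, `QCABound.firstOrder_mid`). Finally decryption is
replaced by the test for `V_k |Φ_{k,r}⟩`: correctness says that an intact ciphertext decrypts to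
`φ⁺` (`Decomposition.defect`), and the formula for `Λ^acc` says that an accepted ciphertext was
intact (`QCABound.bad_le`). Exchanging measurements that do not commute costs roots, and the total
error is `O(q³ ε^{1/4})` (`QCABound.real_sub_ideal_le`).

Many salts. The salts are distinct except with probability `q²/2ⁿ`. For fixed distinct salts,
ciphertexts with unused salts may be rejected (`hybrid_real_sub_usedOnly_le`), and the encryption
queries are then made ideal one at a time (`hybrid_sub_succ_le`); in each change only the key `F(s)`
is averaged, while all other salts are part of the attack. The last hybrid is the ideal experiment:
distinct salts have orthogonal tags, so the decryption loop decouples into rejection plus one term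
for each entry (`decLoop_eq`), and the hybrid handlers have the same form (`TracksIdeal`).

Uniformity. QCA provides a negligible bound for each family of attacks, whereas the hybrids use many
attacks at once. Choosing a nearly worst attack at each `n` gives one bound for all of them
(`IsQCA.exists_bound`). -/

theorem norm_dotProduct_le {a : Type} [Fintype a] (x y : a → ℂ) :
    ‖star x ⬝ᵥ y‖ ≤ Real.sqrt (star x ⬝ᵥ x).re * Real.sqrt (star y ⬝ᵥ y).re := by
  have h := norm_inner_le_norm (𝕜 := ℂ) (WithLp.toLp 2 x) (WithLp.toLp 2 y)
  have e : ∀ z w : a → ℂ, inner ℂ (WithLp.toLp 2 z : EuclideanSpace ℂ a) (WithLp.toLp 2 w) =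
      star z ⬝ᵥ w := by
    intro z w
    rw [EuclideanSpace.inner_toLp_toLp, dotProduct_comm]
  have n : ∀ z : a → ℂ, ‖(WithLp.toLp 2 z : EuclideanSpace ℂ a)‖ =
      Real.sqrt (star z ⬝ᵥ z).re := by
    intro z
    rw [← e, norm_eq_sqrt_re_inner (𝕜 := ℂ)]
    rfl
  rwa [e, n, n] at h

open scoped MatrixOrder in
theorem Matrix.PosSemidef.exists_eq_conjTranspose_mul {a : Type} [Fintype a] {X : Op a}
    (hX : X.PosSemidef) : ∃ B : Op a, X = Bᴴ * B := by
  classical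
  exact CStarAlgebra.nonneg_iff_eq_star_mul_self.mp hX.nonneg

variable {a : Type} [Fintype a] [DecidableEq a]

/-- The eigenvectors of `XᴴX`, as plain vectors. -/
def singVec (X : Op a) (i : a) : a → ℂ :=
  ((isHermitian_conjTranspose_mul_self X).eigenvectorBasis i).ofLp

def singVal (X : Op a) (i : a) : ℝ :=
  Real.sqrt ((isHermitian_conjTranspose_mul_self X).eigenvalues i)

theorem singVec_dot (X : Op a) (i j : a) :
    star (singVec X i) ⬝ᵥ singVec X j = if i = j then 1 else 0 := by
  have := (isHermitian_conjTranspose_mul_self X).eigenvectorBasis.inner_eq_ite i j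
  rw [← this, PiLp.inner_apply]
  simp [singVec, dotProduct, mul_comm]

theorem singVal_sq (X : Op a) (i : a) :
    singVal X i ^ 2 = (isHermitian_conjTranspose_mul_self X).eigenvalues i :=
  Real.sq_sqrt ((posSemidef_conjTranspose_mul_self X).eigenvalues_nonneg i)

theorem singVec_mulVec (X : Op a) (i : a) :
    (Xᴴ * X) *ᵥ singVec X i = ((singVal X i ^ 2 : ℝ) : ℂ) • singVec X i := by
  have := (isHermitian_conjTranspose_mul_self X).mulVec_eigenvectorBasis i
  rw [singVal_sq]
  exact this

theorem singVec_norm_mulVec (X : Op a) (i j : a) :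
    star (X *ᵥ singVec X i) ⬝ᵥ (X *ᵥ singVec X j) =
      if i = j then ((singVal X i ^ 2 : ℝ) : ℂ) else 0 := by
  rw [star_mulVec, ← dotProduct_mulVec, mulVec_mulVec, singVec_mulVec, dotProduct_smul,
    singVec_dot]
  by_cases h : i = j <;> simp [h]

/-- The unitary whose columns are the `singVec`. -/
def singU (X : Op a) : Op a := Matrix.of fun x i => singVec X i x

theorem singU_conjTranspose_mul (X : Op a) : (singU X)ᴴ * singU X = 1 := by
  ext i j
  rw [Matrix.mul_apply, Matrix.one_apply, ← singVec_dot X i j]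
  simp [singU, dotProduct]

theorem singU_mul_conjTranspose (X : Op a) : singU X * (singU X)ᴴ = 1 :=
  mul_eq_one_comm.mp (singU_conjTranspose_mul X)

theorem trace_eq_sum_singVec (X Y : Op a) :
    Y.trace = ∑ i, star (singVec X i) ⬝ᵥ (Y *ᵥ singVec X i) := by
  have : Y.trace = ((singU X)ᴴ * Y * singU X).trace := by
    rw [Matrix.mul_assoc, Matrix.trace_mul_comm, Matrix.mul_assoc, singU_mul_conjTranspose,
      Matrix.mul_one]
  rw [this, Matrix.trace]
  refine Finset.sum_congr rfl fun i _ => ?_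
  rw [Matrix.diag_apply, Matrix.mul_assoc, Matrix.mul_apply]
  rfl

/-- A matrix `E` with `E Eᴴ ≤ 1`. -/
def IsContr (E : Op a) : Prop := (1 - E * Eᴴ).PosSemidef

theorem IsContr.dot_le {E : Op a} (hE : IsContr E) (x : a → ℂ) :
    (star (Eᴴ *ᵥ x) ⬝ᵥ (Eᴴ *ᵥ x)).re ≤ (star x ⬝ᵥ x).re := by
  have h := hE.re_dotProduct_nonneg x
  have : star x ⬝ᵥ ((1 - E * Eᴴ) *ᵥ x) = star x ⬝ᵥ x - star (Eᴴ *ᵥ x) ⬝ᵥ (Eᴴ *ᵥ x) := by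
    rw [sub_mulVec, one_mulVec, dotProduct_sub, star_mulVec, conjTranspose_conjTranspose,
      ← dotProduct_mulVec, mulVec_mulVec]
  rw [this] at h
  simpa using h

/-- One half of the variational formula `‖X‖₁ = max |tr(EX)|` over contractions: in the basis of
right singular vectors `v` the trace is a sum of terms `⟨Eᴴv, Xv⟩`, and `‖Xv‖` is the singular
value. With `exists_trace_mul_eq` it yields the triangle inequality. -/
theorem norm_trace_mul_le {E : Op a} (hE : IsContr E) (X : Op a) :
    ‖(E * X).trace‖ ≤ traceNorm X := by
  rw [trace_eq_sum_singVec X]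
  refine (norm_sum_le _ _).trans (Finset.sum_le_sum fun i _ => ?_)
  have h1 : star (singVec X i) ⬝ᵥ ((E * X) *ᵥ singVec X i) =
      star (Eᴴ *ᵥ singVec X i) ⬝ᵥ (X *ᵥ singVec X i) := by
    rw [star_mulVec, conjTranspose_conjTranspose, ← dotProduct_mulVec, mulVec_mulVec]
  rw [h1]
  refine (norm_dotProduct_le _ _).trans ?_
  have h2 : 0 ≤ singVal X i := Real.sqrt_nonneg _
  rw [singVec_norm_mulVec, if_pos rfl, Complex.ofReal_re, Real.sqrt_sq h2]
  refine mul_le_of_le_one_left (Real.sqrt_nonneg _) ?_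
  rw [Real.sqrt_le_one]
  have := hE.dot_le (singVec X i)
  rwa [singVec_dot, if_pos rfl] at this

theorem exists_trace_mul_eq (X : Op a) :
    ∃ E : Op a, IsContr E ∧ (E * X).trace = (traceNorm X : ℂ) := by
  set U := singU X with hU
  set d : a → ℂ := fun i => ((singVal X i)⁻¹ : ℝ) with hd
  have hD : Uᴴ * (Xᴴ * X) * U = diagonal fun i => ((singVal X i ^ 2 : ℝ) : ℂ) := by
    ext i j
    have : (Uᴴ * (Xᴴ * X) * U) i j = star (X *ᵥ singVec X i) ⬝ᵥ (X *ᵥ singVec X j) := by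
      rw [star_mulVec, ← dotProduct_mulVec, mulVec_mulVec, Matrix.mul_assoc, Matrix.mul_apply]
      rfl
    rw [this, singVec_norm_mulVec, diagonal_apply]
  -- The adjoint of the partial isometry in the polar decomposition of `X`. Since `0⁻¹ = 0`, the
  -- singular vectors with value zero are dropped, and `E Eᴴ` is the projector onto the others.
  refine ⟨U * diagonal d * Uᴴ * Xᴴ, ?_, ?_⟩
  · have h1 : (U * diagonal d * Uᴴ * Xᴴ) * (U * diagonal d * Uᴴ * Xᴴ)ᴴ =
        U * diagonal (fun i => if singVal X i = 0 then 0 else 1) * Uᴴ := by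
      have : (U * diagonal d * Uᴴ * Xᴴ) * (U * diagonal d * Uᴴ * Xᴴ)ᴴ =
          U * (diagonal d * (Uᴴ * (Xᴴ * X) * U) * (diagonal d)ᴴ) * Uᴴ := by
        simp only [conjTranspose_mul, conjTranspose_conjTranspose, Matrix.mul_assoc]
      rw [this, hD, diagonal_conjTranspose, diagonal_mul_diagonal, diagonal_mul_diagonal]
      congr 3
      funext i
      by_cases h : singVal X i = 0
      · simp [hd, h]
      · have : (singVal X i : ℂ) ≠ 0 := by exact_mod_cast h
        simp [hd, h]
        field_simp
    have h2 : (1 : Op a) - U * diagonal (fun i => if singVal X i = 0 then (0 : ℂ) else 1) * Uᴴ =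
        U * diagonal (fun i => if singVal X i = 0 then (1 : ℂ) else 0) * Uᴴ := by
      have h3 : (1 : Op a) = U * 1 * Uᴴ := by
        rw [Matrix.mul_one, singU_mul_conjTranspose]
      rw [h3, ← Matrix.sub_mul, ← Matrix.mul_sub, ← diagonal_one, diagonal_sub]
      congr 3
      funext i
      split_ifs <;> simp
    rw [IsContr, h1, h2]
    refine PosSemidef.mul_mul_conjTranspose_same (PosSemidef.diagonal fun i => ?_) U
    dsimp
    split_ifs <;> simp
  · have h1 : ((U * diagonal d * Uᴴ * Xᴴ) * X).trace =
        (diagonal d * (Uᴴ * (Xᴴ * X) * U)).trace := by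
      have : (U * diagonal d * Uᴴ * Xᴴ) * X = U * (diagonal d * (Uᴴ * (Xᴴ * X))) := by
        simp only [Matrix.mul_assoc]
      rw [this, Matrix.trace_mul_comm]
      simp only [Matrix.mul_assoc]
    rw [h1, hD, diagonal_mul_diagonal, trace_diagonal, traceNorm, Complex.ofReal_sum]
    refine Finset.sum_congr rfl fun i _ => ?_
    change ((singVal X i)⁻¹ : ℝ) * ((singVal X i ^ 2 : ℝ) : ℂ) = (singVal X i : ℂ)
    by_cases h : singVal X i = 0
    · simp [h]
    · have : (singVal X i : ℂ) ≠ 0 := by exact_mod_cast h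
      push_cast
      field_simp

theorem traceNorm_nonneg (X : Op a) : 0 ≤ traceNorm X :=
  Finset.sum_nonneg fun _ _ => Real.sqrt_nonneg _

theorem traceNorm_sum_le {ι : Type} (s : Finset ι) (X : ι → Op a) :
    traceNorm (∑ i ∈ s, X i) ≤ ∑ i ∈ s, traceNorm (X i) := by
  obtain ⟨E, hE, h⟩ := exists_trace_mul_eq (∑ i ∈ s, X i)
  rw [Matrix.mul_sum, Matrix.trace_sum] at h
  have := norm_sum_le s fun i => (E * X i).trace
  rw [h, Complex.norm_real, Real.norm_of_nonneg (traceNorm_nonneg _)] at this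
  exact this.trans (Finset.sum_le_sum fun i _ => norm_trace_mul_le hE _)

theorem traceNorm_smul_le (c : ℂ) (X : Op a) : traceNorm (c • X) ≤ ‖c‖ * traceNorm X := by
  obtain ⟨E, hE, h⟩ := exists_trace_mul_eq (c • X)
  rw [Matrix.mul_smul, Matrix.trace_smul] at h
  have h2 : traceNorm (c • X) = ‖c • (E * X).trace‖ := by
    rw [h, Complex.norm_real, Real.norm_of_nonneg (traceNorm_nonneg _)]
  rw [h2, norm_smul]
  exact mul_le_mul_of_nonneg_left (norm_trace_mul_le hE _) (norm_nonneg _)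

/-- With `X = BᴴB` both traces become sums over the rows of `B`, and Cauchy–Schwarz compares them
row by row. -/
theorem traceNorm_le_of_posSemidef {X : Op a} (hX : X.PosSemidef) : traceNorm X ≤ X.trace.re := by
  obtain ⟨E, hE, h⟩ := exists_trace_mul_eq X
  obtain ⟨B, rfl⟩ := hX.exists_eq_conjTranspose_mul
  have h1 : (E * (Bᴴ * B)).trace = ∑ i, star (Eᴴ *ᵥ star (B i)) ⬝ᵥ star (B i) := by
    rw [← Matrix.mul_assoc, Matrix.trace_mul_comm, ← Matrix.mul_assoc, Matrix.trace]
    refine Finset.sum_congr rfl fun i _ => ?_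
    rw [star_mulVec, conjTranspose_conjTranspose, star_star, Matrix.diag_apply, Matrix.mul_apply]
    rfl
  have h2 : (Bᴴ * B).trace = ∑ i, star (star (B i)) ⬝ᵥ star (B i) := by
    rw [Matrix.trace_mul_comm, Matrix.trace]
    refine Finset.sum_congr rfl fun i _ => ?_
    rw [star_star, Matrix.diag_apply, Matrix.mul_apply]
    rfl
  have h3 : traceNorm (Bᴴ * B) = ‖(E * (Bᴴ * B)).trace‖ := by
    rw [h, Complex.norm_real, Real.norm_of_nonneg (traceNorm_nonneg _)]
  rw [h3, h1, h2, Complex.re_sum]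
  refine (norm_sum_le _ _).trans (Finset.sum_le_sum fun i _ => ?_)
  refine (norm_dotProduct_le _ _).trans ?_
  have h4 : 0 ≤ (star (star (B i)) ⬝ᵥ star (B i)).re :=
    (Complex.le_def.mp (dotProduct_star_self_nonneg (star (B i)))).1
  calc _ ≤ Real.sqrt (star (star (B i)) ⬝ᵥ star (B i)).re *
        Real.sqrt (star (star (B i)) ⬝ᵥ star (B i)).re :=
        mul_le_mul_of_nonneg_right (Real.sqrt_le_sqrt (hE.dot_le _)) (Real.sqrt_nonneg _)
    _ = _ := Real.mul_self_sqrt h4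

end TraceNorm

/-! ### Positive functionals and completely positive maps -/

section Positivity

variable {a b c e : Type}

/-- A linear functional that is nonnegative on positive semidefinite operators. -/
def PosFn (f : Op a →ₗ[ℂ] ℂ) : Prop := ∀ X : Op a, X.PosSemidef → 0 ≤ f X

theorem PosFn.re_nonneg {f : Op a →ₗ[ℂ] ℂ} (hf : PosFn f) {X : Op a} (hX : X.PosSemidef) :
    0 ≤ (f X).re := (Complex.le_def.mp (hf X hX)).1

/-- A linear functional that is bounded by the trace on positive semidefinite operators. -/
def SubTr [Fintype a] (f : Op a →ₗ[ℂ] ℂ) : Prop :=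
  ∀ X : Op a, X.PosSemidef → (f X).re ≤ X.trace.re

/-- Trace nonincreasing maps. -/
def TNI [Fintype a] [Fintype b] (Φ : Op a →ₗ[ℂ] Op b) : Prop :=
  ∀ X : Op a, X.PosSemidef → (Φ X).trace.re ≤ X.trace.re

/-- The trace as a functional. -/
def traceFn (a : Type) [Fintype a] : Op a →ₗ[ℂ] ℂ := Matrix.traceLinearMap a ℂ ℂ

@[simp] theorem traceFn_apply [Fintype a] (X : Op a) : traceFn a X = X.trace := rfl

theorem traceFn_pos [Fintype a] : PosFn (traceFn a) := fun _ hX => hX.trace_nonneg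

theorem traceFn_subTr [Fintype a] : SubTr (traceFn a) := fun _ _ => le_rfl

theorem trace_re_nonneg [Fintype a] {X : Op a} (hX : X.PosSemidef) : 0 ≤ X.trace.re :=
  traceFn_pos.re_nonneg hX

theorem PosFn.zero : PosFn (0 : Op a →ₗ[ℂ] ℂ) := fun _ _ => le_rfl

theorem PosFn.add {f g : Op a →ₗ[ℂ] ℂ} (hf : PosFn f) (hg : PosFn g) : PosFn (f + g) :=
  fun X hX => add_nonneg (hf X hX) (hg X hX)

theorem IsTP.tni [Fintype a] [Fintype b] {Φ : Op a →ₗ[ℂ] Op b} (h : IsTP Φ) : TNI Φ :=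
  fun X _ => by rw [h X]

theorem TNI.comp [Fintype a] [Fintype b] [Fintype c] {Φ : Op a →ₗ[ℂ] Op b} {Ψ : Op b →ₗ[ℂ] Op c}
    (hΨ : TNI Ψ) (hΦ : TNI Φ) (hp : ∀ X : Op a, X.PosSemidef → (Φ X).PosSemidef) :
    TNI (Ψ ∘ₗ Φ) :=
  fun X hX => (hΨ _ (hp X hX)).trans (hΦ X hX)

theorem IsCP.posSemidef [Fintype a] [Finite b] {Φ : Op a →ₗ[ℂ] Op b} (h : IsCP Φ) {X : Op a}
    (hX : X.PosSemidef) : (Φ X).PosSemidef := by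
  obtain ⟨ι, _, A, hA⟩ := h
  rw [hA]
  exact posSemidef_sum _ fun i _ => hX.mul_mul_conjTranspose_same (A i)

theorem PosFn.comp [Fintype a] [Finite b] {f : Op b →ₗ[ℂ] ℂ} (hf : PosFn f) {Φ : Op a →ₗ[ℂ] Op b}
    (hΦ : IsCP Φ) : PosFn (f ∘ₗ Φ) := fun _ hX => hf _ (hΦ.posSemidef hX)

theorem SubTr.comp [Fintype a] [Fintype b] {f : Op b →ₗ[ℂ] ℂ} (hf : SubTr f)
    {Φ : Op a →ₗ[ℂ] Op b} (hΦ : IsCP Φ) (h : TNI Φ) : SubTr (f ∘ₗ Φ) :=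
  fun X hX => (hf _ (hΦ.posSemidef hX)).trans (h X hX)

theorem TNI.comp' [Fintype a] [Fintype b] [Fintype c] {Φ : Op a →ₗ[ℂ] Op b} {Ψ : Op b →ₗ[ℂ] Op c}
    (hΨ : TNI Ψ) (hΦ : TNI Φ) (hp : IsCP Φ) : TNI (Ψ ∘ₗ Φ) :=
  hΨ.comp hΦ fun _ hX => hp.posSemidef hX

theorem IsCP.zero [Fintype a] : IsCP (0 : Op a →ₗ[ℂ] Op b) :=
  ⟨Empty, inferInstance, fun _ => 0, fun X => by simp⟩

theorem IsCP.id [Fintype a] : IsCP (LinearMap.id : Op a →ₗ[ℂ] Op a) := by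
  classical
  exact ⟨Unit, inferInstance, fun _ => 1, fun X => by simp⟩

theorem IsCP.add [Fintype a] {Φ Ψ : Op a →ₗ[ℂ] Op b} (h : IsCP Φ) (h' : IsCP Ψ) :
    IsCP (Φ + Ψ) := by
  obtain ⟨ι, _, A, hA⟩ := h
  obtain ⟨κ, _, B, hB⟩ := h'
  exact ⟨ι ⊕ κ, inferInstance, Sum.elim A B, fun X => by simp [hA, hB]⟩

theorem IsCP.sum [Fintype a] {ι : Type} (s : Finset ι) {Φ : ι → Op a →ₗ[ℂ] Op b}
    (h : ∀ i ∈ s, IsCP (Φ i)) : IsCP (∑ i ∈ s, Φ i) := by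
  classical
  induction s using Finset.induction_on with
  | empty => simpa using IsCP.zero
  | insert i s hi ih =>
    rw [Finset.sum_insert hi]
    exact (h i (Finset.mem_insert_self _ _)).add
      (ih fun j hj => h j (Finset.mem_insert_of_mem hj))

theorem IsCP.comp [Fintype a] [Fintype b] {Φ : Op a →ₗ[ℂ] Op b} {Ψ : Op b →ₗ[ℂ] Op c}
    (h' : IsCP Ψ) (h : IsCP Φ) : IsCP (Ψ ∘ₗ Φ) := by
  obtain ⟨ι, _, A, hA⟩ := h
  obtain ⟨κ, _, B, hB⟩ := h'
  refine ⟨κ × ι, inferInstance, fun p => B p.1 * A p.2, fun X => ?_⟩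
  rw [LinearMap.comp_apply, hB, hA, Fintype.sum_prod_type]
  refine Finset.sum_congr rfl fun i _ => ?_
  simp only [Matrix.mul_sum, Matrix.sum_mul, conjTranspose_mul, Matrix.mul_assoc]

/-- `X ↦ A X A†`. -/
def conjL [Fintype a] (A : Matrix b a ℂ) : Op a →ₗ[ℂ] Op b where
  toFun X := A * X * Aᴴ
  map_add' X Y := by rw [Matrix.mul_add, Matrix.add_mul]
  map_smul' c X := by simp

theorem conjL_apply [Fintype a] (A : Matrix b a ℂ) (X : Op a) : conjL A X = A * X * Aᴴ := rfl

theorem conjL_cp [Fintype a] (A : Matrix b a ℂ) : IsCP (conjL A) :=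
  ⟨Unit, inferInstance, fun _ => A, fun X => by simp [conjL]⟩

theorem conjL_trace [Fintype a] [Fintype b] (A : Matrix b a ℂ) (X : Op a) :
    (conjL A X).trace = (Aᴴ * A * X).trace := by
  rw [conjL_apply, Matrix.trace_mul_comm, Matrix.mul_assoc]

/-- Relabelling and restriction of registers, `X ↦ X.submatrix f f`. -/
def reix (f : b → a) : Op a →ₗ[ℂ] Op b where
  toFun X := X.submatrix f f
  map_add' _ _ := rfl
  map_smul' _ _ := rfl

@[simp] theorem reix_apply (f : b → a) (X : Op a) (i j : b) : reix f X i j = X (f i) (f j) := rfl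

theorem reix_cp [Fintype a] (f : b → a) : IsCP (reix f) := by
  classical
  refine ⟨Unit, inferInstance, fun _ => Matrix.of fun i j => if f i = j then 1 else 0, fun X => ?_⟩
  ext i j
  simp [Matrix.mul_apply, apply_ite star]

theorem reix_trace_equiv [Fintype a] [Fintype b] (f : b ≃ a) (X : Op a) :
    (reix f X).trace = X.trace := by
  simp only [Matrix.trace, Matrix.diag_apply, reix_apply]
  exact Equiv.sum_comp f fun i => X i i

theorem reix_tp [Fintype a] [Fintype b] (f : b ≃ a) : IsTP (reix f) := reix_trace_equiv f

/-- Trace out the first register. -/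
def trL [Fintype a] : Op (a × e) →ₗ[ℂ] Op e := ∑ x : a, reix fun i => (x, i)

theorem trL_apply [Fintype a] (X : Op (a × e)) (i j : e) :
    trL X i j = ∑ x, X (x, i) (x, j) := by
  simp [trL, LinearMap.sum_apply, Matrix.sum_apply]

theorem trL_cp [Fintype a] [Fintype e] : IsCP (trL : Op (a × e) →ₗ[ℂ] Op e) :=
  IsCP.sum _ fun _ _ => reix_cp _

theorem trL_trace [Fintype a] [Fintype e] (X : Op (a × e)) : (trL X).trace = X.trace := by
  simp only [Matrix.trace, Matrix.diag_apply, trL_apply, Fintype.sum_prod_type]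
  exact Finset.sum_comm

/-- Trace out the second register. -/
def trR [Fintype e] : Op (a × e) →ₗ[ℂ] Op a := ∑ x : e, reix fun i => (i, x)

theorem trR_apply [Fintype e] (X : Op (a × e)) (i j : a) :
    trR X i j = ∑ x, X (i, x) (j, x) := by
  simp [trR, LinearMap.sum_apply, Matrix.sum_apply]

theorem trR_cp [Fintype a] [Fintype e] : IsCP (trR : Op (a × e) →ₗ[ℂ] Op a) :=
  IsCP.sum _ fun _ _ => reix_cp _

theorem trR_trace [Fintype a] [Fintype e] (X : Op (a × e)) : (trR X).trace = X.trace := by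
  simp only [Matrix.trace, Matrix.diag_apply, trR_apply, Fintype.sum_prod_type]

theorem ampl_apply (Φ : Op a →ₗ[ℂ] Op b) (r : Type) (X : Op (a × r)) (p q : b × r) :
    ampl Φ r X p q = Φ (X.submatrix (fun i => (i, p.2)) (fun i => (i, q.2))) p.1 q.1 := rfl

theorem ampl_comp (Ψ : Op b →ₗ[ℂ] Op c) (Φ : Op a →ₗ[ℂ] Op b) (r : Type) :
    ampl (Ψ ∘ₗ Φ) r = ampl Ψ r ∘ₗ ampl Φ r := rfl

theorem ampl_add (Φ Ψ : Op a →ₗ[ℂ] Op b) (r : Type) : ampl (Φ + Ψ) r = ampl Φ r + ampl Ψ r := rfl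

theorem ampl_sub (Φ Ψ : Op a →ₗ[ℂ] Op b) (r : Type) : ampl (Φ - Ψ) r = ampl Φ r - ampl Ψ r := rfl

theorem ampl_smul (z : ℂ) (Φ : Op a →ₗ[ℂ] Op b) (r : Type) : ampl (z • Φ) r = z • ampl Φ r := rfl

theorem ampl_sum {ι : Type} (s : Finset ι) (Φ : ι → Op a →ₗ[ℂ] Op b) (r : Type) :
    ampl (∑ i ∈ s, Φ i) r = ∑ i ∈ s, ampl (Φ i) r := by
  ext X p q
  simp [ampl_apply, LinearMap.sum_apply, Matrix.sum_apply]

theorem ampl_reix (f : b → a) (r : Type) : ampl (reix f) r = reix (Prod.map f id) := rfl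

theorem reix_ref_ampl (Φ : Op a →ₗ[ℂ] Op b) {r r' : Type} (g : r' → r) (X : Op (a × r)) :
    reix (Prod.map id g) (ampl Φ r X) = ampl Φ r' (reix (Prod.map id g) X) := rfl

open scoped Kronecker in
theorem ampl_conjL [Fintype a] {r : Type} [Fintype r] [DecidableEq r] (A : Matrix b a ℂ) :
    ampl (conjL A) r = conjL (A ⊗ₖ (1 : Op r)) := by
  ext X p q
  simp only [ampl_apply, conjL_apply, Matrix.mul_apply, kroneckerMap_apply,
    conjTranspose_apply, Fintype.sum_prod_type, Matrix.one_apply, submatrix_apply]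
  simp [apply_ite star, ite_mul, mul_ite]

theorem IsCP.ampl [Fintype a] {Φ : Op a →ₗ[ℂ] Op b} (h : IsCP Φ) (r : Type) [Fintype r] :
    IsCP (ampl Φ r) := by
  classical
  obtain ⟨ι, _, A, hA⟩ := h
  have : Φ = ∑ i, conjL (A i) := by
    ext1 X
    rw [hA, LinearMap.sum_apply]
    rfl
  rw [this, ampl_sum]
  refine IsCP.sum _ fun i _ => ?_
  rw [ampl_conjL]
  exact conjL_cp _

/-- `id_r ⊗ Φ`. -/
def amplR (r : Type) (Φ : Op a →ₗ[ℂ] Op b) : Op (r × a) →ₗ[ℂ] Op (r × b) :=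
  reix Prod.swap ∘ₗ ampl Φ r ∘ₗ reix Prod.swap

theorem amplR_apply (r : Type) (Φ : Op a →ₗ[ℂ] Op b) (X : Op (r × a)) (p q : r × b) :
    amplR r Φ X p q = Φ (X.submatrix (fun i => (p.1, i)) (fun i => (q.1, i))) p.2 q.2 := rfl

theorem IsCP.amplR [Fintype a] [Fintype b] {Φ : Op a →ₗ[ℂ] Op b} (h : IsCP Φ) (r : Type)
    [Fintype r] : IsCP (amplR r Φ) := (reix_cp _).comp ((h.ampl r).comp (reix_cp _))

open scoped Kronecker in
theorem amplR_conjL [Fintype a] {r : Type} [Fintype r] [DecidableEq r] (A : Matrix b a ℂ) :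
    amplR r (conjL A) = conjL ((1 : Op r) ⊗ₖ A) := by
  ext X p q
  simp only [amplR_apply, conjL_apply, Matrix.mul_apply, kroneckerMap_apply,
    conjTranspose_apply, Fintype.sum_prod_type, Matrix.one_apply, submatrix_apply]
  simp [apply_ite star, ite_mul, mul_ite, Finset.sum_ite_irrel]

/-- Operations on the reference commute with `Φ ⊗ id`. -/
theorem ampl_amplR_conjL {r r' : Type} [Fintype r] (Φ : Op a →ₗ[ℂ] Op b) (K : Matrix r' r ℂ)
    (X : Op (a × r)) :
    ampl Φ r' (amplR a (conjL K) X) = amplR b (conjL K) (ampl Φ r X) := by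
  have h : ∀ {z : Type} (Y : Op (z × r)) (i i' : r'),
      (amplR z (conjL K) Y).submatrix (fun x => (x, i)) (fun x => (x, i')) =
      ∑ u, ∑ v, (K i u * star (K i' v)) • Y.submatrix (fun x => (x, u)) (fun x => (x, v)) := by
    intro z Y i i'
    ext x y
    simp only [amplR_apply, conjL_apply, Matrix.mul_apply, submatrix_apply, Matrix.sum_apply,
      conjTranspose_apply, Matrix.smul_apply, Finset.sum_mul, smul_eq_mul]
    rw [Finset.sum_comm]
    refine Finset.sum_congr rfl fun u _ => Finset.sum_congr rfl fun v _ => ?_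
    ring
  ext ⟨p, i⟩ ⟨q, i'⟩
  have h2 := congrFun (congrFun (h (ampl Φ r X) i i') p) q
  rw [submatrix_apply] at h2
  rw [h2, ampl_apply, h]
  simp only [map_sum, map_smul, Matrix.sum_apply, Matrix.smul_apply]
  rfl

theorem trL_ampl [Fintype a] [Fintype b] {Φ : Op a →ₗ[ℂ] Op b} (h : IsTP Φ) {r : Type}
    (X : Op (a × r)) : trL (ampl Φ r X) = trL X := by
  ext i j
  rw [trL_apply, trL_apply]
  exact h (X.submatrix (fun x => (x, i)) (fun x => (x, j)))

theorem trR_ampl {r : Type} [Fintype r] (Φ : Op a →ₗ[ℂ] Op b) (X : Op (a × r)) :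
    trR (ampl Φ r X) = Φ (trR X) := by
  have : (trR X) = ∑ x : r, X.submatrix (fun i => (i, x)) (fun i => (i, x)) := by
    ext i j
    rw [trR_apply, Matrix.sum_apply]
    rfl
  ext i j
  rw [this, trR_apply, map_sum, Matrix.sum_apply]
  rfl

theorem ampl_trace {r : Type} [Fintype r] [Fintype b] [Fintype a] (Φ : Op a →ₗ[ℂ] Op b)
    (X : Op (a × r)) : (ampl Φ r X).trace = (Φ (trR X)).trace := by
  rw [← trR_trace, trR_ampl]

theorem amplR_trace {r : Type} [Fintype r] [Fintype b] [Fintype a] (Φ : Op a →ₗ[ℂ] Op b)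
    (X : Op (r × a)) : (amplR r Φ X).trace = (Φ (trL X)).trace := by
  have h1 : (amplR r Φ X).trace = (ampl Φ r (reix Prod.swap X)).trace :=
    reix_trace_equiv (Equiv.prodComm r b) (ampl Φ r (reix Prod.swap X))
  have h2 : trR (reix Prod.swap X) = trL X := by
    ext i j
    simp [trR_apply, trL_apply]
  rw [h1, ampl_trace, h2]

theorem TNI.ampl [Fintype a] [Fintype b] {Φ : Op a →ₗ[ℂ] Op b} (h : TNI Φ) (r : Type)
    [Fintype r] : TNI (ampl Φ r) := by
  intro X hX
  rw [ampl_trace, ← trR_trace X]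
  exact h _ (trR_cp.posSemidef hX)

theorem IsTP.ampl [Fintype a] [Fintype b] {Φ : Op a →ₗ[ℂ] Op b} (h : IsTP Φ) (r : Type)
    [Fintype r] : IsTP (ampl Φ r) := by
  intro X
  rw [ampl_trace, h, trR_trace X]

/-- A positive functional bounded by the trace is `X ↦ tr(EX)` with `0 ≤ E ≤ 1`, that is, an effect.
The experiments below are compared through such functionals, and this lemma links them to the trace
norm. -/
theorem PosFn.norm_le_traceNorm [Fintype a] [DecidableEq a] {f : Op a →ₗ[ℂ] ℂ} (hf : PosFn f)
    (hf' : SubTr f) (X : Op a) : ‖f X‖ ≤ traceNorm X := by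
  set E : Op a := Matrix.of fun i j => f (Matrix.single j i 1) with hE
  have h1 : ∀ Y : Op a, f Y = (E * Y).trace := by
    intro Y
    conv_lhs => rw [Matrix.matrix_eq_sum_single Y]
    simp only [map_sum, Matrix.trace, Matrix.diag_apply, Matrix.mul_apply]
    rw [Finset.sum_comm]
    refine Finset.sum_congr rfl fun i _ => Finset.sum_congr rfl fun j _ => ?_
    have : Matrix.single j i (Y j i) = Y j i • Matrix.single j i (1 : ℂ) := by
      rw [Matrix.smul_single, smul_eq_mul, mul_one]
    rw [this, map_smul, smul_eq_mul, mul_comm]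
    rfl
  have h2 : ∀ x : a → ℂ, star x ⬝ᵥ E *ᵥ x = f (vecMulVec x (star x)) := by
    intro x
    rw [h1, mul_vecMulVec, trace_vecMulVec, dotProduct_comm]
  have h3 : E.PosSemidef := by
    refine Matrix.posSemidef_iff_dotProduct_mulVec.mpr ⟨?_, fun x => ?_⟩
    -- Hermiticity holds because the quadratic form of `E` takes only real values.
    · refine Matrix.isSymmetric_toEuclideanLin_iff.mp
        ((LinearMap.isSymmetric_iff_inner_map_self_real _).mpr fun v => ?_)
      have h4 : inner ℂ (Matrix.toEuclideanLin E v) v = star (star v.ofLp ⬝ᵥ E *ᵥ v.ofLp) := by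
        rw [← inner_conj_symm]
        exact congrArg star (dotProduct_comm _ _)
      rw [h4, h2]
      have h5 := hf _ (posSemidef_vecMulVec_self_star v.ofLp)
      have h6 : star (f (vecMulVec v.ofLp (star v.ofLp))) = f (vecMulVec v.ofLp (star v.ofLp)) :=
        (IsSelfAdjoint.of_nonneg h5)
      rw [h6]
      exact h6
    · rw [h2]
      exact hf _ (posSemidef_vecMulVec_self_star x)
  have h4 : (1 - E).PosSemidef := by
    refine Matrix.posSemidef_iff_dotProduct_mulVec.mpr ⟨?_, fun x => ?_⟩
    · exact isHermitian_one.sub h3.isHermitian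
    · rw [sub_mulVec, one_mulVec, dotProduct_sub, h2, sub_nonneg]
      have h5 := hf' _ (posSemidef_vecMulVec_self_star x)
      have h6 := hf _ (posSemidef_vecMulVec_self_star x)
      have h7 := dotProduct_star_self_nonneg x
      rw [trace_vecMulVec, dotProduct_comm] at h5
      exact Complex.le_def.mpr ⟨h5, (Complex.le_def.mp h6).2.symm.trans (Complex.le_def.mp h7).2⟩
  rw [h1]
  refine norm_trace_mul_le ?_ X
  -- `1 - E² = (1 - E)(1 + E)` is rewritten as a sum of terms that are visibly positive, so that no
  -- square root of `E` is needed.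
  have h5 : 1 - E * Eᴴ = (1 - E) + (E * (1 - E) * Eᴴ + (1 - E) * E * (1 - E)ᴴ) := by
    rw [conjTranspose_sub, h3.isHermitian.eq, conjTranspose_one]
    noncomm_ring
  rw [IsContr, h5]
  exact h4.add ((h4.mul_mul_conjTranspose_same E).add (h3.mul_mul_conjTranspose_same (1 - E)))

end Positivity

/-! ### Diamond norm bounds tested on states and effects -/

section Diamond

variable {a b c e : Type}

theorem traceNorm_ampl_le_of_diamondNorm_le [Fintype a] [DecidableEq a] [Fintype b]
    [DecidableEq b] {Φ : Op a →ₗ[ℂ] Op b} {ε : ℝ} (hε : 0 ≤ ε)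
    (h : diamondNorm Φ ≤ ENNReal.ofReal ε) {d : ℕ} (X : Op (a × Fin d)) (hX : traceNorm X ≤ 1) :
    traceNorm (ampl Φ (Fin d) X) ≤ ε := by
  have h1 : ENNReal.ofReal (traceNorm (ampl Φ (Fin d) X)) ≤ diamondNorm Φ :=
    le_iSup_of_le d (le_iSup_of_le X (le_iSup_of_le hX le_rfl))
  exact (ENNReal.ofReal_le_ofReal_iff hε).mp (h1.trans h)

/-- A diamond norm bound, tested on a state and an effect. -/
theorem norm_fn_ampl_le [Fintype a] [DecidableEq a] [Fintype b] [DecidableEq b]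
    {Φ : Op a →ₗ[ℂ] Op b} {ε : ℝ} (hε : 0 ≤ ε) (h : diamondNorm Φ ≤ ENNReal.ofReal ε)
    {L : Type} [Fintype L] {ρ : Op (a × L)} (hρ : ρ.PosSemidef)
    {f : Op (b × L) →ₗ[ℂ] ℂ} (hf : PosFn f) (hf' : SubTr f) :
    ‖f (ampl Φ L ρ)‖ ≤ ε * ρ.trace.re := by
  classical
  set u : L ≃ Fin (Fintype.card L) := Fintype.equivFin L
  set t := ρ.trace.re with ht
  have ht0 : 0 ≤ t := trace_re_nonneg hρ
  -- The diamond norm is tested on normalised inputs with reference `Fin d`, so the state is divided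
  -- by its trace and its reference is relabelled; trace zero is treated apart.
  rcases ht0.eq_or_lt with h0 | h0
  · have : ρ = 0 := by
      rw [← hρ.trace_eq_zero_iff]
      refine Complex.ext (by simpa using h0.symm) ?_
      simpa using (Complex.le_def.mp hρ.trace_nonneg).2.symm
    simp [this, ← h0]
  · set X : Op (a × Fin (Fintype.card L)) := ((t⁻¹ : ℝ) : ℂ) • reix (Prod.map id u.symm) ρ with hX
    have hXp : X.PosSemidef := by
      refine ((reix_cp _).posSemidef hρ).smul ?_
      exact_mod_cast (inv_pos.mpr h0).le
    have htr : X.trace.re = 1 := by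
      rw [hX, Matrix.trace_smul, smul_eq_mul, Complex.re_ofReal_mul]
      have := reix_trace_equiv ((Equiv.refl a).prodCongr u.symm) ρ
      change t⁻¹ * (reix ((Equiv.refl a).prodCongr u.symm) ρ).trace.re = 1
      rw [this, ← ht, inv_mul_cancel₀ h0.ne']
    have h1 := traceNorm_ampl_le_of_diamondNorm_le hε h X
      ((traceNorm_le_of_posSemidef hXp).trans htr.le)
    set g : Op (b × Fin (Fintype.card L)) →ₗ[ℂ] ℂ := f ∘ₗ reix (Prod.map id u) with hg
    have hgp : PosFn g := hf.comp (reix_cp _)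
    have hgs : SubTr g := hf'.comp (reix_cp _)
      (reix_tp ((Equiv.refl b).prodCongr u)).tni
    have h2 := (hgp.norm_le_traceNorm hgs _).trans h1
    have h3 : g (ampl Φ (Fin (Fintype.card L)) X) = ((t⁻¹ : ℝ) : ℂ) * f (ampl Φ L ρ) := by
      rw [hX, map_smul, map_smul, smul_eq_mul, hg, LinearMap.comp_apply, reix_ref_ampl]
      congr 4
      ext ⟨i, j⟩ ⟨i', j'⟩
      simp
    rw [h3, norm_mul, Complex.norm_real, Real.norm_of_nonneg (inv_pos.mpr h0).le,
      inv_mul_le_iff₀ h0] at h2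
    rwa [mul_comm]

/-- A trace nonincreasing completely positive map is the restriction of a channel. -/
theorem exists_channel_extending [Fintype a] [DecidableEq a] [Fintype c] [DecidableEq c]
    [Nonempty c] [Fintype b] [DecidableEq b] {Φ : Op a →ₗ[ℂ] Op (c × b)} (hΦ : IsCP Φ)
    (ht : TNI Φ) :
    ∃ Λ : Channel a (c × Option b), reix (Prod.map id some) ∘ₗ Λ.map = Φ := by
  obtain ⟨ι, _, A, hA⟩ := hΦ
  set G : Op a := ∑ i, (A i)ᴴ * A i with hG
  have htr : ∀ X, (Φ X).trace = (G * X).trace := by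
    intro X
    rw [hA, hG, Matrix.sum_mul, Matrix.trace_sum, Matrix.trace_sum]
    exact Finset.sum_congr rfl fun i _ => conjL_trace (A i) X
  have hGp : G.PosSemidef := posSemidef_sum _ fun i _ => posSemidef_conjTranspose_mul_self _
  have h1 : (1 - G).PosSemidef := by
    refine Matrix.posSemidef_iff_dotProduct_mulVec.mpr
      ⟨isHermitian_one.sub hGp.isHermitian, fun x => ?_⟩
    rw [sub_mulVec, one_mulVec, dotProduct_sub, sub_nonneg]
    have h2 := ht _ (posSemidef_vecMulVec_self_star x)
    rw [htr, mul_vecMulVec, trace_vecMulVec, trace_vecMulVec, dotProduct_comm,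
      dotProduct_comm x] at h2
    have h3 := hGp.dotProduct_mulVec_nonneg x
    have h4 := dotProduct_star_self_nonneg x
    exact Complex.le_def.mpr ⟨h2, (Complex.le_def.mp h3).2.symm.trans (Complex.le_def.mp h4).2⟩
  obtain ⟨H, hH⟩ := h1.exists_eq_conjTranspose_mul
  let c0 : c := Classical.arbitrary c
  -- The missing weight `1 - G = HᴴH` is sent to the flag `none`, together with a fixed ciphertext
  -- `c0`. Restricting to the flag `some` recovers `Φ`.
  let Kr : ι ⊕ a → Matrix (c × Option b) a ℂ := Sum.elim
    (fun i => Matrix.of fun p x => match p.2 with | some y => A i (p.1, y) x | none => 0)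
    (fun z => Matrix.of fun p x => if p = (c0, none) then H z x else 0)
  have hK : ∑ i, (Kr i)ᴴ * Kr i = 1 := by
    rw [Fintype.sum_sum_type]
    have e1 : ∀ i, (Kr (Sum.inl i))ᴴ * Kr (Sum.inl i) = (A i)ᴴ * A i := by
      intro i
      ext x y
      simp [Kr, Matrix.mul_apply, Fintype.sum_prod_type]
    have e2 : ∑ z, (Kr (Sum.inr z))ᴴ * Kr (Sum.inr z) = Hᴴ * H := by
      ext x y
      simp [Kr, Matrix.mul_apply, Matrix.sum_apply, apply_ite star]
    rw [Finset.sum_congr rfl fun i _ => e1 i, e2, ← hH]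
    abel
  refine ⟨⟨∑ i, conjL (Kr i), IsCP.sum _ fun i _ => conjL_cp _, fun X => ?_⟩, ?_⟩
  · rw [LinearMap.sum_apply, Matrix.trace_sum]
    simp only [conjL_trace]
    rw [← Matrix.trace_sum, ← Matrix.sum_mul, hK, Matrix.one_mul]
  · ext X p q
    obtain ⟨p1, p2⟩ := p
    obtain ⟨q1, q2⟩ := q
    rw [LinearMap.comp_apply, reix_apply, LinearMap.sum_apply, Matrix.sum_apply,
      Fintype.sum_sum_type, hA, Matrix.sum_apply]
    have e2 : ∀ z, conjL (Kr (Sum.inr z)) X (Prod.map id some (p1, p2))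
        (Prod.map id some (q1, q2)) = 0 := by
      intro z
      simp [Kr, conjL_apply, Matrix.mul_apply]
    rw [Finset.sum_congr rfl fun z _ => e2 z, Finset.sum_const_zero, add_zero]
    refine Finset.sum_congr rfl fun i _ => ?_
    simp [Kr, conjL_apply, Matrix.mul_apply]

end Diamond

/-! ### Consequences of ciphertext authentication at one security parameter -/

section Authentication

variable {S : QScheme} {B B' : Type}

/-- `S` is ciphertext authenticating up to `ε`, uniformly in the attack. -/
def QCABound {S : QScheme} (D : Decomposition S) (ε : ℝ) : Prop :=
  ∀ (B B' : Type) [Fintype B] [DecidableEq B] [Fintype B'] [DecidableEq B']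
    (Λ : Channel (S.C × B) (S.C × B')), ∃ rej : Op B →ₗ[ℂ] Op B',
      diamondNorm (effectiveMap S Λ.map - simulator S.M (accMap D Λ.map) rej)
        ≤ ENNReal.ofReal ε

theorem reix_effectiveMap {B'' : Type} (Λ : Op (S.C × B) →ₗ[ℂ] Op (S.C × B')) (g : B'' → B') :
    effectiveMap S (reix (Prod.map id g) ∘ₗ Λ) = reix (Prod.map id g) ∘ₗ effectiveMap S Λ := by
  ext1 X
  simp only [effectiveMap, LinearMap.smul_apply, LinearMap.sum_apply, LinearMap.comp_apply,
    map_smul, map_sum]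
  rfl

theorem reix_accMap (D : Decomposition S) {B'' : Type} (Λ : Op (S.C × B) →ₗ[ℂ] Op (S.C × B'))
    (g : B'' → B') :
    accMap D (reix (Prod.map id g) ∘ₗ Λ) = reix g ∘ₗ accMap D Λ := by
  ext1 X
  simp only [accMap, LinearMap.smul_apply, LinearMap.sum_apply, LinearMap.comp_apply,
    map_smul, map_sum]
  rfl

theorem reix_simulator {M B'' : Type} [Fintype M] (acc rej : Op B →ₗ[ℂ] Op B') (g : B'' → B') :
    simulator M (reix g ∘ₗ acc) (reix g ∘ₗ rej) =
      reix (Prod.map id g) ∘ₗ simulator M acc rej := by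
  ext X ⟨i, x⟩ ⟨j, y⟩
  cases i <;> cases j <;> rfl

/-- The form in which QCA is used: attacks may lose weight, and the comparison is made by effects on
an arbitrary reference. The attack is extended to a channel with a flag, and selecting the flag
commutes with the effective map and the simulator. No positivity of `rej` is kept, since later uses
either cut the rejecting part off or need only that it depends on the reduced input. -/
theorem QCABound.exists_rej {D : Decomposition S} {ε : ℝ} (hQ : QCABound D ε) (hε : 0 ≤ ε)
    [Nonempty S.C] [Fintype B] [Fintype B'] {Λ : Op (S.C × B) →ₗ[ℂ] Op (S.C × B')}
    (hΛ : IsCP Λ) (hΛ' : TNI Λ) :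
    ∃ rej : Op B →ₗ[ℂ] Op B', ∀ (L : Type) [Fintype L] (ρ : Op ((S.M × B) × L)),
      ρ.PosSemidef → ∀ f : Op ((Option S.M × B') × L) →ₗ[ℂ] ℂ, PosFn f → SubTr f →
        ‖f (ampl (effectiveMap S Λ) L ρ) - f (ampl (simulator S.M (accMap D Λ) rej) L ρ)‖
          ≤ ε * ρ.trace.re := by
  classical
  obtain ⟨Λ', rfl⟩ := exists_channel_extending hΛ hΛ'
  obtain ⟨rej, hrej⟩ := hQ B (Option B') Λ'
  refine ⟨reix some ∘ₗ rej, fun L _ ρ hρ f hf hf' => ?_⟩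
  rw [reix_effectiveMap, reix_accMap, reix_simulator, ampl_comp, ampl_comp, ampl_reix,
    LinearMap.comp_apply, LinearMap.comp_apply, ← map_sub, ← map_sub, ← LinearMap.sub_apply,
    ← ampl_sub]
  refine norm_fn_ampl_le hε hrej hρ (f := f ∘ₗ reix _) (hf.comp (reix_cp _))
    (hf'.comp (reix_cp _) fun X hX => ?_)
  simp only [Matrix.trace, Complex.re_sum, Matrix.diag_apply, reix_apply, Fintype.sum_prod_type,
    Prod.map, id]
  refine Finset.sum_le_sum fun i _ => ?_
  rw [Fintype.sum_option]
  have := Finset.sum_nonneg fun (l : L) (_ : l ∈ Finset.univ) =>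
    (Complex.le_def.mp (hX.diag_nonneg (i := ((i, none), l)))).1
  simpa using this

end Authentication

/-! ### Cross terms and pinching for positive functionals -/

section Pinching

variable {a b c e : Type}

/-- Relaxed parallelogram inequality for positive functionals. -/
theorem PosFn.conjL_add_le [Fintype a] [Fintype b] {f : Op b →ₗ[ℂ] ℂ} (hf : PosFn f) {X : Op a}
    (hX : X.PosSemidef) (A A' : Matrix b a ℂ) :
    (f (conjL (A + A') X)).re ≤ 2 * (f (conjL A X)).re + 2 * (f (conjL A' X)).re := by
  have h := hf.re_nonneg ((conjL_cp (A - A')).posSemidef hX)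
  have e1 : conjL (A - A') X = 2 • conjL A X + 2 • conjL A' X - conjL (A + A') X := by
    simp only [conjL_apply, conjTranspose_add, conjTranspose_sub, Matrix.add_mul, Matrix.mul_add,
      Matrix.sub_mul, Matrix.mul_sub]
    abel
  rw [e1] at h
  simp only [map_add, map_sub, map_nsmul, nsmul_eq_mul, Complex.add_re, Complex.sub_re] at h
  norm_num at h
  linarith

/-- Cross terms of a positive functional are controlled by its diagonal terms. -/
theorem PosFn.abs_cross_le [Fintype a] [Fintype b] {f : Op b →ₗ[ℂ] ℂ} (hf : PosFn f) {X : Op a}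
    (hX : X.PosSemidef) (A A' : Matrix b a ℂ) {η : ℝ} (hη : 0 < η) :
    |(f (A * X * A'ᴴ + A' * X * Aᴴ)).re| ≤
      η * (f (conjL A X)).re + η⁻¹ * (f (conjL A' X)).re := by
  have key : ∀ s : ℝ, s ^ 2 = 1 →
      s * (f (A * X * A'ᴴ + A' * X * Aᴴ)).re ≤
        η * (f (conjL A X)).re + η⁻¹ * (f (conjL A' X)).re := by
    intro s hs
    -- Positivity at `ηA - sA'` with `s = ±1` bounds the cross term from both sides. The weight `η`
    -- moves the cost towards the diagonal term that is known to be small.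
    have h := hf.re_nonneg ((conjL_cp ((η : ℂ) • A - (s : ℂ) • A')).posSemidef hX)
    have e1 : conjL ((η : ℂ) • A - (s : ℂ) • A') X = ((η ^ 2 : ℝ) : ℂ) • conjL A X +
        ((s ^ 2 : ℝ) : ℂ) • conjL A' X - ((η * s : ℝ) : ℂ) • (A * X * A'ᴴ + A' * X * Aᴴ) := by
      simp only [conjL_apply, conjTranspose_sub, conjTranspose_smul, Complex.star_def,
        Complex.conj_ofReal, Matrix.sub_mul, Matrix.mul_sub, Matrix.smul_mul, Matrix.mul_smul,
        smul_sub, smul_add, smul_smul]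
      push_cast
      module
    rw [e1, hs] at h
    simp only [map_add, map_sub, map_smul, smul_eq_mul, Complex.add_re, Complex.sub_re,
      Complex.re_ofReal_mul, one_mul] at h
    have h2 : η * (s * (f (A * X * A'ᴴ + A' * X * Aᴴ)).re) ≤
        η * (η * (f (conjL A X)).re + η⁻¹ * (f (conjL A' X)).re) := by
      have : η * (η⁻¹ * (f (conjL A' X)).re) = (f (conjL A' X)).re := by field_simp
      rw [mul_add, this]
      simp only [map_add, Complex.add_re] at h ⊢
      nlinarith
    exact le_of_mul_le_mul_left h2 hη
  rw [abs_le]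
  have h1 := key 1 (by norm_num)
  have h2 := key (-1) (by norm_num)
  constructor <;> linarith

theorem conjL_eq_pinch [Fintype a] [DecidableEq a] (P X : Op a) :
    X = conjL P X + conjL (1 - P) X + (P * X * (1 - P)ᴴ + (1 - P) * X * Pᴴ) := by
  simp only [conjL_apply, conjTranspose_sub, conjTranspose_one]
  noncomm_ring

/-- Pinching by `P` and `1 - P` changes a positive functional little if one of the two diagonal
terms is small. -/
theorem PosFn.abs_sub_pinch_le [Fintype a] [DecidableEq a] {f : Op a →ₗ[ℂ] ℂ} (hf : PosFn f)
    {X : Op a} (hX : X.PosSemidef) (P : Op a) {η : ℝ} (hη : 0 < η) :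
    |(f X).re - (f (conjL P X)).re| ≤
      η * (f (conjL P X)).re + (1 + η⁻¹) * (f (conjL (1 - P) X)).re := by
  have h := hf.abs_cross_le hX P (1 - P) hη
  have h2 : (f X).re = (f (conjL P X)).re + (f (conjL (1 - P) X)).re +
      (f (P * X * (1 - P)ᴴ + (1 - P) * X * Pᴴ)).re := by
    conv_lhs => rw [conjL_eq_pinch P X]
    simp only [map_add, Complex.add_re]
  have h3 := hf.re_nonneg ((conjL_cp (1 - P)).posSemidef hX)
  rw [h2]
  rw [abs_le] at h ⊢
  constructor <;> nlinarith [h.1, h.2]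

end Pinching

/-! ### Averages over finite sets -/

section Average

/-- The average of a real function on a finite type. -/
def avg {K : Type} [Fintype K] (g : K → ℝ) : ℝ := (Fintype.card K : ℝ)⁻¹ * ∑ k, g k

variable {K : Type} [Fintype K]

theorem avg_mono {g h : K → ℝ} (H : ∀ k, g k ≤ h k) : avg g ≤ avg h :=
  mul_le_mul_of_nonneg_left (Finset.sum_le_sum fun k _ => H k) (by positivity)

theorem avg_add (g h : K → ℝ) : avg (fun k => g k + h k) = avg g + avg h := by
  simp only [avg, Finset.sum_add_distrib, mul_add]

theorem avg_sub (g h : K → ℝ) : avg (fun k => g k - h k) = avg g - avg h := by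
  simp only [avg, Finset.sum_sub_distrib, mul_sub]

theorem avg_mul (c : ℝ) (g : K → ℝ) : avg (fun k => c * g k) = c * avg g := by
  simp only [avg, ← Finset.mul_sum]
  ring

theorem avg_const [Nonempty K] (c : ℝ) : avg (fun _ : K => c) = c := by
  simp [avg]

theorem avg_nonneg {g : K → ℝ} (H : ∀ k, 0 ≤ g k) : 0 ≤ avg g :=
  mul_nonneg (by positivity) (Finset.sum_nonneg fun k _ => H k)

theorem abs_avg_le (g : K → ℝ) : |avg g| ≤ avg fun k => |g k| := by
  rw [avg, abs_mul, abs_of_nonneg (by positivity)]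
  exact mul_le_mul_of_nonneg_left (Finset.abs_sum_le_sum_abs _ _) (by positivity)

theorem avg_sum {ι : Type} (s : Finset ι) (g : ι → K → ℝ) :
    avg (fun k => ∑ i ∈ s, g i k) = ∑ i ∈ s, avg (g i) := by
  simp only [avg]
  rw [Finset.sum_comm, Finset.mul_sum]

end Average

/-! ### Accepting and rejecting branches of a decryption -/

section AcceptReject

variable {C M E : Type}

/-- The accepting part of a decryption map. -/
def accE (Φ : Op C →ₗ[ℂ] Op (Option M)) (E : Type) : Op (C × E) →ₗ[ℂ] Op (M × E) :=
  reix (Prod.map some id) ∘ₗ ampl Φ E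

/-- The rejecting part of a decryption map. -/
def rejE (Φ : Op C →ₗ[ℂ] Op (Option M)) (E : Type) : Op (C × E) →ₗ[ℂ] Op E :=
  reix (fun e => (none, e)) ∘ₗ ampl Φ E

theorem accE_eq_ampl (Φ : Op C →ₗ[ℂ] Op (Option M)) (E : Type) :
    accE Φ E = ampl (reix some ∘ₗ Φ) E := rfl

variable [Fintype C] [Fintype M] [Fintype E]

theorem accE_cp {Φ : Op C →ₗ[ℂ] Op (Option M)} (h : IsCP Φ) (E : Type) [Fintype E] :
    IsCP (accE Φ E) := (reix_cp _).comp (h.ampl E)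

theorem rejE_cp {Φ : Op C →ₗ[ℂ] Op (Option M)} (h : IsCP Φ) (E : Type) [Fintype E] :
    IsCP (rejE Φ E) := (reix_cp _).comp (h.ampl E)

/-- Trace preservation, split into branches: the rejecting branch is the outright discard of the
ciphertext minus the accepted part. Decryption is compared with universal rejection through this
identity. -/
theorem trL_accE_add_rejE {Φ : Op C →ₗ[ℂ] Op (Option M)} (h : IsTP Φ) {E : Type}
    (X : Op (C × E)) : trL (accE Φ E X) + rejE Φ E X = trL X := by
  rw [← trL_ampl h X]
  ext i j
  rw [Matrix.add_apply, trL_apply, trL_apply, Fintype.sum_option, add_comm]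
  rfl

theorem accE_trace_add {Φ : Op C →ₗ[ℂ] Op (Option M)} (h : IsTP Φ) (X : Op (C × E)) :
    (accE Φ E X).trace + (rejE Φ E X).trace = X.trace := by
  rw [← trL_trace X, ← trL_accE_add_rejE h X, Matrix.trace_add, trL_trace]

theorem accE_tni {Φ : Op C →ₗ[ℂ] Op (Option M)} (h : IsTP Φ) (h' : IsCP Φ) :
    TNI (accE Φ E) := by
  intro X hX
  have h1 := congrArg Complex.re (accE_trace_add h X)
  have h2 := trace_re_nonneg ((rejE_cp h' E).posSemidef hX)
  rw [Complex.add_re] at h1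
  linarith

theorem rejE_tni {Φ : Op C →ₗ[ℂ] Op (Option M)} (h : IsTP Φ) (h' : IsCP Φ) :
    TNI (rejE Φ E) := by
  intro X hX
  have h1 := congrArg Complex.re (accE_trace_add h X)
  have h2 := trace_re_nonneg ((accE_cp h' E).posSemidef hX)
  rw [Complex.add_re] at h1
  linarith

theorem accE_trace (Φ : Op C →ₗ[ℂ] Op (Option M)) (X : Op (C × E)) :
    (accE Φ E X).trace = (reix some (Φ (trR X))).trace := by
  rw [accE_eq_ampl, ampl_trace]
  rfl

/-- Forgetting the decrypted plaintext of an accepted ciphertext leaves at most what discarding the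
ciphertext leaves. -/
theorem PosFn.trL_accE_le {Φ : Op C →ₗ[ℂ] Op (Option M)} (h : IsTP Φ) (h' : IsCP Φ)
    {f : Op E →ₗ[ℂ] ℂ} (hf : PosFn f) {X : Op (C × E)} (hX : X.PosSemidef) :
    (f (trL (accE Φ E X))).re ≤ (f (trL X)).re := by
  rw [← trL_accE_add_rejE h X, map_add, Complex.add_re]
  have := hf.re_nonneg ((rejE_cp h' E).posSemidef hX)
  linarith

end AcceptReject

/-! ### Tests on plaintext and reference -/

section Test

variable {M Y L κ κ' : Type}

/-- Apply `K` to the registers `M L`. -/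
def actML [Fintype M] [Fintype L] (K : Matrix κ (M × L) ℂ) :
    Op ((M × Y) × L) →ₗ[ℂ] Op (Y × κ) :=
  amplR Y (conjL K) ∘ₗ reix fun p : Y × (M × L) => ((p.2.1, p.1), p.2.2)

variable [Fintype M] [Fintype L] [Fintype Y] [Fintype κ] [Fintype κ']

theorem actML_cp (K : Matrix κ (M × L) ℂ) :
    IsCP (actML K : Op ((M × Y) × L) →ₗ[ℂ] Op (Y × κ)) :=
  ((conjL_cp K).amplR Y).comp (reix_cp _)

theorem actML_trace_add [DecidableEq M] [DecidableEq L] {K : Matrix κ (M × L) ℂ}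
    {K' : Matrix κ' (M × L) ℂ} {c : ℝ} (hK : Kᴴ * K + K'ᴴ * K' = (c : ℂ) • 1)
    (X : Op ((M × Y) × L)) : (actML K X).trace + (actML K' X).trace = c * X.trace := by
  set X' : Op (Y × (M × L)) := reix (fun p : Y × (M × L) => ((p.2.1, p.1), p.2.2)) X with hX'
  have h1 : X'.trace = X.trace := by
    simp only [Matrix.trace, Matrix.diag_apply, hX', reix_apply, Fintype.sum_prod_type]
    rw [Finset.sum_comm]
  change (amplR Y (conjL K) X').trace + (amplR Y (conjL K') X').trace = _
  rw [amplR_trace, amplR_trace, conjL_trace, conjL_trace, ← Matrix.trace_add, ← Matrix.add_mul,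
    hK, Matrix.smul_mul, Matrix.one_mul, Matrix.trace_smul, trL_trace, h1, smul_eq_mul]

theorem actML_trace_le [DecidableEq M] [DecidableEq L] {K : Matrix κ (M × L) ℂ}
    {K' : Matrix κ' (M × L) ℂ} {c : ℝ} (hK : Kᴴ * K + K'ᴴ * K' = (c : ℂ) • 1)
    {X : Op ((M × Y) × L)} (hX : X.PosSemidef) : (actML K X).trace.re ≤ c * X.trace.re := by
  have h1 := congrArg Complex.re (actML_trace_add hK X)
  have h2 := trace_re_nonneg ((actML_cp K').posSemidef hX)
  rw [Complex.add_re, Complex.re_ofReal_mul] at h1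
  linarith

variable {S : QScheme} {B B' : Type}

/-- The accepting branch of an attack `Λ` with one encryption and one decryption. -/
def accPath (S : QScheme) (k : S.K) (Λ : Op (S.C × B) →ₗ[ℂ] Op (S.C × B')) :
    Op (S.M × B) →ₗ[ℂ] Op (S.M × B') :=
  accE (S.dec k).map B' ∘ₗ Λ ∘ₗ ampl (S.enc k).map B

theorem reix_ampl_effectiveMap {L : Type} (Λ : Op (S.C × B) →ₗ[ℂ] Op (S.C × B')) (X : Op ((S.M × B) × L)) :
    reix (Prod.map (Prod.map some id) id) (ampl (effectiveMap S Λ) L X) =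
      (Fintype.card S.K : ℂ)⁻¹ • ∑ k, ampl (accPath S k Λ) L X := by
  rw [effectiveMap, ampl_smul, ampl_sum, LinearMap.smul_apply, LinearMap.sum_apply, map_smul,
    map_sum]
  rfl

theorem re_inv_card_smul_sum {K : Type} [Fintype K] (g : K → ℂ) :
    ((Fintype.card K : ℂ)⁻¹ • ∑ k, g k).re = avg fun k => (g k).re := by
  rw [avg, smul_eq_mul, ← Complex.re_sum, ← Complex.re_ofReal_mul]
  simp

variable [Fintype B] [Fintype B']

/-- A test on the registers `M L` that fails on the input almost always fails after an attack and
an accepting decryption. -/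
theorem QCABound.test {D : Decomposition S} {ε : ℝ} (hQ : QCABound D ε) (hε : 0 ≤ ε)
    [Nonempty S.C] {Λ : Op (S.C × B) →ₗ[ℂ] Op (S.C × B')} (hΛ : IsCP Λ) (hΛ' : TNI Λ)
    [DecidableEq L] {K : Matrix κ (S.M × L) ℂ} {K' : Matrix κ' (S.M × L) ℂ} {c : ℝ} (hc : 0 < c)
    (hK : Kᴴ * K + K'ᴴ * K' = (c : ℂ) • 1) {X : Op ((S.M × B) × L)} (hX : X.PosSemidef)
    (h0 : actML K X = 0) :
    (avg fun k => (actML K (ampl (accPath S k Λ) L X)).trace.re) ≤ c * ε * X.trace.re := by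
  obtain ⟨rej, hrej⟩ := hQ.exists_rej hε hΛ hΛ'
  set s : Op ((Option S.M × B') × L) →ₗ[ℂ] Op ((S.M × B') × L) :=
    reix (Prod.map (Prod.map some id) id) with hs
  -- The hypothesis on `K'` only serves to give `KᴴK ≤ c`; the factor `c⁻¹` therefore turns the test
  -- into an effect.
  set f : Op ((Option S.M × B') × L) →ₗ[ℂ] ℂ :=
    ((c⁻¹ : ℝ) : ℂ) • (traceFn _ ∘ₗ actML K ∘ₗ s) with hf
  have hs1 : ∀ Z : Op ((Option S.M × B') × L), Z.PosSemidef → (s Z).trace.re ≤ Z.trace.re := by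
    intro Z hZ
    simp only [Matrix.trace, Complex.re_sum, Matrix.diag_apply, hs, reix_apply,
      Fintype.sum_prod_type, Prod.map, id]
    rw [Fintype.sum_option]
    have := Finset.sum_nonneg fun (b : B') (_ : b ∈ Finset.univ) =>
      Finset.sum_nonneg fun (l : L) (_ : l ∈ Finset.univ) =>
      (Complex.le_def.mp (hZ.diag_nonneg (i := ((none, b), l)))).1
    simpa using this
  have hfp : PosFn f := by
    intro Z hZ
    rw [hf, LinearMap.smul_apply, smul_eq_mul]
    refine mul_nonneg ?_ (traceFn_pos _ ((actML_cp K).posSemidef ((reix_cp _).posSemidef hZ)))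
    exact_mod_cast (inv_pos.mpr hc).le
  have hfs : SubTr f := by
    intro Z hZ
    have h1 := actML_trace_le hK (X := s Z) ((reix_cp _).posSemidef hZ)
    rw [hf, LinearMap.smul_apply, smul_eq_mul, Complex.re_ofReal_mul, inv_mul_le_iff₀ hc]
    exact h1.trans (mul_le_mul_of_nonneg_left (hs1 Z hZ) hc.le)
  have h1 := hrej L X hX f hfp hfs
  -- The accepting branch of the simulator is the identity on `M`, so it commutes with `K`, which
  -- already annihilates the input.
  have h2 : f (ampl (simulator S.M (accMap D Λ) rej) L X) = 0 := by
    have : actML K (s (ampl (simulator S.M (accMap D Λ) rej) L X)) =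
        ampl (accMap D Λ) κ (actML K X) := by
      change _ = ampl (accMap D Λ) κ (amplR B (conjL K) _)
      rw [ampl_amplR_conjL]
      rfl
    rw [hf, LinearMap.smul_apply, LinearMap.comp_apply, LinearMap.comp_apply, this, h0]
    simp
  have h3 : (f (ampl (effectiveMap S Λ) L X)).re =
      c⁻¹ * avg fun k => (actML K (ampl (accPath S k Λ) L X)).trace.re := by
    rw [hf, LinearMap.smul_apply, smul_eq_mul, Complex.re_ofReal_mul, LinearMap.comp_apply,
      LinearMap.comp_apply, hs, reix_ampl_effectiveMap, map_smul, map_smul, map_sum, map_sum,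
      re_inv_card_smul_sum]
    rfl
  rw [h2, sub_zero] at h1
  have h4 := (Complex.re_le_norm _).trans h1
  rw [h3, inv_mul_le_iff₀ hc] at h4
  linarith

end Test

/-! ### Product operators and the maximally entangled state -/

section Tensor

variable {a b c e : Type}

theorem ampl_kronecker (Φ : Op a →ₗ[ℂ] Op b) (X : Op a) (Y : Op e) :
    ampl Φ e (X ⊗ₖ Y) = Φ X ⊗ₖ Y := by
  ext ⟨p, i⟩ ⟨q, j⟩
  rw [ampl_apply, kroneckerMap_apply]
  have : (X ⊗ₖ Y).submatrix (fun x => (x, i)) (fun x => (x, j)) = Y i j • X := by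
    ext x y
    simp [mul_comm]
  rw [this, map_smul, Matrix.smul_apply, smul_eq_mul, mul_comm]

theorem trR_kronecker [Fintype e] (X : Op a) (Y : Op e) : trR (X ⊗ₖ Y) = Y.trace • X := by
  ext i j
  simp [trR_apply, Matrix.trace, Finset.mul_sum, mul_comm]

end Tensor

section Bell

variable {M : Type} [Fintype M] [DecidableEq M]

theorem bell_apply (p q : M × M) : bell M p q =
    if p.1 = p.2 ∧ q.1 = q.2 then (Fintype.card M : ℂ)⁻¹ else 0 := by
  have h : ((Real.sqrt (Fintype.card M) : ℝ) : ℂ)⁻¹ * ((Real.sqrt (Fintype.card M) : ℝ) : ℂ)⁻¹ =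
      (Fintype.card M : ℂ)⁻¹ := by
    rw [← mul_inv, ← Complex.ofReal_mul, Real.mul_self_sqrt (by positivity)]
    simp
  by_cases h1 : p.1 = p.2 <;> by_cases h2 : q.1 = q.2 <;>
    simp [bell, vecMulVec_apply, bellVec, h1, h2, h]

theorem bell_posSemidef : (bell M).PosSemidef := posSemidef_vecMulVec_self_star _

theorem bell_conjTranspose : (bell M)ᴴ = bell M := bell_posSemidef.isHermitian

theorem bellVec_dot [Nonempty M] : star (bellVec M) ⬝ᵥ bellVec M = 1 := by
  have h : ∀ p : M × M, star (bellVec M p) * bellVec M p = bell M p p := by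
    intro p
    rw [bell, vecMulVec_apply, mul_comm]
    rfl
  simp only [dotProduct, Pi.star_apply, h, bell_apply, Fintype.sum_prod_type]
  simp

theorem bell_trace [Nonempty M] : (bell M).trace = 1 := by
  rw [bell, trace_vecMulVec, dotProduct_comm, bellVec_dot]

theorem bell_mul_self [Nonempty M] : bell M * bell M = bell M := by
  rw [bell, vecMulVec_mul_vecMulVec, bellVec_dot, one_smul]

theorem conjTranspose_mul_add_of_proj {a : Type} [Fintype a] [DecidableEq a] {P : Op a}
    (h : P * P = P) (h' : Pᴴ = P) :
    (1 - P)ᴴ * (1 - P) + Pᴴ * P = ((1 : ℝ) : ℂ) • 1 := by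
  rw [conjTranspose_sub, h', conjTranspose_one, Matrix.sub_mul, Matrix.mul_sub, Matrix.mul_sub, h]
  simp

/-- `bell` sandwiches to a multiple of itself. -/
theorem conjL_bell_apply (X : Op (M × M)) :
    conjL (bell M) X = (star (bellVec M) ⬝ᵥ X *ᵥ bellVec M) • bell M := by
  rw [conjL_apply, bell_conjTranspose, bell, vecMulVec_mul, vecMulVec_mul_vecMulVec,
    ← dotProduct_mulVec, vecMulVec_smul]

end Bell

/-! ### Forgery without a ciphertext -/

section Forgery

variable {S : QScheme}

theorem conjL_diagonal_apply {a : Type} [Fintype a] [DecidableEq a] (d : a → ℂ) (X : Op a)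
    (i j : a) : conjL (diagonal d) X i j = d i * X i j * star (d j) := by
  rw [conjL_apply, diagonal_conjTranspose, mul_diagonal, diagonal_mul]
  rfl

/-- Without a ciphertext at hand, an accepting decryption is unlikely. -/
theorem QCABound.forge {D : Decomposition S} {ε : ℝ} (hQ : QCABound D ε) (hε : 0 ≤ ε)
    [Nonempty S.C] (hM : 2 ≤ Fintype.card S.M) {E : Type} [Fintype E] {σ : Op (S.C × E)}
    (hσ : σ.PosSemidef) :
    (avg fun k => (accE (S.dec k).map E σ).trace.re) ≤ 2 * ε * σ.trace.re := by
  classical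
  obtain ⟨m0, m1, hm⟩ := Fintype.one_lt_card_iff.mp hM
  set τ : Op S.C := trR σ with hτ
  have hτp : τ.PosSemidef := trR_cp.posSemidef hσ
  -- The attack has `|m⟩` encrypted, keeps the ciphertext and submits `τ` in its place. Since the
  -- plaintext is `m`, an accepted answer different from `m` is unlikely by `QCABound.test`.
  have key : ∀ m : S.M, (avg fun k => ((accE (S.dec k).map E σ).trace -
      reix some ((S.dec k).map τ) m m).re) ≤ ε * σ.trace.re := by
    intro m
    set d : S.M → ℂ := fun x => if x = m then 1 else 0 with hd
    set X : Op ((S.M × S.C) × Unit) :=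
      reix (Prod.fst : (S.M × S.C) × Unit → _) (diagonal d ⊗ₖ τ) with hX
    have hdp : (diagonal d).PosSemidef := PosSemidef.diagonal fun x => by
      simp only [hd, Pi.zero_apply]
      split_ifs <;> simp
    have hdt : (diagonal d).trace = 1 := by simp [trace_diagonal, hd]
    have hXp : X.PosSemidef := (reix_cp _).posSemidef (hdp.kronecker hτp)
    have hXt : X.trace = σ.trace := by
      have : X.trace = (diagonal d ⊗ₖ τ).trace :=
        reix_trace_equiv (Equiv.prodPUnit (S.M × S.C)) _
      rw [this, trace_kronecker, hdt, one_mul, hτ, trR_trace]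
    set K : Op (S.M × Unit) := diagonal fun p => 1 - d p.1 with hK
    set K' : Op (S.M × Unit) := diagonal fun p => d p.1 with hK'
    have hKK : Kᴴ * K + K'ᴴ * K' = ((1 : ℝ) : ℂ) • 1 := by
      rw [hK, hK', diagonal_conjTranspose, diagonal_conjTranspose, diagonal_mul_diagonal,
        diagonal_mul_diagonal, diagonal_add, Complex.ofReal_one, one_smul, ← diagonal_one]
      congr 1
      funext p
      by_cases h : p.1 = m <;> simp [hd, h]
    have h0 : actML K X = 0 := by
      ext ⟨y, p⟩ ⟨y', p'⟩
      change conjL K _ p p' = 0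
      rw [hK, conjL_diagonal_apply]
      by_cases h : p.1 = m <;> by_cases h' : p.1 = p'.1 <;>
        simp [hd, hX, diagonal_apply, h, h']
      exact fun h2 => absurd (h'.trans h2) h
    have h1 := hQ.test hε (Λ := reix Prod.swap) (reix_cp _)
      (reix_tp (Equiv.prodComm S.C S.C)).tni one_pos hKK hXp h0
    rw [hXt, one_mul] at h1
    refine le_of_eq_of_le (congrArg avg (funext fun k => congrArg Complex.re ?_)) h1
    have h2 : ampl (accPath S k (reix Prod.swap)) Unit X =
        reix Prod.fst (reix some ((S.dec k).map τ) ⊗ₖ (S.enc k).map (diagonal d)) := by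
      have h3 : accPath S k (reix Prod.swap) (diagonal d ⊗ₖ τ) =
          reix some ((S.dec k).map τ) ⊗ₖ (S.enc k).map (diagonal d) := by
        rw [accPath, LinearMap.comp_apply, LinearMap.comp_apply, ampl_kronecker]
        have h4 : reix Prod.swap ((S.enc k).map (diagonal d) ⊗ₖ τ) =
            τ ⊗ₖ (S.enc k).map (diagonal d) := by
          ext p q
          simp [mul_comm]
        rw [h4, accE_eq_ampl, ampl_kronecker]
        rfl
      rw [← h3]
      rfl
    rw [h2, accE_trace, ← hτ]
    simp only [Matrix.trace, Matrix.diag_apply, Fintype.sum_prod_type]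
    have h5 : ∀ (y : S.C) (x : S.M) (u : Unit), actML K (reix (Prod.fst : (S.M × S.C) × Unit → _)
        (reix some ((S.dec k).map τ) ⊗ₖ (S.enc k).map (diagonal d))) (y, (x, u)) (y, (x, u)) =
        (if x = m then 0 else reix some ((S.dec k).map τ) x x) *
          (S.enc k).map (diagonal d) y y := by
      intro y x u
      change conjL K _ (x, u) (x, u) = _
      rw [hK, conjL_diagonal_apply]
      by_cases h : x = m <;> simp [hd, h]
    simp only [h5, Finset.univ_unique, Finset.sum_singleton, ← Finset.sum_mul, ← Finset.mul_sum]
    have h6 : ∑ y, (S.enc k).map (diagonal d) y y = 1 := by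
      rw [← hdt]
      exact (S.enc k).tp (diagonal d)
    rw [h6, mul_one, ← Finset.add_sum_erase _ _ (Finset.mem_univ m),
      ← Finset.add_sum_erase _ (fun x => if x = m then 0 else _) (Finset.mem_univ m)]
    simp only [if_true, zero_add, add_sub_cancel_left]
    exact Finset.sum_congr rfl fun x hx => (if_neg (Finset.ne_of_mem_erase hx)).symm
  have h0 := key m0
  have h1 := key m1
  -- The answer to `τ` does not depend on the encrypted plaintext and cannot equal both `m0` and
  -- `m1`; acceptance therefore implies one of two unlikely events.
  have h2 : (avg fun k => (accE (S.dec k).map E σ).trace.re) ≤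
      (avg fun k => ((accE (S.dec k).map E σ).trace - reix some ((S.dec k).map τ) m0 m0).re) +
      avg fun k => ((accE (S.dec k).map E σ).trace - reix some ((S.dec k).map τ) m1 m1).re := by
    rw [← avg_add]
    refine avg_mono fun k => ?_
    have h3 := accE_trace (S.dec k).map σ
    have h4 : (reix some ((S.dec k).map τ)).PosSemidef :=
      (reix_cp _).posSemidef ((S.dec k).cp.posSemidef hτp)
    have h5 : (reix some ((S.dec k).map τ) m0 m0).re + (reix some ((S.dec k).map τ) m1 m1).re ≤
        (accE (S.dec k).map E σ).trace.re := by
      rw [h3, ← hτ, Matrix.trace, Complex.re_sum, ← Finset.sum_pair hm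
        (f := fun m => (reix some ((S.dec k).map τ) m m).re)]
      exact Finset.sum_le_sum_of_subset_of_nonneg (Finset.subset_univ _) fun x _ _ =>
        (Complex.le_def.mp h4.diag_nonneg).1
    simp only [Complex.sub_re]
    linarith
  linarith

end Forgery

/-! ### Two acceptances: the maximally entangled case -/

section DoubleAcceptance

theorem actML_trace {M Y L κ : Type} [Fintype M] [Fintype L] [Fintype Y] [Fintype κ]
    (K : Matrix κ (M × L) ℂ) (X : Op ((M × Y) × L)) :
    (actML K X).trace =
      (conjL K (trL (reix (fun p : Y × (M × L) => ((p.2.1, p.1), p.2.2)) X))).trace := by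
  rw [actML, LinearMap.comp_apply, amplR_trace]

/-- A register cannot be maximally entangled with two others. -/
theorem bell_monogamy {M Y : Type} [Fintype M] [DecidableEq M] [Fintype Y]
    (hM : 2 ≤ Fintype.card M) {Ω : Op ((M × Y) × (M × M))} (hΩ : Ω.PosSemidef) :
    Ω.trace.re ≤ 4 * (amplR (M × Y) (conjL (1 - bell M)) Ω).trace.re +
      2 * (actML (1 - bell M) (reix (fun p : (M × (Y × M)) × M =>
        ((p.1.1, p.1.2.1), (p.1.2.2, p.2))) Ω)).trace.re := by
  classical
  have : Nonempty M := Fintype.card_pos_iff.mp (by omega)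
  -- Call the registers `A`, `Y`, `B`, `R` in this order. One test is for `φ⁺` on `B R`; `σ`
  -- regroups the registers for the other one, for `φ⁺` on `A R`.
  set σ : Op ((M × Y) × (M × M)) →ₗ[ℂ] Op ((M × (Y × M)) × M) :=
    reix (fun p : (M × (Y × M)) × M => ((p.1.1, p.1.2.1), (p.1.2.2, p.2))) with hσ
  have hσt : ∀ Z, (σ Z).trace = Z.trace := by
    intro Z
    simp only [hσ, Matrix.trace, Matrix.diag_apply, reix_apply, Fintype.sum_prod_type]
  have hproj := conjTranspose_mul_add_of_proj (bell_mul_self (M := M)) bell_conjTranspose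
  have hproj' : (bell M)ᴴ * bell M + (1 - bell M)ᴴ * (1 - bell M) = ((1 : ℝ) : ℂ) • 1 := by
    rw [add_comm, hproj]
  set f : Op ((M × Y) × (M × M)) →ₗ[ℂ] ℂ := traceFn _ ∘ₗ actML (bell M) ∘ₗ σ with hf
  have hfp : PosFn f := traceFn_pos.comp ((actML_cp _).comp (reix_cp _))
  have hfs : ∀ Z : Op ((M × Y) × (M × M)), Z.PosSemidef → (f Z).re ≤ Z.trace.re := by
    intro Z hZ
    have := actML_trace_le hproj' ((reix_cp _).posSemidef hZ : (σ Z).PosSemidef)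
    rwa [one_mul, hσt] at this
  set Z1 := amplR (M × Y) (conjL (bell M)) Ω with hZ1
  set Z2 := amplR (M × Y) (conjL (1 - bell M)) Ω with hZ2
  have hZ1p : Z1.PosSemidef := ((conjL_cp _).amplR _).posSemidef hΩ
  have hZ2p : Z2.PosSemidef := ((conjL_cp _).amplR _).posSemidef hΩ
  have h1 : Ω.trace.re = (actML (1 - bell M) (σ Ω)).trace.re + (f Ω).re := by
    have := congrArg Complex.re (actML_trace_add hproj (σ Ω))
    rw [hσt, Complex.ofReal_one, one_mul, Complex.add_re] at this
    exact this.symm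
  -- The two tests do not commute. The relaxed parallelogram inequality replaces `Ω` by its part
  -- with `B R` in the state `φ⁺`, at the price of factors 2.
  have h2 : (f Ω).re ≤ 2 * (f Z1).re + 2 * (f Z2).re := by
    have := hfp.conjL_add_le hΩ ((1 : Op (M × Y)) ⊗ₖ bell M) ((1 : Op (M × Y)) ⊗ₖ (1 - bell M))
    rw [← kronecker_add, add_sub_cancel, one_kronecker_one, ← amplR_conjL, ← amplR_conjL] at this
    simpa [conjL_apply] using this
  have h3 : Z1.trace.re ≤ Ω.trace.re := by
    have e : Z1.trace + Z2.trace = Ω.trace := by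
      rw [hZ1, hZ2, amplR_trace, amplR_trace, conjL_trace, conjL_trace, ← Matrix.trace_add,
        ← Matrix.add_mul, hproj', Complex.ofReal_one, one_smul, Matrix.one_mul, trL_trace]
    have := congrArg Complex.re e
    rw [Complex.add_re] at this
    linarith [trace_re_nonneg hZ2p]
  -- In `Z1` the register `R` is maximally mixed and independent of `A`, so the test on `A R`
  -- succeeds with relative weight `d⁻²`, which is at most `1/4`.
  have h4 : f Z1 = ((Fintype.card M : ℂ)⁻¹ * (Fintype.card M : ℂ)⁻¹) * Z1.trace := by
    set Θ : Op (M × Y) := Matrix.of fun x x' => star (bellVec M) ⬝ᵥ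
      Ω.submatrix (fun i => (x, i)) (fun i => (x', i)) *ᵥ bellVec M with hΘ
    have e1 : Z1 = Θ ⊗ₖ bell M := by
      ext ⟨x, i⟩ ⟨x', i'⟩
      rw [hZ1, amplR_apply, conjL_bell_apply]
      rfl
    have e2 : f Z1 = (bell M * trL (reix (fun p : (Y × M) × (M × M) => ((p.2.1, p.1), p.2.2))
        (σ Z1))).trace := by
      change (actML (bell M) (σ Z1)).trace = _
      rw [actML_trace, conjL_trace, bell_conjTranspose, bell_mul_self]
    have e3 : ∀ i i' : M × M, trL (reix (fun p : (Y × M) × (M × M) => ((p.2.1, p.1), p.2.2))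
        (σ Z1)) i i' = (∑ y, Θ (i.1, y) (i'.1, y)) *
          (if i.2 = i'.2 then (Fintype.card M : ℂ)⁻¹ else 0) := by
      intro i i'
      rw [trL_apply, Fintype.sum_prod_type, Finset.sum_mul]
      refine Finset.sum_congr rfl fun y _ => ?_
      simp only [reix_apply, hσ, e1, kroneckerMap_apply, bell_apply, ← Finset.mul_sum]
      congr 1
      by_cases h : i.2 = i'.2
      · simp [h]
      · rw [if_neg h]
        refine Finset.sum_eq_zero fun m _ => if_neg fun h' => h (h'.1.symm.trans h'.2)
    have e4 : Z1.trace = Θ.trace := by rw [e1, trace_kronecker, bell_trace, mul_one]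
    rw [e2, e4]
    generalize trL (reix (fun p : (Y × M) × (M × M) => ((p.2.1, p.1), p.2.2)) (σ Z1)) = W at e3
    have e5 : (bell M * W).trace = ∑ m, ∑ m', (Fintype.card M : ℂ)⁻¹ * W (m', m') (m, m) := by
      simp only [Matrix.trace, Matrix.diag_apply, Matrix.mul_apply, bell_apply,
        Fintype.sum_prod_type]
      simp [ite_and]
    rw [e5]
    simp only [e3, mul_ite, mul_zero, Finset.sum_ite_eq', Finset.mem_univ, if_true,
      Matrix.trace, Matrix.diag_apply, Fintype.sum_prod_type]
    rw [Finset.mul_sum]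
    refine Finset.sum_congr rfl fun m _ => ?_
    ring
  have h5 : (f Z1).re ≤ (1 / 4) * Z1.trace.re := by
    have e : (Fintype.card M : ℂ)⁻¹ * (Fintype.card M : ℂ)⁻¹ =
        (((Fintype.card M : ℝ)⁻¹ * (Fintype.card M : ℝ)⁻¹ : ℝ) : ℂ) := by push_cast; rfl
    rw [h4, e, Complex.re_ofReal_mul]
    refine mul_le_mul_of_nonneg_right ?_ (trace_re_nonneg hZ1p)
    have h6 : (Fintype.card M : ℝ)⁻¹ ≤ 2⁻¹ := inv_anti₀ (by norm_num) (by exact_mod_cast hM)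
    have h7 : 0 ≤ (Fintype.card M : ℝ)⁻¹ := by positivity
    nlinarith
  -- What remains is `tr Ω ≤ fail(AR) + ½ tr Ω + 2 fail(BR)`, hence the constants 2 and 4.
  have h6 := hfs Z2 hZ2p
  linarith

end DoubleAcceptance

/-! ### Two acceptances after encrypting half of a maximally entangled state -/

section DoubleAcceptance

variable {S : QScheme} {B Y Y' : Type}

theorem ampl_trL {a e r : Type} [Fintype a] (X : Op ((a × e) × r)) :
    ampl (trL : Op (a × e) →ₗ[ℂ] Op e) r X =
      trL (reix (fun p : a × (e × r) => ((p.1, p.2.1), p.2.2)) X) := by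
  ext p q
  rw [ampl_apply, trL_apply, trL_apply]
  rfl

/-- `Φ` on the registers `a b`, with a further register `r` placed after `b`. -/
def amplMid {a b c d : Type} (Φ : Op (a × b) →ₗ[ℂ] Op (c × d)) (r : Type) :
    Op (a × (b × r)) →ₗ[ℂ] Op (c × (d × r)) :=
  reix (fun p : c × (d × r) => ((p.1, p.2.1), p.2.2)) ∘ₗ ampl Φ r ∘ₗ
    reix (fun p : (a × b) × r => (p.1.1, (p.1.2, p.2)))

theorem IsCP.amplMid {a b c d : Type} [Fintype a] [Fintype b] [Fintype c] [Fintype d]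
    {Φ : Op (a × b) →ₗ[ℂ] Op (c × d)} (h : IsCP Φ) (r : Type) [Fintype r] :
    IsCP (amplMid Φ r) := (reix_cp _).comp ((h.ampl r).comp (reix_cp _))

theorem amplMid_trace {a b c d : Type} [Fintype a] [Fintype b] [Fintype c] [Fintype d]
    (Φ : Op (a × b) →ₗ[ℂ] Op (c × d)) (r : Type) [Fintype r] (X : Op (a × (b × r))) :
    (amplMid Φ r X).trace =
      (ampl Φ r (reix (fun p : (a × b) × r => (p.1.1, (p.1.2, p.2))) X)).trace :=
  reix_trace_equiv (Equiv.prodAssoc c d r).symm _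

theorem TNI.amplMid {a b c d : Type} [Fintype a] [Fintype b] [Fintype c] [Fintype d]
    {Φ : Op (a × b) →ₗ[ℂ] Op (c × d)} (h : TNI Φ) (r : Type) [Fintype r] :
    TNI (amplMid Φ r) := by
  intro X hX
  rw [amplMid_trace]
  refine (h.ampl r _ ((reix_cp _).posSemidef hX)).trans (le_of_eq ?_)
  exact congrArg Complex.re (reix_trace_equiv (Equiv.prodAssoc a b r) X)

variable [Fintype B] [Fintype Y] [Fintype Y']

/-- With half of a maximally entangled state encrypted, two accepting decryptions are unlikely. -/
theorem QCABound.bell_double {D : Decomposition S} {ε : ℝ} (hQ : QCABound D ε) (hε : 0 ≤ ε)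
    [Nonempty S.C] (hM : 2 ≤ Fintype.card S.M)
    {Λ₁ : Op (S.C × B) →ₗ[ℂ] Op (S.C × Y)} (h₁ : IsCP Λ₁) (h₁' : TNI Λ₁)
    {Λ₂ : Op (S.M × Y) →ₗ[ℂ] Op (S.C × Y')} (h₂ : IsCP Λ₂) (h₂' : TNI Λ₂)
    {X : Op ((S.M × (B × S.M)) × S.M)} (hX : X.PosSemidef) (h0 : actML (1 - bell S.M) X = 0) :
    (avg fun k => (accE (S.dec k).map Y' (Λ₂ (trR (reix
      (fun p : (S.M × Y) × (S.M × S.M) => ((p.2.1, (p.1.2, p.1.1)), p.2.2))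
      (ampl (accPath S k (amplMid Λ₁ S.M)) S.M X))))).trace.re) ≤ 6 * ε * X.trace.re := by
  classical
  have : Nonempty S.M := Fintype.card_pos_iff.mp (by omega)
  have hproj := conjTranspose_mul_add_of_proj (bell_mul_self (M := S.M)) bell_conjTranspose
  set P : Op (S.M × S.M) := 1 - bell S.M with hP
  -- A second attack throws the first ciphertext away undecrypted and hands the stored register to
  -- `Λ₂`. It needs only one decryption, so `QCABound.test` also covers the later ciphertext.
  set Λ : Op (S.C × (B × S.M)) →ₗ[ℂ] Op (S.C × Y') :=
    Λ₂ ∘ₗ reix Prod.swap ∘ₗ trL ∘ₗ amplMid Λ₁ S.M with hΛ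
  have hΛcp : IsCP Λ := h₂.comp ((reix_cp _).comp (trL_cp.comp (h₁.amplMid _)))
  have hΛtni : TNI Λ := by
    intro Z hZ
    have hp := (h₁.amplMid S.M).posSemidef hZ
    refine (h₂' _ ((reix_cp _).posSemidef (trL_cp.posSemidef hp))).trans ?_
    have := reix_trace_equiv (Equiv.prodComm S.M Y) (trL (amplMid Λ₁ S.M Z))
    change (reix (Equiv.prodComm S.M Y) (trL (amplMid Λ₁ S.M Z))).trace.re ≤ _
    rw [this, trL_trace]
    exact h₁'.amplMid S.M Z hZ
  have t1 := hQ.test hε (h₁.amplMid S.M) (h₁'.amplMid S.M) one_pos hproj hX h0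
  have t2 := hQ.test hε hΛcp hΛtni one_pos hproj hX h0
  have key : ∀ k, (accE (S.dec k).map Y' (Λ₂ (trR (reix
      (fun p : (S.M × Y) × (S.M × S.M) => ((p.2.1, (p.1.2, p.1.1)), p.2.2))
      (ampl (accPath S k (amplMid Λ₁ S.M)) S.M X))))).trace.re ≤
      4 * (actML P (ampl (accPath S k (amplMid Λ₁ S.M)) S.M X)).trace.re +
      2 * (actML P (ampl (accPath S k Λ) S.M X)).trace.re := by
    intro k
    set ω := ampl (accPath S k (amplMid Λ₁ S.M)) S.M X with hω
    set Ψ : Op (S.M × Y) →ₗ[ℂ] Op (S.M × Y') := accE (S.dec k).map Y' ∘ₗ Λ₂ with hΨ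
    have hΨcp : IsCP Ψ := (accE_cp (S.dec k).cp Y').comp h₂
    have hΨtni : TNI Ψ := (accE_tni (S.dec k).tp (S.dec k).cp).comp' h₂' h₂
    have hσp : (ampl (amplMid Λ₁ S.M ∘ₗ ampl (S.enc k).map (B × S.M)) S.M X).PosSemidef :=
      (((h₁.amplMid S.M).comp ((S.enc k).cp.ampl _)).ampl _).posSemidef hX
    have hωp : ω.PosSemidef := (((accE_cp (S.dec k).cp _).comp ((h₁.amplMid S.M).comp
      ((S.enc k).cp.ampl _))).ampl _).posSemidef hX
    set ω' : Op ((S.M × Y) × (S.M × S.M)) :=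
      reix (fun p : (S.M × Y) × (S.M × S.M) => ((p.2.1, (p.1.2, p.1.1)), p.2.2)) ω with hω'
    have hω'p : ω'.PosSemidef := (reix_cp _).posSemidef hωp
    set Ω := ampl Ψ (S.M × S.M) ω' with hΩ
    have hΩp : Ω.PosSemidef := (hΨcp.ampl _).posSemidef hω'p
    have e0 : (accE (S.dec k).map Y' (Λ₂ (trR ω'))).trace = Ω.trace := by
      rw [hΩ, ampl_trace]
      rfl
    rw [e0]
    -- In `Ω` the second answer, the first answer and the reference are the `A`, `B` and `R` of the
    -- monogamy bound.
    refine (bell_monogamy hM hΩp).trans (add_le_add (mul_le_mul_of_nonneg_left ?_ (by norm_num))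
      (mul_le_mul_of_nonneg_left ?_ (by norm_num)))
    · rw [hΩ, ← ampl_amplR_conjL]
      refine (hΨtni.ampl _ _ (((conjL_cp _).amplR _).posSemidef hω'p)).trans (le_of_eq ?_)
      rw [amplR_trace, actML_trace]
      congr 3
      ext i j
      rw [trL_apply, trL_apply, Fintype.sum_prod_type, Fintype.sum_prod_type, Finset.sum_comm]
      rfl
    -- The stored register, and not the first answer, is used afterwards. Requiring the first
    -- decryption to accept can then only lower the weight compared with discarding the first
    -- ciphertext.
    · set h : Op ((Y × S.M) × S.M) →ₗ[ℂ] ℂ := traceFn _ ∘ₗ actML P ∘ₗ ampl Ψ S.M ∘ₗ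
        reix (Prod.map Prod.swap id) with hh
      have hhp : PosFn h := traceFn_pos.comp ((actML_cp P).comp ((hΨcp.ampl _).comp (reix_cp _)))
      set σ : Op (S.C × ((Y × S.M) × S.M)) :=
        reix (fun p : S.C × ((Y × S.M) × S.M) => ((p.1, p.2.1), p.2.2))
        (ampl (amplMid Λ₁ S.M ∘ₗ ampl (S.enc k).map (B × S.M)) S.M X) with hσ
      have d1 := hhp.trL_accE_le (S.dec k).tp (S.dec k).cp (X := σ) ((reix_cp _).posSemidef hσp)
      have d2 : h (trL σ) = (actML P (ampl (accPath S k Λ) S.M X)).trace := by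
        rw [hσ, ← ampl_trL]
        rfl
      have d3 : h (trL (accE (S.dec k).map ((Y × S.M) × S.M) σ)) =
          (actML P (reix (fun p : (S.M × (Y' × S.M)) × S.M =>
            ((p.1.1, p.1.2.1), (p.1.2.2, p.2))) Ω)).trace := by
        have d4 : trL (accE (S.dec k).map ((Y × S.M) × S.M) σ) =
            ∑ m, reix (fun p : (Y × S.M) × S.M => ((m, p.1), p.2)) ω := by
          rw [trL, LinearMap.sum_apply]
          rfl
        change (actML P (ampl Ψ S.M (reix (Prod.map Prod.swap id) _))).trace = _
        rw [d4, map_sum, map_sum, actML_trace, actML_trace]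
        congr 2
        ext i j
        simp only [trL_apply, Fintype.sum_prod_type, reix_apply, Matrix.sum_apply]
        rfl
      rw [← d3, ← d2]
      exact d1
  refine (avg_mono key).trans ?_
  rw [avg_add, avg_mul, avg_mul]
  linarith

end DoubleAcceptance

/-! ### Coherent comparison of two register assignments -/

section SelectionMatrix

variable {a b c : Type} [DecidableEq a]

/-- The matrix of `X ↦ X.submatrix g g`. -/
def selMat (g : b → a) : Matrix b a ℂ := Matrix.of fun i j => if g i = j then 1 else 0

theorem selMat_mul [Fintype a] (g : b → a) (X : Matrix a c ℂ) : selMat g * X = X.submatrix g id := by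
  ext i j
  simp [selMat, Matrix.mul_apply]

theorem mul_selMat_conjTranspose [Fintype a] (g : b → a) (X : Matrix c a ℂ) :
    X * (selMat g)ᴴ = X.submatrix id g := by
  ext i j
  simp [selMat, Matrix.mul_apply, apply_ite star]

theorem conjL_selMat [Fintype a] (g : b → a) : conjL (selMat g) = reix g := by
  ext1 X
  rw [conjL_apply, selMat_mul, mul_selMat_conjTranspose]
  rfl

/-- Both selections read the same amplitudes of an operator pulled back along `h`, so their
difference cancels. -/
theorem conjL_selMat_sub_reix [Fintype a] {g g' : b → a} {h : a → c} (H : h ∘ g = h ∘ g') (X : Op c) :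
    conjL (selMat g - selMat g') (reix h X) = 0 := by
  rw [conjL_apply, conjTranspose_sub, Matrix.sub_mul, Matrix.sub_mul, Matrix.mul_sub,
    Matrix.mul_sub]
  simp only [selMat_mul, mul_selMat_conjTranspose]
  ext i j
  have e : ∀ i, h (g i) = h (g' i) := fun i => congrFun H i
  simp [e]

theorem one_kronecker_selMat {r : Type} [DecidableEq r] (g : b → a) :
    (1 : Op r) ⊗ₖ selMat g = selMat (Prod.map id g) := by
  ext p q
  simp only [kroneckerMap_apply, Matrix.one_apply, selMat, of_apply, Prod.ext_iff]
  split_ifs <;> simp_all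

/-- The two selections split the basis, so sum and difference form a complete pair of Kraus
operators up to the factor 2; this is the shape that `QCABound.test` asks for. -/
theorem selMat_sub_add [Fintype a] [Fintype b] {g g' : b → a} (h : Function.Bijective (Sum.elim g g')) :
    (selMat g - selMat g')ᴴ * (selMat g - selMat g') +
      (selMat g + selMat g')ᴴ * (selMat g + selMat g') = (2 : ℂ) • 1 := by
  have h1 : (selMat g)ᴴ * selMat g + (selMat g')ᴴ * selMat g' = 1 := by
    ext x y
    have h2 := Equiv.sum_comp (Equiv.ofBijective _ h)
      fun z => star (if z = x then (1 : ℂ) else 0) * if z = y then 1 else 0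
    simp only [Equiv.ofBijective_apply, Fintype.sum_sum_type, Sum.elim_inl, Sum.elim_inr] at h2
    refine h2.trans ?_
    simp [Matrix.one_apply, apply_ite star, eq_comm]
  rw [← h1]
  simp only [conjTranspose_add, conjTranspose_sub, Matrix.add_mul, Matrix.mul_add,
      Matrix.sub_mul, Matrix.mul_sub, two_smul]
  abel

end SelectionMatrix

/-! ### Two acceptances for arbitrary plaintexts -/

section DoubleAcceptance

variable {S : QScheme} {B Y Y' : Type} [Fintype B] [Fintype Y] [Fintype Y']

/-- Two accepting decryptions after a single encryption are unlikely. -/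
theorem QCABound.double {D : Decomposition S} {ε : ℝ} (hQ : QCABound D ε) (hε : 0 ≤ ε)
    [Nonempty S.C] (hM : 2 ≤ Fintype.card S.M)
    {Λ₁ : Op (S.C × B) →ₗ[ℂ] Op (S.C × Y)} (h₁ : IsCP Λ₁) (h₁' : TNI Λ₁)
    {Λ₂ : Op (S.M × Y) →ₗ[ℂ] Op (S.C × Y')} (h₂ : IsCP Λ₂) (h₂' : TNI Λ₂)
    {ρ : Op (S.M × B)} (hρ : ρ.PosSemidef) :
    (avg fun k => (accE (S.dec k).map Y' (Λ₂ (accPath S k Λ₁ ρ))).trace.re) ≤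
      20 * ε * ρ.trace.re := by
  classical
  have : Nonempty S.M := Fintype.card_pos_iff.mp (by omega)
  set ρ₀ : Op ((S.M × B) × (S.M × S.M)) := ρ ⊗ₖ bell S.M with hρ₀
  have hρ₀p : ρ₀.PosSemidef := hρ.kronecker bell_posSemidef
  -- A control bit decides coherently whether the plaintext or half of `φ⁺` is encrypted, the other
  -- one being stored. Both branches have full weight, so `ρQ` has twice the trace of `ρ`.
  set w : (S.M × B) × (Bool × (S.M × S.M)) → (S.M × B) × (S.M × S.M) := fun p =>
    if p.2.1 then ((p.2.2.1, p.1.2), (p.1.1, p.2.2.2)) else (p.1, p.2.2) with hw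
  set ρQ : Op ((S.M × B) × (Bool × (S.M × S.M))) := reix w ρ₀ with hρQ
  have hρQp : ρQ.PosSemidef := (reix_cp _).posSemidef hρ₀p
  set g₀ : S.M × (S.M × S.M) → S.M × (Bool × (S.M × S.M)) := fun p => (p.1, (false, p.2)) with hg₀
  set g₁ : S.M × (S.M × S.M) → S.M × (Bool × (S.M × S.M)) :=
    fun p => (p.2.1, (true, (p.1, p.2.2))) with hg₁
  have tr₀ : ρ₀.trace = ρ.trace := by
    rw [hρ₀, Matrix.trace_kronecker, bell_trace, mul_one]
  have trQ : ρQ.trace = 2 * ρ.trace := by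
    rw [← tr₀, two_mul]
    simp only [Matrix.trace, Matrix.diag_apply, hρQ, reix_apply, Fintype.sum_prod_type,
      Fintype.sum_bool, Finset.sum_add_distrib, hw]
    simp only [if_true, Bool.false_eq_true, if_false]
    congr 1
    calc ∑ x, ∑ y, ∑ z, ∑ u, ρ₀ ((z, y), (x, u)) ((z, y), (x, u))
        = ∑ x, ∑ z, ∑ y, ∑ u, ρ₀ ((z, y), (x, u)) ((z, y), (x, u)) :=
          Finset.sum_congr rfl fun _ _ => Finset.sum_comm
      _ = ∑ z, ∑ x, ∑ y, ∑ u, ρ₀ ((z, y), (x, u)) ((z, y), (x, u)) := Finset.sum_comm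
      _ = ∑ z, ∑ y, ∑ x, ∑ u, ρ₀ ((z, y), (x, u)) ((z, y), (x, u)) :=
          Finset.sum_congr rfl fun _ _ => Finset.sum_comm
  have hK : (selMat g₀ - selMat g₁)ᴴ * (selMat g₀ - selMat g₁) +
      (selMat g₀ + selMat g₁)ᴴ * (selMat g₀ + selMat g₁) = ((2 : ℝ) : ℂ) • 1 := by
    rw [selMat_sub_add, Complex.ofReal_ofNat]
    constructor
    · rintro (⟨m, r, r'⟩ | ⟨m, r, r'⟩) (⟨n, s, s'⟩ | ⟨n, s, s'⟩) h <;> simp_all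
    · rintro ⟨m, q, r, r'⟩
      cases q
      · exact ⟨.inl (m, r, r'), rfl⟩
      · exact ⟨.inr (r, m, r'), rfl⟩
  -- `g₁` undoes the exchange in the branch `true`; after that the two branches agree on the input.
  have h0 : actML (selMat g₀ - selMat g₁) ρQ = 0 := by
    have hsub : (1 : Op B) ⊗ₖ (selMat g₀ - selMat g₁) = 1 ⊗ₖ selMat g₀ - 1 ⊗ₖ selMat g₁ := by
      ext i j
      simp [mul_sub]
    rw [actML, LinearMap.comp_apply, amplR_conjL, hsub, one_kronecker_selMat, one_kronecker_selMat]
    have e : reix (fun p : B × (S.M × (Bool × (S.M × S.M))) => ((p.2.1, p.1), p.2.2)) ρQ =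
        reix (fun p : B × (S.M × (Bool × (S.M × S.M))) => w ((p.2.1, p.1), p.2.2)) ρ₀ := rfl
    rw [e]
    refine conjL_selMat_sub_reix ?_ ρ₀
    funext p
    simp only [Function.comp_apply, hg₀, hg₁, hw]
    rfl
  have t := hQ.test hε h₁ h₁' two_pos hK hρQp h0
  set X : Op ((S.M × (B × S.M)) × S.M) :=
    reix (fun p : (S.M × (B × S.M)) × S.M => ((p.1.2.2, p.1.2.1), (p.1.1, p.2))) ρ₀ with hX
  have hXp : X.PosSemidef := (reix_cp _).posSemidef hρ₀p
  have trX : X.trace = ρ.trace := by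
    rw [← tr₀]
    simp only [Matrix.trace, Matrix.diag_apply, hX, reix_apply, Fintype.sum_prod_type]
    calc ∑ x, ∑ y, ∑ z, ∑ u, ρ₀ ((z, y), (x, u)) ((z, y), (x, u))
        = ∑ x, ∑ z, ∑ y, ∑ u, ρ₀ ((z, y), (x, u)) ((z, y), (x, u)) :=
          Finset.sum_congr rfl fun _ _ => Finset.sum_comm
      _ = ∑ z, ∑ x, ∑ y, ∑ u, ρ₀ ((z, y), (x, u)) ((z, y), (x, u)) := Finset.sum_comm
      _ = ∑ z, ∑ y, ∑ x, ∑ u, ρ₀ ((z, y), (x, u)) ((z, y), (x, u)) :=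
          Finset.sum_congr rfl fun _ _ => Finset.sum_comm
  have hX0 : actML (1 - bell S.M) X = 0 := by
    ext p q
    have e : ((reix (fun p : (B × S.M) × (S.M × S.M) => ((p.2.1, p.1), p.2.2)) X).submatrix
        (fun i => (p.1, i)) fun i => (q.1, i)) =
        ρ (p.1.2, p.1.1) (q.1.2, q.1.1) • bell S.M := rfl
    rw [actML, LinearMap.comp_apply, amplR_apply, e, map_smul, conjL_apply, Matrix.sub_mul,
      Matrix.one_mul, bell_mul_self, sub_self, Matrix.zero_mul, smul_zero]
    rfl
  have t' := hQ.bell_double hε hM h₁ h₁' h₂ h₂' hXp hX0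
  rw [trX] at t'
  rw [trQ, show (2 * ρ.trace).re = 2 * ρ.trace.re by simp] at t
  have key : ∀ k, (accE (S.dec k).map Y' (Λ₂ (accPath S k Λ₁ ρ))).trace.re ≤
      2 * (accE (S.dec k).map Y' (Λ₂ (trR (reix
      (fun p : (S.M × Y) × (S.M × S.M) => ((p.2.1, (p.1.2, p.1.1)), p.2.2))
      (ampl (accPath S k (amplMid Λ₁ S.M)) S.M X))))).trace.re +
      2 * (actML (selMat g₀ - selMat g₁)
        (ampl (accPath S k Λ₁) (Bool × (S.M × S.M)) ρQ)).trace.re := by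
    intro k
    set ω := ampl (accPath S k Λ₁) (Bool × (S.M × S.M)) ρQ with hω
    have hωp : ω.PosSemidef := (((accE_cp (S.dec k).cp _).comp (h₁.comp
      ((S.enc k).cp.ampl _))).ampl _).posSemidef hρQp
    set Z : Op (Y × (S.M × (Bool × (S.M × S.M)))) :=
      reix (fun p : Y × (S.M × (Bool × (S.M × S.M))) => ((p.2.1, p.1), p.2.2)) ω with hZ
    have hZp : Z.PosSemidef := (reix_cp _).posSemidef hωp
    set τ : Op (Y × (S.M × (S.M × S.M))) →ₗ[ℂ] Op (S.M × Y) :=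
      trR ∘ₗ reix (fun p : (S.M × Y) × (S.M × S.M) => (p.1.2, (p.1.1, p.2))) with hτ
    set g : Op (Y × (S.M × (S.M × S.M))) →ₗ[ℂ] ℂ :=
      traceFn _ ∘ₗ accE (S.dec k).map Y' ∘ₗ Λ₂ ∘ₗ τ with hg
    have hτcp : IsCP τ := trR_cp.comp (reix_cp _)
    have hgp : PosFn g := traceFn_pos.comp ((accE_cp (S.dec k).cp Y').comp (h₂.comp hτcp))
    have hτtr : ∀ U, (τ U).trace = U.trace := by
      intro U
      rw [hτ, LinearMap.comp_apply, trR_trace]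
      simp only [Matrix.trace, Matrix.diag_apply, reix_apply, Fintype.sum_prod_type]
      exact Finset.sum_comm
    have hgs : SubTr g := by
      intro U hU
      refine ((accE_tni (S.dec k).tp (S.dec k).cp) _ (h₂.posSemidef (hτcp.posSemidef hU))).trans
        ((h₂' _ (hτcp.posSemidef hU)).trans ?_)
      rw [hτtr]
    -- The branch with the plaintext is the branch with `φ⁺` plus the tested difference, and the
    -- latter stays small after acceptance. This gives `2·6ε + 2·4ε = 20ε`.
    have hpar := hgp.conjL_add_le hZp ((1 : Op Y) ⊗ₖ selMat g₁)
      ((1 : Op Y) ⊗ₖ (selMat g₀ - selMat g₁))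
    rw [← Matrix.kronecker_add, add_sub_cancel, ← amplR_conjL, ← amplR_conjL, ← amplR_conjL,
      conjL_selMat, conjL_selMat] at hpar
    have e0 : g (amplR Y (reix g₀) Z) = (accE (S.dec k).map Y' (Λ₂ (accPath S k Λ₁ ρ))).trace := by
      have : accPath S k Λ₁ ρ = trR (ampl (accPath S k Λ₁) (S.M × S.M) ρ₀) := by
        rw [trR_ampl, hρ₀, trR_kronecker, bell_trace, one_smul]
      rw [this]
      rfl
    have e1 : g (amplR Y (reix g₁) Z) = (accE (S.dec k).map Y' (Λ₂ (trR (reix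
      (fun p : (S.M × Y) × (S.M × S.M) => ((p.2.1, (p.1.2, p.1.1)), p.2.2))
      (ampl (accPath S k (amplMid Λ₁ S.M)) S.M X))))).trace := rfl
    have e2 := hgs _ (((conjL_cp (selMat g₀ - selMat g₁)).amplR Y).posSemidef hZp)
    rw [e0, e1] at hpar
    exact hpar.trans (add_le_add le_rfl (mul_le_mul_of_nonneg_left e2 two_pos.le))
  refine (avg_mono key).trans ?_
  rw [avg_add, avg_mul, avg_mul]
  linarith

end DoubleAcceptance

section TraceNonincreasing

theorem reix_tni {a b : Type} [Fintype a] [Fintype b] {f : b → a} (hf : Function.Injective f) :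
    TNI (reix f) := by
  classical
  intro X hX
  simp only [Matrix.trace, Matrix.diag_apply, reix_apply, Complex.re_sum]
  rw [← Finset.sum_image (s := Finset.univ) (g := f) (f := fun x => (X x x).re) hf.injOn]
  exact Finset.sum_le_sum_of_subset_of_nonneg (Finset.subset_univ _) fun x _ _ =>
    (Complex.le_def.mp hX.diag_nonneg).1

theorem conjL_trace_add_of_proj {a : Type} [Fintype a] [DecidableEq a] {P : Op a}
    (h : P * P = P) (h' : Pᴴ = P) (X : Op a) :
    (conjL P X).trace.re + (conjL (1 - P) X).trace.re = X.trace.re := by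
  rw [← Complex.add_re, conjL_trace, conjL_trace, ← Matrix.trace_add, ← Matrix.add_mul, add_comm,
    conjTranspose_mul_add_of_proj h h']
  simp

theorem conjL_tni_of_proj {a : Type} [Fintype a] {P : Op a} (h : P * P = P) (h' : Pᴴ = P) :
    TNI (conjL P) := by
  classical
  intro X hX
  have h1 := conjL_trace_add_of_proj h h' X
  have h2 := trace_re_nonneg ((conjL_cp (1 - P)).posSemidef hX)
  linarith

end TraceNonincreasing

/-! ### Encryption of half of a maximally entangled state -/

section EncryptedBell

variable {S : QScheme} (D : Decomposition S)

theorem Decomposition.encR_tp (k : S.K) (r : D.T) : IsTP (D.encR k r) := by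
  intro X
  have h1 : (vecMulVec (D.ψ k r) (star (D.ψ k r))).trace = 1 := by
    rw [trace_vecMulVec, dotProduct_comm, D.ψ_orthonormal, if_pos rfl]
  change (D.V k * (X ⊗ₖ vecMulVec (D.ψ k r) (star (D.ψ k r))) * (D.V k)ᴴ).trace = _
  rw [Matrix.trace_mul_comm, ← Matrix.mul_assoc, D.V_isometry, Matrix.one_mul, trace_kronecker, h1,
    mul_one]

theorem Decomposition.encBell_eq (k : S.K) (r : D.T) :
    D.encBell k r = vecMulVec (D.phiVec k r) (star (D.phiVec k r)) := by
  ext ⟨c, a⟩ ⟨c', a'⟩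
  have h : ∀ (c : S.C) (a : S.M), D.phiVec k r (c, a) =
      ∑ m, (∑ u, D.V k c (m, u) * D.ψ k r u) * bellVec S.M (m, a) := by
    intro c a
    simp only [Decomposition.phiVec, Fintype.sum_prod_type, Finset.sum_mul]
    refine Finset.sum_congr rfl fun m _ => Finset.sum_congr rfl fun u _ => by ring
  rw [Decomposition.encBell, ampl_apply, Decomposition.encR, encWith_apply, vecMulVec_apply,
    Pi.star_apply, h, h, star_sum, Finset.sum_mul_sum]
  refine Finset.sum_congr rfl fun m _ => Finset.sum_congr rfl fun m' _ => ?_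
  simp only [submatrix_apply, bell, vecMulVec_apply, Pi.star_apply, star_mul']
  ring

theorem Decomposition.encBell_posSemidef (k : S.K) (r : D.T) : (D.encBell k r).PosSemidef := by
  rw [D.encBell_eq]
  exact posSemidef_vecMulVec_self_star _

theorem Decomposition.encBell_conjTranspose (k : S.K) (r : D.T) :
    (D.encBell k r)ᴴ = D.encBell k r := (D.encBell_posSemidef k r).isHermitian

theorem Decomposition.encBell_trace [Nonempty S.M] (k : S.K) (r : D.T) :
    (D.encBell k r).trace = 1 := by
  rw [Decomposition.encBell, (D.encR_tp k r).ampl, bell_trace]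

theorem Decomposition.phiVec_dot [Nonempty S.M] (k : S.K) (r : D.T) :
    star (D.phiVec k r) ⬝ᵥ D.phiVec k r = 1 := by
  rw [← D.encBell_trace k r, D.encBell_eq, trace_vecMulVec, dotProduct_comm]

theorem Decomposition.encBell_mul_self [Nonempty S.M] (k : S.K) (r : D.T) :
    D.encBell k r * D.encBell k r = D.encBell k r := by
  rw [D.encBell_eq, vecMulVec_mul_vecMulVec, D.phiVec_dot, one_smul]

theorem Decomposition.ampl_enc (k : S.K) (L : Type) (X : Op (S.M × L)) :
    ampl (S.enc k).map L X = ∑ r, ((D.p k r : ℝ) : ℂ) • ampl (D.encR k r) L X := by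
  have : (S.enc k).map = ∑ r, ((D.p k r : ℝ) : ℂ) • D.encR k r := by
    ext1 X
    rw [D.enc_eq, LinearMap.sum_apply]
    rfl
  rw [this, ampl_sum, LinearMap.sum_apply]
  rfl

/-- The failure probability of the test for a maximally entangled state on the decryption of an
encrypted half of one. -/
def Decomposition.defect (k : S.K) (r : D.T) : ℝ :=
  1 - (conjL (bell S.M) (accE (S.dec k).map S.M (D.encBell k r))).trace.re

theorem Decomposition.rejE_encBell_le [Nonempty S.M] (k : S.K) (r : D.T) :
    (rejE (S.dec k).map S.M (D.encBell k r)).trace.re ≤ D.defect k r := by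
  have h1 := congrArg Complex.re (accE_trace_add (S.dec k).tp (D.encBell k r))
  rw [D.encBell_trace, Complex.add_re, Complex.one_re] at h1
  have h2 : (conjL (bell S.M) (accE (S.dec k).map S.M (D.encBell k r))).trace.re ≤
      (accE (S.dec k).map S.M (D.encBell k r)).trace.re := by
    exact conjL_tni_of_proj bell_mul_self bell_conjTranspose _
      ((accE_cp (S.dec k).cp S.M).posSemidef (D.encBell_posSemidef k r))
  rw [Decomposition.defect]
  linarith

theorem Decomposition.defect_nonneg [Nonempty S.M] (k : S.K) (r : D.T) : 0 ≤ D.defect k r :=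
  (trace_re_nonneg ((rejE_cp (S.dec k).cp S.M).posSemidef (D.encBell_posSemidef k r))).trans
    (D.rejE_encBell_le k r)

/-- Correctness applied to one half of `φ⁺`: what is decrypted must pass the test for `φ⁺`. The
bound holds for every key, but only on average over `r`. -/
theorem Decomposition.sum_defect_le [Nonempty S.M] {ε : ℝ} (hε : 0 ≤ ε) (k : S.K)
    (h : diamondNorm ((S.dec k).map ∘ₗ (S.enc k).map - embedBot S.M) ≤ ENNReal.ofReal ε) :
    ∑ r, D.p k r * D.defect k r ≤ ε := by
  classical
  set f : Op (Option S.M × S.M) →ₗ[ℂ] ℂ :=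
    traceFn _ ∘ₗ conjL (bell S.M) ∘ₗ reix (Prod.map some id) with hf
  have hfp : PosFn f := traceFn_pos.comp ((conjL_cp _).comp (reix_cp _))
  have hfs : SubTr f := traceFn_subTr.comp ((conjL_cp _).comp (reix_cp _))
    ((conjL_tni_of_proj bell_mul_self bell_conjTranspose).comp'
      (reix_tni ((Option.some_injective _).prodMap Function.injective_id)) (reix_cp _))
  have h1 := norm_fn_ampl_le hε h (bell_posSemidef (M := S.M)) hfp hfs
  rw [ampl_sub, LinearMap.sub_apply, map_sub, bell_trace, Complex.one_re, mul_one] at h1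
  have h2 : f (ampl (embedBot S.M) S.M (bell S.M)) = 1 := by
    change (conjL (bell S.M) (bell S.M)).trace = 1
    rw [conjL_apply, bell_conjTranspose, bell_mul_self, bell_mul_self, bell_trace]
  have h3 : f (ampl ((S.dec k).map ∘ₗ (S.enc k).map) S.M (bell S.M)) =
      ∑ r, ((D.p k r : ℝ) : ℂ) *
        (conjL (bell S.M) (accE (S.dec k).map S.M (D.encBell k r))).trace := by
    rw [ampl_comp, LinearMap.comp_apply (ampl _ _), D.ampl_enc, map_sum, map_sum]
    refine Finset.sum_congr rfl fun r _ => ?_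
    rw [map_smul, map_smul]
    rfl
  rw [h2, h3, norm_sub_rev] at h1
  have h4 := (Complex.re_le_norm _).trans h1
  rw [Complex.sub_re, Complex.one_re, Complex.re_sum] at h4
  simp only [Complex.re_ofReal_mul] at h4
  simp only [Decomposition.defect, mul_sub, mul_one, Finset.sum_sub_distrib, D.p_sum]
  exact h4

/-- The probability of an accepting decryption after the test for `V_k |Φ_{k,r}⟩` has failed. -/
def Decomposition.bad (k : S.K) (r : D.T) : Op (S.C × S.M) →ₗ[ℂ] ℂ :=
  traceFn _ ∘ₗ accE (S.dec k).map S.M ∘ₗ conjL (1 - D.encBell k r)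

theorem Decomposition.bad_pos (k : S.K) (r : D.T) : PosFn (D.bad k r) :=
  traceFn_pos.comp ((accE_cp (S.dec k).cp _).comp (conjL_cp _))

theorem conjL_vecMulVec_apply {a : Type} [Fintype a] (v : a → ℂ) (X : Op a) :
    conjL (vecMulVec v (star v)) X = (star v ⬝ᵥ X *ᵥ v) • vecMulVec v (star v) := by
  rw [conjL_apply, conjTranspose_vecMulVec, star_star, vecMulVec_mul, vecMulVec_mul_vecMulVec,
    ← dotProduct_mulVec, vecMulVec_smul]

/-- Split acceptance along the projector `P` onto `V_k |Φ_{k,r}⟩`. The cross terms have trace zero,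
so their accepting value is minus their rejecting value; and rejection is rare on the range of `P`,
by the defect. The cross terms thus cost only `η` and `η⁻¹` times the defect, and acceptance outside
`P` is acceptance minus the weight of `P`, up to this error. -/
theorem Decomposition.bad_le [Nonempty S.M] (k : S.K) (r : D.T) {σ : Op (S.C × S.M)}
    (hσ : σ.PosSemidef) {η : ℝ} (hη : 0 < η) :
    (D.bad k r σ).re ≤ (accE (S.dec k).map S.M σ).trace.re -
      (conjL (D.encBell k r) σ).trace.re + (η + (1 + η⁻¹) * D.defect k r) * σ.trace.re := by
  classical
  set P := D.encBell k r with hP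
  have hPP : P * P = P := D.encBell_mul_self k r
  have hPH : Pᴴ = P := D.encBell_conjTranspose k r
  set a : Op (S.C × S.M) →ₗ[ℂ] ℂ := traceFn _ ∘ₗ accE (S.dec k).map S.M with ha
  set b : Op (S.C × S.M) →ₗ[ℂ] ℂ := traceFn _ ∘ₗ rejE (S.dec k).map S.M with hb
  have hbp : PosFn b := traceFn_pos.comp (rejE_cp (S.dec k).cp _)
  have hab : ∀ X, a X + b X = X.trace := fun X => accE_trace_add (S.dec k).tp X
  set cr := P * σ * (1 - P)ᴴ + (1 - P) * σ * Pᴴ with hcr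
  have hcr0 : cr.trace = 0 := by
    rw [hcr, Matrix.trace_add, Matrix.trace_mul_comm, Matrix.trace_mul_comm _ Pᴴ,
      ← Matrix.mul_assoc, ← Matrix.mul_assoc, conjTranspose_sub, conjTranspose_one, hPH,
      Matrix.sub_mul, Matrix.mul_sub, Matrix.one_mul, Matrix.mul_one, hPP, sub_self]
    simp
  have hsplit : a σ = a (conjL P σ) + a (conjL (1 - P) σ) + a cr := by
    rw [← map_add, ← map_add, hcr, ← conjL_eq_pinch P σ]
  have hcross := hbp.abs_cross_le hσ (1 - P) P hη
  rw [add_comm ((1 - P) * σ * Pᴴ), ← hcr] at hcross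
  have htr : (conjL P σ).trace.re + (conjL (1 - P) σ).trace.re = σ.trace.re :=
    conjL_trace_add_of_proj hPP hPH σ
  have h0 := trace_re_nonneg ((conjL_cp P).posSemidef hσ)
  have h0' := trace_re_nonneg ((conjL_cp (1 - P)).posSemidef hσ)
  have hb1 : (b (conjL (1 - P) σ)).re ≤ (conjL (1 - P) σ).trace.re :=
    rejE_tni (S.dec k).tp (S.dec k).cp _ ((conjL_cp _).posSemidef hσ)
  have hb2 : (b (conjL P σ)).re ≤ D.defect k r * σ.trace.re := by
    set z := star (D.phiVec k r) ⬝ᵥ σ *ᵥ D.phiVec k r with hz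
    have e : conjL P σ = z • P := by rw [hP, D.encBell_eq, conjL_vecMulVec_apply]
    have ez : (conjL P σ).trace = z := by
      rw [e, Matrix.trace_smul, hP, D.encBell_trace, smul_eq_mul, mul_one]
    have hz0 : 0 ≤ z := by
      rw [← ez]
      exact ((conjL_cp P).posSemidef hσ).trace_nonneg
    have hzr : z = (z.re : ℂ) := by
      refine Complex.ext rfl ?_
      simpa using (Complex.le_def.mp hz0).2.symm
    rw [e, map_smul, smul_eq_mul, hzr, Complex.re_ofReal_mul, mul_comm]
    rw [ez] at htr h0
    refine mul_le_mul (D.rejE_encBell_le k r) (by linarith) h0 (D.defect_nonneg k r)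
  have e1 := congrArg Complex.re hsplit
  have e2 := congrArg Complex.re (hab (conjL P σ))
  have e3 := congrArg Complex.re (hab cr)
  rw [hcr0] at e3
  simp only [Complex.add_re, Complex.zero_re] at e1 e2 e3
  have e4 : η * (b (conjL (1 - P) σ)).re ≤ η * σ.trace.re :=
    mul_le_mul_of_nonneg_left (by linarith) hη.le
  have e5 : (1 + η⁻¹) * (b (conjL P σ)).re ≤ (1 + η⁻¹) * (D.defect k r * σ.trace.re) :=
    mul_le_mul_of_nonneg_left hb2 (by positivity)
  have e6 := (abs_le.mp hcross).2
  change (a (conjL (1 - P) σ)).re ≤ (a σ).re - _ + _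
  nlinarith

end EncryptedBell

/-! ### Acceptance means that the ciphertext is intact -/

section BadBound

variable {S : QScheme} {B X : Type}

/-- Trace out the middle register. -/
def trMid {a b c : Type} [Fintype b] : Op ((a × b) × c) →ₗ[ℂ] Op (a × c) :=
  trR ∘ₗ reix fun p : (a × c) × b => ((p.1.1, p.2), p.1.2)

theorem trMid_cp {a b c : Type} [Fintype a] [Fintype b] [Fintype c] :
    IsCP (trMid : Op ((a × b) × c) →ₗ[ℂ] Op (a × c)) := trR_cp.comp (reix_cp _)

theorem trMid_trace {a b c : Type} [Fintype a] [Fintype b] [Fintype c] (Y : Op ((a × b) × c)) :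
    (trMid Y).trace = Y.trace := by
  rw [trMid, LinearMap.comp_apply, trR_trace]
  simp only [Matrix.trace, Matrix.diag_apply, reix_apply, Fintype.sum_prod_type]
  exact Finset.sum_congr rfl fun _ _ => Finset.sum_comm

theorem attachOp_posSemidef {c m : Type} [Fintype c] [Fintype m] [Fintype B] {Y : Op (c × m)}
    (hY : Y.PosSemidef) {Z : Op B} (hZ : Z.PosSemidef) : (attachOp Y B Z).PosSemidef :=
  (reix_cp fun p : (c × B) × m => ((p.1.1, p.2), p.1.2)).posSemidef (hY.kronecker hZ)

theorem attachOp_trace {c m : Type} [Fintype c] [Fintype m] [Fintype B] (Y : Op (c × m))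
    (Z : Op B) : (attachOp Y B Z).trace = Y.trace * Z.trace := by
  rw [← trace_kronecker]
  simp only [Matrix.trace, Matrix.diag_apply, Fintype.sum_prod_type]
  exact Finset.sum_congr rfl fun _ _ => Finset.sum_comm

theorem sandwich_trace {c m : Type} [Fintype c] [Fintype m] [Fintype B] (v : c × m → ℂ)
    (hv : star v ⬝ᵥ v = 1) (Y : Op ((c × B) × m)) :
    (sandwich v B Y).trace = (conjL (vecMulVec v (star v)) (trMid Y)).trace := by
  rw [conjL_vecMulVec_apply, Matrix.trace_smul, trace_vecMulVec, dotProduct_comm v, hv,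
    smul_eq_mul, mul_one]
  simp only [sandwich, Matrix.trace, Matrix.diag_apply, LinearMap.coe_mk, AddHom.coe_mk, of_apply,
    dotProduct, mulVec, trMid, LinearMap.comp_apply, trR_apply, reix_apply, Finset.mul_sum,
    Finset.sum_mul, Pi.star_apply]
  rw [Finset.sum_comm]
  refine Finset.sum_congr rfl fun p _ => ?_
  rw [Finset.sum_comm]
  refine Finset.sum_congr rfl fun q _ => Finset.sum_congr rfl fun b _ => ?_
  ring

theorem ampl_ampl_attachOp {c c' m : Type} (Φ : Op c →ₗ[ℂ] Op c') (Y : Op (c × m)) (Z : Op B) :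
    ampl (ampl Φ B) m (attachOp Y B Z) = attachOp (ampl Φ m Y) B Z := by
  ext p q
  have h : ((attachOp Y B Z).submatrix (fun i => (i, p.2)) fun i => (i, q.2)).submatrix
      (fun i => (i, p.1.2)) (fun i => (i, q.1.2)) =
      Z p.1.2 q.1.2 • Y.submatrix (fun i => (i, p.2)) fun i => (i, q.2) := by
    ext i j
    exact mul_comm _ _
  rw [ampl_apply, ampl_apply, h, map_smul, Matrix.smul_apply, smul_eq_mul, mul_comm]
  rfl

theorem attachOp_sum_smul {c m ι : Type} (s : Finset ι) (w : ι → ℂ) (Y : ι → Op (c × m))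
    (Z : Op B) : attachOp (∑ i ∈ s, w i • Y i) B Z = ∑ i ∈ s, w i • attachOp (Y i) B Z := by
  ext p q
  simp only [attachOp, LinearMap.coe_mk, AddHom.coe_mk, of_apply, Matrix.sum_apply,
    Matrix.smul_apply, smul_eq_mul, Finset.sum_mul, mul_assoc]

theorem accE_trMid_trace {c m e : Type} [Fintype c] [Fintype m] [Fintype e] {M : Type} [Fintype M]
    (Φ : Op c →ₗ[ℂ] Op (Option M)) (Y : Op ((c × e) × m)) :
    (accE Φ m (trMid Y)).trace = (ampl (accE Φ e) m Y).trace := by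
  rw [ampl_trace, accE_trace, accE_trace]
  congr 3
  ext i j
  simp only [trMid, LinearMap.comp_apply, trR_apply, reix_apply]
  exact Finset.sum_comm

variable [Fintype B] [Fintype X]

/-- After an attack on the encryption of one half of a maximally entangled state, an accepting
decryption almost always implies that the ciphertext was left intact. -/
theorem QCABound.bad_le {D : Decomposition S} {ε : ℝ} (hQ : QCABound D ε) (hε : 0 ≤ ε)
    [Nonempty S.C] [Nonempty S.M]
    (hc : ∀ k, diamondNorm ((S.dec k).map ∘ₗ (S.enc k).map - embedBot S.M) ≤ ENNReal.ofReal ε)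
    {Λ : Op (S.C × B) →ₗ[ℂ] Op (S.C × X)} (hΛ : IsCP Λ) (hΛ' : TNI Λ) {Z : Op B}
    (hZ : Z.PosSemidef) {η : ℝ} (hη : 0 < η) :
    (avg fun k => ∑ r, D.p k r *
      (D.bad k r (trMid (ampl Λ S.M (attachOp (D.encBell k r) B Z)))).re) ≤
      (2 * ε + η + η⁻¹ * ε) * Z.trace.re := by
  set σ : (k : S.K) → D.T → Op (S.C × S.M) := fun k r =>
    trMid (ampl Λ S.M (attachOp (D.encBell k r) B Z)) with hσ
  have hAp : ∀ k r, (attachOp (D.encBell k r) B Z).PosSemidef := fun k r =>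
    attachOp_posSemidef (D.encBell_posSemidef k r) hZ
  have hσp : ∀ k r, (σ k r).PosSemidef := fun k r =>
    trMid_cp.posSemidef ((hΛ.ampl _).posSemidef (hAp k r))
  have hσt : ∀ k r, (σ k r).trace.re ≤ Z.trace.re := by
    intro k r
    rw [hσ, trMid_trace]
    refine (hΛ'.ampl _ _ (hAp k r)).trans (le_of_eq ?_)
    rw [attachOp_trace, D.encBell_trace, one_mul]
  have hZ0 := trace_re_nonneg hZ
  have hstep : ∀ k, ∑ r, D.p k r * (D.bad k r (σ k r)).re ≤
      ∑ r, D.p k r * (accE (S.dec k).map S.M (σ k r)).trace.re -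
      ∑ r, D.p k r * (conjL (D.encBell k r) (σ k r)).trace.re +
        (η + (1 + η⁻¹) * ε) * Z.trace.re := by
    intro k
    have h1 : ∀ r, D.p k r * (D.bad k r (σ k r)).re ≤
        D.p k r * (accE (S.dec k).map S.M (σ k r)).trace.re -
        D.p k r * (conjL (D.encBell k r) (σ k r)).trace.re +
        (D.p k r * η + (1 + η⁻¹) * (D.p k r * D.defect k r)) * Z.trace.re := by
      intro r
      have h2 := D.bad_le k r (hσp k r) hη
      have h3 : (η + (1 + η⁻¹) * D.defect k r) * (σ k r).trace.re ≤
          (η + (1 + η⁻¹) * D.defect k r) * Z.trace.re :=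
        mul_le_mul_of_nonneg_left (hσt k r)
          (add_nonneg hη.le (mul_nonneg (by positivity) (D.defect_nonneg k r)))
      have h4 := mul_le_mul_of_nonneg_left (h2.trans (add_le_add_right h3 _)) (D.p_nonneg k r)
      refine h4.trans (le_of_eq ?_)
      ring
    refine (Finset.sum_le_sum fun r _ => h1 r).trans ?_
    rw [Finset.sum_add_distrib, Finset.sum_sub_distrib, ← Finset.sum_mul, Finset.sum_add_distrib,
      ← Finset.sum_mul, D.p_sum, one_mul, ← Finset.mul_sum]
    have h5 := D.sum_defect_le hε k (hc k)
    gcongr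
  refine (avg_mono hstep).trans ?_
  rw [avg_add, avg_sub, avg_const]
  obtain ⟨rej, hrej⟩ := hQ.exists_rej hε hΛ hΛ'
  -- Only the total weight of acceptance is compared: for the real attack it is the first sum of
  -- `hstep`, and for the simulator it is the trace of `Λ^acc`, which by definition is the second
  -- sum. Their difference is at most `ε`.
  set ρ : Op ((S.M × B) × S.M) := attachOp (bell S.M) B Z with hρ
  have hρp : ρ.PosSemidef := attachOp_posSemidef bell_posSemidef hZ
  set s : Op ((Option S.M × X) × S.M) →ₗ[ℂ] Op ((S.M × X) × S.M) :=
    reix (Prod.map (Prod.map some id) id) with hs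
  have h1 := hrej S.M ρ hρp (traceFn _ ∘ₗ s) (traceFn_pos.comp (reix_cp _))
    (traceFn_subTr.comp (reix_cp _) (reix_tni
      (((Option.some_injective _).prodMap Function.injective_id).prodMap Function.injective_id)))
  rw [hρ, attachOp_trace, bell_trace, one_mul, ← hρ] at h1
  have h2 : ((traceFn _ ∘ₗ s) (ampl (effectiveMap S Λ) S.M ρ)).re =
      avg fun k => ∑ r, D.p k r * (accE (S.dec k).map S.M (σ k r)).trace.re := by
    rw [LinearMap.comp_apply, hs, reix_ampl_effectiveMap, map_smul, map_sum, re_inv_card_smul_sum]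
    congr 1
    funext k
    have h4 : ampl (ampl (S.enc k).map B) S.M ρ =
        ∑ r, ((D.p k r : ℝ) : ℂ) • attachOp (D.encBell k r) B Z := by
      rw [hρ, ampl_ampl_attachOp, D.ampl_enc, attachOp_sum_smul]
      rfl
    rw [accPath, ampl_comp, ampl_comp, LinearMap.comp_apply, LinearMap.comp_apply, h4, map_sum,
      map_sum, map_sum, Complex.re_sum]
    refine Finset.sum_congr rfl fun r _ => ?_
    rw [map_smul, map_smul, map_smul, smul_eq_mul, Complex.re_ofReal_mul, hσ, accE_trMid_trace]
    rfl
  have h3 : ((traceFn _ ∘ₗ s) (ampl (simulator S.M (accMap D Λ) rej) S.M ρ)).re =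
      avg fun k => ∑ r, D.p k r * (conjL (D.encBell k r) (σ k r)).trace.re := by
    have h4 : s (ampl (simulator S.M (accMap D Λ) rej) S.M ρ) =
        attachOp (bell S.M) X (accMap D Λ Z) := by
      ext p q
      have h6 : (ρ.submatrix (fun i => (i, p.2)) fun i => (i, q.2)).submatrix
          (fun i => (p.1.1, i)) (fun i => (q.1.1, i)) =
          bell S.M (p.1.1, p.2) (q.1.1, q.2) • Z := rfl
      change accMap D Λ ((ρ.submatrix (fun i => (i, p.2)) fun i => (i, q.2)).submatrix
          (fun i => (p.1.1, i)) (fun i => (q.1.1, i))) p.1.2 q.1.2 = _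
      rw [h6, map_smul]
      rfl
    rw [LinearMap.comp_apply, h4, traceFn_apply, attachOp_trace, bell_trace, one_mul, accMap,
      LinearMap.smul_apply, LinearMap.sum_apply, Matrix.trace_smul, Matrix.trace_sum,
      re_inv_card_smul_sum]
    congr 1
    funext k
    rw [LinearMap.sum_apply, Matrix.trace_sum, Complex.re_sum]
    refine Finset.sum_congr rfl fun r _ => ?_
    have h7 := sandwich_trace (D.phiVec k r) (D.phiVec_dot k r)
      (ampl Λ S.M (attachOp (D.encBell k r) B Z))
    rw [← D.encBell_eq] at h7
    rw [LinearMap.smul_apply, Matrix.trace_smul, smul_eq_mul, Complex.re_ofReal_mul]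
    exact congrArg (fun z => D.p k r * Complex.re z) h7
  have h5 := (Complex.re_le_norm _).trans h1
  rw [Complex.sub_re, h2, h3] at h5
  linarith

end BadBound

/-! ### Expansions of sequential games -/

section Runs

variable {σ E E₀ ι : Type}

/-- Apply the maps `F q` for the entries `q` of a list, one after the other, and then the
functional `f`. -/
def runSteps (F : σ → Op E →ₗ[ℂ] Op E) (f : Op E →ₗ[ℂ] ℂ) : List σ → Op E →ₗ[ℂ] ℂ
  | [] => f
  | q :: qs => runSteps F f qs ∘ₗ F q

/-- The sum over all entries `q` of a list of the functional `h q qs`, with `qs` the rest of the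
list, after the maps `T` of the earlier entries. -/
def pathSum (T : σ → Op E →ₗ[ℂ] Op E) (h : σ → List σ → Op E →ₗ[ℂ] ℂ) : List σ → Op E →ₗ[ℂ] ℂ
  | [] => 0
  | q :: qs => h q qs + pathSum T h qs ∘ₗ T q

/-- A discrete Duhamel formula: each correction uses `T` before its position, `A` at it, and the
full evolution `F` after it. -/
theorem runSteps_eq_add_pathSum {F T A : σ → Op E →ₗ[ℂ] Op E} (hF : ∀ q, F q = T q + A q)
    (f : Op E →ₗ[ℂ] ℂ) (qs : List σ) :
    runSteps F f qs = runSteps T f qs + pathSum T (fun q qs => runSteps F f qs ∘ₗ A q) qs := by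
  induction qs with
  | nil => simp [runSteps, pathSum]
  | cons q qs ih =>
    rw [runSteps, pathSum, runSteps]
    conv_lhs => rw [hF q, LinearMap.comp_add]
    conv_lhs => arg 1; rw [ih, LinearMap.add_comp]
    abel

theorem pathSum_sub (T : σ → Op E →ₗ[ℂ] Op E) (h h' : σ → List σ → Op E →ₗ[ℂ] ℂ) (qs : List σ) :
    pathSum T h qs - pathSum T h' qs = pathSum T (fun q qs => h q qs - h' q qs) qs := by
  induction qs with
  | nil => simp [pathSum]
  | cons q qs ih =>
    rw [pathSum, pathSum, pathSum, ← ih, LinearMap.sub_comp]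
    abel

theorem pathSum_add (T : σ → Op E →ₗ[ℂ] Op E) (h h' : σ → List σ → Op E →ₗ[ℂ] ℂ) (qs : List σ) :
    pathSum T h qs + pathSum T h' qs = pathSum T (fun q qs => h q qs + h' q qs) qs := by
  induction qs with
  | nil => simp [pathSum]
  | cons q qs ih =>
    rw [pathSum, pathSum, pathSum, ← ih, LinearMap.add_comp]
    abel

variable [Fintype E]

theorem runSteps_pos {F : σ → Op E →ₗ[ℂ] Op E} (hF : ∀ q, IsCP (F q)) {f : Op E →ₗ[ℂ] ℂ}
    (hf : PosFn f) (qs : List σ) : PosFn (runSteps F f qs) := by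
  induction qs with
  | nil => exact hf
  | cons q qs ih => exact ih.comp (hF q)

theorem runSteps_subTr {F : σ → Op E →ₗ[ℂ] Op E} (hF : ∀ q, IsCP (F q)) (hF' : ∀ q, TNI (F q))
    {f : Op E →ₗ[ℂ] ℂ} (hf : SubTr f) (qs : List σ) : SubTr (runSteps F f qs) := by
  induction qs with
  | nil => exact hf
  | cons q qs ih => exact ih.comp (hF q) (hF' q)

theorem pathSum_pos {T : σ → Op E →ₗ[ℂ] Op E} (hT : ∀ q, IsCP (T q))
    {h : σ → List σ → Op E →ₗ[ℂ] ℂ} (hh : ∀ q qs, PosFn (h q qs)) (qs : List σ) :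
    PosFn (pathSum T h qs) := by
  induction qs with
  | nil => exact PosFn.zero
  | cons q qs ih => exact (hh q qs).add (ih.comp (hT q))

theorem abs_pathSum_le {T : σ → Op E →ₗ[ℂ] Op E} (hT : ∀ q, IsCP (T q))
    {h h' : σ → List σ → Op E →ₗ[ℂ] ℂ}
    (H : ∀ q qs (ρ : Op E), ρ.PosSemidef → |(h q qs ρ).re| ≤ (h' q qs ρ).re) (qs : List σ)
    {ρ : Op E} (hρ : ρ.PosSemidef) :
    |(pathSum T h qs ρ).re| ≤ (pathSum T h' qs ρ).re := by
  induction qs generalizing ρ with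
  | nil => simp [pathSum]
  | cons q qs ih =>
    simp only [pathSum, LinearMap.add_apply, Complex.add_re, LinearMap.comp_apply]
    exact (abs_add_le _ _).trans (add_le_add (H q qs ρ hρ) (ih ((hT q).posSemidef hρ)))

/-- A bound on the expectation of a path sum from one on each of its terms; `G` is a class of maps
that contains the evolution up to the current position. -/
theorem expect_pathSum_le {Y : Type} {T : σ → Op Y →ₗ[ℂ] Op Y} {h : ι → σ → List σ → Op Y →ₗ[ℂ] ℂ}
    (𝔼 : (ι → ℝ) →ₗ[ℝ] ℝ) (τ : ι → Op E₀) (G : (Op E₀ →ₗ[ℂ] Op Y) → Prop)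
    (hG : ∀ Γ q, G Γ → G (T q ∘ₗ Γ)) {δ : ℝ} {n : ℕ}
    (H : ∀ Γ q qs, qs.length < n → G Γ → 𝔼 (fun i => (h i q qs (Γ (τ i))).re) ≤ δ)
    {qs : List σ} (hn : qs.length ≤ n) {Γ : Op E₀ →ₗ[ℂ] Op Y} (hΓ : G Γ) :
    𝔼 (fun i => (pathSum T (h i) qs (Γ (τ i))).re) ≤ qs.length * δ := by
  induction qs generalizing Γ with
  | nil =>
    have : (fun i => (pathSum T (h i) [] (Γ (τ i))).re) = 0 := by
      funext i
      simp [pathSum]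
    rw [this, map_zero]
    simp
  | cons q qs ih =>
    rw [List.length_cons] at hn
    have e : (fun i => (pathSum T (h i) (q :: qs) (Γ (τ i))).re) =
        (fun i => (h i q qs (Γ (τ i))).re) +
        fun i => (pathSum T (h i) qs ((T q ∘ₗ Γ) (τ i))).re := by
      funext i
      simp [pathSum]
    rw [e, map_add, List.length_cons, Nat.cast_succ]
    have h1 := H Γ q qs hn hΓ
    have h2 := ih (by omega) (hG Γ q hΓ)
    linarith

end Runs

/-! ### Games with a single encryption and many decryptions -/

section Steps

/-- One step of a game with state register `X` in which a single ciphertext may be decrypted: with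
the part `O` of the evolution nothing is decrypted, with the part `pre` a ciphertext is submitted,
and `onAcc` and `onRej` process the answer. -/
structure Step (C M X : Type) [Fintype C] [Fintype M] [Fintype X] where
  O : Op X →ₗ[ℂ] Op X
  pre : Op X →ₗ[ℂ] Op (C × X)
  onAcc : Op (M × X) →ₗ[ℂ] Op X
  onRej : Op X →ₗ[ℂ] Op X
  O_cp : IsCP O
  pre_cp : IsCP pre
  onAcc_cp : IsCP onAcc
  onRej_cp : IsCP onRej
  tni : ∀ ρ : Op X, ρ.PosSemidef → (O ρ).trace.re + (pre ρ).trace.re ≤ ρ.trace.re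
  onAcc_tni : TNI onAcc
  onRej_tni : TNI onRej

variable {C M X : Type} [Fintype C] [Fintype M] [Fintype X]

namespace Step

theorem pre_tni (q : Step C M X) : TNI q.pre := fun ρ hρ => by
  have := q.tni ρ hρ
  have := trace_re_nonneg (q.O_cp.posSemidef hρ)
  linarith

/-- The step in which the ciphertext is decrypted by `Φ`. -/
def real (Φ : Op C →ₗ[ℂ] Op (Option M)) (q : Step C M X) : Op X →ₗ[ℂ] Op X :=
  q.O + q.onAcc ∘ₗ accE Φ X ∘ₗ q.pre + q.onRej ∘ₗ rejE Φ X ∘ₗ q.pre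

/-- The step in which every ciphertext is rejected. -/
def null (q : Step C M X) : Op X →ₗ[ℂ] Op X := q.O + q.onRej ∘ₗ trL ∘ₗ q.pre

/-- The difference of `real` and `null`. -/
def excess (Φ : Op C →ₗ[ℂ] Op (Option M)) (q : Step C M X) : Op X →ₗ[ℂ] Op X :=
  q.onAcc ∘ₗ accE Φ X ∘ₗ q.pre - q.onRej ∘ₗ trL ∘ₗ accE Φ X ∘ₗ q.pre

/-- The part of `real` and `null` in which `Φ` accepts. -/
def accepted (Φ : Op C →ₗ[ℂ] Op (Option M)) (q : Step C M X) : Op X →ₗ[ℂ] Op X :=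
  q.onAcc ∘ₗ accE Φ X ∘ₗ q.pre + q.onRej ∘ₗ trL ∘ₗ accE Φ X ∘ₗ q.pre

variable {Φ : Op C →ₗ[ℂ] Op (Option M)}

/-- The rejecting branch is the outright discard minus its accepted part, so the difference from
universal rejection is supported on acceptance. -/
theorem real_eq (hΦ : IsTP Φ) (q : Step C M X) : q.real Φ = q.null + q.excess Φ := by
  have h : (rejE Φ X : Op (C × X) →ₗ[ℂ] Op X) = trL - trL ∘ₗ accE Φ X := by
    ext1 Y
    rw [LinearMap.sub_apply, ← trL_accE_add_rejE hΦ Y]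
    simp
  rw [real, null, excess, h, LinearMap.sub_comp, LinearMap.comp_sub]
  simp only [LinearMap.comp_assoc]
  abel

theorem null_cp (q : Step C M X) : IsCP q.null := q.O_cp.add (q.onRej_cp.comp (trL_cp.comp q.pre_cp))

theorem null_tni (q : Step C M X) : TNI q.null := by
  intro ρ hρ
  have h1 := q.onRej_tni _ (trL_cp.posSemidef (q.pre_cp.posSemidef hρ))
  rw [trL_trace] at h1
  have h2 := q.tni ρ hρ
  simp only [null, LinearMap.add_apply, Matrix.trace_add, Complex.add_re, LinearMap.comp_apply]
  linarith

theorem real_cp (hΦ : IsCP Φ) (q : Step C M X) : IsCP (q.real Φ) :=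
  (q.O_cp.add (q.onAcc_cp.comp ((accE_cp hΦ X).comp q.pre_cp))).add
    (q.onRej_cp.comp ((rejE_cp hΦ X).comp q.pre_cp))

theorem real_tni (hΦ : IsTP Φ) (hΦ' : IsCP Φ) (q : Step C M X) : TNI (q.real Φ) := by
  intro ρ hρ
  have hp := q.pre_cp.posSemidef hρ
  have h1 := q.onAcc_tni _ ((accE_cp hΦ' X).posSemidef hp)
  have h2 := q.onRej_tni _ ((rejE_cp hΦ' X).posSemidef hp)
  have h3 := q.tni ρ hρ
  have h4 := congrArg Complex.re (accE_trace_add hΦ (q.pre ρ))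
  rw [Complex.add_re] at h4
  simp only [real, LinearMap.add_apply, Matrix.trace_add, Complex.add_re, LinearMap.comp_apply]
  linarith

/-- The total acceptance probability in a game in which every ciphertext is rejected. -/
def accTotal (Φ : Op C →ₗ[ℂ] Op (Option M)) : List (Step C M X) → Op X →ₗ[ℂ] ℂ :=
  pathSum null fun q _ => traceFn _ ∘ₗ accE Φ X ∘ₗ q.pre

/-- The total probability of two acceptances. -/
def accTwice (Φ : Op C →ₗ[ℂ] Op (Option M)) : List (Step C M X) → Op X →ₗ[ℂ] ℂ :=
  pathSum null fun q qs => accTotal Φ qs ∘ₗ q.accepted Φ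

/-- The contributions to the real game with at most one acceptance. -/
def firstOrder (Φ : Op C →ₗ[ℂ] Op (Option M)) (f : Op X →ₗ[ℂ] ℂ) (qs : List (Step C M X)) :
    Op X →ₗ[ℂ] ℂ :=
  runSteps null f qs + pathSum null (fun q qs => runSteps null f qs ∘ₗ q.excess Φ) qs

theorem accTotal_pos (hΦ : IsCP Φ) (qs : List (Step C M X)) : PosFn (accTotal Φ qs) :=
  pathSum_pos null_cp (fun q _ => traceFn_pos.comp ((accE_cp hΦ X).comp q.pre_cp)) qs

theorem abs_excess_le (hΦ : IsCP Φ) {g g' : Op X →ₗ[ℂ] ℂ}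
    (H : ∀ ρ : Op X, ρ.PosSemidef → |(g ρ).re| ≤ (g' ρ).re) (q : Step C M X) {ρ : Op X}
    (hρ : ρ.PosSemidef) : |(g (q.excess Φ ρ)).re| ≤ (g' (q.accepted Φ ρ)).re := by
  have hp := (accE_cp hΦ X).posSemidef (q.pre_cp.posSemidef hρ)
  have h1 := H _ (q.onAcc_cp.posSemidef hp)
  have h2 := H _ (q.onRej_cp.posSemidef (trL_cp.posSemidef hp))
  simp only [excess, accepted, LinearMap.sub_apply, LinearMap.add_apply, LinearMap.comp_apply,
    map_sub, map_add, Complex.sub_re, Complex.add_re]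
  exact (abs_sub _ _).trans (add_le_add h1 h2)

/-- In the Duhamel expansion each position contributes one acceptance, continued either by `onAcc`
or by `onRej`; hence the factor 2. -/
theorem abs_real_sub_null_le (hΦ : IsTP Φ) (hΦ' : IsCP Φ) {f : Op X →ₗ[ℂ] ℂ} (hf : PosFn f)
    (hf' : SubTr f) (qs : List (Step C M X)) {ρ : Op X} (hρ : ρ.PosSemidef) :
    |(runSteps (real Φ) f qs ρ).re - (runSteps null f qs ρ).re| ≤ 2 * (accTotal Φ qs ρ).re := by
  have h1 : |(pathSum null (fun q qs => runSteps (real Φ) f qs ∘ₗ q.excess Φ) qs ρ).re| ≤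
      (pathSum null (fun q _ => (2 : ℂ) • (traceFn _ ∘ₗ accE Φ X ∘ₗ q.pre)) qs ρ).re := by
    refine abs_pathSum_le null_cp (fun q qs ρ hρ => ?_) qs hρ
    have hp := (accE_cp hΦ' X).posSemidef (q.pre_cp.posSemidef hρ)
    refine (abs_excess_le (g' := traceFn X) hΦ' (fun τ hτ => ?_) q hρ).trans ?_
    · rw [abs_of_nonneg ((runSteps_pos (real_cp hΦ') hf qs).re_nonneg hτ)]
      exact runSteps_subTr (real_cp hΦ') (real_tni hΦ hΦ') hf' qs τ hτ
    · have h1 := q.onAcc_tni _ hp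
      have h2 := q.onRej_tni _ (trL_cp.posSemidef hp)
      rw [trL_trace] at h2
      simp only [accepted, LinearMap.add_apply, LinearMap.comp_apply, map_add, Complex.add_re,
        traceFn_apply, LinearMap.smul_apply, smul_eq_mul, two_mul]
      linarith
  have h2 : ∀ qs : List (Step C M X),
      pathSum null (fun q _ => (2 : ℂ) • (traceFn _ ∘ₗ accE Φ X ∘ₗ q.pre)) qs =
        (2 : ℂ) • accTotal Φ qs := by
    intro qs
    simp only [two_smul, ← pathSum_add]
    rfl
  rw [h2, LinearMap.smul_apply, smul_eq_mul] at h1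
  rw [runSteps_eq_add_pathSum (real_eq hΦ) f qs, LinearMap.add_apply, Complex.add_re,
    add_sub_cancel_left]
  simpa using h1

/-- The Duhamel expansion is applied twice: after the first acceptance the real continuation is
again compared with the null one, by `abs_real_sub_null_le`, which leaves only terms with two
acceptances. -/
theorem abs_real_sub_firstOrder_le (hΦ : IsTP Φ) (hΦ' : IsCP Φ) {f : Op X →ₗ[ℂ] ℂ} (hf : PosFn f)
    (hf' : SubTr f) (qs : List (Step C M X)) {ρ : Op X} (hρ : ρ.PosSemidef) :
    |(runSteps (real Φ) f qs ρ).re - (firstOrder Φ f qs ρ).re| ≤ 2 * (accTwice Φ qs ρ).re := by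
  have h1 : |(pathSum null (fun q qs => (runSteps (real Φ) f qs - runSteps null f qs) ∘ₗ
      q.excess Φ) qs ρ).re| ≤
      (pathSum null (fun q qs => ((2 : ℂ) • accTotal Φ qs) ∘ₗ q.accepted Φ) qs ρ).re := by
    refine abs_pathSum_le null_cp (fun q qs ρ hρ => ?_) qs hρ
    refine abs_excess_le (g := runSteps (real Φ) f qs - runSteps null f qs)
      (g' := (2 : ℂ) • accTotal Φ qs) hΦ' (fun τ hτ => ?_) q hρ
    have := abs_real_sub_null_le hΦ hΦ' hf hf' qs hτ
    simpa using this
  have h2 : ∀ qs : List (Step C M X),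
      pathSum null (fun q qs => ((2 : ℂ) • accTotal Φ qs) ∘ₗ q.accepted Φ) qs =
        (2 : ℂ) • accTwice Φ qs := by
    intro qs
    simp only [two_smul, LinearMap.add_comp, ← pathSum_add]
    rfl
  rw [h2, LinearMap.smul_apply, smul_eq_mul] at h1
  have h3 : runSteps (real Φ) f qs - firstOrder Φ f qs =
      pathSum null (fun q qs => (runSteps (real Φ) f qs - runSteps null f qs) ∘ₗ
        q.excess Φ) qs := by
    conv_lhs => rw [runSteps_eq_add_pathSum (real_eq hΦ) f qs, firstOrder]
    rw [add_sub_add_left_eq_sub, pathSum_sub]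
    rfl
  rw [← Complex.sub_re, ← LinearMap.sub_apply, h3]
  simpa using h1

end Step

end Steps

/-! ### Bounds on repeated acceptance in a game -/

section DoubleAcceptance

variable {S : QScheme} {B X : Type} [Fintype B] [Fintype X]

/-- `avg` as a linear map. -/
def avgLin (K : Type) [Fintype K] : (K → ℝ) →ₗ[ℝ] ℝ where
  toFun := avg
  map_add' := avg_add
  map_smul' c g := avg_mul c g

/-- The weight of one more acceptance when one has already occurred. Each position is an instance of
`QCABound.double`, with the evolution between the two ciphertexts absorbed into the second attack.
-/
theorem QCABound.accTotal_le {D : Decomposition S} {ε : ℝ} (hQ : QCABound D ε) (hε : 0 ≤ ε)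
    [Nonempty S.C] (hM : 2 ≤ Fintype.card S.M) {Y : Type} [Fintype Y]
    {Λ : Op (S.C × B) →ₗ[ℂ] Op (S.C × Y)} (hΛ : IsCP Λ) (hΛ' : TNI Λ)
    {Γ : Op (S.M × Y) →ₗ[ℂ] Op X} (hΓ : IsCP Γ) (hΓ' : TNI Γ) {ρ : Op (S.M × B)}
    (hρ : ρ.PosSemidef) (qs : List (Step S.C S.M X)) :
    (avg fun k => (Step.accTotal (S.dec k).map qs (Γ (accPath S k Λ ρ))).re) ≤
      qs.length * (20 * ε * ρ.trace.re) := by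
  refine expect_pathSum_le (avgLin S.K) (fun k => accPath S k Λ ρ) (fun Γ => IsCP Γ ∧ TNI Γ)
    (fun Γ q h => ⟨q.null_cp.comp h.1, q.null_tni.comp' h.2 h.1⟩) ?_ le_rfl ⟨hΓ, hΓ'⟩
  intro Γ q _ _ h
  exact hQ.double hε hM hΛ hΛ' (Λ₂ := q.pre ∘ₗ Γ) (q.pre_cp.comp h.1)
    (q.pre_tni.comp' h.2 h.1) hρ

/-- After the first acceptance the game continues with `onAcc` or with `onRej ∘ trL`. Both are
covered by `QCABound.accTotal_le`, so each pair of positions costs `2·20ε`. -/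
theorem QCABound.accTwice_le {D : Decomposition S} {ε : ℝ} (hQ : QCABound D ε) (hε : 0 ≤ ε)
    [Nonempty S.C] (hM : 2 ≤ Fintype.card S.M)
    {Γ : Op (S.C × B) →ₗ[ℂ] Op X} (hΓ : IsCP Γ) (hΓ' : TNI Γ) {ρ : Op (S.M × B)}
    (hρ : ρ.PosSemidef) (qs : List (Step S.C S.M X)) :
    (avg fun k => (Step.accTwice (S.dec k).map qs (Γ (ampl (S.enc k).map B ρ))).re) ≤
      40 * qs.length ^ 2 * ε * ρ.trace.re := by
  have hρ0 := trace_re_nonneg hρ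
  have h : (avg fun k => (Step.accTwice (S.dec k).map qs (Γ (ampl (S.enc k).map B ρ))).re) ≤
      qs.length * (qs.length * (40 * ε * ρ.trace.re)) := by
    refine expect_pathSum_le (avgLin S.K) (fun k => ampl (S.enc k).map B ρ)
      (fun Γ => IsCP Γ ∧ TNI Γ)
      (fun Γ q h => ⟨q.null_cp.comp h.1, q.null_tni.comp' h.2 h.1⟩) ?_ le_rfl ⟨hΓ, hΓ'⟩
    intro Γ q qs' hn h
    have hΛ : IsCP (q.pre ∘ₗ Γ) := q.pre_cp.comp h.1
    have hΛ' : TNI (q.pre ∘ₗ Γ) := q.pre_tni.comp' h.2 h.1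
    have h1 := hQ.accTotal_le hε hM hΛ hΛ' q.onAcc_cp q.onAcc_tni hρ qs'
    have h2 := hQ.accTotal_le hε hM hΛ hΛ' (Γ := q.onRej ∘ₗ trL) (q.onRej_cp.comp trL_cp)
      (q.onRej_tni.comp' (fun Y _ => (congrArg Complex.re (trL_trace Y)).le) trL_cp) hρ qs'
    have h3 : (avg fun k => (Step.accTotal (S.dec k).map qs' (q.accepted (S.dec k).map
        (Γ (ampl (S.enc k).map B ρ)))).re) ≤ 2 * (qs'.length * (20 * ε * ρ.trace.re)) := by
      rw [two_mul]
      refine le_of_eq_of_le ?_ (add_le_add h1 h2)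
      rw [← avg_add]
      congr 1
      funext k
      simp only [Step.accepted, LinearMap.add_apply, map_add, Complex.add_re]
      rfl
    refine h3.trans ?_
    have h4 : (qs'.length : ℝ) ≤ qs.length := by exact_mod_cast hn.le
    have h5 : 0 ≤ 40 * ε * ρ.trace.re := by positivity
    nlinarith
  refine h.trans (le_of_eq ?_)
  ring

end DoubleAcceptance

/-! ### Keeping the plaintext in a slot -/

section Slots

variable {C M X B : Type}

/-- The answer `M` and the second register of the slot `L = (M'', M)` are exchanged. -/
def slotSwap : Op (M × (X × (M × M))) →ₗ[ℂ] Op ((M × X) × (M × M)) :=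
  reix fun p => (p.2.2, (p.1.2, (p.2.1, p.1.1)))

/-- Half of a maximally entangled state in place of the register `M`, which is moved to a slot. -/
def slotIn [Fintype M] [DecidableEq M] (ρ : Op (M × B)) : Op (M × (B × (M × M))) :=
  reix (fun p : M × (B × (M × M)) => ((p.1, p.2.2.1), (p.2.2.2, p.2.1))) (bell M ⊗ₖ ρ)

theorem slotIn_posSemidef [Fintype M] [DecidableEq M] [Fintype B] {ρ : Op (M × B)}
    (hρ : ρ.PosSemidef) : (slotIn ρ).PosSemidef :=
  (reix_cp _).posSemidef (bell_posSemidef.kronecker hρ)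

/-- The reordering of registers in `slotIn`. -/
def slotEquiv (M B : Type) : M × (B × (M × M)) ≃ (M × M) × (M × B) where
  toFun p := ((p.1, p.2.2.1), (p.2.2.2, p.2.1))
  invFun p := (p.1.1, (p.2.2, (p.1.2, p.2.1)))
  left_inv _ := rfl
  right_inv _ := rfl

theorem slotIn_trace [Fintype M] [DecidableEq M] [Nonempty M] [Fintype B] (ρ : Op (M × B)) :
    (slotIn ρ).trace = ρ.trace := by
  have : (slotIn ρ).trace = (bell M ⊗ₖ ρ).trace := reix_trace_equiv (slotEquiv M B) _
  rw [this, trace_kronecker, bell_trace, one_mul]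

/-- `Γ ⊗ id_L` on `C (B L)`. -/
def slotExt (Γ : Op (C × B) →ₗ[ℂ] Op X) (L : Type) : Op (C × (B × L)) →ₗ[ℂ] Op (X × L) :=
  ampl Γ L ∘ₗ reix fun p : (C × B) × L => (p.1.1, (p.1.2, p.2))

theorem slotExt_cp [Fintype C] [Fintype B] {Γ : Op (C × B) →ₗ[ℂ] Op X} (h : IsCP Γ) (L : Type) [Fintype L] :
    IsCP (slotExt Γ L) := (h.ampl L).comp (reix_cp _)

variable [Fintype C] [Fintype M] [Fintype X] [Fintype B]

theorem slotExt_tni {Γ : Op (C × B) →ₗ[ℂ] Op X} (h : TNI Γ) (L : Type) [Fintype L] :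
    TNI (slotExt Γ L) := (h.ampl L).comp' (reix_tp (Equiv.prodAssoc C B L)).tni (reix_cp _)

/-- The exchange of registers in `slotSwap`. -/
def slotSwapEquiv (M X : Type) : (M × X) × (M × M) ≃ M × (X × (M × M)) where
  toFun p := (p.2.2, (p.1.2, (p.2.1, p.1.1)))
  invFun p := ((p.2.2.2, p.2.1), (p.2.2.1, p.1))
  left_inv _ := rfl
  right_inv _ := rfl

/-- The step `q` with a slot: on acceptance, the content of the slot is returned. -/
def Step.mid (q : Step C M X) : Step C M (X × (M × M)) where
  O := ampl q.O (M × M)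
  pre := reix (fun p : C × (X × (M × M)) => ((p.1, p.2.1), p.2.2)) ∘ₗ ampl q.pre (M × M)
  onAcc := ampl q.onAcc (M × M) ∘ₗ slotSwap
  onRej := ampl q.onRej (M × M)
  O_cp := q.O_cp.ampl _
  pre_cp := (reix_cp _).comp (q.pre_cp.ampl _)
  onAcc_cp := (q.onAcc_cp.ampl _).comp (reix_cp _)
  onRej_cp := q.onRej_cp.ampl _
  tni ρ hρ := by
    have h1 : (reix (fun p : C × (X × (M × M)) => ((p.1, p.2.1), p.2.2))
        (ampl q.pre (M × M) ρ)).trace = (ampl q.pre (M × M) ρ).trace :=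
      reix_trace_equiv (Equiv.prodAssoc C X (M × M)).symm _
    rw [LinearMap.comp_apply, h1, ampl_trace, ampl_trace, ← trR_trace ρ]
    exact q.tni _ (trR_cp.posSemidef hρ)
  onAcc_tni := (q.onAcc_tni.ampl _).comp' (reix_tp (slotSwapEquiv M X)).tni (reix_cp _)
  onRej_tni := q.onRej_tni.ampl _

theorem Step.null_mid (q : Step C M X) : q.mid.null = ampl q.null (M × M) := by
  ext1 Y
  have h := ampl_trL (ampl q.pre (M × M) Y)
  simp only [null, mid, ampl_add, ampl_comp, LinearMap.add_apply, LinearMap.comp_apply, h]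

/-- Without acceptance the slot is never touched and may be traced out at the start. -/
theorem Step.runSteps_null_mid (f : Op X →ₗ[ℂ] ℂ) (qs : List (Step C M X)) :
    runSteps null (f ∘ₗ trR) (qs.map mid) = runSteps null f qs ∘ₗ trR := by
  induction qs with
  | nil => rfl
  | cons q qs ih =>
    ext1 Y
    simp only [List.map_cons, runSteps, LinearMap.comp_apply, ih, null_mid, trR_ampl]

/-- Return the content of the slot and discard the rest. -/
def slotOut : Op (M × (X × (M × M))) →ₗ[ℂ] Op (M × X) := trR ∘ₗ slotSwap

/-- If nothing is accepted later, the slot may be forgotten right after an acceptance. Only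
`slotOut` of the accepted branch remains, which is the quantity in `QCABound.slot`. -/
theorem Step.trR_excess_mid (q : Step C M X) (Φ : Op C →ₗ[ℂ] Op (Option M))
    (Y : Op (X × (M × M))) :
    trR (q.mid.excess Φ Y) =
      q.onAcc (slotOut (accE Φ _ (q.mid.pre Y))) -
        q.onRej (trL (slotOut (accE Φ _ (q.mid.pre Y)))) := by
  have h : ∀ Z : Op (M × (X × (M × M))), trR (trL Z) = trL (slotOut Z) := by
    intro Z
    ext i j
    simp only [trR_apply, trL_apply, slotOut, LinearMap.comp_apply, slotSwap, reix_apply,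
      Fintype.sum_prod_type]
    calc ∑ a, ∑ b, ∑ m, Z (m, i, a, b) (m, j, a, b)
        = ∑ b, ∑ a, ∑ m, Z (m, i, a, b) (m, j, a, b) := Finset.sum_comm
      _ = _ := rfl
  rw [excess, LinearMap.sub_apply, map_sub, ← h]
  simp only [mid, LinearMap.comp_apply, trR_ampl, slotOut]

end Slots

/-! ### Ciphertexts hide the plaintext -/

section Hiding

variable {S : QScheme} {B X : Type} [Fintype B] [Fintype X]

theorem measureBot_tp (M : Type) [Fintype M] : IsTP (measureBot M) := by
  intro Y
  simp [measureBot, Matrix.trace]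

theorem QScheme.decMeas_tp (S : QScheme) (k : S.K) : IsTP (S.decMeas k) := fun Y => by
  rw [QScheme.decMeas, LinearMap.comp_apply, measureBot_tp, (S.dec k).tp]

/-- With the answer discarded, the simulator depends only on the reduced state of the side register.
Hiding comes from this. -/
theorem trL_simulator {M b x : Type} [Fintype M] (acc rej : Op b →ₗ[ℂ] Op x) (ρ : Op (M × b)) :
    trL (simulator M acc rej ρ) = acc (trL ρ) + rej (trL ρ) := by
  have h : trL ρ = ∑ m : M, ρ.submatrix (fun i => (m, i)) (fun i => (m, i)) := by
    rw [trL, LinearMap.sum_apply]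
    rfl
  ext i j
  rw [trL_apply, Fintype.sum_option, Matrix.add_apply, add_comm, h, map_sum, Matrix.sum_apply]
  rfl

/-- Ciphertexts do not reveal the plaintext. -/
theorem QCABound.hiding {D : Decomposition S} {ε : ℝ} (hQ : QCABound D ε) (hε : 0 ≤ ε)
    [Nonempty S.C] {Γ : Op (S.C × B) →ₗ[ℂ] Op X} (hΓ : IsCP Γ) (hΓ' : TNI Γ)
    {ρ ρ' : Op (S.M × B)} (hρ : ρ.PosSemidef) (hρ' : ρ'.PosSemidef) (h : trL ρ = trL ρ')
    {f : Op X →ₗ[ℂ] ℂ} (hf : PosFn f) (hf' : SubTr f) :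
    |(avg fun k => (f (Γ (ampl (S.enc k).map B ρ))).re) -
      avg fun k => (f (Γ (ampl (S.enc k).map B ρ'))).re| ≤ 2 * ε * ρ.trace.re := by
  classical
  obtain ⟨c⟩ := ‹Nonempty S.C›
  have : Nonempty S.C := ⟨c⟩
  -- To use QCA on an adversary that never decrypts, its output is kept as side information and a
  -- fixed dummy ciphertext `c` is submitted, whose decryption is ignored.
  set emb : Op X →ₗ[ℂ] Op (S.C × X) := conjL (selMat fun x : X => (c, x))ᴴ with hemb
  have htr : ∀ Y, trL (emb Y) = Y := by
    intro Y
    ext i j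
    simp only [trL_apply, hemb, conjL_apply, Matrix.mul_apply, conjTranspose_apply, selMat,
      of_apply, star_star, Prod.mk.injEq, ite_and]
    simp [apply_ite star]
  have hcp : IsCP emb := conjL_cp _
  have htni : TNI emb := fun Y _ => by rw [← trL_trace, htr]
  obtain ⟨rej, hrej⟩ := hQ.exists_rej hε (hcp.comp hΓ) (htni.comp' hΓ' hΓ)
  set g : Op ((Option S.M × X) × Unit) →ₗ[ℂ] ℂ := f ∘ₗ trL ∘ₗ trR with hg
  have hgp : PosFn g := hf.comp (trL_cp.comp trR_cp)
  have hgs : SubTr g := by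
    intro Z hZ
    refine (hf' _ (trL_cp.posSemidef (trR_cp.posSemidef hZ))).trans (le_of_eq ?_)
    rw [trL_trace, trR_trace]
  have key : ∀ ρ : Op (S.M × B), ρ.PosSemidef →
      |(avg fun k => (f (Γ (ampl (S.enc k).map B ρ))).re) -
        (f (accMap D (emb ∘ₗ Γ) (trL ρ) + rej (trL ρ))).re| ≤ ε * ρ.trace.re := by
    intro ρ hρ
    set ρ₁ : Op ((S.M × B) × Unit) := reix Prod.fst ρ with hρ₁
    have e : trR ρ₁ = ρ := by
      ext i j
      simp [trR_apply, hρ₁]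
    have h1 := hrej Unit ρ₁ ((reix_cp _).posSemidef hρ) g hgp hgs
    have e1 : g (ampl (simulator S.M (accMap D (emb ∘ₗ Γ)) rej) Unit ρ₁) =
        f (accMap D (emb ∘ₗ Γ) (trL ρ) + rej (trL ρ)) := by
      rw [hg, LinearMap.comp_apply, LinearMap.comp_apply, trR_ampl, e, trL_simulator]
    have e2 : (g (ampl (effectiveMap S (emb ∘ₗ Γ)) Unit ρ₁)).re =
        avg fun k => (f (Γ (ampl (S.enc k).map B ρ))).re := by
      rw [hg, LinearMap.comp_apply, LinearMap.comp_apply, trR_ampl, e, effectiveMap,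
        LinearMap.smul_apply, LinearMap.sum_apply, map_smul, map_sum, map_smul, map_sum,
        re_inv_card_smul_sum]
      simp only [LinearMap.comp_apply, trL_ampl (S.decMeas_tp _), htr]
    rw [← trR_trace ρ₁, e] at h1
    have h2 := (Complex.abs_re_le_norm _).trans h1
    rwa [Complex.sub_re, e1, e2] at h2
  have k1 := key ρ hρ
  have k2 := key ρ' hρ'
  rw [← h, ← trL_trace ρ', ← h, trL_trace] at k2
  have := abs_sub_le (avg fun k => (f (Γ (ampl (S.enc k).map B ρ))).re)
    (f (accMap D (emb ∘ₗ Γ) (trL ρ) + rej (trL ρ))).re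
    (avg fun k => (f (Γ (ampl (S.enc k).map B ρ'))).re)
  rw [abs_sub_comm (f (accMap D (emb ∘ₗ Γ) (trL ρ) + rej (trL ρ))).re] at this
  linarith

/-- On acceptance, the plaintext may be kept in a slot while half of a maximally entangled state is
encrypted in its place. -/
theorem QCABound.slot {D : Decomposition S} {ε : ℝ} (hQ : QCABound D ε) (hε : 0 ≤ ε)
    [Nonempty S.C] [Nonempty S.M] {Λ : Op (S.C × B) →ₗ[ℂ] Op (S.C × X)} (hΛ : IsCP Λ)
    (hΛ' : TNI Λ) {ρ : Op (S.M × B)} (hρ : ρ.PosSemidef)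
    {f : Op (S.M × X) →ₗ[ℂ] ℂ} (hf : PosFn f) (hf' : SubTr f) :
    |(avg fun k => (f (accE (S.dec k).map X (Λ (ampl (S.enc k).map B ρ)))).re) -
      avg fun k => (f (slotOut (accE (S.dec k).map (X × (S.M × S.M))
        (reix (fun p : S.C × (X × (S.M × S.M)) => ((p.1, p.2.1), p.2.2))
          (slotExt Λ (S.M × S.M) (ampl (S.enc k).map (B × (S.M × S.M)) (slotIn ρ))))))).re| ≤
      2 * ε * ρ.trace.re := by
  obtain ⟨rej, hrej⟩ := hQ.exists_rej hε hΛ hΛ'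
  -- Both quantities are compared with the simulator's value. When it accepts, it acts on `B` alone,
  -- so it makes no difference whether the returned register was encrypted or stored.
  set u : ℝ := (f (amplR S.M (accMap D Λ) ρ)).re with hu
  have k1 : |(avg fun k => (f (accE (S.dec k).map X (Λ (ampl (S.enc k).map B ρ)))).re) - u| ≤
      ε * ρ.trace.re := by
    set ρ₁ : Op ((S.M × B) × Unit) := reix Prod.fst ρ with hρ₁
    have e : trR ρ₁ = ρ := by
      ext i j
      simp [trR_apply, hρ₁]
    set g : Op ((Option S.M × X) × Unit) →ₗ[ℂ] ℂ := f ∘ₗ trR ∘ₗ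
      reix (Prod.map (Prod.map some id) id) with hg
    have hgp : PosFn g := hf.comp (trR_cp.comp (reix_cp _))
    have hgs : SubTr g := hf'.comp (trR_cp.comp (reix_cp _))
      (TNI.comp' (fun Z _ => (congrArg Complex.re (trR_trace Z)).le) (reix_tni
      (((Option.some_injective _).prodMap Function.injective_id).prodMap Function.injective_id))
      (reix_cp _))
    have h1 := hrej Unit ρ₁ ((reix_cp _).posSemidef hρ) g hgp hgs
    have e1 : (g (ampl (simulator S.M (accMap D Λ) rej) Unit ρ₁)).re = u := by
      rw [hu, hg, LinearMap.comp_apply, LinearMap.comp_apply]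
      congr 2
      ext i j
      rw [trR_apply, Fintype.sum_unique]
      rfl
    have e2 : (g (ampl (effectiveMap S Λ) Unit ρ₁)).re =
        avg fun k => (f (accE (S.dec k).map X (Λ (ampl (S.enc k).map B ρ)))).re := by
      rw [hg, LinearMap.comp_apply, LinearMap.comp_apply, reix_ampl_effectiveMap, map_smul,
        map_smul, map_sum, map_sum, re_inv_card_smul_sum]
      simp only [trR_ampl, e]
      rfl
    rw [← trR_trace ρ₁, e] at h1
    have h2 := (Complex.abs_re_le_norm _).trans h1
    rwa [Complex.sub_re, e1, e2] at h2
  have k2 : |(avg fun k => (f (slotOut (accE (S.dec k).map (X × (S.M × S.M))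
        (reix (fun p : S.C × (X × (S.M × S.M)) => ((p.1, p.2.1), p.2.2))
          (slotExt Λ (S.M × S.M) (ampl (S.enc k).map (B × (S.M × S.M)) (slotIn ρ))))))).re) - u| ≤
      ε * ρ.trace.re := by
    set ρ₁ : Op ((S.M × B) × (S.M × S.M)) :=
      reix (fun p => (p.1.1, (p.1.2, p.2))) (slotIn ρ) with hρ₁
    have ht : ρ₁.trace = ρ.trace := by
      rw [← slotIn_trace ρ]
      exact reix_trace_equiv (Equiv.prodAssoc _ _ _) _
    set g : Op ((Option S.M × X) × (S.M × S.M)) →ₗ[ℂ] ℂ := f ∘ₗ trR ∘ₗ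
      reix (fun p : (S.M × X) × (S.M × S.M) => ((some p.2.2, p.1.2), (p.2.1, p.1.1))) with hg
    have hgp : PosFn g := hf.comp (trR_cp.comp (reix_cp _))
    have hgs : SubTr g := hf'.comp (trR_cp.comp (reix_cp _))
      (TNI.comp' (fun Z _ => (congrArg Complex.re (trR_trace Z)).le) (reix_tni (by
        rintro ⟨⟨m, x⟩, a, b⟩ ⟨⟨m', x'⟩, a', b'⟩ h
        simp only [Prod.mk.injEq, Option.some.injEq] at h
        obtain ⟨⟨rfl, rfl⟩, rfl, rfl⟩ := h
        rfl)) (reix_cp _))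
    have h1 := hrej (S.M × S.M) ρ₁ ((reix_cp _).posSemidef (slotIn_posSemidef hρ)) g hgp hgs
    have e1 : (g (ampl (simulator S.M (accMap D Λ) rej) (S.M × S.M) ρ₁)).re = u := by
      rw [hu, hg, LinearMap.comp_apply, LinearMap.comp_apply]
      congr 2
      ext i j
      rw [trR_apply]
      have e3 : ∀ y : S.M × S.M, (ρ₁.submatrix (fun z => (z, (y.1, i.1)))
          fun z => (z, (y.1, j.1))).submatrix (fun z => (y.2, z)) (fun z => (y.2, z)) =
          bell S.M (y.2, y.1) (y.2, y.1) •
            ρ.submatrix (fun z => (i.1, z)) (fun z => (j.1, z)) := fun y => rfl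
      have e4 : ∀ y : S.M × S.M, reix (fun p : (S.M × X) × (S.M × S.M) =>
          ((some p.2.2, p.1.2), (p.2.1, p.1.1)))
          (ampl (simulator S.M (accMap D Λ) rej) (S.M × S.M) ρ₁) (i, y) (j, y) =
          bell S.M (y.2, y.1) (y.2, y.1) * amplR S.M (accMap D Λ) ρ i j := by
        intro y
        change accMap D Λ ((ρ₁.submatrix (fun z => (z, (y.1, i.1)))
          fun z => (z, (y.1, j.1))).submatrix (fun z => (y.2, z)) (fun z => (y.2, z))) i.2 j.2 = _
        rw [e3, map_smul]
        rfl
      -- The encrypted half of `φ⁺` and its partner are discarded; together they have weight one.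
      have e5 : ∑ y : S.M × S.M, bell S.M (y.2, y.1) (y.2, y.1) = 1 := by
        rw [← bell_trace (M := S.M)]
        exact Equiv.sum_comp (Equiv.prodComm S.M S.M) fun y => bell S.M y y
      simp only [e4, ← Finset.sum_mul, e5, one_mul]
    have e2 : (g (ampl (effectiveMap S Λ) (S.M × S.M) ρ₁)).re =
        avg fun k => (f (slotOut (accE (S.dec k).map (X × (S.M × S.M))
        (reix (fun p : S.C × (X × (S.M × S.M)) => ((p.1, p.2.1), p.2.2))
          (slotExt Λ (S.M × S.M)
            (ampl (S.enc k).map (B × (S.M × S.M)) (slotIn ρ))))))).re := by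
      have e3 : reix (fun p : (S.M × X) × (S.M × S.M) =>
          ((some p.2.2, p.1.2), (p.2.1, p.1.1))) (ampl (effectiveMap S Λ) (S.M × S.M) ρ₁) =
          reix (fun p : (S.M × X) × (S.M × S.M) => ((p.2.2, p.1.2), (p.2.1, p.1.1)))
          ((Fintype.card S.K : ℂ)⁻¹ • ∑ k, ampl (accPath S k Λ) (S.M × S.M) ρ₁) := by
        rw [← reix_ampl_effectiveMap]
        rfl
      rw [hg, LinearMap.comp_apply, LinearMap.comp_apply, e3, map_smul,
        map_smul, map_smul, map_sum, map_sum, map_sum, re_inv_card_smul_sum]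
      rfl
    rw [ht] at h1
    have h2 := (Complex.abs_re_le_norm _).trans h1
    rwa [Complex.sub_re, e1, e2] at h2
  refine (abs_sub_le _ u _).trans ?_
  rw [abs_sub_comm u]
  linarith

end Hiding

/-! ### First-order agreement of the games with and without a slot -/

section FirstOrder

variable {S : QScheme} {B X : Type} [Fintype B] [Fintype X]

/-- To first order in the number of acceptances, the game with a slot does not differ from the game
without. -/
theorem QCABound.firstOrder_mid {D : Decomposition S} {ε : ℝ} (hQ : QCABound D ε) (hε : 0 ≤ ε)
    [Nonempty S.C] [Nonempty S.M] {Γ : Op (S.C × B) →ₗ[ℂ] Op X} (hΓ : IsCP Γ)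
    (hΓ' : TNI Γ) {ρ : Op (S.M × B)} (hρ : ρ.PosSemidef)
    {f : Op X →ₗ[ℂ] ℂ} (hf : PosFn f) (hf' : SubTr f) (qs : List (Step S.C S.M X)) :
    |(avg fun k => (Step.firstOrder (S.dec k).map f qs (Γ (ampl (S.enc k).map B ρ))).re) -
      avg fun k => (Step.firstOrder (S.dec k).map (f ∘ₗ trR) (qs.map Step.mid)
        (slotExt Γ (S.M × S.M) (ampl (S.enc k).map (B × (S.M × S.M)) (slotIn ρ)))).re| ≤
      (2 + 4 * qs.length) * ε * ρ.trace.re := by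
  have hnull : ∀ qs : List (Step S.C S.M X), PosFn (runSteps Step.null f qs) :=
    runSteps_pos Step.null_cp hf
  have hnull' : ∀ qs : List (Step S.C S.M X), SubTr (runSteps Step.null f qs) :=
    runSteps_subTr Step.null_cp Step.null_tni hf'
  set L := S.M × S.M with hL
  have term : ∀ (Γ : Op (S.C × B) →ₗ[ℂ] Op X), IsCP Γ → TNI Γ →
      ∀ (q : Step S.C S.M X) (qs : List (Step S.C S.M X)),
      |(avg fun k => (runSteps Step.null f qs (q.excess (S.dec k).map
        (Γ (ampl (S.enc k).map B ρ)))).re) -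
      avg fun k => (runSteps Step.null (f ∘ₗ trR) (qs.map Step.mid)
        (q.mid.excess (S.dec k).map
          (slotExt Γ L (ampl (S.enc k).map (B × L) (slotIn ρ))))).re| ≤ 4 * ε * ρ.trace.re := by
    intro Γ hΓ hΓ' q qs
    have hΛ : IsCP (q.pre ∘ₗ Γ) := q.pre_cp.comp hΓ
    have hΛ' : TNI (q.pre ∘ₗ Γ) := q.pre_tni.comp' hΓ' hΓ
    -- The excess is the difference of a continuation with the answer and one with the answer
    -- discarded. Each is covered by `QCABound.slot` with error `2ε`, which gives `4ε` for each
    -- position.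
    have h1 := hQ.slot hε hΛ hΛ' hρ (f := runSteps Step.null f qs ∘ₗ q.onAcc)
      ((hnull qs).comp q.onAcc_cp) ((hnull' qs).comp q.onAcc_cp q.onAcc_tni)
    have h2 := hQ.slot hε hΛ hΛ' hρ (f := runSteps Step.null f qs ∘ₗ q.onRej ∘ₗ trL)
      ((hnull qs).comp (q.onRej_cp.comp trL_cp)) ((hnull' qs).comp (q.onRej_cp.comp trL_cp)
        (q.onRej_tni.comp' (fun Y _ => (congrArg Complex.re (trL_trace Y)).le) trL_cp))
    simp only [Step.runSteps_null_mid, LinearMap.comp_apply, Step.trR_excess_mid, map_sub,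
      Complex.sub_re, avg_sub] at *
    refine le_trans (le_of_eq_of_le ?_ (abs_sub _ _)) ((add_le_add h1 h2).trans (le_of_eq (by ring)))
    congr 1
    simp only [Step.excess, LinearMap.sub_apply, map_sub, Complex.sub_re, avg_sub]
    have e : ∀ k, q.mid.pre (slotExt Γ L (ampl (S.enc k).map (B × L) (slotIn ρ))) =
        reix (fun p : S.C × (X × (S.M × S.M)) => ((p.1, p.2.1), p.2.2))
          (slotExt (q.pre ∘ₗ Γ) (S.M × S.M)
            (ampl (S.enc k).map (B × (S.M × S.M)) (slotIn ρ))) := fun k => rfl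
    simp only [e, LinearMap.comp_apply]
    ring
  have paths : ∀ (qs : List (Step S.C S.M X)) (Γ : Op (S.C × B) →ₗ[ℂ] Op X), IsCP Γ → TNI Γ →
      |(avg fun k => (pathSum Step.null (fun q qs => runSteps Step.null f qs ∘ₗ
        q.excess (S.dec k).map) qs (Γ (ampl (S.enc k).map B ρ))).re) -
      avg fun k => (pathSum Step.null (fun q qs => runSteps Step.null (f ∘ₗ trR) qs ∘ₗ
        q.excess (S.dec k).map) (qs.map Step.mid)
          (slotExt Γ L (ampl (S.enc k).map (B × L) (slotIn ρ)))).re| ≤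
        qs.length * (4 * ε * ρ.trace.re) := by
    intro qs
    induction qs with
    | nil =>
      intro Γ _ _
      simp [pathSum]
    | cons q qs ih =>
      intro Γ hΓ hΓ'
      have h1 := term Γ hΓ hΓ' q qs
      have h2 := ih (q.null ∘ₗ Γ) (q.null_cp.comp hΓ) (q.null_tni.comp' hΓ' hΓ)
      have e : ∀ k, q.mid.null (slotExt Γ L (ampl (S.enc k).map (B × L) (slotIn ρ))) =
          slotExt (q.null ∘ₗ Γ) L (ampl (S.enc k).map (B × L) (slotIn ρ)) := fun k => by
        rw [Step.null_mid]
        rfl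
      simp only [List.map_cons, pathSum, LinearMap.add_apply, LinearMap.comp_apply,
        Complex.add_re, avg_add, e]
      rw [add_sub_add_comm, List.length_cons, Nat.cast_succ, add_mul, one_mul, add_comm (_ * _)]
      exact (abs_add_le _ _).trans (add_le_add h1 h2)
  have main : |(avg fun k => (runSteps Step.null f qs (Γ (ampl (S.enc k).map B ρ))).re) -
      avg fun k => (runSteps Step.null (f ∘ₗ trR) (qs.map Step.mid)
        (slotExt Γ L (ampl (S.enc k).map (B × L) (slotIn ρ)))).re| ≤ 2 * ε * ρ.trace.re := by
    -- Without acceptance only the ciphertext matters. With the slot forgotten, half of `φ⁺` is a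
    -- maximally mixed plaintext next to an unchanged side register, so `QCABound.hiding` applies.
    set ρ' : Op (S.M × B) := trR (reix (fun p : (S.M × B) × L => (p.1.1, (p.1.2, p.2))) (slotIn ρ))
      with hρ'
    have h1 : ρ'.PosSemidef := trR_cp.posSemidef ((reix_cp _).posSemidef (slotIn_posSemidef hρ))
    have h2 : trL ρ = trL ρ' := by
      ext i j
      have e : ∀ x : S.M, ∑ y : L, bell S.M (x, y.1) (x, y.1) * ρ (y.2, i) (y.2, j) =
          (∑ a : S.M, bell S.M (x, a) (x, a)) * ∑ m, ρ (m, i) (m, j) := fun x => by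
        rw [Finset.sum_mul_sum]
        exact Fintype.sum_prod_type _
      have e' : ∑ x : S.M, ∑ a : S.M, bell S.M (x, a) (x, a) = 1 := by
        rw [← bell_trace (M := S.M), Matrix.trace, Fintype.sum_prod_type]
        rfl
      simp only [trL_apply, hρ', trR_apply, reix_apply, slotIn, kroneckerMap_apply, e, ← Finset.sum_mul, e', one_mul]
    refine le_of_eq_of_le ?_ (hQ.hiding hε hΓ hΓ' hρ h1 h2 (hnull qs) (hnull' qs))
    congr 3
    funext k
    have e : ampl (S.enc k).map B ρ' = trR (reix (fun p : (S.C × B) × L => (p.1.1, (p.1.2, p.2)))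
        (ampl (S.enc k).map (B × L) (slotIn ρ))) := by
      rw [hρ', ← trR_ampl]
      rfl
    rw [Step.runSteps_null_mid, LinearMap.comp_apply, slotExt, LinearMap.comp_apply, trR_ampl, e]
  have h1 := paths qs Γ hΓ hΓ'
  simp only [Step.firstOrder, LinearMap.add_apply, Complex.add_re, avg_add]
  rw [add_sub_add_comm]
  refine (abs_add_le _ _).trans ((add_le_add main h1).trans (le_of_eq ?_))
  ring

end FirstOrder

/-! ### Operations on the ciphertext and the first register of the slot -/

section ActCM

variable {C M X : Type}

/-- The ciphertext and the first register of the slot, separated from the other registers. -/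
def cmEquiv (C M X : Type) : C × (X × (M × M)) ≃ (X × M) × (C × M) where
  toFun p := ((p.2.1, p.2.2.2), (p.1, p.2.2.1))
  invFun p := (p.2.1, (p.1.1, (p.2.2, p.1.2)))
  left_inv _ := rfl
  right_inv _ := rfl

/-- Trace out all but the ciphertext and the first register of the slot. -/
def redCM [Fintype M] [Fintype X] : Op (C × (X × (M × M))) →ₗ[ℂ] Op (C × M) :=
  trL ∘ₗ reix (cmEquiv C M X).symm

/-- Conjugation by `K` on the ciphertext and the first register of the slot. -/
def actCM [Fintype C] [Fintype M] (K : Op (C × M)) :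
    Op (C × (X × (M × M))) →ₗ[ℂ] Op (C × (X × (M × M))) :=
  reix (cmEquiv C M X) ∘ₗ amplR (X × M) (conjL K) ∘ₗ reix (cmEquiv C M X).symm

theorem trL_amplR {a b r : Type} [Fintype r] (Φ : Op a →ₗ[ℂ] Op b) (Y : Op (r × a)) :
    trL (amplR r Φ Y) = Φ (trL Y) := by
  have h : trL Y = ∑ x : r, Y.submatrix (fun i => (x, i)) (fun i => (x, i)) := by
    rw [trL, LinearMap.sum_apply]
    rfl
  ext i j
  rw [trL_apply, h, map_sum, Matrix.sum_apply]
  rfl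

variable [Fintype C] [Fintype M] [Fintype X]

theorem redCM_cp : IsCP (redCM : Op (C × (X × (M × M))) →ₗ[ℂ] Op (C × M)) :=
  trL_cp.comp (reix_cp _)

theorem redCM_trace (Y : Op (C × (X × (M × M)))) : (redCM Y).trace = Y.trace := by
  rw [redCM, LinearMap.comp_apply, trL_trace, reix_trace_equiv]

theorem actCM_cp (K : Op (C × M)) :
    IsCP (actCM K : Op (C × (X × (M × M))) →ₗ[ℂ] Op (C × (X × (M × M)))) :=
  (reix_cp _).comp (((conjL_cp K).amplR _).comp (reix_cp _))

theorem redCM_actCM (K : Op (C × M)) (Y : Op (C × (X × (M × M)))) :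
    redCM (actCM K Y) = conjL K (redCM Y) := by
  rw [redCM, LinearMap.comp_apply, LinearMap.comp_apply, ← trL_amplR]
  rfl

theorem accE_redCM_trace (Φ : Op C →ₗ[ℂ] Op (Option M)) (Y : Op (C × (X × (M × M)))) :
    (accE Φ M (redCM Y)).trace = (accE Φ _ Y).trace := by
  rw [accE_trace, accE_trace]
  congr 3
  ext i j
  simp only [trR_apply, redCM, LinearMap.comp_apply, trL_apply, reix_apply, Fintype.sum_prod_type,
    cmEquiv, Equiv.coe_fn_symm_mk]
  rw [Finset.sum_comm]

theorem rejE_redCM_trace {Φ : Op C →ₗ[ℂ] Op (Option M)} (h : IsTP Φ)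
    (Y : Op (C × (X × (M × M)))) : (rejE Φ M (redCM Y)).trace = (rejE Φ _ Y).trace := by
  have h1 := accE_trace_add h (redCM Y)
  have h2 := accE_trace_add h Y
  rw [redCM_trace, ← h2, accE_redCM_trace] at h1
  exact add_left_cancel h1

theorem PosFn.abs_sub_actCM_le [DecidableEq C] [DecidableEq M]
    {g : Op (C × (X × (M × M))) →ₗ[ℂ] ℂ} (hg : PosFn g)
    {Y : Op (C × (X × (M × M)))} (hY : Y.PosSemidef) (K : Op (C × M)) {η : ℝ} (hη : 0 < η) :
    |(g Y).re - (g (actCM K Y)).re| ≤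
      η * (g (actCM K Y)).re + (1 + η⁻¹) * (g (actCM (1 - K) Y)).re := by
  classical
  have h := (hg.comp (reix_cp (cmEquiv C M X))).abs_sub_pinch_le
    ((reix_cp (cmEquiv C M X).symm).posSemidef hY) ((1 : Op (X × M)) ⊗ₖ K) hη
  have e : (1 : Op ((X × M) × (C × M))) - (1 : Op (X × M)) ⊗ₖ K = (1 : Op (X × M)) ⊗ₖ (1 - K) := by
    ext i j
    rw [Matrix.sub_apply, ← Matrix.one_kronecker_one]
    simp [mul_sub]
  rw [e, ← amplR_conjL, ← amplR_conjL] at h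
  exact h

end ActCM

/-! ### The ideal decryption step -/

section IdealStep

variable {S : QScheme} (D : Decomposition S) {X : Type}

/-- The result of the test of the ciphertext with the first register of the slot when it succeeds;
the content of the slot is returned. -/
def Decomposition.idealAcc (k : S.K) (r : D.T) (X : Type) :
    Op (S.C × (X × (S.M × S.M))) →ₗ[ℂ] Op (S.M × X) :=
  sandwich (D.phiVec k r) (S.M × X) ∘ₗ
    reix fun p : (S.C × (S.M × X)) × S.M => (p.1.1, (p.1.2.2, (p.2, p.1.2.1)))

/-- The test has rank one, so success leaves a product: the tested registers in a fixed state and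
everything else in `idealAcc`. -/
theorem Decomposition.actCM_encBell (k : S.K) (r : D.T) (Y : Op (S.C × (X × (S.M × S.M)))) :
    actCM (D.encBell k r) Y =
      reix (fun p : S.C × (X × (S.M × S.M)) => ((p.1, p.2.2.1), (p.2.2.2, p.2.1)))
        (D.encBell k r ⊗ₖ D.idealAcc k r X Y) := by
  ext p q
  rw [actCM, LinearMap.comp_apply, LinearMap.comp_apply, reix_apply, amplR_apply, D.encBell_eq,
    conjL_vecMulVec_apply, Matrix.smul_apply, smul_eq_mul, mul_comm, reix_apply,
    kroneckerMap_apply]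
  congr 1
  simp only [dotProduct, mulVec, Decomposition.idealAcc, LinearMap.comp_apply, sandwich,
    LinearMap.coe_mk, AddHom.coe_mk, of_apply, Finset.mul_sum, Pi.star_apply, ← mul_assoc]
  rfl

variable [Fintype X]

theorem Decomposition.idealAcc_cp (k : S.K) (r : D.T) : IsCP (D.idealAcc k r X) := by
  have h : sandwich (D.phiVec k r) (S.M × X) = reix (fun b => (b, ())) ∘ₗ
      amplR (S.M × X) (conjL (Matrix.of fun (_ : Unit) p => star (D.phiVec k r p))) ∘ₗ
      reix (fun p : (S.M × X) × (S.C × S.M) => ((p.2.1, p.1), p.2.2)) := by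
    ext Y b b'
    simp only [sandwich, LinearMap.coe_mk, AddHom.coe_mk, of_apply, LinearMap.comp_apply,
      reix_apply, amplR_apply, conjL_apply, Matrix.mul_apply, conjTranspose_apply, star_star,
      submatrix_apply, Finset.sum_mul]
    exact Finset.sum_comm
  rw [Decomposition.idealAcc, h]
  exact ((reix_cp _).comp (((conjL_cp _).amplR _).comp (reix_cp _))).comp (reix_cp _)

theorem Decomposition.idealAcc_trace [Nonempty S.M] (k : S.K) (r : D.T)
    (Y : Op (S.C × (X × (S.M × S.M)))) :
    (D.idealAcc k r X Y).trace = (conjL (D.encBell k r) (redCM Y)).trace := by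
  rw [← redCM_actCM, redCM_trace, D.actCM_encBell]
  have h : (reix (fun p : S.C × (X × (S.M × S.M)) => ((p.1, p.2.2.1), (p.2.2.2, p.2.1)))
        (D.encBell k r ⊗ₖ D.idealAcc k r X Y)).trace =
        (D.encBell k r ⊗ₖ D.idealAcc k r X Y).trace :=
    reix_trace_equiv (⟨fun p => ((p.1, p.2.2.1), (p.2.2.2, p.2.1)),
      fun p => (p.1.1, (p.2.2, (p.1.2, p.2.1))), fun _ => rfl, fun _ => rfl⟩ :
      S.C × (X × (S.M × S.M)) ≃ (S.C × S.M) × (S.M × X)) _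
  rw [h, trace_kronecker, D.encBell_trace, one_mul]

/-- Put a maximally entangled state into the slot. -/
def attachBell (M X : Type) [Fintype M] [DecidableEq M] : Op X →ₗ[ℂ] Op (X × (M × M)) where
  toFun Z := Z ⊗ₖ bell M
  map_add' Y Z := by rw [add_kronecker]
  map_smul' c Z := by rw [smul_kronecker]; rfl

theorem attachBell_apply {M Y : Type} [Fintype M] [DecidableEq M] (Z : Op Y) :
    attachBell M Y Z = Z ⊗ₖ bell M := rfl

theorem attachBell_cp {M : Type} [Fintype M] [DecidableEq M] : IsCP (attachBell M X) := by
  classical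
  refine ⟨Unit, inferInstance, fun _ => Matrix.of fun p x =>
    if p.1 = x then bellVec M p.2 else 0, fun Y => ?_⟩
  ext p q
  simp [Matrix.mul_apply, attachBell_apply, bell, vecMulVec_apply, apply_ite star]
  ring

/-- The ideal step: the ciphertext is tested with the first register of the slot. -/
def Step.ideal (k : S.K) (r : D.T) (q : Step S.C S.M X) :
    Op (X × (S.M × S.M)) →ₗ[ℂ] Op (X × (S.M × S.M)) :=
  -- On success the slot is refilled with `φ⁺`: in the ideal oracle `M'` and `M''` are then in the
  -- state `φ⁺`, and `M'` takes the place of the returned register.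
  q.mid.O + attachBell S.M X ∘ₗ q.onAcc ∘ₗ D.idealAcc k r X ∘ₗ q.mid.pre +
    q.mid.onRej ∘ₗ trL ∘ₗ actCM (1 - D.encBell k r) ∘ₗ q.mid.pre

theorem Step.ideal_cp (k : S.K) (r : D.T) (q : Step S.C S.M X) : IsCP (q.ideal D k r) :=
  (q.mid.O_cp.add (attachBell_cp.comp (q.onAcc_cp.comp ((D.idealAcc_cp k r).comp
    q.mid.pre_cp)))).add (q.mid.onRej_cp.comp (trL_cp.comp ((actCM_cp _).comp q.mid.pre_cp)))

theorem Decomposition.ideal_trace_add [Nonempty S.M] (k : S.K) (r : D.T)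
    (Y : Op (S.C × (X × (S.M × S.M)))) :
    (D.idealAcc k r X Y).trace.re + (actCM (1 - D.encBell k r) Y).trace.re = Y.trace.re := by
  rw [D.idealAcc_trace, ← redCM_trace (actCM _ Y), redCM_actCM, conjL_trace_add_of_proj
    (D.encBell_mul_self k r) (D.encBell_conjTranspose k r), redCM_trace]

theorem Step.ideal_tni [Nonempty S.M] (k : S.K) (r : D.T) (q : Step S.C S.M X) :
    TNI (q.ideal D k r) := by
  intro ρ hρ
  have hp := q.mid.pre_cp.posSemidef hρ
  have h1 := q.onAcc_tni _ ((D.idealAcc_cp k r).posSemidef hp)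
  have h2 := q.mid.onRej_tni _ (trL_cp.posSemidef
    ((actCM_cp (1 - D.encBell k r)).posSemidef hp))
  rw [trL_trace] at h2
  have h3 := q.mid.tni ρ hρ
  have h4 := D.ideal_trace_add k r (q.mid.pre ρ)
  simp only [ideal, LinearMap.add_apply, Matrix.trace_add, Complex.add_re, LinearMap.comp_apply,
    attachBell_apply, trace_kronecker, bell_trace, mul_one]
  linarith

/-- A functional on a nearly maximally entangled state. -/
theorem PosFn.abs_sub_bell_le {M : Type} [Fintype M] [DecidableEq M] [Nonempty M]
    {h : Op (M × M) →ₗ[ℂ] ℂ} (hh : PosFn h) {t : ℝ}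
    (ht : ∀ Z : Op (M × M), Z.PosSemidef → (h Z).re ≤ t * Z.trace.re) {τ : Op (M × M)}
    (hτ : τ.PosSemidef) (hτ1 : τ.trace.re ≤ 1) {η : ℝ} (hη : 0 < η) (hη1 : η ≤ 1) :
    |(h τ).re - (h (bell M)).re| ≤ (η + 3 * η⁻¹ * (1 - (conjL (bell M) τ).trace.re)) * t := by
  set c := 1 - (conjL (bell M) τ).trace.re with hc
  have h1 := hh.abs_sub_pinch_le hτ (bell M) hη
  have hsum := conjL_trace_add_of_proj bell_mul_self (bell_conjTranspose (M := M)) τ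
  have hp1 := trace_re_nonneg ((conjL_cp (bell M)).posSemidef hτ)
  have hp2 := trace_re_nonneg ((conjL_cp (1 - bell M)).posSemidef hτ)
  have hb := ht _ (bell_posSemidef (M := M))
  rw [bell_trace, Complex.one_re, mul_one] at hb
  have hb0 := hh.re_nonneg (bell_posSemidef (M := M))
  -- The projected part is a multiple of `φ⁺`, where `c` is the weight by which `τ` falls short of
  -- passing the test.
  have e : conjL (bell M) τ = ((1 - c : ℝ) : ℂ) • bell M := by
    have e1 := conjL_bell_apply τ
    set z := star (bellVec M) ⬝ᵥ τ *ᵥ bellVec M with hz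
    have e2 : (conjL (bell M) τ).trace = z := by
      rw [e1, Matrix.trace_smul, bell_trace, smul_eq_mul, mul_one]
    have e3 : z = (z.re : ℂ) := by
      refine Complex.ext rfl ?_
      rw [← e2]
      simpa using (Complex.le_def.mp ((conjL_cp (bell M)).posSemidef hτ).trace_nonneg).2.symm
    rw [e1, hc, sub_sub_cancel, e2, ← e3]
  have e4 : (h (conjL (bell M) τ)).re = (1 - c) * (h (bell M)).re := by
    rw [e, map_smul, smul_eq_mul, Complex.re_ofReal_mul]
  have h2 := ht _ ((conjL_cp (1 - bell M)).posSemidef hτ)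
  have h2' := ht _ ((conjL_cp (bell M)).posSemidef hτ)
  have hc0 : 0 ≤ c := by linarith
  have ht0 : 0 ≤ t := hb0.trans hb
  have h3 : (h (conjL (1 - bell M) τ)).re ≤ t * c :=
    h2.trans (mul_le_mul_of_nonneg_left (by linarith) ht0)
  have h3' : (h (conjL (bell M) τ)).re ≤ t * 1 :=
    h2'.trans (mul_le_mul_of_nonneg_left (by linarith) ht0)
  have h4 : |(h (conjL (bell M) τ)).re - (h (bell M)).re| ≤ c * t := by
    rw [e4, show (1 - c) * (h (bell M)).re - (h (bell M)).re = -(c * (h (bell M)).re) by ring,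
      abs_neg, abs_of_nonneg (mul_nonneg hc0 hb0)]
    exact mul_le_mul_of_nonneg_left hb hc0
  have hη' : 1 ≤ η⁻¹ := (one_le_inv₀ hη).mpr hη1
  have h5 := mul_le_mul_of_nonneg_left h3' hη.le
  have h6 := mul_le_mul_of_nonneg_left h3 (show 0 ≤ 1 + η⁻¹ by positivity)
  have h7 : c * t ≤ η⁻¹ * (c * t) := le_mul_of_one_le_left (mul_nonneg hc0 ht0) hη'
  refine (abs_sub_le _ (h (conjL (bell M) τ)).re _).trans ?_
  nlinarith

set_option maxHeartbeats 1000000 in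
/-- The ideal step is close to the step with a slot. -/
theorem Step.abs_mid_sub_ideal_le [Nonempty S.M] (k : S.K) (r : D.T) (q : Step S.C S.M X)
    {f : Op (X × (S.M × S.M)) →ₗ[ℂ] ℂ} (hf : PosFn f) (hf' : SubTr f)
    {ρ : Op (X × (S.M × S.M))} (hρ : ρ.PosSemidef) {η : ℝ} (hη : 0 < η) (hη1 : η ≤ 1) :
    |(f (q.ideal D k r ρ)).re - (f (q.mid.real (S.dec k).map ρ)).re| ≤
      (3 * η + 5 * η⁻¹ * D.defect k r) * ρ.trace.re +
        3 * η⁻¹ * (D.bad k r (redCM (q.mid.pre ρ))).re := by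
  set Y := q.mid.pre ρ with hYdef
  have hY : Y.PosSemidef := q.mid.pre_cp.posSemidef hρ
  have hYt : Y.trace.re ≤ ρ.trace.re := q.mid.pre_tni ρ hρ
  set P := D.encBell k r with hP
  set c := D.defect k r with hc
  have hc0 : 0 ≤ c := D.defect_nonneg k r
  set Φ := (S.dec k).map with hΦ
  have hcp := (S.dec k).cp
  have htp := (S.dec k).tp
  set bad := (D.bad k r (redCM Y)).re with hbad
  have hbad_eq : bad = (accE Φ _ (actCM (1 - P) Y)).trace.re := by
    rw [hbad, ← accE_redCM_trace, redCM_actCM]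
    rfl
  have hPY : (actCM P Y).PosSemidef := (actCM_cp P).posSemidef hY
  have hPY' : (actCM (1 - P) Y).PosSemidef := (actCM_cp (1 - P)).posSemidef hY
  have hsum : (actCM P Y).trace.re + (actCM (1 - P) Y).trace.re = Y.trace.re := by
    rw [← redCM_trace, ← redCM_trace (actCM (1 - P) Y), redCM_actCM, redCM_actCM,
      conjL_trace_add_of_proj (D.encBell_mul_self k r) (D.encBell_conjTranspose k r), redCM_trace]
  have hPt := trace_re_nonneg hPY
  have hPt' := trace_re_nonneg hPY'
  set ω := D.idealAcc k r X Y with hω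
  have hωp : ω.PosSemidef := (D.idealAcc_cp k r).posSemidef hY
  have hωt : ω.trace.re = (actCM P Y).trace.re := by
    rw [hω, D.idealAcc_trace, ← redCM_actCM, redCM_trace]
  -- the accepting branch
  set g₁ : Op (S.C × (X × (S.M × S.M))) →ₗ[ℂ] ℂ := f ∘ₗ q.mid.onAcc ∘ₗ accE Φ _ with hg₁
  have hg₁p : PosFn g₁ := hf.comp (q.mid.onAcc_cp.comp (accE_cp hcp _))
  have hg₁t : ∀ Z, Z.PosSemidef → (g₁ Z).re ≤ (accE Φ _ Z).trace.re := fun Z hZ =>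
    (hf' _ (q.mid.onAcc_cp.posSemidef ((accE_cp hcp _).posSemidef hZ))).trans
      (q.mid.onAcc_tni _ ((accE_cp hcp _).posSemidef hZ))
  have a1 := hg₁p.abs_sub_actCM_le hY P hη
  have a2 : (g₁ (actCM P Y)).re ≤ ρ.trace.re := by
    have := hg₁t _ hPY
    have := accE_tni (E := X × (S.M × S.M)) htp hcp _ hPY
    linarith
  have a3 : (g₁ (actCM (1 - P) Y)).re ≤ bad := by
    rw [hbad_eq]
    exact hg₁t _ hPY'
  have a4 : |(g₁ (actCM P Y)).re - (f (attachBell S.M X (q.onAcc ω))).re| ≤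
      (η + 3 * η⁻¹ * c) * ρ.trace.re := by
    set τ := accE Φ S.M P with hτ
    have hτp : τ.PosSemidef := (accE_cp hcp _).posSemidef (D.encBell_posSemidef k r)
    have hτ1 : τ.trace.re ≤ 1 := by
      have := accE_tni (E := S.M) htp hcp _ (D.encBell_posSemidef k r)
      rwa [D.encBell_trace, Complex.one_re] at this
    have hN : (q.onAcc ω).PosSemidef := q.onAcc_cp.posSemidef hωp
    -- After a successful test the ciphertext and its partner are in the state `P`, and decryption
    -- turns them into `τ`, which is `φ⁺` up to the defect. The functional `h` evaluates the game
    -- with a given pair in the slot, so that `τ` can be exchanged for the fresh `φ⁺` of the ideal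
    -- step.
    set h : Op (S.M × S.M) →ₗ[ℂ] ℂ :=
      { toFun := fun Z => f (q.onAcc ω ⊗ₖ reix Prod.swap Z)
        map_add' := fun Z Z' => by rw [map_add, kronecker_add, map_add]
        map_smul' := fun z Z => by rw [map_smul, kronecker_smul, map_smul]; rfl } with hh
    have hhp : PosFn h := fun Z hZ => hf _ (hN.kronecker ((reix_cp _).posSemidef hZ))
    have hht : ∀ Z : Op (S.M × S.M), Z.PosSemidef → (h Z).re ≤ ρ.trace.re * Z.trace.re := by
      intro Z hZ
      have e1 := hf' _ (hN.kronecker ((reix_cp (Prod.swap (α := S.M) (β := S.M))).posSemidef hZ))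
      have e2 : (reix (Prod.swap (α := S.M) (β := S.M)) Z).trace = Z.trace :=
        reix_trace_equiv (Equiv.prodComm S.M S.M) Z
      have e3 := q.onAcc_tni _ hωp
      have e4 : (q.onAcc ω).trace = ((q.onAcc ω).trace.re : ℂ) := by
        refine Complex.ext rfl ?_
        simpa using (Complex.le_def.mp hN.trace_nonneg).2.symm
      rw [trace_kronecker, e2, e4, Complex.re_ofReal_mul] at e1
      exact e1.trans (mul_le_mul_of_nonneg_right (by linarith) (trace_re_nonneg hZ))
    have e := hhp.abs_sub_bell_le hht hτp hτ1 hη hη1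
    have e1 : h (bell S.M) = f (attachBell S.M X (q.onAcc ω)) := by
      change f (q.onAcc ω ⊗ₖ reix Prod.swap (bell S.M)) = _
      congr 2
      ext i j
      simp [bell_apply, eq_comm]
    have e2 : g₁ (actCM P Y) = h τ := by
      change f (q.mid.onAcc (accE Φ _ (actCM P Y))) = f (q.onAcc ω ⊗ₖ reix Prod.swap τ)
      rw [← ampl_kronecker]
      congr 1
      rw [hP, D.actCM_encBell]
      have e3 : slotSwap (accE Φ _
          (reix (fun p : S.C × (X × (S.M × S.M)) => ((p.1, p.2.2.1), (p.2.2.2, p.2.1)))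
          (P ⊗ₖ ω))) = ω ⊗ₖ reix Prod.swap τ := by
        ext i j
        have e4 : ((reix (fun p : S.C × (X × (S.M × S.M)) => ((p.1, p.2.2.1), (p.2.2.2, p.2.1)))
          (P ⊗ₖ ω)).submatrix (fun z => (z, (i.1.2, (i.2.1, i.1.1))))
            fun z => (z, (j.1.2, (j.2.1, j.1.1)))) =
            ω i.1 j.1 • P.submatrix (fun z => (z, i.2.1)) (fun z => (z, j.2.1)) := by
          ext z z'
          exact mul_comm _ _
        change Φ ((reix (fun p : S.C × (X × (S.M × S.M)) => ((p.1, p.2.2.1), (p.2.2.2, p.2.1)))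
          (P ⊗ₖ ω)).submatrix (fun z => (z, (i.1.2, (i.2.1, i.1.1))))
            fun z => (z, (j.1.2, (j.2.1, j.1.1)))) (some i.2.2) (some j.2.2) = _
        rw [e4, map_smul]
        rfl
      exact congrArg (ampl q.onAcc (S.M × S.M)) e3
    rw [e2, ← e1]
    exact e
  -- the rejecting branch
  set g₂ : Op (S.C × (X × (S.M × S.M))) →ₗ[ℂ] ℂ := f ∘ₗ q.mid.onRej ∘ₗ rejE Φ _ with hg₂
  have hg₂p : PosFn g₂ := hf.comp (q.mid.onRej_cp.comp (rejE_cp hcp _))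
  have hg₂t : ∀ Z, Z.PosSemidef → (g₂ Z).re ≤ (rejE Φ _ Z).trace.re := fun Z hZ =>
    (hf' _ (q.mid.onRej_cp.posSemidef ((rejE_cp hcp _).posSemidef hZ))).trans
      (q.mid.onRej_tni _ ((rejE_cp hcp _).posSemidef hZ))
  -- Here `P` and `1 - P` exchange their roles: rejection is rare on the range of `P`, acceptance on
  -- that of `1 - P`.
  have b1 := hg₂p.abs_sub_actCM_le hY (1 - P) hη
  rw [sub_sub_cancel] at b1
  have b2 : (g₂ (actCM (1 - P) Y)).re ≤ ρ.trace.re := by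
    have := hg₂t _ hPY'
    have := rejE_tni (E := X × (S.M × S.M)) htp hcp _ hPY'
    linarith
  have b3 : (g₂ (actCM P Y)).re ≤ c * ρ.trace.re := by
    refine (hg₂t _ hPY).trans ?_
    have e1 : conjL P (redCM Y) = ω.trace • P := by
      rw [hω, D.idealAcc_trace, ← hP]
      have := conjL_vecMulVec_apply (D.phiVec k r) (redCM Y)
      rw [← D.encBell_eq, ← hP] at this
      rw [this, Matrix.trace_smul, hP, D.encBell_trace, smul_eq_mul, mul_one]
    have e4 : ω.trace = (ω.trace.re : ℂ) := by
      refine Complex.ext rfl ?_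
      simpa using (Complex.le_def.mp hωp.trace_nonneg).2.symm
    rw [← rejE_redCM_trace htp, redCM_actCM, e1, map_smul, Matrix.trace_smul, smul_eq_mul, e4,
      Complex.re_ofReal_mul, mul_comm]
    exact mul_le_mul (D.rejE_encBell_le k r) (by linarith) (by linarith) hc0
  -- After a failed test the ideal step rejects outright, the other one only if decryption rejects.
  -- The difference is acceptance after a failed test, which is `bad`.
  have b4 : |(g₂ (actCM (1 - P) Y)).re - (f (q.mid.onRej (trL (actCM (1 - P) Y)))).re| ≤ bad := by
    have e1 : (f (q.mid.onRej (trL (actCM (1 - P) Y)))).re = (g₂ (actCM (1 - P) Y)).re +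
        (f (q.mid.onRej (trL (accE Φ _ (actCM (1 - P) Y))))).re := by
      rw [← trL_accE_add_rejE htp, map_add, map_add, Complex.add_re, add_comm]
      rfl
    have hp := trL_cp.posSemidef ((accE_cp hcp _).posSemidef hPY')
    have e2 := (hf.comp q.mid.onRej_cp).re_nonneg hp
    have e3 := (hf' _ (q.mid.onRej_cp.posSemidef hp)).trans (q.mid.onRej_tni _ hp)
    rw [trL_trace, ← hbad_eq] at e3
    rw [e1, sub_add_cancel_left, abs_neg]
    exact (abs_of_nonneg e2).le.trans e3
  have hη' : 1 ≤ η⁻¹ := (one_le_inv₀ hη).mpr hη1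
  have hρ0 := trace_re_nonneg hρ
  have hbad0 : 0 ≤ bad := (D.bad_pos k r).re_nonneg (redCM_cp.posSemidef hY)
  have m1 := mul_le_mul_of_nonneg_left a2 hη.le
  have m2 := mul_le_mul_of_nonneg_left a3 (show 0 ≤ 1 + η⁻¹ by positivity)
  have m3 := mul_le_mul_of_nonneg_left b2 hη.le
  have m4 := mul_le_mul_of_nonneg_left b3 (show 0 ≤ 1 + η⁻¹ by positivity)
  have m5 : bad ≤ η⁻¹ * bad := le_mul_of_one_le_left hbad0 hη'
  have m6 : c * ρ.trace.re ≤ η⁻¹ * (c * ρ.trace.re) :=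
    le_mul_of_one_le_left (mul_nonneg hc0 hρ0) hη'
  have e1 : (f (q.ideal D k r ρ)).re = (f (q.mid.O ρ)).re +
      (f (attachBell S.M X (q.onAcc ω))).re + (f (q.mid.onRej (trL (actCM (1 - P) Y)))).re := by
    simp only [ideal, LinearMap.add_apply, map_add, Complex.add_re]
    rfl
  have e2 : (f (q.mid.real Φ ρ)).re = (f (q.mid.O ρ)).re + (g₁ Y).re + (g₂ Y).re := by
    simp only [real, LinearMap.add_apply, map_add, Complex.add_re]
    rfl
  rw [e1, e2]
  have h1 := abs_le.mp a1
  have h2 := abs_le.mp a4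
  have h3 := abs_le.mp b1
  have h4 := abs_le.mp b4
  rw [abs_le]
  constructor <;> linarith [h1.1, h1.2, h2.1, h2.2, h3.1, h3.2, h4.1, h4.2]

end IdealStep

/-! ### Path sums along the evolution with decryptions -/

section Runs

variable {σ σ' E : Type}

theorem runSteps_map (F : σ' → Op E →ₗ[ℂ] Op E) (f : Op E →ₗ[ℂ] ℂ) (g : σ → σ') (qs : List σ) :
    runSteps F f (qs.map g) = runSteps (fun q => F (g q)) f qs := by
  induction qs with
  | nil => rfl
  | cons q qs ih => rw [List.map_cons, runSteps, runSteps, ih]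

theorem pathSum_map (T : σ' → Op E →ₗ[ℂ] Op E) (h : σ' → List σ' → Op E →ₗ[ℂ] ℂ) (g : σ → σ')
    (qs : List σ) :
    pathSum T h (qs.map g) = pathSum (fun q => T (g q)) (fun q qs => h (g q) (qs.map g)) qs := by
  induction qs with
  | nil => rfl
  | cons q qs ih => rw [List.map_cons, pathSum, pathSum, ih]

theorem pathSum_smul (T : σ → Op E →ₗ[ℂ] Op E) (z : ℂ) (h : σ → List σ → Op E →ₗ[ℂ] ℂ)
    (qs : List σ) : pathSum T (fun q qs => z • h q qs) qs = z • pathSum T h qs := by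
  induction qs with
  | nil => simp [pathSum]
  | cons q qs ih => rw [pathSum, pathSum, ih, smul_add, LinearMap.smul_comp]

theorem pathSum_le_length [Fintype E] {T : σ → Op E →ₗ[ℂ] Op E} (hT : ∀ q, IsCP (T q))
    (hT' : ∀ q, TNI (T q)) {h : σ → List σ → Op E →ₗ[ℂ] ℂ} (hh : ∀ q qs, SubTr (h q qs))
    (qs : List σ) {ρ : Op E} (hρ : ρ.PosSemidef) :
    (pathSum T h qs ρ).re ≤ qs.length * ρ.trace.re := by
  induction qs generalizing ρ with
  | nil => simp [pathSum]
  | cons q qs ih =>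
    simp only [pathSum, LinearMap.add_apply, Complex.add_re, LinearMap.comp_apply,
      List.length_cons, Nat.cast_succ]
    have h1 := hh q qs ρ hρ
    have h2 := ih ((hT q).posSemidef hρ)
    have h3 := mul_le_mul_of_nonneg_left (hT' q ρ hρ) (Nat.cast_nonneg (α := ℝ) qs.length)
    linarith

end Runs

namespace Step

variable {C M X : Type} [Fintype C] [Fintype M] [Fintype X] {Φ : Op C →ₗ[ℂ] Op (Option M)}

/-- Pass from the evolution with decryptions to the evolution without, up to one acceptance. -/
theorem real_le (hΦ : IsTP Φ) (hΦ' : IsCP Φ) {g : Op X →ₗ[ℂ] ℂ} (hg : PosFn g)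
    (q : Step C M X) {ρ : Op X} (hρ : ρ.PosSemidef) :
    (g (q.real Φ ρ)).re ≤ (g (q.null ρ)).re + (g (q.onAcc (accE Φ X (q.pre ρ)))).re := by
  rw [real_eq hΦ, LinearMap.add_apply, map_add, Complex.add_re]
  have h := (hg.comp (q.onRej_cp.comp (trL_cp.comp ((accE_cp hΦ' X).comp q.pre_cp)))).re_nonneg hρ
  simp only [excess, LinearMap.sub_apply, map_sub, Complex.sub_re, LinearMap.comp_apply] at h ⊢
  linarith

/-- After the first acceptance, the remaining sum over at most `qs.length` positions is bounded
trivially by the accepted weight. -/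
theorem pathSum_real_le (hΦ : IsTP Φ) (hΦ' : IsCP Φ) {b : Step C M X → Op X →ₗ[ℂ] ℂ}
    (hb : ∀ q, PosFn (b q)) (hb' : ∀ q, SubTr (b q)) (qs : List (Step C M X)) {ρ : Op X}
    (hρ : ρ.PosSemidef) :
    (pathSum (real Φ) (fun q _ => b q) qs ρ).re ≤
      (pathSum null (fun q _ => b q) qs ρ).re + qs.length * (accTotal Φ qs ρ).re := by
  induction qs generalizing ρ with
  | nil => simp [pathSum]
  | cons q qs ih =>
    have hp : PosFn (pathSum (real Φ) (fun q _ => b q) qs) :=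
      pathSum_pos (real_cp hΦ') (fun q _ => hb q) qs
    have h1 := real_le hΦ hΦ' hp q hρ
    have h2 := ih (q.null_cp.posSemidef hρ)
    have ha := (accE_cp hΦ' X).posSemidef (q.pre_cp.posSemidef hρ)
    have h3 := pathSum_le_length (real_cp hΦ') (real_tni hΦ hΦ') (fun q (_ : List _) => hb' q) qs
      (q.onAcc_cp.posSemidef ha)
    have h4 := mul_le_mul_of_nonneg_left (q.onAcc_tni _ ha) (Nat.cast_nonneg (α := ℝ) qs.length)
    have h5 := trace_re_nonneg ha
    have h6 := (accTotal_pos hΦ' qs).re_nonneg (q.null_cp.posSemidef hρ)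
    simp only [accTotal] at h2 h6
    simp only [accTotal, pathSum, LinearMap.add_apply, Complex.add_re, LinearMap.comp_apply,
      List.length_cons, Nat.cast_succ, traceFn_apply] at h2 h6 ⊢
    linarith

/-- A refinement of `pathSum_real_le`: a first acceptance need not be rare, so the contribution with
exactly one acceptance is kept to be bounded by other means, and only that with two acceptances is
estimated trivially. -/
theorem pathSum_real_le_add (hΦ : IsTP Φ) (hΦ' : IsCP Φ) {b : Step C M X → Op X →ₗ[ℂ] ℂ}
    (hb : ∀ q, PosFn (b q)) (hb' : ∀ q, SubTr (b q)) {n : ℕ} {qs : List (Step C M X)}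
    (hn : qs.length ≤ n) {ρ : Op X} (hρ : ρ.PosSemidef) :
    (pathSum (real Φ) (fun q _ => b q) qs ρ).re ≤ (pathSum null (fun q _ => b q) qs ρ).re +
      ((pathSum null (fun q qs => pathSum null (fun q _ => b q) qs ∘ₗ q.onAcc ∘ₗ accE Φ X ∘ₗ q.pre)
        qs ρ).re + n * (accTwice Φ qs ρ).re) := by
  induction qs generalizing ρ with
  | nil => simp [pathSum, accTwice]
  | cons q qs ih =>
    rw [List.length_cons] at hn
    have hp : PosFn (pathSum (real Φ) (fun q _ => b q) qs) :=
      pathSum_pos (real_cp hΦ') (fun q _ => hb q) qs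
    have h1 := real_le hΦ hΦ' hp q hρ
    have h2 := ih (by omega) (q.null_cp.posSemidef hρ)
    have ha := (accE_cp hΦ' X).posSemidef (q.pre_cp.posSemidef hρ)
    have h3 := pathSum_real_le hΦ hΦ' hb hb' qs (q.onAcc_cp.posSemidef ha)
    have h4 := (accTotal_pos hΦ' qs).re_nonneg (q.onAcc_cp.posSemidef ha)
    have h5 := (accTotal_pos hΦ' qs).re_nonneg (q.onRej_cp.posSemidef (trL_cp.posSemidef ha))
    have hn' : (qs.length : ℝ) ≤ n := by exact_mod_cast (by omega : qs.length ≤ n)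
    have h6 := mul_le_mul_of_nonneg_right hn' h4
    have h7 := mul_nonneg (Nat.cast_nonneg (α := ℝ) n) h5
    simp only [accTwice] at h2
    simp only [accTwice, pathSum, LinearMap.add_apply, Complex.add_re, LinearMap.comp_apply,
      accepted, map_add] at h2 ⊢
    linarith

end Step

/-! ### Expectation over the key and the randomness of encryption -/

section KeyAverage

variable {S : QScheme} (D : Decomposition S)

/-- The expectation over the key and the randomness of encryption. -/
def Decomposition.expect : (S.K × D.T → ℝ) →ₗ[ℝ] ℝ where
  toFun g := avg fun k => ∑ r, D.p k r * g (k, r)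
  map_add' g h := by
    rw [← avg_add]
    congr 1
    funext k
    simp [mul_add, Finset.sum_add_distrib]
  map_smul' c g := by
    rw [RingHom.id_apply, smul_eq_mul, ← avg_mul]
    congr 1
    funext k
    rw [Finset.mul_sum]
    exact Finset.sum_congr rfl fun r _ => mul_left_comm _ _ _

theorem Decomposition.expect_apply (g : S.K × D.T → ℝ) :
    D.expect g = avg fun k => ∑ r, D.p k r * g (k, r) := rfl

theorem Decomposition.expect_mono {g h : S.K × D.T → ℝ} (H : ∀ i, g i ≤ h i) :
    D.expect g ≤ D.expect h :=
  avg_mono fun k => Finset.sum_le_sum fun r _ =>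
    mul_le_mul_of_nonneg_left (H (k, r)) (D.p_nonneg k r)

theorem Decomposition.abs_expect_le (g : S.K × D.T → ℝ) :
    |D.expect g| ≤ D.expect fun i => |g i| := by
  refine (abs_avg_le _).trans (avg_mono fun k => (Finset.abs_sum_le_sum_abs _ _).trans
    (le_of_eq (Finset.sum_congr rfl fun r _ => ?_)))
  rw [abs_mul, abs_of_nonneg (D.p_nonneg k r)]

theorem Decomposition.expect_const (c : ℝ) : D.expect (fun _ => c) = c := by
  rw [D.expect_apply]
  simp only [← Finset.sum_mul, D.p_sum, one_mul, avg_const]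

/-- When the continuation depends on the key but not on `r`, averaging over `r` restores the full
encryption. -/
theorem Decomposition.expect_enc {B : Type} (ρ : Op (S.M × B))
    (f : S.K → Op (S.C × B) →ₗ[ℂ] ℂ) :
    D.expect (fun i => (f i.1 (ampl (D.encR i.1 i.2) B ρ)).re) =
      avg fun k => (f k (ampl (S.enc k).map B ρ)).re := by
  rw [D.expect_apply]
  congr 1
  funext k
  rw [D.ampl_enc, map_sum, Complex.re_sum]
  refine Finset.sum_congr rfl fun r _ => ?_
  rw [map_smul, smul_eq_mul, Complex.re_ofReal_mul]

theorem Decomposition.expect_defect_le [Nonempty S.M] {ε : ℝ} (hε : 0 ≤ ε)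
    (h : ∀ k, diamondNorm ((S.dec k).map ∘ₗ (S.enc k).map - embedBot S.M) ≤ ENNReal.ofReal ε) :
    D.expect (fun i => D.defect i.1 i.2) ≤ ε := by
  rw [D.expect_apply, ← avg_const (K := S.K) ε]
  exact avg_mono fun k => D.sum_defect_le hε k (h k)

theorem Decomposition.bad_subTr [Nonempty S.M] (k : S.K) (r : D.T) : SubTr (D.bad k r) := by
  have h : (1 - D.encBell k r) * (1 - D.encBell k r) = 1 - D.encBell k r := by
    have := D.encBell_mul_self k r
    simp only [Matrix.sub_mul, Matrix.mul_sub, Matrix.one_mul, Matrix.mul_one, this]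
    abel
  have h' : (1 - D.encBell k r)ᴴ = 1 - D.encBell k r := by
    rw [conjTranspose_sub, conjTranspose_one, D.encBell_conjTranspose]
  exact traceFn_subTr.comp ((accE_cp (S.dec k).cp _).comp (conjL_cp _))
    ((accE_tni (S.dec k).tp (S.dec k).cp).comp' (conjL_tni_of_proj h h') (conjL_cp _))

/-- The encryption of half of a maximally entangled state, with the plaintext in a slot. -/
theorem Decomposition.ampl_encR_slotIn {B : Type} (k : S.K) (r : D.T) (ρ : Op (S.M × B)) :
    ampl (D.encR k r) (B × (S.M × S.M)) (slotIn ρ) =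
      reix (fun p : S.C × (B × (S.M × S.M)) => ((p.1, (p.2.1, p.2.2.2)), p.2.2.1))
        (attachOp (D.encBell k r) (B × S.M) (reix Prod.swap ρ)) := by
  ext p q
  have h : (slotIn ρ).submatrix (fun i => (i, p.2)) (fun i => (i, q.2)) =
      ρ (p.2.2.2, p.2.1) (q.2.2.2, q.2.1) •
        (bell S.M).submatrix (fun i => (i, p.2.2.1)) (fun i => (i, q.2.2.1)) := by
    ext i j
    exact mul_comm _ _
  rw [ampl_apply, h, map_smul, Matrix.smul_apply, smul_eq_mul, mul_comm]
  rfl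

end KeyAverage

/-! ### Acceptance of tampered ciphertexts during a game -/

section BadPaths

variable {S : QScheme} {B X : Type} [Fintype B] [Fintype X]

/-- The evolution up to the tested position is an attack in the sense of `QCABound.bad_le`, with the
stored plaintext as an idle part of its side register. -/
theorem QCABound.bad_direct {D : Decomposition S} {ε : ℝ} (hQ : QCABound D ε) (hε : 0 ≤ ε)
    [Nonempty S.C] [Nonempty S.M]
    (hc : ∀ k, diamondNorm ((S.dec k).map ∘ₗ (S.enc k).map - embedBot S.M) ≤ ENNReal.ofReal ε)
    {Γ : Op (S.C × B) →ₗ[ℂ] Op X} (hΓ : IsCP Γ) (hΓ' : TNI Γ) {ρ : Op (S.M × B)}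
    (hρ : ρ.PosSemidef) (q : Step S.C S.M X) {η : ℝ} (hη : 0 < η) :
    D.expect (fun i => (D.bad i.1 i.2 (redCM (q.mid.pre (slotExt Γ (S.M × S.M)
      (ampl (D.encR i.1 i.2) (B × (S.M × S.M)) (slotIn ρ)))))).re) ≤
      (2 * ε + η + η⁻¹ * ε) * ρ.trace.re := by
  have h := hQ.bad_le hε hc (Λ := amplMid (q.pre ∘ₗ Γ) S.M) (Z := reix Prod.swap ρ)
    ((q.pre_cp.comp hΓ).amplMid _) ((q.pre_tni.comp' hΓ' hΓ).amplMid _)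
    ((reix_cp _).posSemidef hρ) hη
  have ht : (reix Prod.swap ρ).trace = ρ.trace := reix_trace_equiv (Equiv.prodComm B S.M) ρ
  rw [ht] at h
  have key : ∀ k r, redCM (q.mid.pre (slotExt Γ (S.M × S.M)
      (ampl (D.encR k r) (B × (S.M × S.M)) (slotIn ρ)))) =
      trMid (ampl (amplMid (q.pre ∘ₗ Γ) S.M) S.M
        (attachOp (D.encBell k r) (B × S.M) (reix Prod.swap ρ))) := by
    intro k r
    rw [D.ampl_encR_slotIn]
    ext i j
    simp only [redCM, trMid, LinearMap.comp_apply, trL_apply, trR_apply]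
    rfl
  simp only [D.expect_apply, key]
  exact h

/-- An earlier acceptance does no harm: what it returned was the stored plaintext, so the accepted
branch is dominated by the attack that discards the first ciphertext and continues with the stored
plaintext. That attack submits only one ciphertext, and `QCABound.bad_le` applies to it. -/
theorem QCABound.bad_after_accept {D : Decomposition S} {ε : ℝ} (hQ : QCABound D ε) (hε : 0 ≤ ε)
    [Nonempty S.C] [Nonempty S.M]
    (hc : ∀ k, diamondNorm ((S.dec k).map ∘ₗ (S.enc k).map - embedBot S.M) ≤ ENNReal.ofReal ε)
    {Γ : Op (S.C × B) →ₗ[ℂ] Op X} (hΓ : IsCP Γ) (hΓ' : TNI Γ) {ρ : Op (S.M × B)}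
    (hρ : ρ.PosSemidef) (q q' : Step S.C S.M X) {Γ₂ : Op (S.M × X) →ₗ[ℂ] Op X} (hΓ₂ : IsCP Γ₂)
    (hΓ₂' : TNI Γ₂) {η : ℝ} (hη : 0 < η) :
    D.expect (fun i => (D.bad i.1 i.2 (redCM (q'.mid.pre (ampl Γ₂ (S.M × S.M) (slotSwap
      (accE (S.dec i.1).map _ (q.mid.pre (slotExt Γ (S.M × S.M)
      (ampl (D.encR i.1 i.2) (B × (S.M × S.M)) (slotIn ρ)))))))))).re) ≤
      (2 * ε + η + η⁻¹ * ε) * ρ.trace.re := by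
  set Λ₂ : Op (S.M × X) →ₗ[ℂ] Op (S.C × X) := q'.pre ∘ₗ Γ₂ with hΛ₂
  have hΛ₂cp : IsCP Λ₂ := q'.pre_cp.comp hΓ₂
  have hΛ₂tni : TNI Λ₂ := q'.pre_tni.comp' hΓ₂' hΓ₂
  set Γ₀ : Op (S.C × B) →ₗ[ℂ] Op X := trL ∘ₗ q.pre ∘ₗ Γ with hΓ₀
  have hΓ₀cp : IsCP Γ₀ := trL_cp.comp (q.pre_cp.comp hΓ)
  have hΓ₀tni : TNI Γ₀ := TNI.comp' (fun Y _ => (congrArg Complex.re (trL_trace Y)).le)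
    (q.pre_tni.comp' hΓ' hΓ) (q.pre_cp.comp hΓ)
  set Λ : Op (S.C × (B × S.M)) →ₗ[ℂ] Op (S.C × X) :=
    Λ₂ ∘ₗ reix Prod.swap ∘ₗ slotExt Γ₀ S.M with hΛ
  have hΛcp : IsCP Λ := hΛ₂cp.comp ((reix_cp _).comp (slotExt_cp hΓ₀cp _))
  have hΛtni : TNI Λ := hΛ₂tni.comp' ((reix_tp (Equiv.prodComm S.M X)).tni.comp'
    (slotExt_tni hΓ₀tni _) (slotExt_cp hΓ₀cp _)) ((reix_cp _).comp (slotExt_cp hΓ₀cp _))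
  have h := hQ.bad_le hε hc (Λ := Λ) (Z := reix Prod.swap ρ) hΛcp hΛtni
    ((reix_cp _).posSemidef hρ) hη
  have ht : (reix Prod.swap ρ).trace = ρ.trace := reix_trace_equiv (Equiv.prodComm B S.M) ρ
  rw [ht] at h
  refine le_trans ?_ h
  rw [D.expect_apply]
  refine avg_mono fun k => Finset.sum_le_sum fun r _ =>
    mul_le_mul_of_nonneg_left ?_ (D.p_nonneg k r)
  set b : Op (X × (S.M × S.M)) →ₗ[ℂ] ℂ := D.bad k r ∘ₗ trMid ∘ₗ ampl Λ₂ S.M ∘ₗ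
    reix (fun p : (S.M × X) × S.M => (p.1.2, (p.2, p.1.1))) with hb
  have hbp : PosFn b := (D.bad_pos k r).comp
    (trMid_cp.comp ((hΛ₂cp.ampl _).comp (reix_cp _)))
  have e1 : ∀ Z : Op (S.M × (X × (S.M × S.M))),
      D.bad k r (redCM (q'.mid.pre (ampl Γ₂ (S.M × S.M) (slotSwap Z)))) = b (trL Z) := by
    intro Z
    change D.bad k r _ = D.bad k r _
    congr 1
    have e2 : trL Z = ∑ m, reix (fun p => (m, p)) Z := by
      rw [trL, LinearMap.sum_apply]
    rw [e2, map_sum]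
    ext i j
    simp only [redCM, trMid, LinearMap.comp_apply, trL_apply, trR_apply, Matrix.sum_apply,
      Fintype.sum_prod_type]
    rw [Finset.sum_comm]
    rfl
  rw [e1]
  refine (hbp.trL_accE_le (S.dec k).tp (S.dec k).cp (q.mid.pre_cp.posSemidef
    ((slotExt_cp hΓ _).posSemidef ?_))).trans (le_of_eq ?_)
  · rw [D.ampl_encR_slotIn]
    exact (reix_cp _).posSemidef (attachOp_posSemidef (D.encBell_posSemidef k r)
      ((reix_cp _).posSemidef hρ))
  · have e3 : ∀ Y : Op (X × (S.M × S.M)), trL (q.mid.pre Y) =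
        ampl (trL ∘ₗ q.pre) (S.M × S.M) Y := by
      intro Y
      rw [ampl_comp, LinearMap.comp_apply, ampl_trL]
      rfl
    rw [D.ampl_encR_slotIn, e3]
    rfl

end BadPaths

/-! ### The single-key theorem -/

section SingleKey

variable {S : QScheme} {B X : Type} [Fintype B] [Fintype X]

theorem Decomposition.encR_cp (D : Decomposition S) (k : S.K) (r : D.T) : IsCP (D.encR k r) := by
  refine ⟨Unit, inferInstance, fun _ => Matrix.of fun c m => ∑ u, D.V k c (m, u) * D.ψ k r u,
    fun Y => ?_⟩
  ext i j
  rw [Decomposition.encR, encWith_apply]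
  simp only [Finset.univ_unique, Finset.sum_singleton, Matrix.mul_apply, of_apply,
    conjTranspose_apply, Finset.sum_mul]
  exact Finset.sum_comm

/-- Paths are sorted by the number of acceptances before the tested position: none
(`QCABound.bad_direct`), one (`QCABound.bad_after_accept`), or more (`QCABound.accTwice_le`). These
give the terms of degree 1, 2 and 3 in the number of steps. -/
theorem QCABound.expect_bad_le {D : Decomposition S} {ε : ℝ} (hQ : QCABound D ε) (hε : 0 ≤ ε)
    [Nonempty S.C] (hM : 2 ≤ Fintype.card S.M)
    (hc : ∀ k, diamondNorm ((S.dec k).map ∘ₗ (S.enc k).map - embedBot S.M) ≤ ENNReal.ofReal ε)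
    {Γ : Op (S.C × B) →ₗ[ℂ] Op X} (hΓ : IsCP Γ) (hΓ' : TNI Γ) {ρ : Op (S.M × B)}
    (hρ : ρ.PosSemidef) (qs : List (Step S.C S.M X)) {η : ℝ} (hη : 0 < η) :
    D.expect (fun i => (pathSum (fun q : Step S.C S.M X => q.mid.real (S.dec i.1).map)
      (fun q _ => D.bad i.1 i.2 ∘ₗ redCM ∘ₗ q.mid.pre) qs (slotExt Γ (S.M × S.M)
      (ampl (D.encR i.1 i.2) (B × (S.M × S.M)) (slotIn ρ)))).re) ≤
      ((qs.length + qs.length ^ 2) * (2 * ε + η + η⁻¹ * ε) + 40 * qs.length ^ 3 * ε) *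
        ρ.trace.re := by
  have : Nonempty S.M := Fintype.card_pos_iff.mp (by omega)
  set n := qs.length with hn
  set δ := (2 * ε + η + η⁻¹ * ε) * ρ.trace.re with hδ
  have hρ0 := trace_re_nonneg hρ
  have hδ0 : 0 ≤ δ := mul_nonneg (by positivity) hρ0
  set L := S.M × S.M with hL
  set τ : S.K × D.T → Op (S.C × (B × L)) := fun i => ampl (D.encR i.1 i.2) (B × L) (slotIn ρ)
    with hτ
  have hτp : ∀ i, (slotExt Γ L (τ i)).PosSemidef := fun i =>
    (slotExt_cp hΓ L).posSemidef (((D.encR_cp i.1 i.2).ampl _).posSemidef (slotIn_posSemidef hρ))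
  set b : S.K × D.T → Step S.C S.M (X × L) → Op (X × L) →ₗ[ℂ] ℂ := fun i q =>
    D.bad i.1 i.2 ∘ₗ redCM ∘ₗ q.pre with hb
  have hbp : ∀ i q, PosFn (b i q) := fun i q =>
    (D.bad_pos i.1 i.2).comp (redCM_cp.comp q.pre_cp)
  have hbs : ∀ i q, SubTr (b i q) := fun i q =>
    (D.bad_subTr i.1 i.2).comp (redCM_cp.comp q.pre_cp)
      (TNI.comp' (fun Y _ => (congrArg Complex.re (redCM_trace Y)).le) q.pre_tni q.pre_cp)
  have hlen : (qs.map Step.mid).length = n := by rw [List.length_map]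
  have h1 : ∀ i, (pathSum (fun q : Step S.C S.M X => q.mid.real (S.dec i.1).map)
      (fun q _ => b i q.mid) qs (slotExt Γ L (τ i))).re ≤
      (pathSum Step.null (fun q _ => b i q) (qs.map Step.mid) (slotExt Γ L (τ i))).re +
      ((pathSum Step.null (fun q qs => pathSum Step.null (fun q _ => b i q) qs ∘ₗ q.onAcc ∘ₗ
        accE (S.dec i.1).map (X × L) ∘ₗ q.pre) (qs.map Step.mid) (slotExt Γ L (τ i))).re +
      n * (Step.accTwice (S.dec i.1).map (qs.map Step.mid) (slotExt Γ L (τ i))).re) := fun i => by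
    have := Step.pathSum_real_le_add (S.dec i.1).tp (S.dec i.1).cp (hbp i) (hbs i) hlen.le (hτp i)
    have e := pathSum_map (Step.real (S.dec i.1).map) (fun q _ => b i q) Step.mid qs
    rw [e] at this
    exact this
  refine (D.expect_mono h1).trans ?_
  have hadd : ∀ g h : S.K × D.T → ℝ, D.expect (fun i => g i + h i) = D.expect g + D.expect h :=
    map_add D.expect
  have hmul : ∀ (z : ℝ) (g : S.K × D.T → ℝ), D.expect (fun i => z * g i) = z * D.expect g :=
    fun z g => map_smul D.expect z g
  rw [hadd, hadd, hmul]
  have t1 : D.expect (fun i => (pathSum Step.null (fun q _ => b i q) (qs.map Step.mid)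
      (slotExt Γ L (τ i))).re) ≤ n * δ := by
    simp only [pathSum_map]
    refine expect_pathSum_le (h := fun i (q : Step S.C S.M X) _ => b i q.mid) D.expect τ
      (fun Γ' => ∃ Γ₀ : Op (S.C × B) →ₗ[ℂ] Op X, IsCP Γ₀ ∧ TNI Γ₀ ∧ Γ' = slotExt Γ₀ L) ?_ ?_ le_rfl
      ⟨Γ, hΓ, hΓ', rfl⟩
    · rintro _ q ⟨Γ₀, h0, h0', rfl⟩
      refine ⟨q.null ∘ₗ Γ₀, q.null_cp.comp h0, q.null_tni.comp' h0' h0, ?_⟩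
      rw [Step.null_mid]
      rfl
    · rintro _ q _ _ ⟨Γ₀, h0, h0', rfl⟩
      exact hQ.bad_direct hε hc h0 h0' hρ q hη
  have t2 : D.expect (fun i => (pathSum Step.null (fun q qs => pathSum Step.null (fun q _ => b i q)
      qs ∘ₗ q.onAcc ∘ₗ accE (S.dec i.1).map (X × L) ∘ₗ q.pre) (qs.map Step.mid)
      (slotExt Γ L (τ i))).re) ≤ n * (n * δ) := by
    have e : ∀ i, pathSum Step.null (fun q qs => pathSum Step.null (fun q _ => b i q)
        qs ∘ₗ q.onAcc ∘ₗ accE (S.dec i.1).map (X × L) ∘ₗ q.pre) (qs.map Step.mid) =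
        pathSum (fun q : Step S.C S.M X => q.mid.null) (fun q qs => pathSum (fun q => q.mid.null)
          (fun q _ => b i q.mid) qs ∘ₗ q.mid.onAcc ∘ₗ accE (S.dec i.1).map (X × L) ∘ₗ
          q.mid.pre) qs := by
      intro i
      rw [pathSum_map]
      congr 1
      funext q qs
      rw [pathSum_map]
    simp only [e]
    refine expect_pathSum_le (σ := Step S.C S.M X) (T := fun q => q.mid.null) (δ := n * δ)
      (n := qs.length) (h := fun i (q : Step S.C S.M X) qs => pathSum (fun q => q.mid.null) (fun q _ => b i q.mid)
      qs ∘ₗ q.mid.onAcc ∘ₗ accE (S.dec i.1).map (X × L) ∘ₗ q.mid.pre) D.expect τ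
      (fun Γ' => ∃ Γ₀ : Op (S.C × B) →ₗ[ℂ] Op X, IsCP Γ₀ ∧ TNI Γ₀ ∧ Γ' = slotExt Γ₀ L) ?_ ?_ le_rfl
      ⟨Γ, hΓ, hΓ', rfl⟩
    · rintro _ q ⟨Γ₀, h0, h0', rfl⟩
      refine ⟨q.null ∘ₗ Γ₀, q.null_cp.comp h0, q.null_tni.comp' h0' h0, ?_⟩
      rw [Step.null_mid]
      rfl
    · rintro _ q qs' hqs' ⟨Γ₀, h0, h0', rfl⟩
      have t3 : D.expect (fun i => (pathSum (fun q => q.mid.null) (fun q _ => b i q.mid) qs'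
          ((ampl q.onAcc L ∘ₗ slotSwap) (accE (S.dec i.1).map (X × L)
            (q.mid.pre (slotExt Γ₀ L (τ i)))))).re) ≤ qs'.length * δ := by
        refine expect_pathSum_le (σ := Step S.C S.M X) (T := fun q => q.mid.null) (δ := δ)
          (n := qs'.length) (h := fun i (q : Step S.C S.M X) _ => b i q.mid) D.expect
          (fun i => accE (S.dec i.1).map (X × L) (q.mid.pre (slotExt Γ₀ L (τ i))))
          (fun Γ' => ∃ Γ₂ : Op (S.M × X) →ₗ[ℂ] Op X, IsCP Γ₂ ∧ TNI Γ₂ ∧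
            Γ' = ampl Γ₂ L ∘ₗ slotSwap) ?_ ?_ le_rfl ⟨q.onAcc, q.onAcc_cp, q.onAcc_tni, rfl⟩
        · rintro _ q' ⟨Γ₂, h2, h2', rfl⟩
          refine ⟨q'.null ∘ₗ Γ₂, q'.null_cp.comp h2, q'.null_tni.comp' h2' h2, ?_⟩
          rw [Step.null_mid]
          rfl
        · rintro _ q' _ _ ⟨Γ₂, h2, h2', rfl⟩
          exact hQ.bad_after_accept hε hc h0 h0' hρ q q' h2 h2' hη
      refine t3.trans (mul_le_mul_of_nonneg_right ?_ hδ0)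
      exact_mod_cast hqs'.le
  have t4 : D.expect (fun i => (Step.accTwice (S.dec i.1).map (qs.map Step.mid)
      (slotExt Γ L (τ i))).re) ≤ 40 * n ^ 2 * ε * ρ.trace.re := by
    have h := hQ.accTwice_le hε hM (slotExt_cp hΓ L) (slotExt_tni hΓ' L) (slotIn_posSemidef hρ)
      (qs.map Step.mid)
    rw [hlen, slotIn_trace] at h
    refine le_of_eq_of_le ?_ h
    exact D.expect_enc (slotIn ρ) fun k => Step.accTwice (S.dec k).map (qs.map Step.mid) ∘ₗ
      slotExt Γ L
  have t5 := mul_le_mul_of_nonneg_left t4 (Nat.cast_nonneg (α := ℝ) n)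
  refine (add_le_add t1 (add_le_add t2 t5)).trans (le_of_eq ?_)
  rw [hδ]
  ring

/-- The game with a single key: encryption and decryption may be replaced by the ideal
functionalities. -/
theorem QCABound.real_sub_ideal_le {D : Decomposition S} {μ : ℝ} (hμ : 0 < μ) (hμ1 : μ ≤ 1)
    (hQ : QCABound D (μ ^ 4)) [Nonempty S.C] (hM : 2 ≤ Fintype.card S.M)
    (hc : ∀ k, diamondNorm ((S.dec k).map ∘ₗ (S.enc k).map - embedBot S.M) ≤
      ENNReal.ofReal (μ ^ 4))
    {Γ : Op (S.C × B) →ₗ[ℂ] Op X} (hΓ : IsCP Γ) (hΓ' : TNI Γ) {ρ : Op (S.M × B)}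
    (hρ : ρ.PosSemidef) {f : Op X →ₗ[ℂ] ℂ} (hf : PosFn f) (hf' : SubTr f)
    (qs : List (Step S.C S.M X)) :
    |(avg fun k => (runSteps (Step.real (S.dec k).map) f qs (Γ (ampl (S.enc k).map B ρ))).re) -
      D.expect (fun i => (runSteps (Step.ideal D i.1 i.2) (f ∘ₗ trR) qs (slotExt Γ (S.M × S.M)
        (ampl (D.encR i.1 i.2) (B × (S.M × S.M)) (slotIn ρ)))).re)| ≤
      400 * (qs.length + 1) ^ 3 * μ * ρ.trace.re := by
  have : Nonempty S.M := Fintype.card_pos_iff.mp (by omega)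
  -- The exponent balances two weights: tests are exchanged with decryptions at weight `μ`, and
  -- `bad` is bounded at weight `μ²`. Then `μ⁻¹ (μ² + μ⁻² ε)` is of order `μ`.
  set ε := μ ^ 4 with hε'
  have hε : 0 ≤ ε := by positivity
  set n := qs.length with hn
  have hρ0 := trace_re_nonneg hρ
  set t := ρ.trace.re with ht
  set L := S.M × S.M with hL
  have hlen : (qs.map Step.mid).length = n := by rw [List.length_map]
  have hg : PosFn (f ∘ₗ trR (a := X) (e := L)) := hf.comp trR_cp
  have hg' : SubTr (f ∘ₗ trR (a := X) (e := L)) :=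
    hf'.comp trR_cp fun Y _ => (congrArg Complex.re (trR_trace Y)).le
  have habs : ∀ g h : S.K → ℝ, |avg g - avg h| ≤ avg fun k => |g k - h k| := fun g h => by
    rw [← avg_sub]
    exact abs_avg_le _
  -- real to first order
  have s1 : |(avg fun k => (runSteps (Step.real (S.dec k).map) f qs
      (Γ (ampl (S.enc k).map B ρ))).re) - avg fun k => (Step.firstOrder (S.dec k).map f qs
      (Γ (ampl (S.enc k).map B ρ))).re| ≤ 2 * (40 * n ^ 2 * ε * t) := by
    refine (habs _ _).trans ((avg_mono fun k => Step.abs_real_sub_firstOrder_le (S.dec k).tp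
      (S.dec k).cp hf hf' qs (hΓ.posSemidef (((S.enc k).cp.ampl B).posSemidef hρ))).trans ?_)
    rw [avg_mul]
    exact mul_le_mul_of_nonneg_left (hQ.accTwice_le hε hM hΓ hΓ' hρ qs) two_pos.le
  -- The slot is introduced at first order because it holds the original plaintext only until the
  -- first return; the full games on both sides differ from first order by two acceptances.
  have s2 := hQ.firstOrder_mid hε hΓ hΓ' hρ hf hf' qs
  have s3 : |(avg fun k => (Step.firstOrder (S.dec k).map (f ∘ₗ trR) (qs.map Step.mid)
        (slotExt Γ L (ampl (S.enc k).map (B × L) (slotIn ρ)))).re) -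
      avg fun k => (runSteps (Step.real (S.dec k).map) (f ∘ₗ trR) (qs.map Step.mid)
        (slotExt Γ L (ampl (S.enc k).map (B × L) (slotIn ρ)))).re| ≤ 2 * (40 * n ^ 2 * ε * t) := by
    rw [abs_sub_comm]
    refine (habs _ _).trans ((avg_mono fun k => Step.abs_real_sub_firstOrder_le (S.dec k).tp
      (S.dec k).cp hg hg' (qs.map Step.mid) ((slotExt_cp hΓ L).posSemidef
        (((S.enc k).cp.ampl _).posSemidef (slotIn_posSemidef hρ)))).trans ?_)
    rw [avg_mul]
    have h := hQ.accTwice_le hε hM (slotExt_cp hΓ L) (slotExt_tni hΓ' L) (slotIn_posSemidef hρ)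
      (qs.map Step.mid)
    rw [hlen, slotIn_trace] at h
    exact mul_le_mul_of_nonneg_left h two_pos.le
  have s4 : |(avg fun k => (runSteps (Step.real (S.dec k).map) (f ∘ₗ trR) (qs.map Step.mid)
        (slotExt Γ L (ampl (S.enc k).map (B × L) (slotIn ρ)))).re) -
      D.expect (fun i => (runSteps (Step.ideal D i.1 i.2) (f ∘ₗ trR) qs (slotExt Γ L
        (ampl (D.encR i.1 i.2) (B × L) (slotIn ρ)))).re)| ≤
      n * (3 * μ + 5 * μ⁻¹ * ε) * t + 3 * μ⁻¹ *
        (((n + n ^ 2) * (2 * ε + μ ^ 2 + (μ ^ 2)⁻¹ * ε) + 40 * n ^ 3 * ε) * t) := by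
    have e1 := D.expect_enc (slotIn ρ) fun k =>
      runSteps (Step.real (S.dec k).map) (f ∘ₗ trR) (qs.map Step.mid) ∘ₗ slotExt Γ L
    simp only [LinearMap.comp_apply] at e1
    rw [← e1, abs_sub_comm, ← map_sub]
    refine (D.abs_expect_le _).trans ?_
    have hbad := hQ.expect_bad_le hε hM hc hΓ hΓ' hρ qs (show 0 < μ ^ 2 by positivity)
    have hdef := D.expect_defect_le hε hc
    have key : ∀ i : S.K × D.T,
        |(runSteps (Step.ideal D i.1 i.2) (f ∘ₗ trR) qs (slotExt Γ L
          (ampl (D.encR i.1 i.2) (B × L) (slotIn ρ)))).re -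
        (runSteps (Step.real (S.dec i.1).map) (f ∘ₗ trR) (qs.map Step.mid)
          (slotExt Γ L (ampl (D.encR i.1 i.2) (B × L) (slotIn ρ)))).re| ≤
        (n * (3 * μ) * t + n * (5 * μ⁻¹) * t * D.defect i.1 i.2) + 3 * μ⁻¹ *
          (pathSum (fun q : Step S.C S.M X => q.mid.real (S.dec i.1).map)
          (fun q _ => D.bad i.1 i.2 ∘ₗ redCM ∘ₗ q.mid.pre) qs (slotExt Γ L
          (ampl (D.encR i.1 i.2) (B × L) (slotIn ρ)))).re := by
      intro i
      have hzp := ((D.encR_cp i.1 i.2).ampl (B × L)).posSemidef (slotIn_posSemidef hρ)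
      have hp := (slotExt_cp hΓ L).posSemidef hzp
      have hpt : (slotExt Γ L (ampl (D.encR i.1 i.2) (B × L) (slotIn ρ))).trace.re ≤ t := by
        refine (slotExt_tni hΓ' L _ hzp).trans (le_of_eq ?_)
        rw [(D.encR_tp i.1 i.2).ampl, slotIn_trace]
      have hd0 := D.defect_nonneg i.1 i.2
      set c := D.defect i.1 i.2 with hc
      have hco : (0 : ℝ) ≤ 3 * μ + 5 * μ⁻¹ * c := by positivity
      -- Steps before the exchanged one still decrypt, with a slot, and the later ones are ideal. In
      -- this way `bad` is evaluated along the evolution for which `QCABound.expect_bad_le` holds.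
      rw [runSteps_map, runSteps_eq_add_pathSum (F := Step.ideal D i.1 i.2)
        (T := fun q => q.mid.real (S.dec i.1).map)
        (A := fun q => q.ideal D i.1 i.2 - q.mid.real (S.dec i.1).map)
        (fun q => (add_sub_cancel _ _).symm), LinearMap.add_apply, Complex.add_re,
        add_sub_cancel_left]
      have hcp : ∀ q : Step S.C S.M X, IsCP (q.mid.real (S.dec i.1).map) := fun q =>
        q.mid.real_cp (S.dec i.1).cp
      have htni : ∀ q : Step S.C S.M X, TNI (q.mid.real (S.dec i.1).map) := fun q =>
        q.mid.real_tni (S.dec i.1).tp (S.dec i.1).cp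
      have h1 := abs_pathSum_le hcp
        (h := fun q qs => runSteps (Step.ideal D i.1 i.2) (f ∘ₗ trR) qs ∘ₗ
          (q.ideal D i.1 i.2 - q.mid.real (S.dec i.1).map))
        (h' := fun q _ => ((3 * μ + 5 * μ⁻¹ * c : ℝ) : ℂ) • traceFn (X × L) +
          ((3 * μ⁻¹ : ℝ) : ℂ) • (D.bad i.1 i.2 ∘ₗ redCM ∘ₗ q.mid.pre)) (fun q qs ρ hρ => by
          have := q.abs_mid_sub_ideal_le D i.1 i.2
            (runSteps_pos (Step.ideal_cp D i.1 i.2) hg qs)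
            (runSteps_subTr (Step.ideal_cp D i.1 i.2) (Step.ideal_tni D i.1 i.2) hg' qs) hρ hμ hμ1
          simpa only [LinearMap.comp_apply, LinearMap.sub_apply, map_sub, Complex.sub_re,
            LinearMap.add_apply, LinearMap.smul_apply, smul_eq_mul, Complex.add_re,
            Complex.re_ofReal_mul, traceFn_apply] using this) qs hp
      rw [← pathSum_add, pathSum_smul, pathSum_smul, LinearMap.add_apply, LinearMap.smul_apply,
        LinearMap.smul_apply, Complex.add_re, smul_eq_mul, smul_eq_mul, Complex.re_ofReal_mul,
        Complex.re_ofReal_mul] at h1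
      have h2 := pathSum_le_length hcp htni (h := fun _ _ => traceFn (X × L))
        (fun _ _ => traceFn_subTr) qs hp
      have h3 := h2.trans (mul_le_mul_of_nonneg_left hpt (Nat.cast_nonneg (α := ℝ) n))
      have h4 := mul_le_mul_of_nonneg_left h3 hco
      refine h1.trans (add_le_add (h4.trans (le_of_eq ?_)) le_rfl)
      ring
    refine (D.expect_mono key).trans ?_
    have hadd : ∀ g h : S.K × D.T → ℝ, D.expect (fun i => g i + h i) = D.expect g + D.expect h :=
      map_add D.expect
    have hmul : ∀ (z : ℝ) (g : S.K × D.T → ℝ), D.expect (fun i => z * g i) = z * D.expect g :=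
      fun z g => map_smul D.expect z g
    rw [hadd, hadd, D.expect_const, hmul, hmul]
    have m1 := mul_le_mul_of_nonneg_left hdef (show 0 ≤ n * (5 * μ⁻¹) * t by positivity)
    have m2 := mul_le_mul_of_nonneg_left hbad (show 0 ≤ 3 * μ⁻¹ by positivity)
    refine (add_le_add (add_le_add le_rfl m1) m2).trans (le_of_eq ?_)
    ring
  have total := (abs_sub_le _ _ _).trans (add_le_add s1 ((abs_sub_le _ _ _).trans
    (add_le_add s2 ((abs_sub_le _ _ _).trans (add_le_add s3 s4)))))
  refine total.trans ?_
  have i1 : μ⁻¹ * ε = μ ^ 3 := by rw [hε']; field_simp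
  have i2 : (μ ^ 2)⁻¹ * ε = μ ^ 2 := by rw [hε']; field_simp
  have i3 : μ⁻¹ * μ ^ 2 = μ := by field_simp
  have e : 2 * (40 * n ^ 2 * ε * t) + ((2 + 4 * n) * ε * t + (2 * (40 * n ^ 2 * ε * t) +
      (n * (3 * μ + 5 * μ⁻¹ * ε) * t + 3 * μ⁻¹ *
        (((n + n ^ 2) * (2 * ε + μ ^ 2 + (μ ^ 2)⁻¹ * ε) + 40 * n ^ 3 * ε) * t)))) =
      ((160 * n ^ 2 + 2 + 4 * n) * μ ^ 4 + (11 * n + 6 * n ^ 2 + 120 * n ^ 3) * μ ^ 3 +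
        (9 * n + 6 * n ^ 2) * μ) * t := by
    rw [i2]
    calc _ = ((160 * n ^ 2 + 2 + 4 * n) * ε + (11 * n + 6 * n ^ 2 + 120 * n ^ 3) * (μ⁻¹ * ε) +
        3 * n * μ + (6 * n + 6 * n ^ 2) * (μ⁻¹ * μ ^ 2)) * t := by ring
      _ = _ := by
        rw [i1, i3, hε']
        ring
  rw [e]
  have hμ3 : μ ^ 3 ≤ μ := pow_le_of_le_one hμ.le hμ1 (by norm_num)
  have hμ4 : μ ^ 4 ≤ μ := pow_le_of_le_one hμ.le hμ1 (by norm_num)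
  refine mul_le_mul_of_nonneg_right ?_ hρ0
  have n0 : (0 : ℝ) ≤ n := Nat.cast_nonneg n
  calc _ ≤ (160 * n ^ 2 + 2 + 4 * n) * μ + (11 * n + 6 * n ^ 2 + 120 * n ^ 3) * μ +
        (9 * n + 6 * n ^ 2) * μ := by gcongr
    _ = (120 * n ^ 3 + 172 * n ^ 2 + 24 * n + 2) * μ := by ring
    _ ≤ (400 * (n + 1) ^ 3) * μ := by
        refine mul_le_mul_of_nonneg_right ?_ hμ.le
        have : (400 * ((n : ℝ) + 1) ^ 3) = 400 * n ^ 3 + 1200 * n ^ 2 + 1200 * n + 400 := by ring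
        rw [this]
        have h2 : (0 : ℝ) ≤ n ^ 2 := by positivity
        have h3 : (0 : ℝ) ≤ n ^ 3 := by positivity
        linarith

end SingleKey

/-! ### Relabelling of registers with undefined labels -/

section PullOp

variable {a b c e : Type}

/-- The operator whose entries are those of `Y` at `g x`, `g y`, and zero where `g` is undefined. -/
def pullOp (g : b → Option a) : Op a →ₗ[ℂ] Op b where
  toFun Y := Matrix.of fun x y =>
    match g x, g y with
    | some i, some j => Y i j
    | _, _ => 0
  map_add' Y Z := by
    ext x y
    simp only [of_apply, Matrix.add_apply]
    cases g x <;> cases g y <;> simp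
  map_smul' z Y := by
    ext x y
    simp only [of_apply, Matrix.smul_apply, RingHom.id_apply]
    cases g x <;> cases g y <;> simp

theorem pullOp_apply (g : b → Option a) (Y : Op a) (x y : b) : pullOp g Y x y =
    match g x, g y with
    | some i, some j => Y i j
    | _, _ => 0 := rfl

theorem pullOp_cp [Fintype a] (g : b → Option a) : IsCP (pullOp g) := by
  classical
  refine ⟨Unit, inferInstance, fun _ => Matrix.of fun x i => if g x = some i then 1 else 0,
    fun Y => ?_⟩
  ext x y
  rw [pullOp_apply]
  simp only [Finset.univ_unique, Finset.sum_singleton, Matrix.mul_apply, of_apply,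
    conjTranspose_apply, ite_mul, one_mul, zero_mul, apply_ite star, star_one, star_zero, mul_ite,
    mul_one, mul_zero]
  cases g x <;> cases g y <;> simp

theorem pullOp_tp [Fintype a] [Fintype b] {g : b → Option a} {h : a → b}
    (H : ∀ x i, g x = some i ↔ x = h i) : IsTP (pullOp g) := by
  classical
  intro Y
  have e : ∀ x, pullOp g Y x x = ∑ i, if x = h i then Y i i else 0 := by
    intro x
    rw [pullOp_apply]
    rcases hx : g x with _ | i
    · refine (Finset.sum_eq_zero fun i _ => if_neg fun h' => ?_).symm
      rw [(H x i).mpr h'] at hx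
      cases hx
    · rw [Finset.sum_eq_single i]
      · rw [if_pos ((H x i).mp hx)]
      · intro j _ hj
        refine if_neg fun h' => hj ?_
        rw [(H x j).mpr h'] at hx
        exact Option.some.inj hx
      · simp
  simp only [Matrix.trace, Matrix.diag_apply, e]
  rw [Finset.sum_comm]
  simp

theorem ampl_pullOp (g : b → Option a) (r : Type) :
    ampl (pullOp g) r = pullOp fun p : b × r => (g p.1).map fun i => (i, p.2) := by
  ext Y p q
  rw [ampl_apply, pullOp_apply, pullOp_apply]
  cases g p.1 <;> cases g q.1 <;> rfl

theorem pullOp_reix (g : b → Option a) (f : a → c) (Y : Op c) :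
    pullOp g (reix f Y) = pullOp (fun x => (g x).map f) Y := by
  ext x y
  rw [pullOp_apply, pullOp_apply]
  cases g x <;> cases g y <;> rfl

/-- `X ↦ X ⊕ 0` on the register `M`. -/
def embSome (M E : Type) : Op (M × E) →ₗ[ℂ] Op (Option M × E) :=
  pullOp fun p => p.1.map fun m => (m, p.2)

/-- `X ↦ |⊥⟩⟨⊥| ⊗ X`. -/
def embNone (M E : Type) : Op E →ₗ[ℂ] Op (Option M × E) :=
  pullOp fun p => match p.1 with
    | none => some p.2
    | some _ => none

theorem embSome_tp [Fintype a] [Fintype e] : IsTP (embSome a e) :=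
  pullOp_tp (h := fun p => (some p.1, p.2)) fun x i => by
    obtain ⟨_ | m, y⟩ := x <;> obtain ⟨m', y'⟩ := i <;> simp

theorem embNone_tp [Fintype a] [Fintype e] : IsTP (embNone a e) :=
  pullOp_tp (h := fun p => (none, p)) fun x i => by
    obtain ⟨_ | m, y⟩ := x <;> simp

theorem ampl_measureBot (Φ : Op c →ₗ[ℂ] Op (Option a)) (Y : Op (c × e)) :
    ampl (measureBot a ∘ₗ Φ) e Y = embSome a e (accE Φ e Y) + embNone a e (rejE Φ e Y) := by
  ext ⟨p, i⟩ ⟨q, j⟩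
  rw [Matrix.add_apply, ampl_apply]
  cases p <;> cases q <;>
    simp [measureBot, embSome, embNone, pullOp_apply, accE, rejE, ampl_apply]

theorem measureBot_cp [Fintype a] : IsCP (measureBot a) := by
  classical
  refine ⟨Bool, inferInstance, fun b => diagonal fun i : Option a => if i.isSome = b then 1 else 0,
    fun Y => ?_⟩
  ext x y
  simp only [Fintype.sum_bool, Matrix.add_apply, diagonal_conjTranspose, diagonal_mul,
    mul_diagonal]
  cases x <;> cases y <;> simp [measureBot]

end PullOp

/-! ### Treatments of submitted ciphertexts -/

section Handlers

variable {S : QScheme}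

/-- The treatment of ciphertexts by a challenger with memory `L`. -/
structure Handler (S : QScheme) (L : Type) [Fintype L] where
  map : Op (S.C × L) →ₗ[ℂ] Op (Option S.M × L)
  cp : IsCP map
  tni : TNI map

/-- Decryption with the key `k`. -/
def Handler.real (k : S.K) (L : Type) [Fintype L] : Handler S L where
  map := ampl (S.decMeas k) L
  cp := (measureBot_cp.comp (S.dec k).cp).ampl L
  tni := (S.decMeas_tp k).tni.ampl L

/-- Rejection. -/
def Handler.null (S : QScheme) (L : Type) [Fintype L] : Handler S L where
  map := embNone S.M L ∘ₗ trL
  cp := (pullOp_cp _).comp trL_cp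
  tni := embNone_tp.tni.comp' (fun Y _ => (congrArg Complex.re (trL_trace Y)).le) trL_cp

/-- The same treatment when the memory has a further slot. -/
def Handler.lift {L : Type} [Fintype L] (h : Handler S L) : Handler S (L × (S.M × S.M)) where
  map := reix (fun p : Option S.M × (L × (S.M × S.M)) => ((p.1, p.2.1), p.2.2)) ∘ₗ
    ampl h.map (S.M × S.M) ∘ₗ reix (fun p => (p.1.1, (p.1.2, p.2)))
  cp := (reix_cp _).comp ((h.cp.ampl _).comp (reix_cp _))
  tni := (reix_tp (Equiv.prodAssoc _ _ _).symm).tni.comp' ((h.tni.ampl _).comp'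
    (reix_tp (Equiv.prodAssoc _ _ _)).tni (reix_cp _)) ((h.cp.ampl _).comp (reix_cp _))

/-- The ciphertext is tested with the first register of the last slot of the memory; if the test
succeeds, the second register is returned. -/
def Handler.ideal [Nonempty S.M] (D : Decomposition S) (k : S.K) (r : D.T) (L : Type)
    [Fintype L] : Handler S (L × (S.M × S.M)) where
  map := embSome S.M (L × (S.M × S.M)) ∘ₗ
      reix (fun p : S.M × (L × (S.M × S.M)) => ((p.1, p.2.1), p.2.2)) ∘ₗ
      attachBell S.M (S.M × L) ∘ₗ D.idealAcc k r L +
    embNone S.M (L × (S.M × S.M)) ∘ₗ trL ∘ₗ actCM (1 - D.encBell k r)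
  cp := ((pullOp_cp _).comp ((reix_cp _).comp (attachBell_cp.comp (D.idealAcc_cp k r)))).add
    ((pullOp_cp _).comp (trL_cp.comp (actCM_cp _)))
  tni Y hY := by
    have h1 : (reix (fun p : S.M × (L × (S.M × S.M)) => ((p.1, p.2.1), p.2.2))
        (attachBell S.M (S.M × L) (D.idealAcc k r L Y))).trace =
        (attachBell S.M (S.M × L) (D.idealAcc k r L Y)).trace :=
      reix_trace_equiv (Equiv.prodAssoc _ _ _).symm _
    simp only [LinearMap.add_apply, LinearMap.comp_apply, Matrix.trace_add, Complex.add_re]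
    rw [embSome_tp, embNone_tp, trL_trace, h1, attachBell_apply, trace_kronecker, bell_trace,
      mul_one, D.ideal_trace_add]

theorem Handler.ext_map {L : Type} [Fintype L] {h h' : Handler S L} (H : h.map = h'.map) :
    h = h' := by
  cases h
  cases h'
  cases H
  rfl

theorem Handler.lift_real (k : S.K) (L : Type) [Fintype L] :
    (Handler.real k L).lift = Handler.real k (L × (S.M × S.M)) := Handler.ext_map rfl

end Handlers

/-! ### Oracle queries with a given salt -/

section Oracles

variable {S : QScheme} {R W L : Type} [Fintype R] [Fintype W] [Fintype L]

/-- A ciphertext with salt `s` is submitted. -/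
def decIn (pre : Channel W ((R × S.C) × W)) (s : R) (L : Type) :
    Op (W × L) →ₗ[ℂ] Op ((S.C × L) × W) :=
  reix (fun p : (S.C × L) × W => (((s, p.1.1), p.2), p.1.2)) ∘ₗ ampl pre.map L

/-- The answer to a decryption query is processed. -/
def decOut (post : Channel (Option S.M × W) W) (L : Type) :
    Op ((Option S.M × L) × W) →ₗ[ℂ] Op (W × L) :=
  ampl post.map L ∘ₗ reix fun p : (Option S.M × W) × L => ((p.1.1, p.2), p.1.2)

/-- The part of a decryption query with salt `s`. -/
def decBlock (pre : Channel W ((R × S.C) × W)) (post : Channel (Option S.M × W) W) (s : R)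
    (h : Handler S L) : Op (W × L) →ₗ[ℂ] Op (W × L) :=
  decOut post L ∘ₗ ampl h.map W ∘ₗ decIn pre s L

/-- A decryption query. -/
def decStep (pre : Channel W ((R × S.C) × W)) (post : Channel (Option S.M × W) W)
    (h : R → Handler S L) : Op (W × L) →ₗ[ℂ] Op (W × L) :=
  ∑ s, decBlock pre post s (h s)

theorem decIn_cp (pre : Channel W ((R × S.C) × W)) (s : R) : IsCP (decIn pre s L) :=
  (reix_cp _).comp (pre.cp.ampl L)

theorem decOut_cp (post : Channel (Option S.M × W) W) : IsCP (decOut post L) :=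
  (post.cp.ampl L).comp (reix_cp _)

theorem decOut_tni (post : Channel (Option S.M × W) W) : TNI (decOut post L) :=
  (post.tp.tni.ampl L).comp' (reix_tp (⟨fun p => ((p.1.1, p.2), p.1.2),
    fun p => ((p.1.1, p.2), p.1.2), fun _ => rfl, fun _ => rfl⟩ :
    (Option S.M × W) × L ≃ (Option S.M × L) × W)).tni (reix_cp _)

/-- The salt is measured, so its outcomes share the weight of the state; handlers for different
salts therefore never compete for weight. -/
theorem sum_decIn_trace (pre : Channel W ((R × S.C) × W)) (ρ : Op (W × L)) :
    ∑ s, (decIn pre s L ρ).trace = ρ.trace := by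
  have h : ∀ Y : Op (((R × S.C) × W) × L), ∑ s, (reix (fun p : (S.C × L) × W =>
      (((s, p.1.1), p.2), p.1.2)) Y).trace = Y.trace := by
    intro Y
    simp only [Matrix.trace, Matrix.diag_apply, reix_apply, Fintype.sum_prod_type]
    exact Finset.sum_congr rfl fun _ _ => Finset.sum_congr rfl fun _ _ => Finset.sum_comm
  refine (h _).trans ?_
  rw [pre.tp.ampl]

theorem decBlock_cp (pre : Channel W ((R × S.C) × W)) (post : Channel (Option S.M × W) W) (s : R)
    (h : Handler S L) : IsCP (decBlock pre post s h) :=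
  (decOut_cp post).comp ((h.cp.ampl W).comp (decIn_cp pre s))

theorem decBlock_trace_le (pre : Channel W ((R × S.C) × W)) (post : Channel (Option S.M × W) W)
    (s : R) (h : Handler S L) {ρ : Op (W × L)} (hρ : ρ.PosSemidef) :
    (decBlock pre post s h ρ).trace.re ≤ (decIn pre s L ρ).trace.re :=
  ((decOut_tni post).comp' (h.tni.ampl W) (h.cp.ampl W)) _ ((decIn_cp pre s).posSemidef hρ)

theorem decStep_cp (pre : Channel W ((R × S.C) × W)) (post : Channel (Option S.M × W) W)
    (h : R → Handler S L) : IsCP (decStep pre post h) :=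
  IsCP.sum _ fun s _ => decBlock_cp pre post s (h s)

theorem decStep_tni (pre : Channel W ((R × S.C) × W)) (post : Channel (Option S.M × W) W)
    (h : R → Handler S L) : TNI (decStep pre post h) := by
  intro ρ hρ
  rw [← sum_decIn_trace pre ρ, decStep, LinearMap.sum_apply, Matrix.trace_sum, Complex.re_sum,
    Complex.re_sum]
  exact Finset.sum_le_sum fun s _ => decBlock_trace_le pre post s (h s) hρ

variable [DecidableEq R]

/-- A plaintext is submitted. -/
def encIn (pre : Channel W (S.M × W)) (L : Type) : Op (W × L) →ₗ[ℂ] Op (S.M × (W × L)) :=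
  reix (fun p : S.M × (W × L) => ((p.1, p.2.1), p.2.2)) ∘ₗ ampl pre.map L

/-- A ciphertext with salt `s` is processed. -/
def encOut (post : Channel ((R × S.C) × W) W) (s : R) (L : Type) :
    Op (S.C × (W × L)) →ₗ[ℂ] Op (W × L) :=
  ampl post.map L ∘ₗ pullOp fun p : ((R × S.C) × W) × L =>
    if p.1.1.1 = s then some (p.1.1.2, (p.1.2, p.2)) else none

/-- An encryption query that is answered by `Φ` with salt `s`. -/
def encStep (pre : Channel W (S.M × W)) (post : Channel ((R × S.C) × W) W) (s : R)
    (Φ : Op S.M →ₗ[ℂ] Op S.C) (L : Type) : Op (W × L) →ₗ[ℂ] Op (W × L) :=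
  encOut post s L ∘ₗ ampl Φ (W × L) ∘ₗ encIn pre L

/-- `slotIn` as a linear map. -/
def slotInLin (M B : Type) [Fintype M] [DecidableEq M] :
    Op (M × B) →ₗ[ℂ] Op (M × (B × (M × M))) where
  toFun := slotIn
  map_add' X Y := by simp [slotIn, kronecker_add]
  map_smul' z X := by simp [slotIn, kronecker_smul]

/-- An encryption query that is answered with an encryption of half of a maximally entangled state,
while the plaintext is stored. -/
def idealEncStep (pre : Channel W (S.M × W)) (post : Channel ((R × S.C) × W) W) (s : R)
    (Φ : Op S.M →ₗ[ℂ] Op S.C) (L : Type) : Op (W × L) →ₗ[ℂ] Op (W × (L × (S.M × S.M))) :=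
  reix (fun p : W × (L × (S.M × S.M)) => ((p.1, p.2.1), p.2.2)) ∘ₗ
    slotExt (encOut post s L) (S.M × S.M) ∘ₗ ampl Φ ((W × L) × (S.M × S.M)) ∘ₗ
    slotInLin S.M (W × L) ∘ₗ encIn pre L

theorem encIn_cp (pre : Channel W (S.M × W)) : IsCP (encIn pre L) :=
  (reix_cp _).comp (pre.cp.ampl L)

theorem encIn_tp (pre : Channel W (S.M × W)) : IsTP (encIn pre L) := fun ρ => by
  have h : (encIn pre L ρ).trace = (ampl pre.map L ρ).trace :=
    reix_trace_equiv (Equiv.prodAssoc _ _ _).symm _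
  rw [h, pre.tp.ampl]

theorem encOut_cp (post : Channel ((R × S.C) × W) W) (s : R) : IsCP (encOut post s L) :=
  (post.cp.ampl L).comp (pullOp_cp _)

theorem encOut_tp (post : Channel ((R × S.C) × W) W) (s : R) : IsTP (encOut post s L) := by
  have h : IsTP (pullOp fun p : ((R × S.C) × W) × L =>
      if p.1.1.1 = s then some (p.1.1.2, (p.1.2, p.2)) else none) :=
    pullOp_tp (h := fun p => (((s, p.1), p.2.1), p.2.2)) fun x i => by
      obtain ⟨⟨⟨s', c⟩, w⟩, l⟩ := x
      obtain ⟨c', w', l'⟩ := i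
      by_cases hs : s' = s <;> simp [hs]
      tauto
  intro ρ
  rw [encOut, LinearMap.comp_apply, post.tp.ampl, h]

theorem encStep_cp (pre : Channel W (S.M × W)) (post : Channel ((R × S.C) × W) W) (s : R)
    {Φ : Op S.M →ₗ[ℂ] Op S.C} (h : IsCP Φ) : IsCP (encStep pre post s Φ L) :=
  (encOut_cp post s).comp ((h.ampl _).comp (encIn_cp pre))

theorem encStep_tp (pre : Channel W (S.M × W)) (post : Channel ((R × S.C) × W) W) (s : R)
    {Φ : Op S.M →ₗ[ℂ] Op S.C} (h : IsTP Φ) : IsTP (encStep pre post s Φ L) := fun ρ => by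
  rw [encStep, LinearMap.comp_apply, LinearMap.comp_apply, encOut_tp, h.ampl, encIn_tp]

theorem slotInLin_cp {M B : Type} [Fintype M] [DecidableEq M] [Fintype B] :
    IsCP (slotInLin M B) := by
  classical
  have h : slotInLin M B = reix (fun p : M × (B × (M × M)) => ((p.2.2.2, p.2.1), (p.1, p.2.2.1)))
      ∘ₗ attachBell M (M × B) := by
    ext Y p q
    simp only [LinearMap.comp_apply, reix_apply, attachBell_apply, kroneckerMap_apply]
    exact mul_comm _ _
  rw [h]
  exact (reix_cp _).comp attachBell_cp

theorem idealEncStep_cp (pre : Channel W (S.M × W)) (post : Channel ((R × S.C) × W) W) (s : R)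
    {Φ : Op S.M →ₗ[ℂ] Op S.C} (h : IsCP Φ) : IsCP (idealEncStep pre post s Φ L) :=
  (reix_cp _).comp ((slotExt_cp (encOut_cp post s) _).comp ((h.ampl _).comp
    (slotInLin_cp.comp (encIn_cp pre))))

theorem idealEncStep_tni [Nonempty S.M] (pre : Channel W (S.M × W))
    (post : Channel ((R × S.C) × W) W) (s : R)
    {Φ : Op S.M →ₗ[ℂ] Op S.C} (h : IsCP Φ) (h' : IsTP Φ) : TNI (idealEncStep pre post s Φ L) := by
  intro ρ hρ
  have e : ∀ Y : Op ((W × L) × (S.M × S.M)),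
      (reix (fun p : W × (L × (S.M × S.M)) => ((p.1, p.2.1), p.2.2)) Y).trace = Y.trace :=
    fun Y => reix_trace_equiv (Equiv.prodAssoc _ _ _).symm _
  have hp := (slotInLin_cp (M := S.M)).posSemidef ((encIn_cp pre).posSemidef hρ)
  simp only [idealEncStep, LinearMap.comp_apply, e]
  refine (slotExt_tni (encOut_tp post s).tni _ _ ((h.ampl _).posSemidef hp)).trans (le_of_eq ?_)
  rw [h'.ampl]
  refine (congrArg Complex.re (slotIn_trace _)).trans ?_
  rw [encIn_tp]

end Oracles

/-! ### Hybrids over the encryption queries -/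

section Hybrids

variable {S : QScheme} {R W : Type} [Fintype R] [DecidableEq R] [Fintype W] [Nonempty S.M]

/-- The game with a random function `F` in which the first `b` encryption queries are answered by
the ideal functionality and the later ones by encryption.  Each query comes with the salt that is
used for its answer; a submitted ciphertext with salt `s` is treated by `h s`. -/
def hybrid (D : Decomposition S) (F : R → S.K) (f : Op W →ₗ[ℂ] ℂ) :
    ℕ → List (Query S.M (R × S.C) W × R) → (L : Type) → [Fintype L] → (R → Handler S L) →
      Op (W × L) →ₗ[ℂ] ℂ
  | _, [], _, _, _ => f ∘ₗ trR
  | b, (.dec pre post, _) :: qs, L, _, h => hybrid D F f b qs L h ∘ₗ decStep pre post h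
  -- From its use on, a salt is treated by decryption with its key, whatever `h` prescribed before.
  | 0, (.enc pre post, s) :: qs, L, _, h =>
      hybrid D F f 0 qs L (Function.update h s (Handler.real (F s) L)) ∘ₗ
        encStep pre post s (S.enc (F s)).map L
  | b + 1, (.enc pre post, s) :: qs, L, _, h =>
      ∑ r, ((D.p (F s) r : ℝ) : ℂ) •
        (hybrid D F f b qs (L × (S.M × S.M))
          (Function.update (fun s' => (h s').lift) s (Handler.ideal D (F s) r L)) ∘ₗ
          idealEncStep pre post s (D.encR (F s) r) L)

variable (D : Decomposition S) {F : R → S.K} {f : Op W →ₗ[ℂ] ℂ}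

theorem PosFn.sum_smul {E ι : Type} [Fintype ι] {w : ι → ℝ} (hw : ∀ i, 0 ≤ w i)
    {g : ι → Op E →ₗ[ℂ] ℂ} (hg : ∀ i, PosFn (g i)) : PosFn (∑ i, ((w i : ℝ) : ℂ) • g i) := by
  intro X hX
  rw [LinearMap.sum_apply]
  refine Finset.sum_nonneg fun i _ => ?_
  rw [LinearMap.smul_apply, smul_eq_mul]
  exact mul_nonneg (by exact_mod_cast hw i) (hg i X hX)

theorem SubTr.sum_smul {E ι : Type} [Fintype E] [Fintype ι] {w : ι → ℝ} (hw : ∀ i, 0 ≤ w i)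
    (hw1 : ∑ i, w i = 1) {g : ι → Op E →ₗ[ℂ] ℂ} (hg : ∀ i, SubTr (g i)) :
    SubTr (∑ i, ((w i : ℝ) : ℂ) • g i) := by
  intro X hX
  rw [LinearMap.sum_apply, Complex.re_sum, ← one_mul X.trace.re, ← hw1, Finset.sum_mul]
  refine Finset.sum_le_sum fun i _ => ?_
  rw [LinearMap.smul_apply, smul_eq_mul, Complex.re_ofReal_mul]
  exact mul_le_mul_of_nonneg_left (hg i X hX) (hw i)

theorem hybrid_pos (hf : PosFn f) (qs : List (Query S.M (R × S.C) W × R)) (b : ℕ) (L : Type)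
    [Fintype L] (h : R → Handler S L) : PosFn (hybrid D F f b qs L h) := by
  induction qs generalizing b L with
  | nil => cases b <;> exact hf.comp trR_cp
  | cons q qs ih =>
    obtain ⟨⟨pre, post⟩ | ⟨pre, post⟩, s⟩ := q
    · cases b
      · exact (ih 0 L _).comp (encStep_cp pre post s (S.enc _).cp)
      · exact PosFn.sum_smul (D.p_nonneg _) fun r =>
          (ih _ _ _).comp (idealEncStep_cp pre post s (D.encR_cp _ r))
    · cases b <;> exact (ih _ L h).comp (decStep_cp pre post h)

theorem hybrid_subTr (hf : SubTr f) (qs : List (Query S.M (R × S.C) W × R)) (b : ℕ) (L : Type)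
    [Fintype L] (h : R → Handler S L) : SubTr (hybrid D F f b qs L h) := by
  induction qs generalizing b L with
  | nil =>
    cases b <;> exact hf.comp trR_cp fun Y _ => (congrArg Complex.re (trR_trace Y)).le
  | cons q qs ih =>
    obtain ⟨⟨pre, post⟩ | ⟨pre, post⟩, s⟩ := q
    · cases b
      · exact (ih 0 L _).comp (encStep_cp pre post s (S.enc _).cp)
          (encStep_tp pre post s (S.enc _).tp).tni
      · exact SubTr.sum_smul (D.p_nonneg _) (D.p_sum _) fun r =>
          (ih _ _ _).comp (idealEncStep_cp pre post s (D.encR_cp _ r))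
            (idealEncStep_tni pre post s (D.encR_cp _ r) (D.encR_tp _ r))
    · cases b <;> exact (ih _ L h).comp (decStep_cp pre post h) (decStep_tni pre post h)

theorem hybrid_dec (b : ℕ) (pre : Channel W ((R × S.C) × W)) (post : Channel (Option S.M × W) W)
    (s : R) (qs : List (Query S.M (R × S.C) W × R)) (L : Type) [Fintype L] (h : R → Handler S L) :
    hybrid D F f b ((.dec pre post, s) :: qs) L h =
      hybrid D F f b qs L h ∘ₗ decStep pre post h := by
  cases b <;> rfl

theorem hybrid_nil (b : ℕ) (L : Type) [Fintype L] (h : R → Handler S L) :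
    hybrid D F f b [] L h = f ∘ₗ trR := by
  cases b <;> rfl

/-- Only the values of `F` at the salts of the queries matter. -/
theorem hybrid_congr {F' : R → S.K} (qs : List (Query S.M (R × S.C) W × R))
    (hF : ∀ s ∈ qs.map Prod.snd, F s = F' s) (b : ℕ) (L : Type) [Fintype L]
    (h : R → Handler S L) : hybrid D F f b qs L h = hybrid D F' f b qs L h := by
  induction qs generalizing b L with
  | nil => cases b <;> rfl
  | cons q qs ih =>
    have ih := fun b L [Fintype L] h => ih (fun s hs => hF s (List.mem_cons_of_mem _ hs)) b L h
    have hs : F q.2 = F' q.2 := hF _ (by simp)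
    obtain ⟨⟨pre, post⟩ | ⟨pre, post⟩, s⟩ := q
    · cases b
      · simp only [hybrid, ih]
        rw [hs]
      · simp only [hybrid, ih]
        rw [hs]
    · simp only [hybrid_dec, ih]

end Hybrids

/-! ### Oracle queries as steps of the game for one salt -/

section SaltSteps

variable {S : QScheme} {R W L : Type} [Fintype R] [DecidableEq R] [Fintype W] [Fintype L]

/-- An encryption query as a step of the game for the salt of another one. -/
def Step.ofEnc (pre : Channel W (S.M × W)) (post : Channel ((R × S.C) × W) W) (s : R) (k : S.K) :
    Step S.C S.M (W × L) where
  O := encStep pre post s (S.enc k).map L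
  pre := 0
  onAcc := 0
  onRej := 0
  O_cp := encStep_cp pre post s (S.enc k).cp
  pre_cp := IsCP.zero
  onAcc_cp := IsCP.zero
  onRej_cp := IsCP.zero
  tni ρ _ := by
    rw [encStep_tp pre post s (S.enc k).tp]
    simp
  onAcc_tni ρ hρ := by simpa using trace_re_nonneg hρ
  onRej_tni ρ hρ := by simpa using trace_re_nonneg hρ

/-- A decryption query as a step of the game for the salt `s`. -/
def Step.ofDec (pre : Channel W ((R × S.C) × W)) (post : Channel (Option S.M × W) W)
    (h : R → Handler S L) (s : R) : Step S.C S.M (W × L) where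
  O := ∑ s' ∈ Finset.univ.erase s, decBlock pre post s' (h s')
  pre := reix (fun p : S.C × (W × L) => ((p.1, p.2.2), p.2.1)) ∘ₗ decIn pre s L
  onAcc := decOut post L ∘ₗ
    reix (fun p : (Option S.M × L) × W => (p.1.1, (p.2, p.1.2))) ∘ₗ embSome S.M (W × L)
  onRej := decOut post L ∘ₗ
    reix (fun p : (Option S.M × L) × W => (p.1.1, (p.2, p.1.2))) ∘ₗ embNone S.M (W × L)
  O_cp := IsCP.sum _ fun s' _ => decBlock_cp pre post s' (h s')
  pre_cp := (reix_cp _).comp (decIn_cp pre s)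
  onAcc_cp := (decOut_cp post).comp ((reix_cp _).comp (pullOp_cp _))
  onRej_cp := (decOut_cp post).comp ((reix_cp _).comp (pullOp_cp _))
  tni ρ hρ := by
    have e : (reix (fun p : S.C × (W × L) => ((p.1, p.2.2), p.2.1)) (decIn pre s L ρ)).trace =
        (decIn pre s L ρ).trace :=
      reix_trace_equiv (⟨fun p => ((p.1, p.2.2), p.2.1), fun p => (p.1.1, (p.2, p.1.2)),
        fun _ => rfl, fun _ => rfl⟩ : S.C × (W × L) ≃ (S.C × L) × W) _
    rw [LinearMap.comp_apply, e, ← sum_decIn_trace pre ρ,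
      ← Finset.sum_erase_add _ _ (Finset.mem_univ s), Complex.add_re, LinearMap.sum_apply,
      Matrix.trace_sum, Complex.re_sum, Complex.re_sum]
    exact add_le_add (Finset.sum_le_sum fun s' _ => decBlock_trace_le pre post s' (h s') hρ) le_rfl
  onAcc_tni := (decOut_tni post).comp' ((reix_tp (⟨fun p => (p.1.1, (p.2, p.1.2)),
    fun p => ((p.1, p.2.2), p.2.1), fun _ => rfl, fun _ => rfl⟩ :
    (Option S.M × L) × W ≃ Option S.M × (W × L))).tni.comp' embSome_tp.tni (pullOp_cp _))
    ((reix_cp _).comp (pullOp_cp _))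
  onRej_tni := (decOut_tni post).comp' ((reix_tp (⟨fun p => (p.1.1, (p.2, p.1.2)),
    fun p => ((p.1, p.2.2), p.2.1), fun _ => rfl, fun _ => rfl⟩ :
    (Option S.M × L) × W ≃ Option S.M × (W × L))).tni.comp' embNone_tp.tni (pullOp_cp _))
    ((reix_cp _).comp (pullOp_cp _))

/-- The salt `s` is singled out of the measurement. All other salts belong to the part of the step
in which nothing is decrypted. -/
theorem Step.real_ofDec (pre : Channel W ((R × S.C) × W)) (post : Channel (Option S.M × W) W)
    (h : R → Handler S L) (s : R) (k : S.K) :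
    (Step.ofDec pre post h s).real (S.dec k).map =
      decStep pre post (Function.update h s (Handler.real k L)) := by
  have e : decBlock pre post s (Handler.real k L) =
      (Step.ofDec pre post h s).onAcc ∘ₗ accE (S.dec k).map (W × L) ∘ₗ
        (Step.ofDec pre post h s).pre +
      (Step.ofDec pre post h s).onRej ∘ₗ rejE (S.dec k).map (W × L) ∘ₗ
        (Step.ofDec pre post h s).pre := by
    ext1 ρ
    have e1 : ∀ Y : Op ((S.C × L) × W), ampl (ampl (S.decMeas k) L) W Y =
        reix (fun p : (Option S.M × L) × W => (p.1.1, (p.2, p.1.2)))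
          (ampl (S.decMeas k) (W × L) (reix (fun p : S.C × (W × L) => ((p.1, p.2.2), p.2.1)) Y)) :=
      fun Y => rfl
    simp only [decBlock, Handler.real, LinearMap.comp_apply, e1, LinearMap.add_apply]
    rw [QScheme.decMeas, ampl_measureBot, map_add, map_add]
    rfl
  rw [decStep, ← Finset.sum_erase_add _ _ (Finset.mem_univ s), Function.update_self, e, Step.real,
    ← add_assoc]
  congr 2
  exact Finset.sum_congr rfl fun s' hs' => by
    rw [Function.update_of_ne (Finset.ne_of_mem_erase hs')]

theorem Step.real_ofEnc (pre : Channel W (S.M × W)) (post : Channel ((R × S.C) × W) W) (s : R)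
    (k k' : S.K) : (Step.ofEnc pre post s k : Step S.C S.M (W × L)).real (S.dec k').map =
      encStep pre post s (S.enc k).map L := by
  simp [Step.real, Step.ofEnc]

/-- The reordering of `W (L (M'' M))` as `(W L) (M'' M)`. -/
def unassoc (W L N : Type) : Op (W × (L × N)) →ₗ[ℂ] Op ((W × L) × N) :=
  reix (Equiv.prodAssoc W L N)

theorem Step.ideal_ofEnc (D : Decomposition S) (pre : Channel W (S.M × W))
    (post : Channel ((R × S.C) × W) W) (s : R) (k k' : S.K) (r : D.T) :
    (Step.ofEnc pre post s k : Step S.C S.M (W × L)).ideal D k' r ∘ₗ unassoc W L (S.M × S.M) =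
      unassoc W L (S.M × S.M) ∘ₗ encStep pre post s (S.enc k).map (L × (S.M × S.M)) := by
  have e : (Step.ofEnc pre post s k : Step S.C S.M (W × L)).ideal D k' r =
      ampl (encStep pre post s (S.enc k).map L) (S.M × S.M) := by
    have h0 : ∀ {a b r : Type}, ampl (0 : Op a →ₗ[ℂ] Op b) r = 0 := fun {_ _ _} => rfl
    simp [Step.ideal, Step.mid, Step.ofEnc, h0]
  rw [e]
  ext1 Y
  set Z := ampl (S.enc k).map (W × (L × (S.M × S.M))) (encIn pre (L × (S.M × S.M)) Y) with hZ
  have h1 : ampl (encStep pre post s (S.enc k).map L) (S.M × S.M) (unassoc W L (S.M × S.M) Y) =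
      ampl (ampl post.map L) (S.M × S.M) (ampl (pullOp fun p : ((R × S.C) × W) × L =>
        if p.1.1.1 = s then some (p.1.1.2, (p.1.2, p.2)) else none) (S.M × S.M)
        (reix (fun p : (S.C × (W × L)) × (S.M × S.M) => (p.1.1, (p.1.2.1, (p.1.2.2, p.2)))) Z)) :=
    rfl
  have h2 : unassoc W L (S.M × S.M) (encStep pre post s (S.enc k).map (L × (S.M × S.M)) Y) =
      ampl (ampl post.map L) (S.M × S.M) (reix (Equiv.prodAssoc _ L (S.M × S.M))
        (pullOp (fun p : ((R × S.C) × W) × (L × (S.M × S.M)) =>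
          if p.1.1.1 = s then some (p.1.1.2, (p.1.2, p.2)) else none) Z)) := rfl
  rw [LinearMap.comp_apply, LinearMap.comp_apply, h1, h2, ampl_pullOp, pullOp_reix]
  congr 1
  ext x y
  simp only [reix_apply, pullOp_apply, Equiv.prodAssoc_apply]
  by_cases hx : x.1.1.1.1 = s <;> by_cases hy : y.1.1.1.1 = s <;> simp [hx, hy]

/-- The step tests with `W L` as its state and the slot apart, the handler with `L` and the slot as
its memory and `W` as a bystander; the two agree up to the order of registers. Other salts, success
and failure are matched separately. -/
theorem Step.ideal_ofDec [Nonempty S.M] (D : Decomposition S) (pre : Channel W ((R × S.C) × W))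
    (post : Channel (Option S.M × W) W)
    (h : R → Handler S L) (s : R) (k : S.K) (r : D.T) :
    (Step.ofDec pre post h s).ideal D k r ∘ₗ unassoc W L (S.M × S.M) =
      unassoc W L (S.M × S.M) ∘ₗ decStep pre post
        (Function.update (fun s' => (h s').lift) s (Handler.ideal D k r L)) := by
  ext1 Y
  have h1 : ampl (∑ s' ∈ Finset.univ.erase s, decBlock pre post s' (h s')) (S.M × S.M) (unassoc W L (S.M × S.M) Y) =
      unassoc W L (S.M × S.M) (∑ s' ∈ Finset.univ.erase s, decBlock pre post s' (h s').lift Y) := by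
    rw [ampl_sum, LinearMap.sum_apply, map_sum]
    rfl
  set A : Op (S.C × ((W × L) × (S.M × S.M))) :=
    reix (fun p : S.C × ((W × L) × (S.M × S.M)) => ((p.1, (p.2.1.2, p.2.2)), p.2.1.1)) (decIn pre s (L × (S.M × S.M)) Y)
    with hA
  have hpre : (Step.ofDec pre post h s).mid.pre (unassoc W L (S.M × S.M) Y) = A := rfl
  set Z := D.idealAcc k r (W × L) A with hZ
  have h2 : attachBell S.M (W × L) ((Step.ofDec pre post h s).onAcc Z) =
      unassoc W L (S.M × S.M) (decOut post (L × (S.M × S.M)) (ampl (embSome S.M (L × (S.M × S.M)) ∘ₗ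
        reix (fun p : S.M × (L × (S.M × S.M)) => ((p.1, p.2.1), p.2.2)) ∘ₗ
        attachBell S.M (S.M × L) ∘ₗ D.idealAcc k r L) W (decIn pre s (L × (S.M × S.M)) Y))) := by
    rw [attachBell_apply, ← ampl_kronecker]
    set B : Op ((S.M × L) × W) := ampl (D.idealAcc k r L) W (decIn pre s (L × (S.M × S.M)) Y) with hB
    have e1 : ampl (Step.ofDec pre post h s).onAcc (S.M × S.M) (Z ⊗ₖ bell S.M) =
        ampl (ampl post.map L) (S.M × S.M) (reix (fun p : ((Option S.M × W) × L) × (S.M × S.M) =>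
          ((p.1.1.1, (p.1.1.2, p.1.2)), p.2)) (ampl (embSome S.M (W × L)) (S.M × S.M) (Z ⊗ₖ bell S.M))) := rfl
    have e2 : unassoc W L (S.M × S.M) (decOut post (L × (S.M × S.M)) (ampl (embSome S.M (L × (S.M × S.M)) ∘ₗ
        reix (fun p : S.M × (L × (S.M × S.M)) => ((p.1, p.2.1), p.2.2)) ∘ₗ
        attachBell S.M (S.M × L) ∘ₗ D.idealAcc k r L) W (decIn pre s (L × (S.M × S.M)) Y))) =
        ampl (ampl post.map L) (S.M × S.M) (reix (fun p : ((Option S.M × W) × L) × (S.M × S.M) =>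
          ((p.1.1.1, (p.1.2, p.2)), p.1.1.2)) (ampl (embSome S.M (L × (S.M × S.M)) ∘ₗ
            reix (fun p : S.M × (L × (S.M × S.M)) => ((p.1, p.2.1), p.2.2)) ∘ₗ
            attachBell S.M (S.M × L)) W B)) := rfl
    rw [e1, e2]
    congr 1
    ext ⟨⟨⟨p, w⟩, l⟩, n⟩ ⟨⟨⟨q, w'⟩, l'⟩, n'⟩
    simp only [reix_apply, ampl_apply, LinearMap.comp_apply, embSome, pullOp_apply]
    cases p <;> cases q <;> rfl
  have h3 : (Step.ofDec pre post h s).mid.onRej (trL (actCM (1 - D.encBell k r) A)) =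
      unassoc W L (S.M × S.M) (decOut post (L × (S.M × S.M)) (ampl (embNone S.M (L × (S.M × S.M)) ∘ₗ trL ∘ₗ
        actCM (1 - D.encBell k r)) W (decIn pre s (L × (S.M × S.M)) Y))) := by
    set B : Op ((L × (S.M × S.M)) × W) := ampl (trL ∘ₗ actCM (1 - D.encBell k r)) W
      (decIn pre s (L × (S.M × S.M)) Y) with hB
    have hBZ : ∀ i j, B i j = trL (actCM (1 - D.encBell k r) A) ((i.2, i.1.1), i.1.2)
        ((j.2, j.1.1), j.1.2) := fun i j => by
      rw [hB, ampl_comp, LinearMap.comp_apply, ampl_apply, trL_apply, trL_apply]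
      rfl
    have e1 : (Step.ofDec pre post h s).mid.onRej (trL (actCM (1 - D.encBell k r) A)) =
        ampl (ampl post.map L) (S.M × S.M) (reix (fun p : ((Option S.M × W) × L) × (S.M × S.M) =>
          ((p.1.1.1, (p.1.1.2, p.1.2)), p.2)) (ampl (embNone S.M (W × L)) (S.M × S.M)
            (trL (actCM (1 - D.encBell k r) A)))) := rfl
    have e2 : unassoc W L (S.M × S.M) (decOut post (L × (S.M × S.M)) (ampl (embNone S.M (L × (S.M × S.M)) ∘ₗ trL ∘ₗ
        actCM (1 - D.encBell k r)) W (decIn pre s (L × (S.M × S.M)) Y))) =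
        ampl (ampl post.map L) (S.M × S.M) (reix (fun p : ((Option S.M × W) × L) × (S.M × S.M) =>
          ((p.1.1.1, (p.1.2, p.2)), p.1.1.2)) (ampl (embNone S.M (L × (S.M × S.M))) W B)) := rfl
    rw [e1, e2]
    congr 1
    ext ⟨⟨⟨p, w⟩, l⟩, n⟩ ⟨⟨⟨q, w'⟩, l'⟩, n'⟩
    simp only [reix_apply, ampl_apply, embNone, pullOp_apply]
    cases p <;> cases q <;> simp [hBZ]
  have hR : decStep pre post (Function.update (fun s' => (h s').lift) s (Handler.ideal D k r L)) Y =
      ∑ s' ∈ Finset.univ.erase s, decBlock pre post s' (h s').lift Y +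
        decBlock pre post s (Handler.ideal D k r L) Y := by
    rw [decStep, ← Finset.sum_erase_add _ _ (Finset.mem_univ s), Function.update_self,
      LinearMap.add_apply, LinearMap.sum_apply]
    congr 1
    exact Finset.sum_congr rfl fun s' hs' => by
      rw [Function.update_of_ne (Finset.ne_of_mem_erase hs')]
  rw [LinearMap.comp_apply, LinearMap.comp_apply, hR, map_add, ← h1]
  have hI : decBlock pre post s (Handler.ideal D k r L) Y =
      decOut post (L × (S.M × S.M)) (ampl (embSome S.M (L × (S.M × S.M)) ∘ₗ
        reix (fun p : S.M × (L × (S.M × S.M)) => ((p.1, p.2.1), p.2.2)) ∘ₗ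
        attachBell S.M (S.M × L) ∘ₗ D.idealAcc k r L) W (decIn pre s (L × (S.M × S.M)) Y)) +
      decOut post (L × (S.M × S.M)) (ampl (embNone S.M (L × (S.M × S.M)) ∘ₗ trL ∘ₗ
        actCM (1 - D.encBell k r)) W (decIn pre s (L × (S.M × S.M)) Y)) := by
    rw [← map_add, ← LinearMap.add_apply, ← ampl_add]
    rfl
  rw [hI, map_add, ← h2, ← h3, ← add_assoc, Step.ideal]
  simp only [LinearMap.add_apply, LinearMap.comp_apply]
  rw [hpre]
  rfl

end SaltSteps

/-! ### Resampling one value of the random function -/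

section Resample

variable {R K : Type} [Fintype R] [DecidableEq R] [Fintype K] [Nonempty K]

/-- The value at `s` is uniform and independent of the others. This is what turns a salt into a
fresh key. -/
theorem avg_resample (s : R) (g : (R → K) → ℝ) :
    avg (fun F => avg fun k => g (Function.update F s k)) = avg g := by
  classical
  set e := Equiv.funSplitAt s K with he
  have hu : ∀ (F : R → K) k, Function.update F s k = e.symm (k, (e F).2) := by
    intro F k
    funext x
    by_cases hx : x = s
    · subst hx
      simp [he]
    · simp [he, hx]
  have h1 : ∑ F, ∑ k, g (Function.update F s k) = Fintype.card K * ∑ F, g F := by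
    simp only [hu]
    rw [← Equiv.sum_comp e.symm g, Fintype.sum_prod_type,
      ← Equiv.sum_comp e.symm fun F => ∑ k, g (e.symm (k, (e F).2)), Fintype.sum_prod_type]
    simp only [Equiv.apply_symm_apply, Finset.sum_const, Finset.card_univ, nsmul_eq_mul]
    rw [Finset.sum_comm]
  have hc : (Fintype.card K : ℝ) ≠ 0 := by
    exact_mod_cast Fintype.card_ne_zero
  simp only [avg, ← Finset.mul_sum]
  rw [h1]
  field_simp

end Resample

/-! ### From one hybrid to the next -/

section HybridStep

variable {S : QScheme} {R W : Type} [Fintype R] [DecidableEq R] [Fintype W]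

/-- The queries that follow an encryption query with salt `s`, as steps of the game for `s`. -/
def saltSteps (F : R → S.K) (s : R) {L : Type} [Fintype L] :
    List (Query S.M (R × S.C) W × R) → (R → Handler S L) → List (Step S.C S.M (W × L))
  | [], _ => []
  | (.enc pre post, s') :: qs, h =>
      Step.ofEnc pre post s' (F s') ::
        saltSteps F s qs (Function.update h s' (Handler.real (F s') L))
  | (.dec pre post, _) :: qs, h => Step.ofDec pre post h s :: saltSteps F s qs h

theorem saltSteps_length (F : R → S.K) (s : R) {L : Type} [Fintype L]
    (qs : List (Query S.M (R × S.C) W × R)) (h : R → Handler S L) :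
    (saltSteps F s qs h).length = qs.length := by
  induction qs generalizing h with
  | nil => rfl
  | cons q qs ih => obtain ⟨⟨pre, post⟩ | ⟨pre, post⟩, s'⟩ := q <;> simp [saltSteps, ih]

variable [Nonempty S.M] (D : Decomposition S) (f : Op W →ₗ[ℂ] ℂ) {L : Type} [Fintype L]

/-- Distinct salts are essential: another encryption with salt `s` would reuse the key and replace
the handler. -/
theorem hybrid_eq_runSteps_real (F : R → S.K) (s : R) (k : S.K)
    (qs : List (Query S.M (R × S.C) W × R)) (hs : s ∉ qs.map Prod.snd) (h : R → Handler S L) :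
    hybrid D F f 0 qs L (Function.update h s (Handler.real k L)) =
      runSteps (Step.real (S.dec k).map) (f ∘ₗ trR) (saltSteps F s qs h) := by
  induction qs generalizing h with
  | nil => rfl
  | cons q qs ih =>
    simp only [List.map_cons, List.mem_cons, not_or] at hs
    obtain ⟨⟨pre, post⟩ | ⟨pre, post⟩, s'⟩ := q
    · rw [hybrid, saltSteps, runSteps, Step.real_ofEnc, ← ih hs.2, Function.update_comm hs.1]
    · rw [hybrid_dec, saltSteps, runSteps, Step.real_ofDec, ih hs.2]

theorem hybrid_eq_runSteps_ideal (F : R → S.K) (s : R) (k : S.K) (r : D.T)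
    (qs : List (Query S.M (R × S.C) W × R)) (hs : s ∉ qs.map Prod.snd) (h : R → Handler S L) :
    hybrid D F f 0 qs (L × (S.M × S.M))
        (Function.update (fun s' => (h s').lift) s (Handler.ideal D k r L)) =
      runSteps (Step.ideal D k r) (f ∘ₗ trR ∘ₗ trR) (saltSteps F s qs h) ∘ₗ
        unassoc W L (S.M × S.M) := by
  induction qs generalizing h with
  | nil =>
    rw [hybrid_nil, saltSteps, runSteps, LinearMap.comp_assoc, LinearMap.comp_assoc]
    congr 1
    ext Y i j
    simp only [LinearMap.comp_apply, trR_apply, unassoc, reix_apply, Fintype.sum_prod_type,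
      Equiv.prodAssoc_apply]
  | cons q qs ih =>
    simp only [List.map_cons, List.mem_cons, not_or] at hs
    obtain ⟨⟨pre, post⟩ | ⟨pre, post⟩, s'⟩ := q
    · have e : Function.update (Function.update (fun s' => (h s').lift) s (Handler.ideal D k r L))
          s' (Handler.real (F s') _) = Function.update (fun s'' =>
            (Function.update h s' (Handler.real (F s') L) s'').lift) s (Handler.ideal D k r L) := by
        rw [Function.update_comm hs.1]
        congr 1
        funext x
        by_cases hx : x = s'
        · subst hx
          simp [Handler.lift_real]
        · simp [hx]
      rw [hybrid, saltSteps, runSteps, e, ih hs.2, LinearMap.comp_assoc, LinearMap.comp_assoc,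
        Step.ideal_ofEnc]
    · rw [hybrid_dec, saltSteps, runSteps, ih hs.2, LinearMap.comp_assoc, LinearMap.comp_assoc,
        Step.ideal_ofDec]

theorem Matrix.PosSemidef.ofReal_smul {a : Type} {X : Op a} (hX : X.PosSemidef) {c : ℝ}
    (hc : 0 ≤ c) : ((c : ℂ) • X).PosSemidef := hX.smul (by exact_mod_cast hc)

variable {D f}

/-- With all values of `F` except `F(s)` fixed, the attacker of the single-key game can answer the
queries for other salts itself, so `QCABound.real_sub_ideal_le` applies. -/
theorem hybrid_zero_sub_one_le {μ : ℝ} (hμ : 0 < μ) (hμ1 : μ ≤ 1)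
    (hQ : QCABound D (μ ^ 4)) [Nonempty S.C] (hM : 2 ≤ Fintype.card S.M)
    (hc : ∀ k, diamondNorm ((S.dec k).map ∘ₗ (S.enc k).map - embedBot S.M) ≤
      ENNReal.ofReal (μ ^ 4)) (hf : PosFn f) (hf' : SubTr f) (F : R → S.K) (s : R)
    (pre : Channel W (S.M × W)) (post : Channel ((R × S.C) × W) W)
    (qs : List (Query S.M (R × S.C) W × R)) (hs : s ∉ qs.map Prod.snd) (h : R → Handler S L)
    {ρ : Op (W × L)} (hρ : ρ.PosSemidef) :
    |(avg fun k => (hybrid D (Function.update F s k) f 0 ((.enc pre post, s) :: qs) L h ρ).re) -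
      avg fun k => (hybrid D (Function.update F s k) f 1 ((.enc pre post, s) :: qs) L h ρ).re| ≤
      400 * (qs.length + 1) ^ 3 * μ * ρ.trace.re := by
  have hF : ∀ k, ∀ s' ∈ qs.map Prod.snd, Function.update F s k s' = F s' := fun k s' hs' =>
    Function.update_of_ne (fun e => hs (by rwa [← e])) _ _
  have e0 : ∀ k, hybrid D (Function.update F s k) f 0 ((.enc pre post, s) :: qs) L h ρ =
      runSteps (Step.real (S.dec k).map) (f ∘ₗ trR) (saltSteps F s qs h)
        (encOut post s L (ampl (S.enc k).map (W × L) (encIn pre L ρ))) := by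
    intro k
    rw [hybrid, hybrid_congr D qs (hF k), Function.update_self,
      hybrid_eq_runSteps_real D f F s k qs hs]
    rfl
  have e1 : ∀ k, (hybrid D (Function.update F s k) f 1 ((.enc pre post, s) :: qs) L h ρ).re =
      ∑ r, D.p k r * (runSteps (Step.ideal D k r) ((f ∘ₗ trR) ∘ₗ trR) (saltSteps F s qs h)
        (slotExt (encOut post s L) (S.M × S.M) (ampl (D.encR k r) ((W × L) × (S.M × S.M))
          (slotIn (encIn pre L ρ))))).re := by
    intro k
    rw [hybrid, LinearMap.sum_apply, Complex.re_sum, Function.update_self]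
    refine Finset.sum_congr rfl fun r _ => ?_
    rw [LinearMap.smul_apply, smul_eq_mul, Complex.re_ofReal_mul, hybrid_congr D qs (hF k),
      hybrid_eq_runSteps_ideal D f F s k r qs hs]
    rfl
  have hρ' := (encIn_cp pre (L := L)).posSemidef hρ
  have key := hQ.real_sub_ideal_le hμ hμ1 hM hc (encOut_cp post s) (encOut_tp post s).tni hρ'
    (hf.comp trR_cp) (hf'.comp trR_cp fun Y _ => (congrArg Complex.re (trR_trace Y)).le)
    (saltSteps F s qs h)
  rw [saltSteps_length, encIn_tp] at key
  simp only [e0, e1]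
  exact key

/-- The induction walks to the encryption query at which the hybrids differ. State and handlers may
depend on `F`, but not on its values at salts still to come, so `F(s)` is still uniform when its
query is reached. -/
theorem hybrid_sub_succ_le {μ : ℝ} (hμ : 0 < μ) (hμ1 : μ ≤ 1)
    (hQ : QCABound D (μ ^ 4)) [Nonempty S.C] (hM : 2 ≤ Fintype.card S.M)
    (hc : ∀ k, diamondNorm ((S.dec k).map ∘ₗ (S.enc k).map - embedBot S.M) ≤
      ENNReal.ofReal (μ ^ 4)) (hf : PosFn f) (hf' : SubTr f) {n : ℕ}
    (qs : List (Query S.M (R × S.C) W × R)) (hn : qs.length ≤ n) (hqs : (qs.map Prod.snd).Nodup)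
    (b : ℕ) (L : Type) [Fintype L]
    (h : (R → S.K) → R → Handler S L) (ρ : (R → S.K) → Op (W × L)) (hρ : ∀ F, (ρ F).PosSemidef)
    (hh : ∀ s ∈ qs.map Prod.snd, ∀ F k, h (Function.update F s k) = h F)
    (hρ' : ∀ s ∈ qs.map Prod.snd, ∀ F k, ρ (Function.update F s k) = ρ F) :
    |(avg fun F => (hybrid D F f b qs L (h F) (ρ F)).re) -
      avg fun F => (hybrid D F f (b + 1) qs L (h F) (ρ F)).re| ≤
      400 * (n + 1) ^ 3 * μ * avg fun F => (ρ F).trace.re := by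
  induction qs generalizing b L with
  -- The list had at most `b` encryption queries, so the two hybrids coincide.
  | nil =>
    simp only [hybrid_nil, sub_self, abs_zero]
    exact mul_nonneg (by positivity) (avg_nonneg fun F => trace_re_nonneg (hρ F))
  | cons q qs ih =>
    rw [List.length_cons] at hn
    rw [List.map_cons, List.nodup_cons] at hqs
    have hmem : ∀ s ∈ qs.map Prod.snd, s ∈ (q :: qs).map Prod.snd := fun s hs => by
      rw [List.map_cons]
      exact List.mem_cons_of_mem _ hs
    have ih := ih (by omega) hqs.2
    obtain ⟨⟨pre, post⟩ | ⟨pre, post⟩, s⟩ := q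
    · have hne : ∀ s' ∈ qs.map Prod.snd, ∀ (F : R → S.K) k, Function.update F s' k s = F s :=
        fun s' hs' F k => Function.update_of_ne (fun e => hqs.1 (by rwa [e])) _ _
      cases b with
      | zero =>
        have hs : s ∈ ((Query.enc pre post, s) :: qs).map Prod.snd := by simp
        rw [← avg_resample s, ← avg_resample s (fun F => (hybrid D F f (0 + 1) _ L _ _).re),
          ← avg_sub]
        refine (abs_avg_le _).trans ?_
        rw [← avg_mul]
        refine avg_mono fun F => ?_
        simp only [hh s hs, hρ' s hs]
        refine (hybrid_zero_sub_one_le hμ hμ1 hQ hM hc hf hf' F s pre post qs hqs.1 (h F)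
          (hρ F)).trans ?_
        refine mul_le_mul_of_nonneg_right ?_ (trace_re_nonneg (hρ F))
        have : (qs.length : ℝ) ≤ n := by exact_mod_cast (by omega : qs.length ≤ n)
        gcongr
      | succ b =>
        have e : ∀ b F, (hybrid D F f (b + 1) ((.enc pre post, s) :: qs) L (h F) (ρ F)).re =
            ∑ r, (hybrid D F f b qs (L × (S.M × S.M)) (Function.update (fun s' => (h F s').lift) s
              (Handler.ideal D (F s) r L)) (((D.p (F s) r : ℝ) : ℂ) •
                idealEncStep pre post s (D.encR (F s) r) L (ρ F))).re := by
          intro b F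
          rw [hybrid, LinearMap.sum_apply, Complex.re_sum]
          refine Finset.sum_congr rfl fun r _ => ?_
          rw [map_smul]
          rfl
        simp only [e]
        -- The probability of `r` depends on `F` and is absorbed into the state. The induction
        -- hypothesis allows unnormalised states because its bound is homogeneous in the trace.
        rw [avg_sum, avg_sum, ← Finset.sum_sub_distrib]
        refine (Finset.abs_sum_le_sum_abs _ _).trans ((Finset.sum_le_sum fun r _ =>
          ih b (L × (S.M × S.M)) (fun F => Function.update (fun s' => (h F s').lift) s
              (Handler.ideal D (F s) r L)) (fun F => ((D.p (F s) r : ℝ) : ℂ) •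
                idealEncStep pre post s (D.encR (F s) r) L (ρ F)) (fun F =>
            ((idealEncStep_cp pre post s (D.encR_cp _ r)).posSemidef (hρ F)).ofReal_smul
              (D.p_nonneg _ r)) (fun s' hs' F k => by
              simp only [hh s' (hmem s' hs'), hne s' hs']) (fun s' hs' F k => by
              simp only [hρ' s' (hmem s' hs'), hne s' hs'])).trans ?_)
        rw [← Finset.mul_sum, ← avg_sum]
        refine mul_le_mul_of_nonneg_left (avg_mono fun F => ?_) (by positivity)
        rw [← one_mul (ρ F).trace.re, ← D.p_sum (F s), Finset.sum_mul]
        refine Finset.sum_le_sum fun r _ => ?_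
        rw [Matrix.trace_smul, smul_eq_mul, Complex.re_ofReal_mul]
        exact mul_le_mul_of_nonneg_left (idealEncStep_tni pre post s (D.encR_cp _ r)
          (D.encR_tp _ r) _ (hρ F)) (D.p_nonneg _ r)
    · simp only [hybrid_dec, LinearMap.comp_apply]
      refine (ih b L h (fun F => decStep pre post (h F) (ρ F)) (fun F =>
        (decStep_cp pre post _).posSemidef (hρ F)) (fun s' hs' => hh s' (hmem s' hs'))
        (fun s' hs' F k => by simp only [hh s' (hmem s' hs'), hρ' s' (hmem s' hs')])).trans ?_
      exact mul_le_mul_of_nonneg_left (avg_mono fun F => decStep_tni pre post _ _ (hρ F))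
        (by positivity)

end HybridStep

/-! ### Rejecting ciphertexts with unused salts -/

section Forgeries

variable {S : QScheme} {R W L : Type} [Fintype R] [Fintype W] [Fintype L]

/-- The two treatments agree on the rejecting branch, so their difference is confined to acceptance.
-/
theorem abs_decBlock_real_sub_null_le {g : Op (W × L) →ₗ[ℂ] ℂ} (hg : PosFn g) (hg' : SubTr g)
    (pre : Channel W ((R × S.C) × W)) (post : Channel (Option S.M × W) W) (s : R) (k : S.K)
    {ρ : Op (W × L)} (hρ : ρ.PosSemidef) :
    |(g (decBlock pre post s (Handler.real k L) ρ)).re -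
      (g (decBlock pre post s (Handler.null S L) ρ)).re| ≤
      2 * (accE (S.dec k).map (L × W) (reix (fun p : S.C × (L × W) => ((p.1, p.2.1), p.2.2))
        (decIn pre s L ρ))).trace.re := by
  set Z := reix (fun p : S.C × (L × W) => ((p.1, p.2.1), p.2.2)) (decIn pre s L ρ) with hZ
  have hZp : Z.PosSemidef := (reix_cp _).posSemidef ((decIn_cp pre s).posSemidef hρ)
  set out := decOut post L ∘ₗ reix (fun p : (Option S.M × L) × W => (p.1.1, (p.1.2, p.2)))
    with hout
  have ocp : IsCP out := (decOut_cp post).comp (reix_cp _)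
  have otni : TNI out := (decOut_tni post).comp' (reix_tp (Equiv.prodAssoc _ _ _)).tni (reix_cp _)
  have e1 : decBlock pre post s (Handler.real k L) ρ =
      out (embSome S.M (L × W) (accE (S.dec k).map (L × W) Z)) +
        out (embNone S.M (L × W) (rejE (S.dec k).map (L × W) Z)) := by
    rw [← map_add, ← ampl_measureBot]
    rfl
  have e2 : decBlock pre post s (Handler.null S L) ρ =
      out (embNone S.M (L × W) (trL Z)) := by
    have h1 : ampl (embNone S.M L ∘ₗ trL) W (decIn pre s L ρ) =
        reix (fun p : (Option S.M × L) × W => (p.1.1, (p.1.2, p.2)))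
          (embNone S.M (L × W) (trL Z)) := by
      rw [ampl_comp, LinearMap.comp_apply, ampl_trL, embNone, ampl_pullOp]
      ext ⟨⟨p, l⟩, w⟩ ⟨⟨q, l'⟩, w'⟩
      rw [pullOp_apply, reix_apply, embNone, pullOp_apply]
      cases p <;> cases q <;> rfl
    rw [decBlock, LinearMap.comp_apply, LinearMap.comp_apply]
    exact congrArg _ h1
  rw [e1, e2, ← trL_accE_add_rejE (S.dec k).tp Z, map_add, map_add, map_add, map_add]
  have ha := (accE_cp (S.dec k).cp (L × W)).posSemidef hZp
  have p1 : IsCP (out ∘ₗ embSome S.M (L × W)) := ocp.comp (pullOp_cp _)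
  have p2 : IsCP (out ∘ₗ embNone S.M (L × W) ∘ₗ trL (a := S.M)) :=
    ocp.comp ((pullOp_cp _).comp trL_cp)
  have b1 := hg.re_nonneg (p1.posSemidef ha)
  have b2 := hg.re_nonneg (p2.posSemidef ha)
  have c1 := (hg' _ (p1.posSemidef ha)).trans (otni _ ((pullOp_cp _).posSemidef ha))
  have c2 := (hg' _ (p2.posSemidef ha)).trans (otni _ ((pullOp_cp _).posSemidef
    (trL_cp.posSemidef ha)))
  have d1 : (embSome S.M (L × W) (accE (S.dec k).map (L × W) Z)).trace =
    (accE (S.dec k).map (L × W) Z).trace := embSome_tp _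
  have d2 : (embNone S.M (L × W) (trL (accE (S.dec k).map (L × W) Z))).trace =
    (accE (S.dec k).map (L × W) Z).trace := (embNone_tp _).trans (trL_trace _)
  have c1' := c1.trans (le_of_eq (congrArg Complex.re d1))
  have c2' := c2.trans (le_of_eq (congrArg Complex.re d2))
  simp only [LinearMap.comp_apply] at b1 b2 c1' c2'
  rw [Complex.add_re, Complex.add_re, abs_le]
  constructor <;> linarith

variable [DecidableEq R] [Nonempty S.M]

/-- Decryption for salts in `A`, and rejection for all others. -/
def usedOnly (L : Type) [Fintype L] (A : Finset R) (F : R → S.K) : R → Handler S L := fun s =>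
  if s ∈ A then Handler.real (F s) L else Handler.null S L

/-- A salt outside `A` is unused, so its key is independent of the state and `QCABound.forge` bounds
acceptance by `2ε`, doubled by `abs_decBlock_real_sub_null_le`. Rejection keeps the state
independent of that key, which preserves the invariant `hρ'`. -/
theorem hybrid_real_sub_usedOnly_le {D : Decomposition S} {ε : ℝ} (hQ : QCABound D ε) (hε : 0 ≤ ε)
    [Nonempty S.C] (hM : 2 ≤ Fintype.card S.M) {f : Op W →ₗ[ℂ] ℂ} (hf : PosFn f) (hf' : SubTr f)
    (qs : List (Query S.M (R × S.C) W × R)) (A : Finset R) (ρ : (R → S.K) → Op (W × L))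
    (hρ : ∀ F, (ρ F).PosSemidef) (hρ' : ∀ s ∉ A, ∀ F k, ρ (Function.update F s k) = ρ F) :
    |(avg fun F => (hybrid D F f 0 qs L (fun s => Handler.real (F s) L) (ρ F)).re) -
      avg fun F => (hybrid D F f 0 qs L (usedOnly L A F) (ρ F)).re| ≤
      qs.length * (4 * ε * avg fun F => (ρ F).trace.re) := by
  induction qs generalizing A ρ with
  | nil => simp [hybrid_nil]
  | cons q qs ih =>
    have hT : 0 ≤ avg fun F => (ρ F).trace.re := avg_nonneg fun F => trace_re_nonneg (hρ F)
    rw [List.length_cons, Nat.cast_succ]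
    obtain ⟨⟨pre, post⟩ | ⟨pre, post⟩, s⟩ := q
    · have e1 : ∀ F : R → S.K, Function.update (fun s => Handler.real (F s) L) s
          (Handler.real (F s) L) = fun s => Handler.real (F s) L := fun F =>
        Function.update_eq_self s _
      -- An encryption query moves its salt into the used set.
      have e2 : ∀ F : R → S.K, Function.update (usedOnly L A F) s (Handler.real (F s) L) =
          usedOnly L (insert s A) F := by
        intro F
        funext x
        by_cases hx : x = s
        · subst hx
          simp [usedOnly]
        · simp [usedOnly, hx]
      simp only [hybrid, e1, e2, LinearMap.comp_apply]
      refine (ih (insert s A) (fun F => encStep pre post s (S.enc (F s)).map L (ρ F))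
        (fun F => (encStep_cp pre post s (S.enc _).cp).posSemidef (hρ F)) ?_).trans ?_
      · intro s' hs' F k
        simp only [Finset.mem_insert, not_or] at hs'
        simp only [hρ' s' hs'.2, Function.update_of_ne (Ne.symm hs'.1)]
      · simp only [encStep_tp pre post s (S.enc _).tp _]
        nlinarith
    · simp only [hybrid_dec, LinearMap.comp_apply]
      have h1 := ih A (fun F => decStep pre post (usedOnly L A F) (ρ F))
        (fun F => (decStep_cp pre post _).posSemidef (hρ F)) (fun s' hs' F k => by
          have : usedOnly L A (Function.update F s' k) = (usedOnly L A F : R → Handler S L) := by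
            funext x
            by_cases hx : x ∈ A
            · have : x ≠ s' := fun e => hs' (by rwa [← e])
              simp [usedOnly, hx, this]
            · simp [usedOnly, hx]
          simp only [this, hρ' s' hs'])
      have h2 : (avg fun F => (decStep pre post (usedOnly L A F) (ρ F)).trace.re) ≤
          avg fun F => (ρ F).trace.re := avg_mono fun F => decStep_tni pre post _ _ (hρ F)
      -- Only the current query changes. The later ones still decrypt, and the whole continuation is
      -- an effect, so it does not enlarge the difference.
      have h3 : |(avg fun F => (hybrid D F f 0 qs L (fun s => Handler.real (F s) L)
            (decStep pre post (fun s => Handler.real (F s) L) (ρ F))).re) -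
          avg fun F => (hybrid D F f 0 qs L (fun s => Handler.real (F s) L)
            (decStep pre post (usedOnly L A F) (ρ F))).re| ≤
          4 * ε * avg fun F => (ρ F).trace.re := by
        rw [← avg_sub]
        set Z : R → (R → S.K) → Op (S.C × (L × W)) := fun s F =>
          reix (fun p : S.C × (L × W) => ((p.1, p.2.1), p.2.2)) (decIn pre s L (ρ F)) with hZ
        have step : ∀ F, |(hybrid D F f 0 qs L (fun s => Handler.real (F s) L)
            (decStep pre post (fun s => Handler.real (F s) L) (ρ F))).re -
            (hybrid D F f 0 qs L (fun s => Handler.real (F s) L)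
            (decStep pre post (usedOnly L A F) (ρ F))).re| ≤
            ∑ s ∈ Finset.univ.filter (· ∉ A),
              2 * (accE (S.dec (F s)).map (L × W) (Z s F)).trace.re := by
          intro F
          rw [decStep, decStep, LinearMap.sum_apply, LinearMap.sum_apply, map_sum, map_sum,
            Complex.re_sum, Complex.re_sum, ← Finset.sum_sub_distrib, Finset.sum_filter]
          refine (Finset.abs_sum_le_sum_abs _ _).trans (Finset.sum_le_sum fun s _ => ?_)
          by_cases hs : s ∈ A
          · simp [usedOnly, hs]
          · simp only [usedOnly, hs, if_false, not_false_eq_true, if_true]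
            exact abs_decBlock_real_sub_null_le (hybrid_pos D hf qs 0 L _)
              (hybrid_subTr D hf' qs 0 L _) pre post s (F s) (hρ F)
        refine (abs_avg_le _).trans ((avg_mono step).trans ?_)
        rw [avg_sum]
        have each : ∀ s ∈ Finset.univ.filter (· ∉ A),
            (avg fun F => 2 * (accE (S.dec (F s)).map (L × W) (Z s F)).trace.re) ≤
            4 * ε * avg fun F => (decIn pre s L (ρ F)).trace.re := by
          intro s hs
          rw [Finset.mem_filter] at hs
          rw [← avg_resample s, ← avg_mul]
          refine avg_mono fun F => ?_
          have hz : ∀ k, Z s (Function.update F s k) = Z s F := fun k => by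
            simp only [hZ, hρ' s hs.2]
          simp only [hz, Function.update_self]
          have hZp : (Z s F).PosSemidef :=
            (reix_cp _).posSemidef ((decIn_cp pre s).posSemidef (hρ F))
          have := hQ.forge hε hM hZp
          have ht : (Z s F).trace = (decIn pre s L (ρ F)).trace :=
            reix_trace_equiv (Equiv.prodAssoc _ _ _).symm _
          rw [ht] at this
          rw [avg_mul]
          linarith
        refine (Finset.sum_le_sum each).trans ?_
        rw [← Finset.mul_sum, ← avg_sum]
        refine mul_le_mul_of_nonneg_left (avg_mono fun F => ?_) (by positivity)
        rw [← sum_decIn_trace pre (ρ F), Complex.re_sum]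
        exact Finset.sum_le_sum_of_subset_of_nonneg (Finset.subset_univ _) fun s _ _ =>
          trace_re_nonneg ((decIn_cp pre s).posSemidef (hρ F))
      refine (abs_sub_le _ _ _).trans ((add_le_add h3 h1).trans ?_)
      have h4 : (qs.length : ℝ) * (4 * ε * avg fun F => (decStep pre post (usedOnly L A F)
          (ρ F)).trace.re) ≤ qs.length * (4 * ε * avg fun F => (ρ F).trace.re) := by gcongr
      linarith

end Forgeries

/-! ### Operators acting on a part of a register -/

section RegLens

variable {Z A B : Type}

/-- The register `A` as a part of `Z`. -/
structure RegLens (Z A : Type) where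
  get : Z → A
  put : Z → A → Z
  get_put : ∀ x a, get (put x a) = a
  put_put : ∀ x a b, put (put x a) b = put x b
  put_get : ∀ x, put x (get x) = x

namespace RegLens

variable [DecidableEq Z] (l : RegLens Z A)

/-- The operator on `Z` that acts as `K` on the register `A`. -/
def mat (K : Op A) : Op Z := Matrix.of fun x y =>
  if y = l.put x (l.get y) then K (l.get x) (l.get y) else 0

theorem mat_conjTranspose (K : Op A) : (l.mat K)ᴴ = l.mat Kᴴ := by
  ext x y
  have h : ∀ x y, y = l.put x (l.get y) → x = l.put y (l.get x) := fun x y h => by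
    rw [h, l.put_put, l.put_get]
  simp only [conjTranspose_apply, mat, of_apply]
  by_cases hxy : y = l.put x (l.get y)
  · rw [if_pos hxy, if_pos (h x y hxy)]
  · rw [if_neg hxy, if_neg fun h' => hxy (h y x h'), star_zero]

theorem mat_zero : l.mat 0 = 0 := by
  ext x y
  simp [mat]

variable [Fintype Z] [Fintype A]

theorem mat_mul_apply (K : Op A) (X : Op Z) (x y : Z) :
    (l.mat K * X) x y = ∑ a, K (l.get x) a * X (l.put x a) y := by
  have h : ∀ z, l.mat K x z * X z y =
      ∑ a, if z = l.put x a then K (l.get x) a * X (l.put x a) y else 0 := by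
    intro z
    rw [Finset.sum_eq_single (l.get z)]
    · simp only [mat, of_apply]
      by_cases hz : z = l.put x (l.get z)
      · rw [if_pos hz, if_pos hz, ← hz]
      · rw [if_neg hz, if_neg hz, zero_mul]
    · intro a _ ha
      refine if_neg fun hz => ha ?_
      rw [hz, l.get_put]
    · simp
  rw [Matrix.mul_apply, Finset.sum_congr rfl fun z _ => h z, Finset.sum_comm]
  simp

theorem mul_mat_apply (K : Op A) (X : Op Z) (x y : Z) :
    (X * l.mat K) x y = ∑ a, X x (l.put y a) * K a (l.get y) := by
  have h : X * l.mat K = (l.mat Kᴴ * Xᴴ)ᴴ := by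
    rw [conjTranspose_mul, conjTranspose_conjTranspose, mat_conjTranspose,
      conjTranspose_conjTranspose]
  rw [h, conjTranspose_apply, mat_mul_apply, star_sum]
  refine Finset.sum_congr rfl fun a _ => ?_
  rw [star_mul', conjTranspose_apply, conjTranspose_apply, star_star, star_star, mul_comm]

theorem mat_mul_mat (K K' : Op A) : l.mat K * l.mat K' = l.mat (K * K') := by
  ext x y
  rw [mat_mul_apply]
  simp only [mat, of_apply, l.put_put, l.get_put]
  by_cases h : y = l.put x (l.get y)
  · simp only [if_pos h, Matrix.mul_apply]
  · simp [if_neg h]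

theorem mat_mul_mat_comm [Fintype B] (l' : RegLens Z B) (h : ∀ x a b, l.put (l'.put x b) a =
    l'.put (l.put x a) b) (h1 : ∀ x b, l.get (l'.put x b) = l.get x)
    (h2 : ∀ x a, l'.get (l.put x a) = l'.get x) (K : Op A) (K' : Op B) :
    l.mat K * l'.mat K' = l'.mat K' * l.mat K := by
  rw [← mul_one (l'.mat K'), ← mul_one (l.mat K), Matrix.mul_assoc, Matrix.mul_assoc,
    ← Matrix.mul_assoc (1 : Op Z), ← Matrix.mul_assoc (1 : Op Z)]
  simp only [one_mul]
  ext x y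
  simp only [mat_mul_apply, h1, h2, Finset.mul_sum]
  rw [Finset.sum_comm]
  refine Finset.sum_congr rfl fun b _ => Finset.sum_congr rfl fun a _ => ?_
  rw [h]
  ring

end RegLens

end RegLens

/-! ### The decryption loop of the ideal oracle -/

section DecLoop

variable {M T W : Type} {j : ℕ}

/-- The register `T`. -/
def tagLens (M T W : Type) (j : ℕ) : RegLens (((M × T) × W) × Mem M j) T where
  get x := x.1.1.2
  put x t := (((x.1.1.1, t), x.1.2), x.2)
  get_put _ _ := rfl
  put_put _ _ _ := rfl
  put_get _ := rfl

/-- The register `M'` and the first register of the entry `i`. -/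
def pairLens (M T W : Type) {j : ℕ} (i : Fin j) :
    RegLens (((M × T) × W) × Mem M j) (M × M) where
  get x := (x.1.1.1, (x.2 i).1)
  put x a := (((a.1, x.1.1.2), x.1.2), Function.update x.2 i (a.2, (x.2 i).2))
  get_put _ _ := by simp
  put_put _ _ _ := by simp
  put_get _ := by simp

theorem tagProj_eq [DecidableEq M] [DecidableEq T] [DecidableEq W] (ψ : T → ℂ) :
    (tagProj ψ : Op (((M × T) × W) × Mem M j)) =
      (tagLens M T W j).mat (vecMulVec ψ (star ψ)) := by
  ext ⟨⟨⟨m, t⟩, w⟩, μ⟩ ⟨⟨⟨m', t'⟩, w'⟩, μ'⟩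
  simp only [tagProj, RegLens.mat, tagLens, of_apply, vecMulVec_apply, Pi.star_apply,
    Prod.mk.injEq, and_true]
  refine if_congr ?_ rfl rfl
  constructor
  · rintro ⟨rfl, rfl, rfl⟩
    simp
  · rintro ⟨⟨rfl, rfl⟩, rfl⟩
    simp

theorem bellProj_eq [Fintype M] [DecidableEq M] [DecidableEq T] [DecidableEq W] (i : Fin j) :
    (bellProj i : Op (((M × T) × W) × Mem M j)) = (pairLens M T W i).mat (bell M) := by
  ext ⟨⟨⟨m, t⟩, w⟩, μ⟩ ⟨⟨⟨m', t'⟩, w'⟩, μ'⟩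
  simp only [bellProj, RegLens.mat, pairLens, of_apply, Prod.mk.injEq, true_and]
  refine if_congr ?_ rfl rfl
  constructor
  · rintro ⟨rfl, rfl, h, h'⟩
    refine ⟨⟨rfl, rfl⟩, ?_⟩
    funext l
    by_cases hl : l = i
    · subst hl
      rw [Function.update_self, h]
    · rw [Function.update_of_ne hl, h' l hl]
  · rintro ⟨⟨rfl, rfl⟩, h⟩
    refine ⟨rfl, rfl, ?_, fun l hl => ?_⟩
    · have := congrFun h i
      rw [Function.update_self] at this
      rw [this]
    · have := congrFun h l
      rw [Function.update_of_ne hl] at this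
      exact this.symm

theorem tagProj_conjTranspose [DecidableEq M] [DecidableEq T] [DecidableEq W] (ψ : T → ℂ) :
    (tagProj ψ : Op (((M × T) × W) × Mem M j))ᴴ = tagProj ψ := by
  rw [tagProj_eq, RegLens.mat_conjTranspose, conjTranspose_vecMulVec, star_star]

theorem bellProj_conjTranspose [Fintype M] [DecidableEq M] [DecidableEq T] [DecidableEq W]
    (i : Fin j) :
    (bellProj i : Op (((M × T) × W) × Mem M j))ᴴ = bellProj i := by
  rw [bellProj_eq, RegLens.mat_conjTranspose, bell_conjTranspose]

theorem vecMulVec_mul_of_dot [Fintype T] {ψ φ : T → ℂ} {z : ℂ} (h : star ψ ⬝ᵥ φ = z) :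
    vecMulVec ψ (star ψ) * vecMulVec φ (star φ) = z • vecMulVec ψ (star φ) := by
  rw [vecMulVec_mul_vecMulVec, h]
  ext x y
  simp [vecMulVec_apply]
  ring

/-- `returnBot` as a linear map. -/
def retBot (M T W : Type) [Fintype M] [Fintype T] (j : ℕ) :
    Op (((M × T) × W) × Mem M j) →ₗ[ℂ] Op ((Option M × W) × Mem M j) :=
  reix (fun p : (Option M × W) × Mem M j => (p.1.1, (p.1.2, p.2))) ∘ₗ embNone M (W × Mem M j) ∘ₗ
    trL ∘ₗ reix fun p : (M × T) × (W × Mem M j) => ((p.1, p.2.1), p.2.2)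

theorem returnBot_eq [Fintype M] [Fintype T] (σ : Op (((M × T) × W) × Mem M j)) :
    returnBot σ = retBot M T W j σ := by
  ext ⟨⟨o, w⟩, μ⟩ ⟨⟨o', w'⟩, μ'⟩
  cases o <;> cases o' <;>
    simp [returnBot, retBot, embNone, pullOp_apply, trL_apply]

/-- `returnEntry` as a linear map. -/
def retEntry (M T W : Type) [Fintype T] {j : ℕ} (i : Fin j) :
    Op (((M × T) × W) × Mem M j) →ₗ[ℂ] Op ((Option M × W) × Mem M j) :=
  reix (fun p : (Option M × W) × Mem M j => (p.1.1, (p.1.2, p.2))) ∘ₗ embSome M (W × Mem M j) ∘ₗ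
    trL ∘ₗ reix fun p : T × (M × (W × Mem M j)) =>
      ((((p.2.2.2 i).2, p.1), p.2.2.1), Function.update p.2.2.2 i ((p.2.2.2 i).1, p.2.1))

theorem returnEntry_eq [Fintype T] (i : Fin j) (σ : Op (((M × T) × W) × Mem M j)) :
    returnEntry i σ = retEntry M T W i σ := by
  ext ⟨⟨o, w⟩, μ⟩ ⟨⟨o', w'⟩, μ'⟩
  cases o <;> cases o' <;>
    simp [returnEntry, retEntry, embSome, pullOp_apply, trL_apply]

variable [Fintype M] [DecidableEq M] [Fintype T] [DecidableEq T] [Fintype W] [DecidableEq W]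

theorem bellProj_mul_tagProj (i : Fin j) (ψ : T → ℂ) :
    (bellProj i * tagProj ψ : Op (((M × T) × W) × Mem M j)) = tagProj ψ * bellProj i := by
  rw [tagProj_eq, bellProj_eq]
  exact RegLens.mat_mul_mat_comm _ _ (fun _ _ _ => rfl) (fun _ _ => rfl) (fun _ _ => rfl) _ _

theorem tagProj_mul_self {ψ : T → ℂ} (h : star ψ ⬝ᵥ ψ = 1) :
    (tagProj ψ * tagProj ψ : Op (((M × T) × W) × Mem M j)) = tagProj ψ := by
  rw [tagProj_eq, RegLens.mat_mul_mat, vecMulVec_mul_of_dot h, one_smul]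

theorem tagProj_mul_tagProj {ψ φ : T → ℂ} (h : star ψ ⬝ᵥ φ = 0) :
    (tagProj ψ * tagProj φ : Op (((M × T) × W) × Mem M j)) = 0 := by
  rw [tagProj_eq, tagProj_eq, RegLens.mat_mul_mat, vecMulVec_mul_of_dot h, zero_smul,
    RegLens.mat_zero]

theorem bellProj_mul_self [Nonempty M] (i : Fin j) :
    (bellProj i * bellProj i : Op (((M × T) × W) × Mem M j)) = bellProj i := by
  rw [bellProj_eq, RegLens.mat_mul_mat, bell_mul_self]

/-- Rejection discards `T`, and operators on `T` are cyclic under its trace. This removes the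
coherences between a tag projector and its complement. -/
theorem retBot_comm (ψ : T → ℂ) (X : Op (((M × T) × W) × Mem M j)) :
    retBot M T W j (tagProj ψ * X) = retBot M T W j (X * tagProj ψ) := by
  simp only [retBot, LinearMap.comp_apply]
  congr 2
  ext p q
  rw [tagProj_eq, trL_apply, trL_apply, Fintype.sum_prod_type, Fintype.sum_prod_type]
  refine Finset.sum_congr rfl fun m _ => ?_
  simp only [reix_apply, RegLens.mat_mul_apply, RegLens.mul_mat_apply]
  rw [Finset.sum_comm]
  refine Finset.sum_congr rfl fun t _ => Finset.sum_congr rfl fun t' _ => ?_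
  exact mul_comm _ _

/-- The contribution of the entry `i` to the loop, compared with rejection. -/
def loopExcess (ψ : T → ℂ) (i : Fin j) (σ : Op (((M × T) × W) × Mem M j)) :
    Op ((Option M × W) × Mem M j) :=
  let K : Op (((M × T) × W) × Mem M j) := bellProj i * tagProj ψ
  retEntry M T W i (K * σ * K) + retBot M T W j (K * σ * K - K * σ - σ * K)

/-- The loop sees `σ` only through `PσP`. As `P` commutes with `Q` and `T` is discarded on
rejection, the terms linear in `QP` are unaffected by this compression. -/
theorem loopExcess_eq {ψ : T → ℂ} (hψ : star ψ ⬝ᵥ ψ = 1) (i : Fin j)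
    (σ : Op (((M × T) × W) × Mem M j)) :
    loopExcess ψ i σ = retEntry M T W i (bellProj i * (tagProj ψ * σ * tagProj ψ) * bellProj i) +
      retBot M T W j (bellProj i * (tagProj ψ * σ * tagProj ψ) * bellProj i -
        bellProj i * (tagProj ψ * σ * tagProj ψ) - tagProj ψ * σ * tagProj ψ * bellProj i) := by
  set P : Op (((M × T) × W) × Mem M j) := tagProj ψ with hP
  set Q : Op (((M × T) × W) × Mem M j) := bellProj i with hQ
  have hPP : P * P = P := tagProj_mul_self hψ
  have hQP : Q * P = P * Q := bellProj_mul_tagProj i ψ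
  have hPQP : P * Q * P = Q * P := by rw [← hQP, Matrix.mul_assoc, hPP]
  have k1 : Q * P * σ * (Q * P) = Q * (P * σ * P) * Q := by
    have : Q * P * σ * (P * Q) = Q * (P * σ * P) * Q := by simp only [Matrix.mul_assoc]
    rw [← this, ← hQP]
  have r3 : retBot M T W j (Q * (P * σ * P)) = retBot M T W j (Q * P * σ) := by
    have e1 : Q * (P * σ * P) = Q * (P * σ) * P := by simp only [Matrix.mul_assoc]
    have e2 : P * (Q * (P * σ)) = P * Q * P * σ := by simp only [Matrix.mul_assoc]
    rw [e1, ← retBot_comm, ← hP, e2, hPQP]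
  have r4 : retBot M T W j (P * σ * P * Q) = retBot M T W j (σ * (Q * P)) := by
    have e1 : P * σ * P * Q = P * (σ * P * Q) := by simp only [Matrix.mul_assoc]
    have e2 : σ * P * Q * P = σ * (P * Q * P) := by simp only [Matrix.mul_assoc]
    rw [e1, retBot_comm, ← hP, e2, hPQP]
  simp only [loopExcess, map_sub, ← hP, ← hQ, r3, r4, k1]

/-- A failure at one entry does not change what an entry with an orthogonal tag sees: `P'`
annihilates the component that carries the earlier tag. -/
theorem compress_pinch {A : Type} [Ring A] {P Q P' : A} (h1 : P' * P = 0) (h2 : P * P' = 0)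
    (h3 : Q * P' = P' * Q) (σ : A) :
    P' * ((1 - P) * σ * (1 - P) + (1 - Q) * (P * σ * P) * (1 - Q)) * P' = P' * σ * P' := by
  have e1 : P' * (1 - P) = P' := by rw [mul_sub, h1, mul_one, sub_zero]
  have e2 : (1 - P) * P' = P' := by rw [sub_mul, h2, one_mul, sub_zero]
  have e3 : P' * (1 - Q) = (1 - Q) * P' := by rw [mul_sub, sub_mul, h3, mul_one, one_mul]
  calc _ = (P' * (1 - P)) * σ * ((1 - P) * P') +
        (P' * (1 - Q)) * P * σ * P * ((1 - Q) * P') := by noncomm_ring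
    _ = P' * σ * P' + (1 - Q) * (P' * P) * σ * (P * P') * (1 - Q) := by
        rw [e1, e2, ← e3, e3]
        nth_rw 2 [← e3]
        noncomm_ring
    _ = _ := by rw [h1, h2]; simp

/-- Orthogonal tags decouple the entries: the sequential loop becomes a sum of rejection and one
correction for each entry, evaluated on the same state `σ`. -/
theorem decLoop_eq {ψ : Fin j → T → ℂ} (hψ : ∀ i, star (ψ i) ⬝ᵥ ψ i = 1) {is : List (Fin j)}
    (his : is.Pairwise fun i i' => star (ψ i) ⬝ᵥ ψ i' = 0) (σ : Op (((M × T) × W) × Mem M j)) :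
    decLoop ψ is σ = retBot M T W j σ + (is.map fun i => loopExcess (ψ i) i σ).sum := by
  induction is generalizing σ with
  | nil => simp [decLoop, returnBot_eq]
  | cons i is ih =>
    rw [List.pairwise_cons] at his
    set P : Op (((M × T) × W) × Mem M j) := tagProj (ψ i) with hP
    set Q : Op (((M × T) × W) × Mem M j) := bellProj i with hQ
    have hPP : P * P = P := tagProj_mul_self (hψ i)
    have hrest : ∀ i' ∈ is, loopExcess (ψ i') i'
        ((1 - P) * σ * (1 - P) + (1 - Q) * (P * σ * P) * (1 - Q)) = loopExcess (ψ i') i' σ := by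
      intro i' hi'
      have h0 : star (ψ i') ⬝ᵥ ψ i = 0 := by
        rw [← star_star (star (ψ i') ⬝ᵥ ψ i), ← star_dotProduct, his.1 i' hi', star_zero]
      rw [loopExcess_eq (hψ i'), loopExcess_eq (hψ i'), compress_pinch (tagProj_mul_tagProj h0)
        (tagProj_mul_tagProj (his.1 i' hi')) (bellProj_mul_tagProj i (ψ i'))]
    have hloop : decLoop ψ (i :: is) σ = retEntry M T W i (Q * (P * σ * P) * Q) +
        decLoop ψ is ((1 - P) * σ * (1 - P) + (1 - Q) * (P * σ * P) * (1 - Q)) := by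
      rw [← returnEntry_eq]
      rfl
    rw [hloop, ih his.2, List.map_congr_left hrest, List.map_cons, List.sum_cons,
      loopExcess_eq (hψ i), ← hP, ← hQ]
    have r1 : retBot M T W j (P * σ * P) = retBot M T W j (P * σ) := by
      rw [← retBot_comm, ← hP, ← Matrix.mul_assoc, hPP]
    have r2 : retBot M T W j (σ * P) = retBot M T W j (P * σ) := (retBot_comm _ _).symm
    have r5 : (1 - P) * σ * (1 - P) + (1 - Q) * (P * σ * P) * (1 - Q) =
        σ - P * σ - σ * P + P * σ * P + (P * σ * P - Q * (P * σ * P) - P * σ * P * Q +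
          Q * (P * σ * P) * Q) := by
      noncomm_ring
    rw [r5]
    simp only [map_add, map_sub, r1, r2]
    abel

end DecLoop

/-! ### The excess of a test over rejection -/

section Excess

variable {C M X : Type} [Fintype C] [Fintype M] [DecidableEq M]

/-- The result of the test of a ciphertext for the vector `φ` on `C` and the first register of a
slot, compared with rejection.  The slot is accessed through `g` and `u`. -/
def excess (φ : C × M → ℂ) (g : X → M × M) (u : X → M × M → X) (Y : Op (C × X)) :
    Op (Option M × X) :=
  Matrix.of fun p q =>
    match p, q with
    | (some m, x), (some m', x') =>
      bell M (g x) (g x') *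
        ∑ a, ∑ b, star (φ a) * Y (a.1, u x (a.2, m)) (b.1, u x' (b.2, m')) * φ b
    | (none, x), (none, x') => ∑ c,
      (φ (c, (g x).1) * star (φ (c, (g x').1)) * (∑ a, ∑ b, star (φ a) *
          Y (a.1, u x (a.2, (g x).2)) (b.1, u x' (b.2, (g x').2)) * φ b) -
        φ (c, (g x).1) * (∑ a, star (φ a) * Y (a.1, u x (a.2, (g x).2)) (c, x')) -
        (∑ b, Y (c, x) (b.1, u x' (b.2, (g x').2)) * φ b) * star (φ (c, (g x').1)))
    | (some _, _), (none, _) => 0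
    | (none, _), (some _, _) => 0

theorem ampl_undoV_apply {Z : Type} (V : Matrix C Z ℂ) (Y : Op (C × X))
    (U : Op C →ₗ[ℂ] Op Z) (hU : ∀ A, U A = Vᴴ * A * V) (p q : Z × X) :
    ampl U X Y p q = ∑ c', (∑ c, star (V c p.1) * Y (c, p.2) (c', q.2)) * V c' q.1 := by
  rw [ampl_apply, hU]
  simp only [Matrix.mul_apply, conjTranspose_apply, submatrix_apply]

/-- Only overlaps with `φ` and a partial trace over the ciphertext enter, and neither changes when
the isometry is moved from the operator to the vector. -/
theorem excess_conj {Z : Type} [Fintype Z] [DecidableEq Z] {V : Matrix C Z ℂ} (hV : Vᴴ * V = 1)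
    {U : Op C →ₗ[ℂ] Op Z} (hU : ∀ A, U A = Vᴴ * A * V) (Φ : Z × M → ℂ) {φ : C × M → ℂ}
    (hφ : ∀ c m, φ (c, m) = ∑ z, V c z * Φ (z, m)) (g : X → M × M) (u : X → M × M → X)
    (Y : Op (C × X)) : excess Φ g u (ampl U X Y) = excess φ g u Y := by
  have A1 : ∀ H : C → M → ℂ, ∑ a : Z × M, star (Φ a) * ∑ c, star (V c a.1) * H c a.2 =
      ∑ a : C × M, star (φ a) * H a.1 a.2 := by
    intro H
    simp only [Fintype.sum_prod_type_right, hφ, star_sum, Finset.sum_mul, Finset.mul_sum]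
    refine Finset.sum_congr rfl fun m _ => ?_
    rw [Finset.sum_comm]
    refine Finset.sum_congr rfl fun c _ => Finset.sum_congr rfl fun z _ => ?_
    rw [star_mul']
    ring
  have A2 : ∀ H : C → M → ℂ, ∑ b : Z × M, (∑ c, H c b.2 * V c b.1) * Φ b =
      ∑ b : C × M, H b.1 b.2 * φ b := by
    intro H
    simp only [Fintype.sum_prod_type_right, hφ, Finset.sum_mul, Finset.mul_sum]
    refine Finset.sum_congr rfl fun m _ => ?_
    rw [Finset.sum_comm]
    refine Finset.sum_congr rfl fun c _ => Finset.sum_congr rfl fun z _ => ?_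
    ring
  have A3 : ∀ (H : C → ℂ) m, ∑ z, Φ (z, m) * (∑ c, H c * V c z) = ∑ c, φ (c, m) * H c := by
    intro H m
    simp only [hφ, Finset.sum_mul, Finset.mul_sum]
    rw [Finset.sum_comm]
    refine Finset.sum_congr rfl fun c _ => Finset.sum_congr rfl fun z _ => ?_
    ring
  have A4 : ∀ (H : C → ℂ) m, ∑ z, (∑ c, star (V c z) * H c) * star (Φ (z, m)) =
      ∑ c, H c * star (φ (c, m)) := by
    intro H m
    simp only [hφ, Finset.sum_mul, Finset.mul_sum, star_sum, star_mul']
    rw [Finset.sum_comm]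
    refine Finset.sum_congr rfl fun c _ => Finset.sum_congr rfl fun z _ => ?_
    ring
  have A5 : ∀ m m', ∑ z, Φ (z, m) * star (Φ (z, m')) = ∑ c, φ (c, m) * star (φ (c, m')) := by
    intro m m'
    rw [← A4]
    refine Finset.sum_congr rfl fun z _ => ?_
    congr 1
    have h := congrFun (congrArg (fun A => A *ᵥ fun z => Φ (z, m)) hV) z
    simp only [Matrix.one_mulVec, ← Matrix.mulVec_mulVec] at h
    rw [← h]
    simp [mulVec, dotProduct, hφ]
  have B1 : ∀ (p : M → X) (z' : Z) (x' : X),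
      ∑ a : Z × M, star (Φ a) * ampl U X Y (a.1, p a.2) (z', x') =
        ∑ c', (∑ a : C × M, star (φ a) * Y (a.1, p a.2) (c', x')) * V c' z' := by
    intro p z' x'
    simp only [ampl_undoV_apply V Y U hU, Finset.mul_sum (Finset.univ (α := C))]
    rw [Finset.sum_comm]
    refine Finset.sum_congr rfl fun c' _ => ?_
    rw [← A1 fun c m => Y (c, p m) (c', x'), Finset.sum_mul]
    refine Finset.sum_congr rfl fun a _ => ?_
    ring
  have B2 : ∀ (p : M → X) (z : Z) (x : X),
      ∑ b : Z × M, ampl U X Y (z, x) (b.1, p b.2) * Φ b =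
        ∑ c, star (V c z) * ∑ b : C × M, Y (c, x) (b.1, p b.2) * φ b := by
    intro p z x
    simp only [ampl_undoV_apply V Y U hU]
    rw [A2 fun c' m => ∑ c, star (V c z) * Y (c, x) (c', p m)]
    simp only [Finset.sum_mul, Finset.mul_sum]
    rw [Finset.sum_comm]
    refine Finset.sum_congr rfl fun c _ => Finset.sum_congr rfl fun b _ => ?_
    ring
  have B3 : ∀ p p' : M → X, ∑ a : Z × M, ∑ b : Z × M,
      star (Φ a) * ampl U X Y (a.1, p a.2) (b.1, p' b.2) * Φ b =
      ∑ a : C × M, ∑ b : C × M, star (φ a) * Y (a.1, p a.2) (b.1, p' b.2) * φ b := by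
    intro p p'
    have e : ∀ a : Z × M, ∑ b : Z × M, star (Φ a) * ampl U X Y (a.1, p a.2) (b.1, p' b.2) * Φ b =
        star (Φ a) * ∑ c, star (V c a.1) * ∑ b : C × M, Y (c, p a.2) (b.1, p' b.2) * φ b := by
      intro a
      rw [← B2, Finset.mul_sum]
      simp only [mul_assoc]
    simp only [e]
    rw [A1 fun c m => ∑ b : C × M, Y (c, p m) (b.1, p' b.2) * φ b]
    simp only [Finset.mul_sum, mul_assoc]
  ext ⟨o, x⟩ ⟨o', x'⟩
  rcases o with _ | m <;> rcases o' with _ | m'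
  · simp only [excess, of_apply, Finset.sum_sub_distrib, ← Finset.sum_mul]
    rw [A5, B3 (fun m => u x (m, (g x).2)) fun m => u x' (m, (g x').2)]
    congr 1
    · congr 1
      rw [← A3]
      refine Finset.sum_congr rfl fun z _ => ?_
      rw [B1 fun m => u x (m, (g x).2)]
    · rw [← A4]
      refine Finset.sum_congr rfl fun z _ => ?_
      rw [B2 fun m => u x' (m, (g x').2)]
  · rfl
  · rfl
  · simp only [excess, of_apply]
    rw [B3 (fun n => u x (n, m)) fun n => u x' (n, m')]

/-- `φ'` is supported on the salt `s`. Every term contains it, so only the block of `Y` with salt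
`s` on both sides survives. -/
theorem excess_salted {R : Type} [Fintype R] [DecidableEq R] (s : R) {φ : C × M → ℂ}
    {φ' : (R × C) × M → ℂ} (hφ : ∀ s' c m, φ' ((s', c), m) = if s' = s then φ (c, m) else 0)
    (g : X → M × M) (u : X → M × M → X) (Y : Op ((R × C) × X)) :
    excess φ' g u Y = excess φ g u (reix (fun p : C × X => ((s, p.1), p.2)) Y) := by
  have B1 : ∀ H : (R × C) × M → ℂ, ∑ a, star (φ' a) * H a =
      ∑ a : C × M, star (φ a) * H ((s, a.1), a.2) := by
    intro H
    rw [Fintype.sum_prod_type, Fintype.sum_prod_type, Finset.sum_eq_single s]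
    · simp [Fintype.sum_prod_type, hφ]
    · intro s' _ hs
      simp [hφ, hs]
    · simp
  have B2 : ∀ H : (R × C) × M → ℂ, ∑ a, H a * φ' a = ∑ a : C × M, H ((s, a.1), a.2) * φ a := by
    intro H
    rw [Fintype.sum_prod_type, Fintype.sum_prod_type, Finset.sum_eq_single s]
    · simp [Fintype.sum_prod_type, hφ]
    · intro s' _ hs
      simp [hφ, hs]
    · simp
  have B3 : ∀ (H : R × C → ℂ) m, ∑ c, φ' (c, m) * H c = ∑ c, φ (c, m) * H (s, c) := by
    intro H m
    rw [Fintype.sum_prod_type, Finset.sum_eq_single s]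
    · simp [hφ]
    · intro s' _ hs
      simp [hφ, hs]
    · simp
  have B4 : ∀ (H : R × C → ℂ) m, ∑ c, H c * star (φ' (c, m)) = ∑ c, H (s, c) * star (φ (c, m)) := by
    intro H m
    rw [Fintype.sum_prod_type, Finset.sum_eq_single s]
    · simp [hφ]
    · intro s' _ hs
      simp [hφ, hs]
    · simp
  have B5 : ∀ c m, φ' ((s, c), m) = φ (c, m) := fun c m => by simp [hφ]
  ext ⟨o, x⟩ ⟨o', x'⟩
  rcases o with _ | m <;> rcases o' with _ | m'
  · simp only [excess, of_apply, Finset.sum_sub_distrib, B1, B2, B3, B4,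
      B5, reix_apply, mul_assoc, ← Finset.mul_sum]
  · rfl
  · rfl
  · simp only [excess, of_apply, mul_assoc, ← Finset.mul_sum, B1, B2, reix_apply]

end Excess

/-! ### Ideal handlers as rejection plus excess -/

section IdealHandler

variable {S : QScheme} (D : Decomposition S)

/-- Expanding `(1 - P) Y (1 - P)` gives outright rejection plus terms with `P`, which together with
the successful branch form `excess`. The decryption loop has the same shape by `decLoop_eq`. -/
theorem Handler.ideal_map [Nonempty S.M] (k : S.K) (r : D.T) (L : Type) [Fintype L]
    (Y : Op (S.C × (L × (S.M × S.M)))) :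
    (Handler.ideal D k r L).map Y = (Handler.null S (L × (S.M × S.M))).map Y +
      excess (D.phiVec k r) Prod.snd (fun x n => (x.1, n)) Y := by
  classical
  set φ := D.phiVec k r with hφ
  have hE : D.encBell k r = vecMulVec φ (star φ) := D.encBell_eq k r
  ext ⟨o, x⟩ ⟨o', x'⟩
  simp only [Handler.ideal, Handler.null, LinearMap.add_apply, LinearMap.comp_apply,
    Matrix.add_apply, embSome, embNone, pullOp_apply]
  rcases o with _ | m <;> rcases o' with _ | m'
  · simp only [Option.map_none, zero_add, excess, of_apply, trL_apply]
    rw [← Finset.sum_add_distrib]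
    refine Finset.sum_congr rfl fun c _ => ?_
    set A : Op (S.C × S.M) := Y.submatrix (fun p => (p.1, (x.1, (p.2, x.2.2))))
      (fun p => (p.1, (x'.1, (p.2, x'.2.2)))) with hA
    have e1 : actCM (1 - D.encBell k r) Y (c, x) (c, x') =
        ((1 - D.encBell k r) * A * (1 - D.encBell k r)ᴴ : Op (S.C × S.M)) (c, x.2.1) (c, x'.2.1) := rfl
    have e2 : (1 - D.encBell k r) * A * (1 - D.encBell k r)ᴴ = A + (vecMulVec φ (star φ) * A *
        vecMulVec φ (star φ) - vecMulVec φ (star φ) * A - A * vecMulVec φ (star φ)) := by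
      rw [conjTranspose_sub, conjTranspose_one, D.encBell_conjTranspose, hE]
      noncomm_ring
    have f1 : ∀ p q, (vecMulVec φ (star φ) * A) p q = φ p * ∑ a, star (φ a) * A a q := by
      intro p q
      simp only [Matrix.mul_apply, vecMulVec_apply, Finset.mul_sum, Pi.star_apply, mul_assoc]
    have f2 : ∀ (B : Op (S.C × S.M)) p q, (B * vecMulVec φ (star φ)) p q =
        (∑ b, B p b * φ b) * star (φ q) := by
      intro B p q
      simp only [Matrix.mul_apply, vecMulVec_apply, Finset.sum_mul, Pi.star_apply, mul_assoc]
    rw [e1, e2, Matrix.add_apply, Matrix.sub_apply, Matrix.sub_apply, f2, f2, f1]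
    simp only [f1]
    congr 1
    congr 1
    congr 1
    simp only [Finset.mul_sum, Finset.sum_mul]
    rw [Finset.sum_comm]
    refine Finset.sum_congr rfl fun a _ => Finset.sum_congr rfl fun b _ => ?_
    simp only [hA, submatrix_apply]
    ring
  · simp [excess]
  · simp [excess]
  · simp only [Option.map_some, add_zero, zero_add, excess, of_apply]
    rw [reix_apply, attachBell_apply, kroneckerMap_apply, mul_comm]
    rfl

theorem Decomposition.phiVec_withRandomFunction {R : Type} [Fintype R] [DecidableEq R] [Nonempty R]
    (F : R → S.K) (s : R) (t : D.T) (s' : R) (c : S.C) (m : S.M) :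
    (D.withRandomFunction R).phiVec F (s, t) ((s', c), m) =
      if s' = s then D.phiVec (F s) t (c, m) else 0 := by
  have h : (D.withRandomFunction R).phiVec F (s, t) ((s', c), m) =
      ∑ x : S.M × (R × D.T), (if s' = x.2.1 then D.V (F s') c (x.1, x.2.2) else 0) *
        (bellVec S.M (x.1, m) * if x.2.1 = s then D.ψ (F s) t x.2.2 else 0) := rfl
  rw [h, Decomposition.phiVec]
  simp only [Fintype.sum_prod_type]
  by_cases hs : s' = s
  · subst hs
    rw [if_pos rfl]
    refine Finset.sum_congr rfl fun x _ => ?_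
    rw [Finset.sum_eq_single s']
    · simp
    · intro z _ hz
      simp [hz]
    · simp
  · rw [if_neg hs]
    refine Finset.sum_eq_zero fun x _ => Finset.sum_eq_zero fun z _ =>
      Finset.sum_eq_zero fun t _ => ?_
    by_cases hz : s' = z
    · subst hz
      simp [hs]
    · simp [hz]

end IdealHandler

/-! ### Loop corrections as excess terms -/

section LoopExcess

variable {M T W : Type} {j : ℕ} [Fintype M] [DecidableEq M] [Fintype T] [DecidableEq T]
  [Fintype W] [DecidableEq W]

/-- The vector `|φ⁺⟩ ⊗ |ψ⟩` on `M' T` and the first register of an entry. -/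
def tagBellVec (ψ : T → ℂ) : (M × T) × M → ℂ := fun p => bellVec M (p.1.1, p.2) * ψ p.1.2

theorem bell_tag_mul_apply (ψ : T → ℂ) (i : Fin j) (σ : Op (((M × T) × W) × Mem M j))
    (x y : ((M × T) × W) × Mem M j) :
    (bellProj i * tagProj ψ * σ : Op (((M × T) × W) × Mem M j)) x y = tagBellVec ψ (x.1.1, (x.2 i).1) *
      ∑ a : (M × T) × M, star (tagBellVec ψ a) *
        σ ((a.1, x.1.2), Function.update x.2 i (a.2, (x.2 i).2)) y := by
  rw [Matrix.mul_assoc, bellProj_eq, tagProj_eq, RegLens.mat_mul_apply]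
  simp only [RegLens.mat_mul_apply, Fintype.sum_prod_type, Finset.mul_sum]
  refine Finset.sum_congr rfl fun m _ => ?_
  rw [Finset.sum_comm]
  refine Finset.sum_congr rfl fun t _ => Finset.sum_congr rfl fun m' _ => ?_
  simp only [pairLens, tagLens, bell, vecMulVec_apply, Pi.star_apply, tagBellVec, star_mul']
  ring

theorem mul_bell_tag_apply (ψ : T → ℂ) (i : Fin j) (σ : Op (((M × T) × W) × Mem M j))
    (x y : ((M × T) × W) × Mem M j) :
    (σ * (bellProj i * tagProj ψ) : Op (((M × T) × W) × Mem M j)) x y = (∑ b : (M × T) × M,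
      σ x ((b.1, y.1.2), Function.update y.2 i (b.2, (y.2 i).2)) * tagBellVec ψ b) *
        star (tagBellVec ψ (y.1.1, (y.2 i).1)) := by
  rw [← Matrix.mul_assoc, bellProj_eq, tagProj_eq, RegLens.mul_mat_apply]
  simp only [RegLens.mul_mat_apply, Fintype.sum_prod_type, Finset.sum_mul]
  rw [Finset.sum_comm]
  refine Finset.sum_congr rfl fun m _ => ?_
  refine Finset.sum_congr rfl fun t _ => ?_
  refine Finset.sum_congr rfl fun m' _ => ?_
  simp only [pairLens, tagLens, bell, vecMulVec_apply, Pi.star_apply, tagBellVec, star_mul']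
  ring

/-- Tag and entanglement test together project onto the single vector `|φ⁺⟩|ψ⟩`. When the entry is
returned, the tag register is traced out and contributes only its norm. -/
theorem loopExcess_eq_excess {ψ : T → ℂ} (hψ : star ψ ⬝ᵥ ψ = 1) (i : Fin j)
    (σ : Op (((M × T) × W) × Mem M j)) :
    loopExcess ψ i σ = reix (fun p : (Option M × W) × Mem M j => (p.1.1, (p.1.2, p.2)))
      (excess (tagBellVec ψ) (fun x : W × Mem M j => x.2 i)
        (fun x n => (x.1, Function.update x.2 i n))
        (reix (fun p : (M × T) × (W × Mem M j) => ((p.1, p.2.1), p.2.2)) σ)) := by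
  set K : Op (((M × T) × W) × Mem M j) := bellProj i * tagProj ψ with hK
  have hKK : ∀ x y, (K * σ * K) x y = tagBellVec ψ (x.1.1, (x.2 i).1) *
      star (tagBellVec ψ (y.1.1, (y.2 i).1)) * ∑ a : (M × T) × M, ∑ b : (M × T) × M,
        star (tagBellVec ψ a) * σ ((a.1, x.1.2), Function.update x.2 i (a.2, (x.2 i).2))
          ((b.1, y.1.2), Function.update y.2 i (b.2, (y.2 i).2)) * tagBellVec ψ b := by
    intro x y
    rw [hK, mul_bell_tag_apply]
    simp only [bell_tag_mul_apply, Finset.mul_sum, Finset.sum_mul]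
    rw [Finset.sum_comm]
    refine Finset.sum_congr rfl fun a _ => Finset.sum_congr rfl fun b _ => ?_
    ring
  have hψ' : ∑ t, ψ t * star (ψ t) = 1 := by
    rw [← hψ]
    simp [dotProduct, mul_comm]
  ext ⟨⟨o, w⟩, μ⟩ ⟨⟨o', w'⟩, μ'⟩
  simp only [loopExcess, ← hK, Matrix.add_apply, retEntry, retBot, LinearMap.comp_apply,
    reix_apply, embSome, embNone, pullOp_apply]
  rcases o with _ | m <;> rcases o' with _ | m'
  · simp only [Option.map_none, zero_add, trL_apply, reix_apply, excess, of_apply,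
      Matrix.sub_apply, hKK]
    refine Finset.sum_congr rfl fun c _ => ?_
    rw [hK, bell_tag_mul_apply, mul_bell_tag_apply]
  · simp [excess]
  · simp [excess]
  · simp only [Option.map_some, add_zero, trL_apply, reix_apply, excess, of_apply, hKK,
      Function.update_self, Function.update_idem, ← Finset.sum_mul]
    congr 1
    rw [← mul_one (bell M (μ i) (μ' i)), ← hψ', Finset.mul_sum]
    refine Finset.sum_congr rfl fun t _ => ?_
    simp only [tagBellVec, bell, vecMulVec_apply, Pi.star_apply, star_mul', bellVec,
      eq_comm (a := (μ i).2), eq_comm (a := (μ' i).2)]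
    ring

end LoopExcess

/-! ### The ideal decryption oracle of the salted scheme -/

section IdealDec

variable {S : QScheme} {D : Decomposition S} {R W : Type} [Fintype R] [DecidableEq R] [Nonempty R]
  [Fintype W] [DecidableEq W] {j : ℕ}

theorem undoV_tp {M T C : Type} [Fintype M] [Fintype T] [Fintype C] [DecidableEq C]
    {V : Matrix C (M × T) ℂ} (hV : V * Vᴴ = 1) : IsTP (undoV V) := fun Y => by
  have h : undoV V Y = Vᴴ * Y * V := rfl
  rw [h, Matrix.trace_mul_comm, ← Matrix.mul_assoc, hV, Matrix.one_mul]

/-- Distinct salts make the tags of all entries orthogonal, so `decLoop_eq` applies; `excess_conj`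
absorbs the controlled unitary and `excess_salted` selects the salt of each entry. -/
theorem idealDec_withRandomFunction (F : R → S.K) {r : Fin j → R × D.T}
    (hr : Function.Injective fun i => (r i).1) (Y : Op (((R × S.C) × W) × Mem S.M j)) :
    idealDec (D.withRandomFunction R) F r Y =
      reix (fun p : (Option S.M × W) × Mem S.M j => (p.1.1, (p.1.2, p.2)))
        (embNone S.M (W × Mem S.M j)
          (trL (reix (fun p : (R × S.C) × (W × Mem S.M j) => ((p.1, p.2.1), p.2.2)) Y)) +
        ∑ i, excess (D.phiVec (F (r i).1) (r i).2) (fun x : W × Mem S.M j => x.2 i)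
          (fun x n => (x.1, Function.update x.2 i n))
          (reix (fun p : S.C × (W × Mem S.M j) => ((((r i).1, p.1), p.2.1), p.2.2)) Y)) := by
  set D' := D.withRandomFunction R with hD'
  set V : Matrix (R × S.C) (S.M × (R × D.T)) ℂ := D'.V F with hV
  set ψ : Fin j → R × D.T → ℂ := fun i => D'.ψ F (r i) with hψdef
  set Y' : Op ((R × S.C) × (W × Mem S.M j)) :=
    reix (fun p : (R × S.C) × (W × Mem S.M j) => ((p.1, p.2.1), p.2.2)) Y with hY'
  set σ : Op (((S.M × (R × D.T)) × W) × Mem S.M j) := ampl (ampl (undoV V) W) (Mem S.M j) Y with hσ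
  have hψ : ∀ i i', star (ψ i) ⬝ᵥ ψ i' = if r i = r i' then 1 else 0 := fun i i' =>
    D'.ψ_orthonormal F (r i) (r i')
  have hdec : idealDec D' F r Y = decLoop ψ (List.finRange j) σ := rfl
  have hpw : (List.finRange j).Pairwise fun i i' => star (ψ i) ⬝ᵥ ψ i' = 0 := by
    refine (List.nodup_finRange j).imp fun {i i'} h => ?_
    rw [hψ, if_neg fun e => h (hr (congrArg Prod.fst e))]
  rw [hdec, decLoop_eq (fun i => by rw [hψ, if_pos rfl]) hpw, map_add]
  have hσ' : reix (fun p : (S.M × (R × D.T)) × (W × Mem S.M j) => ((p.1, p.2.1), p.2.2)) σ =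
      ampl (undoV V) (W × Mem S.M j) Y' := rfl
  have hiso : Vᴴ * V = 1 := D'.V_isometry F
  have hco : V * Vᴴ = 1 := D'.V_coisometry F
  have htp : IsTP (undoV V) := undoV_tp hco
  congr 1
  · rw [retBot, LinearMap.comp_apply, LinearMap.comp_apply, LinearMap.comp_apply, hσ',
      trL_ampl htp]
  · rw [← List.ofFn_eq_map, List.sum_ofFn, map_sum]
    refine Finset.sum_congr rfl fun i _ => ?_
    let φ : (R × S.C) × S.M → ℂ := D'.phiVec F (r i)
    have hφ : ∀ c m, φ (c, m) = ∑ z, V c z * tagBellVec (ψ i) (z, m) := fun c m => rfl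
    rw [loopExcess_eq_excess (by rw [hψ, if_pos rfl]), hσ',
      excess_conj hiso (fun _ => rfl) _ hφ,
      excess_salted (r i).1 (D.phiVec_withRandomFunction F (r i).1 (r i).2)]
    rfl

end IdealDec

/-! ### The memory of the hybrids and that of the ideal oracle -/

section Invariant

variable {S : QScheme} (D : Decomposition S) {R W : Type} [DecidableEq R] {j : ℕ} {L : Type}
  [Fintype L]

/-- The handlers `h` treat ciphertexts as the ideal functionality does after encryptions with
randomness `r`, where the memory `L` is identified with `Mem S.M j`. -/
def TracksIdeal (F : R → S.K) (r : Fin j → R × D.T) (e : L ≃ Mem S.M j) (h : R → Handler S L) :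
    Prop :=
  ∀ s Y, (h s).map Y = (Handler.null S L).map Y + ∑ i, if (r i).1 = s then
    excess (D.phiVec (F s) (r i).2) (fun l => e l i)
      (fun l n => e.symm (Function.update (e l) i n)) Y else 0

/-- The identification of `L (M'' M)` with `Mem M (j + 1)`. -/
def snocMem {M L : Type} {j : ℕ} (e : L ≃ Mem M j) : L × (M × M) ≃ Mem M (j + 1) where
  toFun p := Fin.snoc (α := fun _ => M × M) (e p.1) p.2
  invFun μ := (e.symm fun i => μ i.castSucc, μ (Fin.last j))
  left_inv p := by simp
  right_inv μ := by
    simp only [Equiv.apply_symm_apply]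
    exact Fin.snoc_init_self μ

theorem snocMem_castSucc {M L : Type} {j : ℕ} (e : L ≃ Mem M j) (p : L × (M × M)) (i : Fin j) :
    snocMem e p i.castSucc = e p.1 i :=
  Fin.snoc_castSucc (α := fun _ => M × M) _ _ _

theorem snocMem_last {M L : Type} {j : ℕ} (e : L ≃ Mem M j) (p : L × (M × M)) :
    snocMem e p (Fin.last j) = p.2 :=
  Fin.snoc_last (α := fun _ => M × M) _ _

theorem snocMem_symm_update_castSucc {M L : Type} {j : ℕ} (e : L ≃ Mem M j) (p : L × (M × M))
    (i : Fin j) (n : M × M) : (snocMem e).symm (Function.update (snocMem e p) i.castSucc n) =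
      (e.symm (Function.update (e p.1) i n), p.2) := by
  rw [Equiv.symm_apply_eq]
  change Function.update (Fin.snoc _ _) _ _ = Fin.snoc _ _
  simp only [Equiv.apply_symm_apply]
  exact (Fin.snoc_update (α := fun _ => M × M) p.2 (e p.1) i n).symm

theorem snocMem_symm_update_last {M L : Type} {j : ℕ} (e : L ≃ Mem M j) (p : L × (M × M))
    (n : M × M) : (snocMem e).symm (Function.update (snocMem e p) (Fin.last j) n) = (p.1, n) := by
  rw [Equiv.symm_apply_eq]
  exact Fin.update_snoc_last (α := fun _ => M × M) p.2 (e p.1) n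

theorem Handler.lift_map_apply (h : Handler S L) (Y : Op (S.C × (L × (S.M × S.M))))
    (p q : Option S.M × (L × (S.M × S.M))) :
    h.lift.map Y p q = h.map (Y.submatrix (fun i => (i.1, (i.2, p.2.2)))
      fun i => (i.1, (i.2, q.2.2))) (p.1, p.2.1) (q.1, q.2.1) := rfl

theorem Handler.lift_null : (Handler.null S L).lift = Handler.null S (L × (S.M × S.M)) := by
  refine Handler.ext_map ?_
  ext Y ⟨o, l, n⟩ ⟨o', l', n'⟩
  rw [Handler.lift_map_apply]
  simp only [Handler.null, LinearMap.comp_apply, embNone, pullOp_apply]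
  cases o <;> cases o' <;> simp [trL_apply]

variable {D}

/-- A fresh salt owns exactly the new last entry. For every other salt the sum over entries is
unchanged, since the added slot is idle. -/
theorem TracksIdeal.succ [Nonempty S.M] {F : R → S.K} {r : Fin j → R × D.T} {e : L ≃ Mem S.M j}
    {h : R → Handler S L} (H : TracksIdeal D F r e h) {s : R} (hs : ∀ i, (r i).1 ≠ s) (t : D.T) :
    TracksIdeal D F (Fin.snoc (α := fun _ => R × D.T) r (s, t)) (snocMem e)
      (Function.update (fun s' => (h s').lift) s (Handler.ideal D (F s) t L)) := by
  intro s' Y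
  simp only [Fin.sum_univ_castSucc, Fin.snoc_castSucc, Fin.snoc_last, snocMem_castSucc,
    snocMem_last, snocMem_symm_update_castSucc, snocMem_symm_update_last]
  by_cases hs' : s' = s
  · subst hs'
    rw [Function.update_self, Handler.ideal_map, if_pos rfl,
      Finset.sum_eq_zero fun i _ => if_neg (hs i), zero_add]
  · rw [Function.update_of_ne hs', if_neg (Ne.symm hs'), add_zero, ← Handler.lift_null]
    ext ⟨o, l, n⟩ ⟨o', l', n'⟩
    rw [Handler.lift_map_apply, H, Matrix.add_apply, Matrix.add_apply, Handler.lift_map_apply,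
      Matrix.sum_apply, Matrix.sum_apply]
    congr 1
    refine Finset.sum_congr rfl fun i _ => ?_
    by_cases hi : (r i).1 = s'
    · rw [if_pos hi, if_pos hi]
      cases o <;> cases o' <;> rfl
    · rw [if_neg hi, if_neg hi]
      rfl

variable [Fintype R] [Nonempty R] [Fintype W] [DecidableEq W]

/-- Summed over the measured salts, the rejection terms discard the whole ciphertext, and each entry
is counted once, at its own salt. -/
theorem TracksIdeal.decStep_eq {F : R → S.K} {r : Fin j → R × D.T} {e : L ≃ Mem S.M j}
    {h : R → Handler S L} (H : TracksIdeal D F r e h) (hr : Function.Injective fun i => (r i).1)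
    (pre : Channel W ((R × S.C) × W)) (post : Channel (Option S.M × W) W)
    (ρ : Op (W × Mem S.M j)) :
    decStep pre post h (reix (Prod.map id e) ρ) = reix (Prod.map id e)
      (ampl post.map (Mem S.M j) (idealDec (D.withRandomFunction R) F r
        (ampl pre.map (Mem S.M j) ρ))) := by
  rw [idealDec_withRandomFunction F hr]
  unfold TracksIdeal at H
  set Y := ampl pre.map (Mem S.M j) ρ with hY
  have hin : ∀ s, decIn pre s L (reix (Prod.map id e) ρ) =
      reix (fun p : (S.C × L) × W => (((s, p.1.1), p.2), e p.1.2)) Y := fun s => rfl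
  have hL : decStep pre post h (reix (Prod.map id e) ρ) =
      ampl post.map L (reix (fun p : (Option S.M × W) × L => ((p.1.1, p.2), p.1.2))
        (∑ s, ampl (h s).map W (reix (fun p : (S.C × L) × W => (((s, p.1.1), p.2), e p.1.2)) Y))) := by
    simp only [decStep, LinearMap.sum_apply, decBlock, decOut, LinearMap.comp_apply, map_sum, hin]
  rw [hL, reix_ref_ampl]
  congr 1
  ext ⟨⟨o, w⟩, l⟩ ⟨⟨o', w'⟩, l'⟩
  simp only [reix_apply, Matrix.sum_apply, ampl_apply, H, Matrix.add_apply, Prod.map_apply, id_eq,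
    Finset.sum_add_distrib]
  congr 1
  · simp only [Handler.null, LinearMap.comp_apply, embNone, pullOp_apply]
    cases o <;> cases o' <;> simp [trL_apply, Fintype.sum_prod_type]
  · rw [Finset.sum_comm]
    refine Finset.sum_congr rfl fun i _ => ?_
    rw [Finset.sum_eq_single (r i).1 (fun s _ hs => by rw [if_neg (Ne.symm hs)]; rfl) (by simp),
      if_pos rfl]
    cases o <;> cases o' <;> simp [excess]

end Invariant

/-! ### The ideal encryption oracle of the salted scheme -/

section IdealEnc

variable {S : QScheme} {D : Decomposition S} {R W L : Type} [Fintype R] [DecidableEq R]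
  [Nonempty R] [Fintype W] {j : ℕ}

theorem ampl_slotIn_apply {M C B : Type} [Fintype M] [DecidableEq M] (Φ : Op M →ₗ[ℂ] Op C)
    (Z : Op (M × B)) (p q : C × (B × (M × M))) :
    ampl Φ (B × (M × M)) (slotIn Z) p q = ampl Φ M (bell M) (p.1, p.2.2.1) (q.1, q.2.2.1) *
      Z (p.2.2.2, p.2.1) (q.2.2.2, q.2.1) := by
  rw [ampl_apply, ampl_apply]
  have e : (slotIn Z).submatrix (fun i => (i, p.2)) (fun i => (i, q.2)) =
      Z (p.2.2.2, p.2.1) (q.2.2.2, q.2.1) •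
        (bell M).submatrix (fun i => (i, p.2.2.1)) (fun i => (i, q.2.2.1)) := by
    ext i i'
    simp [slotIn, mul_comm]
  rw [e, map_smul, Matrix.smul_apply, smul_eq_mul, mul_comm]

theorem encBell_withRandomFunction (F : R → S.K) (s : R) (t : D.T) (p q : (R × S.C) × S.M) :
    (D.withRandomFunction R).encBell F (s, t) p q = if p.1.1 = s ∧ q.1.1 = s then
      D.encBell (F s) t (p.1.2, p.2) (q.1.2, q.2) else 0 :=
  encWith_controlled (fun s => D.V (F s)) s (D.ψ (F s) t) _ p.1 q.1

/-- The salted tag confines the ciphertext to the block of salt `s`, which is what `encOut`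
produces; the slot becomes the last entry of the memory. -/
theorem idealEncStep_eq (F : R → S.K) (e : L ≃ Mem S.M j) (s : R) (t : D.T)
    (pre : Channel W (S.M × W)) (post : Channel ((R × S.C) × W) W) (ρ : Op (W × Mem S.M j)) :
    idealEncStep pre post s (D.encR (F s) t) L (reix (Prod.map id e) ρ) =
      reix (Prod.map id (snocMem e)) (ampl post.map (Mem S.M (j + 1))
        (idealEnc (D.withRandomFunction R) F (s, t) (ampl pre.map (Mem S.M j) ρ))) := by
  set Z := encIn pre L (reix (Prod.map id e) ρ) with hZ
  have h1 : idealEncStep pre post s (D.encR (F s) t) L (reix (Prod.map id e) ρ) =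
      ampl post.map (L × (S.M × S.M)) (reix (Equiv.prodAssoc _ L (S.M × S.M)).symm
        (ampl (pullOp fun p : ((R × S.C) × W) × L =>
          if p.1.1.1 = s then some (p.1.1.2, (p.1.2, p.2)) else none) (S.M × S.M)
          (reix (fun p : (S.C × (W × L)) × (S.M × S.M) => (p.1.1, (p.1.2, p.2)))
            (ampl (D.encR (F s) t) ((W × L) × (S.M × S.M)) (slotIn Z))))) := rfl
  set E : Op (((R × S.C) × W) × Mem S.M (j + 1)) :=
    idealEnc (D.withRandomFunction R) F (s, t) (ampl pre.map (Mem S.M j) ρ) with hE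
  have hR : reix (Prod.map id (snocMem e)) (ampl post.map (Mem S.M (j + 1)) E) =
      ampl post.map (L × (S.M × S.M)) (reix (Prod.map id (snocMem e)) E) := rfl
  rw [h1, hR, ampl_pullOp]
  congr 1
  ext ⟨⟨⟨s₁, c⟩, w⟩, l, n⟩ ⟨⟨⟨s₂, c'⟩, w'⟩, l', n'⟩
  have h2 : ∀ x y : ((R × S.C) × W) × Mem S.M (j + 1),
      E x y =
      (if x.1.1.1 = s ∧ y.1.1.1 = s then D.encBell (F s) t (x.1.1.2, (x.2 (Fin.last j)).1)
        (y.1.1.2, (y.2 (Fin.last j)).1) else 0) * ampl pre.map (Mem S.M j) ρ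
          (((x.2 (Fin.last j)).2, x.1.2), fun i => x.2 i.castSucc)
          (((y.2 (Fin.last j)).2, y.1.2), fun i => y.2 i.castSucc) := fun x y =>
    congrArg (· * _) (encBell_withRandomFunction F s t (x.1.1, (x.2 (Fin.last j)).1)
      (y.1.1, (y.2 (Fin.last j)).1))
  rw [reix_apply, reix_apply, h2, pullOp_apply]
  simp only [Prod.map_apply, id_eq, snocMem_last, snocMem_castSucc, Equiv.prodAssoc_symm_apply]
  by_cases hx : s₁ = s <;> by_cases hy : s₂ = s <;> simp only [hx, hy, if_true, if_false, and_true,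
    and_false, Option.map_some, Option.map_none, and_self, zero_mul]
  rw [reix_apply, ampl_slotIn_apply]
  rfl

end IdealEnc

/-! ### The ideal experiment with fixed salts -/

section FixedSalts

variable {S : QScheme} (D : Decomposition S) {R W : Type} [Fintype R] [DecidableEq R] [Nonempty R]
  [Fintype W] [DecidableEq W]

/-- The ideal experiment with given salts. -/
def idealSaltedRun (F : R → S.K) (effect : Op W) :
    List (Query S.M (R × S.C) W × R) → (j : ℕ) → (Fin j → R × D.T) → Op (W × Mem S.M j) → ℝ
  | [], _, _, ρ => (kroneckerMap (· * ·) effect 1 * ρ).trace.re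
  | (.enc pre post, s) :: qs, j, r, ρ =>
      ∑ t : D.T, D.p (F s) t *
        idealSaltedRun F effect qs (j + 1) (Fin.snoc (α := fun _ => R × D.T) r (s, t))
          (ampl post.map (Mem S.M (j + 1))
            (idealEnc (D.withRandomFunction R) F (s, t) (ampl pre.map (Mem S.M j) ρ)))
  | (.dec pre post, _) :: qs, j, r, ρ =>
      idealSaltedRun F effect qs j r (ampl post.map (Mem S.M j)
        (idealDec (D.withRandomFunction R) F r (ampl pre.map (Mem S.M j) ρ)))

/-- The functional of a final measurement. -/
def effectFn {E : Type} [Fintype E] (effect : Op E) : Op E →ₗ[ℂ] ℂ :=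
  traceFn E ∘ₗ LinearMap.mulLeft ℂ effect

theorem effectFn_apply {E : Type} [Fintype E] (effect X : Op E) :
    effectFn effect X = (effect * X).trace := rfl

theorem effectFn_trR {E L : Type} [Fintype E] [Fintype L] [DecidableEq L] (effect : Op E)
    (ρ : Op (E × L)) :
    (kroneckerMap (· * ·) effect (1 : Op L) * ρ).trace = effectFn effect (trR ρ) := by
  rw [effectFn_apply]
  simp only [Matrix.trace, Matrix.diag_apply, Matrix.mul_apply, Fintype.sum_prod_type,
    kroneckerMap_apply, Matrix.one_apply, trR_apply, mul_ite, mul_one, mul_zero, ite_mul,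
    zero_mul, Finset.sum_ite_eq, Finset.mem_univ, if_true, Finset.mul_sum]
  refine Finset.sum_congr rfl fun w _ => ?_
  rw [Finset.sum_comm]

theorem effectFn_pos {E : Type} [Fintype E] {effect : Op E} (h : effect.PosSemidef) :
    PosFn (effectFn effect) := by
  intro X hX
  obtain ⟨B, rfl⟩ := hX.exists_eq_conjTranspose_mul
  rw [effectFn_apply, ← Matrix.mul_assoc, Matrix.trace_mul_comm, ← Matrix.mul_assoc]
  exact (h.mul_mul_conjTranspose_same B).trace_nonneg

theorem effectFn_subTr {E : Type} [Fintype E] [DecidableEq E] {effect : Op E}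
    (h : (1 - effect).PosSemidef) : SubTr (effectFn effect) := by
  intro X hX
  have := (effectFn_pos h).re_nonneg hX
  rw [effectFn_apply, Matrix.sub_mul, Matrix.one_mul, Matrix.trace_sub, Complex.sub_re] at this
  rw [effectFn_apply]
  linarith

variable {D}

/-- With `b` at least the number of queries, every encryption is ideal. `TracksIdeal` is carried
along the induction; extending it requires that each new salt differs from all earlier ones. -/
theorem idealSaltedRun_eq_hybrid [Nonempty S.M] {F : R → S.K} (effect : Op W)
    (qs : List (Query S.M (R × S.C) W × R)) (hqs : (qs.map Prod.snd).Nodup) {b : ℕ}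
    (hb : qs.length ≤ b) {j : ℕ} {r : Fin j → R × D.T}
    (hr : Function.Injective fun i => (r i).1) (hr' : ∀ i, (r i).1 ∉ qs.map Prod.snd) {L : Type}
    [Fintype L] {e : L ≃ Mem S.M j} {h : R → Handler S L} (H : TracksIdeal D F r e h)
    (ρ : Op (W × Mem S.M j)) :
    idealSaltedRun D F effect qs j r ρ =
      (hybrid D F (effectFn effect) b qs L h (reix (Prod.map id e) ρ)).re := by
  induction qs generalizing b j L with
  | nil =>
    rw [idealSaltedRun, hybrid_nil, effectFn_trR, LinearMap.comp_apply]
    congr 2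
    ext w w'
    simp only [trR_apply, reix_apply, Prod.map_apply, id_eq]
    exact (Equiv.sum_comp e fun μ => ρ (w, μ) (w', μ)).symm
  | cons q qs ih =>
    rw [List.map_cons, List.nodup_cons] at hqs
    simp only [List.map_cons, List.mem_cons, not_or] at hr'
    rw [List.length_cons] at hb
    obtain ⟨⟨pre, post⟩ | ⟨pre, post⟩, s⟩ := q
    · obtain ⟨b, rfl⟩ : ∃ b', b = b' + 1 := ⟨b - 1, by omega⟩
      rw [idealSaltedRun, hybrid, LinearMap.sum_apply, Complex.re_sum]
      refine Finset.sum_congr rfl fun t _ => ?_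
      rw [LinearMap.smul_apply, smul_eq_mul, Complex.re_ofReal_mul, LinearMap.comp_apply,
        idealEncStep_eq, ← ih hqs.2 (by omega) ?_ ?_ (H.succ (fun i => (hr' i).1) t)]
      · intro i i'
        refine Fin.lastCases ?_ (fun i => ?_) i <;> refine Fin.lastCases ?_ (fun i' => ?_) i'
        · simp
        · simp only [Fin.snoc_last, Fin.snoc_castSucc]
          intro h
          exact absurd h.symm (hr' i').1
        · simp only [Fin.snoc_last, Fin.snoc_castSucc]
          intro h
          exact absurd h (hr' i).1
        · simp only [Fin.snoc_castSucc]
          intro h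
          rw [hr h]
      · intro i
        refine Fin.lastCases ?_ (fun i => ?_) i
        · rw [Fin.snoc_last]
          exact hqs.1
        · rw [Fin.snoc_castSucc]
          exact (hr' i).2
    · rw [idealSaltedRun, hybrid_dec, LinearMap.comp_apply, H.decStep_eq hr,
        ← ih hqs.2 (by omega) hr (fun i => (hr' i).2) H]

end FixedSalts

/-! ### Random salts and collisions -/

section AvgSalts

variable {α R : Type} [Fintype R]

/-- The expectation of a function of a list of queries with independent uniform salts. -/
def avgSalts : List α → (List (α × R) → ℝ) → ℝ
  | [], g => g []
  | q :: qs, g => avg fun s => avgSalts qs fun l => g ((q, s) :: l)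

theorem avgSalts_add (qs : List α) (g h : List (α × R) → ℝ) :
    avgSalts qs (fun l => g l + h l) = avgSalts qs g + avgSalts qs h := by
  induction qs generalizing g h with
  | nil => rfl
  | cons q qs ih => simp only [avgSalts, ih, avg_add]

theorem avgSalts_mul (c : ℝ) (qs : List α) (g : List (α × R) → ℝ) :
    avgSalts qs (fun l => c * g l) = c * avgSalts qs g := by
  induction qs generalizing g with
  | nil => rfl
  | cons q qs ih => simp only [avgSalts, ih, avg_mul]

theorem avgSalts_const [Nonempty R] (qs : List α) (c : ℝ) :
    avgSalts qs (fun _ : List (α × R) => c) = c := by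
  induction qs with
  | nil => rfl
  | cons q qs ih => simp only [avgSalts, ih, avg_const]

theorem avgSalts_sum {ι : Type} (s : Finset ι) (qs : List α) (g : ι → List (α × R) → ℝ) :
    avgSalts qs (fun l => ∑ i ∈ s, g i l) = ∑ i ∈ s, avgSalts qs (g i) := by
  induction qs generalizing g with
  | nil => rfl
  | cons q qs ih => simp only [avgSalts, ih, avg_sum]

theorem avgSalts_avg {K : Type} [Fintype K] (qs : List α) (g : K → List (α × R) → ℝ) :
    avgSalts qs (fun l => avg fun k => g k l) = avg fun k => avgSalts qs (g k) := by
  simp only [avg, avgSalts_mul, avgSalts_sum]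

theorem avgSalts_mono {qs : List α} {g h : List (α × R) → ℝ}
    (H : ∀ l, l.map Prod.fst = qs → g l ≤ h l) : avgSalts qs g ≤ avgSalts qs h := by
  induction qs generalizing g h with
  | nil => exact H [] rfl
  | cons q qs ih => exact avg_mono fun s => ih fun l hl => H _ (by simp [hl])

variable [DecidableEq R] [Nonempty R]

/-- A union bound: `A` holds the salts to be avoided, the next salt hits it with probability
`|A|/|R|`, and then joins it. -/
theorem avgSalts_collision_le (qs : List α) (A : Finset R) :
    avgSalts qs (fun l : List (α × R) => if (l.map Prod.snd).Nodup ∧ ∀ s ∈ l.map Prod.snd, s ∉ A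
      then (0 : ℝ) else 1) ≤ qs.length * (A.card + qs.length) / Fintype.card R := by
  have hR : (0 : ℝ) < Fintype.card R := by exact_mod_cast Fintype.card_pos
  induction qs generalizing A with
  | nil => simp [avgSalts]
  | cons q qs ih =>
    have h1 : ∀ s : R, avgSalts qs (fun l : List (α × R) =>
        if (((q, s) :: l).map Prod.snd).Nodup ∧ ∀ s' ∈ ((q, s) :: l).map Prod.snd, s' ∉ A
          then (0 : ℝ) else 1) ≤
        (if s ∈ A then 1 else 0) + qs.length * (A.card + 1 + qs.length) / Fintype.card R := by
      intro s
      refine (avgSalts_mono (h := fun l => (if s ∈ A then 1 else 0) +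
        if (l.map Prod.snd).Nodup ∧ ∀ s' ∈ l.map Prod.snd, s' ∉ insert s A then (0 : ℝ) else 1)
        fun l _ => ?_).trans ?_
      · by_cases hs : s ∈ A
        · rw [if_pos hs]
          split_ifs <;> norm_num
        · rw [if_neg hs, zero_add]
          by_cases hl : (l.map Prod.snd).Nodup ∧ ∀ s' ∈ l.map Prod.snd, s' ∉ insert s A
          · rw [if_pos hl, if_pos]
            simp only [Finset.mem_insert, not_or] at hl
            rw [List.map_cons, List.nodup_cons]
            refine ⟨⟨fun h => (hl.2 s h).1 rfl, hl.1⟩, fun s' hs' => ?_⟩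
            rcases List.mem_cons.mp hs' with rfl | h
            · exact hs
            · exact (hl.2 s' h).2
          · rw [if_neg hl]
            split_ifs <;> norm_num
      · rw [avgSalts_add, avgSalts_const]
        refine add_le_add le_rfl ((ih _).trans ?_)
        have : ((insert s A).card : ℝ) ≤ A.card + 1 := by exact_mod_cast Finset.card_insert_le s A
        gcongr
    refine (avg_mono h1).trans ?_
    rw [avg_add, avg_const]
    have h2 : (avg fun s : R => if s ∈ A then (1 : ℝ) else 0) = A.card / Fintype.card R := by
      simp [avg, div_eq_inv_mul]
    rw [h2, ← add_div, List.length_cons]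
    push_cast
    gcongr
    nlinarith

/-- Two functions of the salts that are close for distinct salts have close expectations. -/
theorem abs_avgSalts_sub_le {qs : List α} {g h : List (α × R) → ℝ} {c : ℝ} (hc : 0 ≤ c)
    (H1 : ∀ l, l.map Prod.fst = qs → |g l - h l| ≤ 1)
    (H : ∀ l, l.map Prod.fst = qs → (l.map Prod.snd).Nodup → |g l - h l| ≤ c) :
    |avgSalts qs g - avgSalts qs h| ≤ c + (qs.length : ℝ) ^ 2 / Fintype.card R := by
  have hcol := avgSalts_collision_le qs (∅ : Finset R)
  simp only [Finset.notMem_empty, not_false_eq_true, implies_true, and_true, Finset.card_empty,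
    Nat.cast_zero, zero_add, ← sq] at hcol
  have key : ∀ g h : List (α × R) → ℝ, (∀ l, l.map Prod.fst = qs → g l - h l ≤ 1) →
      (∀ l, l.map Prod.fst = qs → (l.map Prod.snd).Nodup → g l - h l ≤ c) →
      avgSalts qs g - avgSalts qs h ≤ c + (qs.length : ℝ) ^ 2 / Fintype.card R := by
    intro g h H1 H
    have := avgSalts_mono (qs := qs) (g := g) (h := fun l => (h l + c) +
      if (l.map Prod.snd).Nodup then (0 : ℝ) else 1) fun l hl => by
        by_cases hn : (l.map Prod.snd).Nodup
        · have := H l hl hn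
          rw [if_pos hn]
          linarith
        · have := H1 l hl
          rw [if_neg hn]
          linarith
    rw [avgSalts_add, avgSalts_add, avgSalts_const] at this
    linarith
  rw [abs_le]
  constructor
  · have := key h g (fun l hl => by linarith [(abs_le.mp (H1 l hl)).1])
      fun l hl hn => by linarith [(abs_le.mp (H l hl hn)).1]
    linarith
  · exact key g h (fun l hl => (abs_le.mp (H1 l hl)).2) fun l hl hn => (abs_le.mp (H l hl hn)).2

end AvgSalts

/-! ### Drawing the salts in advance -/

section Runs

variable {S : QScheme} (D : Decomposition S) {R W : Type} [Fintype R] [Fintype W]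

theorem ampl_saltedDec_decStep (F : R → S.K) (pre : Channel W ((R × S.C) × W))
    (post : Channel (Option S.M × W) W) (ρ : Op W) :
    reix (Prod.fst : W × Unit → W)
        (post.map (ampl (measureBot S.M ∘ₗ saltedDec fun s => (S.dec (F s)).map) W (pre.map ρ))) =
      decStep pre post (fun s => Handler.real (F s) Unit) (reix Prod.fst ρ) := by
  have h1 : ∀ s, decBlock pre post s (Handler.real (F s) Unit) (reix Prod.fst ρ) =
      reix Prod.fst (post.map (ampl (S.decMeas (F s)) W
        (reix (fun p : S.C × W => ((s, p.1), p.2)) (pre.map ρ)))) := fun s => rfl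
  rw [decStep, LinearMap.sum_apply]
  simp only [h1, ← map_sum]
  congr 2
  ext ⟨o, w⟩ ⟨o', w'⟩
  simp only [ampl_apply, LinearMap.comp_apply, saltedDec, LinearMap.coe_mk, AddHom.coe_mk,
    map_sum, Matrix.sum_apply]
  rfl

variable [DecidableEq R]

theorem re_hybrid_avg [Nonempty S.M] (F : R → S.K) (f : Op W →ₗ[ℂ] ℂ) (b : ℕ)
    (l : List (Query S.M (R × S.C) W × R)) (L : Type) [Fintype L] (h : R → Handler S L)
    (X : R → Op (W × L)) :
    (hybrid D F f b l L h ((Fintype.card R : ℂ)⁻¹ • ∑ s, X s)).re =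
      avg fun s => (hybrid D F f b l L h (X s)).re := by
  rw [map_smul, map_sum, re_inv_card_smul_sum]

theorem ampl_saltedEnc_encStep (F : R → S.K) (pre : Channel W (S.M × W))
    (post : Channel ((R × S.C) × W) W) (ρ : Op W) :
    reix (Prod.fst : W × Unit → W)
        (post.map (ampl (saltedEnc fun s => (S.enc (F s)).map) W (pre.map ρ))) =
      (Fintype.card R : ℂ)⁻¹ • ∑ s, encStep pre post s (S.enc (F s)).map Unit
        (reix Prod.fst ρ) := by
  have h1 : ∀ s, encStep pre post s (S.enc (F s)).map Unit (reix Prod.fst ρ) =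
      reix Prod.fst (post.map (pullOp (fun p : (R × S.C) × W =>
        if p.1.1 = s then some (p.1.2, p.2) else none)
          (ampl (S.enc (F s)).map W (pre.map ρ)))) := by
    intro s
    have e1 : encStep pre post s (S.enc (F s)).map Unit (reix Prod.fst ρ) =
        ampl post.map Unit (pullOp (fun p : ((R × S.C) × W) × Unit =>
          if p.1.1.1 = s then some (p.1.1.2, (p.1.2, p.2)) else none)
          (reix (fun p : S.C × (W × Unit) => (p.1, p.2.1))
            (ampl (S.enc (F s)).map W (pre.map ρ)))) := rfl
    have e2 : ∀ Y : Op ((R × S.C) × W), reix (Prod.fst : W × Unit → W) (post.map Y) =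
        ampl post.map Unit (reix Prod.fst Y) := fun Y => rfl
    rw [e1, e2, pullOp_reix]
    congr 1
    ext x y
    simp only [reix_apply, pullOp_apply]
    by_cases hx : x.1.1.1 = s <;> by_cases hy : y.1.1.1 = s <;> simp [hx, hy]
  simp only [h1, ← map_sum, ← map_smul]
  congr 2
  ext ⟨⟨s, c⟩, w⟩ ⟨⟨s', c'⟩, w'⟩
  rw [ampl_apply, Matrix.smul_apply, Matrix.sum_apply, Finset.sum_eq_single s]
  · by_cases hs : s = s'
    · subst hs
      simp [saltedEnc, pullOp_apply, ampl_apply]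
    · simp [saltedEnc, pullOp_apply, hs, Ne.symm hs]
  · intro z _ hz
    simp [pullOp_apply, Ne.symm hz]
  · simp

variable [Nonempty R]

/-- The run is linear in the state, so the mixture over salts becomes an average of runs. The salt
attached to a decryption query is ignored and averages out. -/
theorem realRun_withRandomFunction [Nonempty S.M] (F : R → S.K) (effect : Op W)
    (qs : List (Query S.M (R × S.C) W)) (ρ : Op W) :
    realRun (S.withRandomFunction R) F effect qs ρ =
      avgSalts qs fun l => (hybrid D F (effectFn effect) 0 l Unit
        (fun s => Handler.real (F s) Unit) (reix Prod.fst ρ)).re := by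
  induction qs generalizing ρ with
  | nil =>
    rw [avgSalts, hybrid_nil, LinearMap.comp_apply, effectFn_apply]
    have : trR (reix (Prod.fst : W × Unit → W) ρ) = ρ := by
      ext w w'
      simp [trR_apply]
    rw [this]
    rfl
  | cons q qs ih =>
    obtain ⟨pre, post⟩ | ⟨pre, post⟩ := q
    · refine (ih (post.map (ampl (saltedEnc fun s => (S.enc (F s)).map) W (pre.map ρ)))).trans ?_
      simp only [ampl_saltedEnc_encStep, re_hybrid_avg, avgSalts_avg, avgSalts, hybrid,
        LinearMap.comp_apply]
      congr 1
      funext s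
      rw [Function.update_eq_self s fun s => Handler.real (F s) Unit]
    · refine (ih (post.map (ampl (measureBot S.M ∘ₗ saltedDec fun s => (S.dec (F s)).map) W
        (pre.map ρ)))).trans ?_
      simp only [ampl_saltedDec_decStep, avgSalts, hybrid_dec, LinearMap.comp_apply, avg_const]

theorem idealRun_withRandomFunction [DecidableEq W] (F : R → S.K) (effect : Op W)
    (qs : List (Query S.M (R × S.C) W)) (j : ℕ) (r : Fin j → R × D.T) (ρ : Op (W × Mem S.M j)) :
    idealRun (D.withRandomFunction R) F effect qs j r ρ =
      avgSalts qs fun l => idealSaltedRun D F effect l j r ρ := by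
  induction qs generalizing j with
  | nil => rfl
  | cons q qs ih =>
    obtain ⟨pre, post⟩ | ⟨pre, post⟩ := q
    · have h : idealRun (D.withRandomFunction R) F effect (.enc pre post :: qs) j r ρ =
          ∑ z : R × D.T, ((Fintype.card R : ℝ)⁻¹ * D.p (F z.1) z.2) *
            idealRun (D.withRandomFunction R) F effect qs (j + 1)
              (Fin.snoc (α := fun _ => R × D.T) r z) (ampl post.map (Mem S.M (j + 1))
                (idealEnc (D.withRandomFunction R) F z (ampl pre.map (Mem S.M j) ρ))) := rfl
      refine h.trans ?_
      rw [Fintype.sum_prod_type, avgSalts, avg, Finset.mul_sum]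
      refine Finset.sum_congr rfl fun s _ => ?_
      simp only [idealSaltedRun, avgSalts_sum, avgSalts_mul, Finset.mul_sum]
      refine Finset.sum_congr rfl fun t _ => ?_
      rw [mul_assoc]
      congr 2
      exact ih _ _ _
    · refine (ih j r _).trans ?_
      simp only [avgSalts, idealSaltedRun, avg_const]
      rfl

end Runs

/-! ### Weights in the ideal experiment -/

section Bounds

variable {M T W : Type} [Fintype M] [Fintype T] [Fintype W] {j : ℕ}

/-- The exchange of `M'` with the register `M` of the entry `i`. -/
def swapEntry (M T W : Type) {j : ℕ} (i : Fin j) :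
    T × (M × (W × Mem M j)) ≃ ((M × T) × W) × Mem M j where
  toFun p := ((((p.2.2.2 i).2, p.1), p.2.2.1), Function.update p.2.2.2 i ((p.2.2.2 i).1, p.2.1))
  invFun q := (q.1.1.2, ((q.2 i).2, (q.1.2, Function.update q.2 i ((q.2 i).1, q.1.1.1))))
  left_inv p := by simp
  right_inv q := by simp

theorem retEntry_cp (i : Fin j) : IsCP (retEntry M T W i) :=
  (reix_cp _).comp ((pullOp_cp _).comp (trL_cp.comp (reix_cp _)))

theorem retEntry_tp (i : Fin j) : IsTP (retEntry M T W i) := fun σ => by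
  have h1 : ∀ Y : Op (Option M × (W × Mem M j)),
      (reix (fun p : (Option M × W) × Mem M j => (p.1.1, (p.1.2, p.2))) Y).trace = Y.trace :=
    fun Y => reix_trace_equiv (Equiv.prodAssoc _ _ _) Y
  simp only [retEntry, LinearMap.comp_apply, h1]
  rw [embSome_tp, trL_trace]
  exact reix_trace_equiv (swapEntry M T W i) σ

theorem retBot_cp : IsCP (retBot M T W j) :=
  (reix_cp _).comp ((pullOp_cp _).comp (trL_cp.comp (reix_cp _)))

theorem retBot_tp : IsTP (retBot M T W j) := fun σ => by
  have h1 : ∀ Y : Op (Option M × (W × Mem M j)),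
      (reix (fun p : (Option M × W) × Mem M j => (p.1.1, (p.1.2, p.2))) Y).trace = Y.trace :=
    fun Y => reix_trace_equiv (Equiv.prodAssoc _ _ _) Y
  simp only [retBot, LinearMap.comp_apply, h1]
  rw [embNone_tp, trL_trace]
  exact reix_trace_equiv (Equiv.prodAssoc _ _ _).symm σ

/-- Every round applies complete projective measurements, so the weight is conserved; orthogonality
of different tags is not needed. -/
theorem decLoop_posSemidef_trace [DecidableEq M] [DecidableEq T] [DecidableEq W] [Nonempty M]
    {ψ : Fin j → T → ℂ} (hψ : ∀ i, star (ψ i) ⬝ᵥ ψ i = 1) (is : List (Fin j)) {σ : Op (((M × T) × W) × Mem M j)}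
    (hσ : σ.PosSemidef) :
    (decLoop ψ is σ).PosSemidef ∧ (decLoop ψ is σ).trace.re = σ.trace.re := by
  induction is generalizing σ with
  | nil =>
    rw [decLoop, returnBot_eq]
    exact ⟨retBot_cp.posSemidef hσ, congrArg Complex.re (retBot_tp σ)⟩
  | cons i is ih =>
    have hP := tagProj_conjTranspose (M := M) (W := W) (j := j) (ψ i)
    have hQ := bellProj_conjTranspose (M := M) (T := T) (W := W) i
    have hPP := tagProj_mul_self (M := M) (W := W) (j := j) (hψ i)
    have hQQ := bellProj_mul_self (M := M) (T := T) (W := W) i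
    set P : Op (((M × T) × W) × Mem M j) := tagProj (ψ i) with hPdef
    set Q : Op (((M × T) × W) × Mem M j) := bellProj i with hQdef
    have h : decLoop ψ (i :: is) σ = retEntry M T W i (conjL Q (conjL P σ)) +
        decLoop ψ is (conjL (1 - P) σ + conjL (1 - Q) (conjL P σ)) := by
      simp only [conjL_apply, conjTranspose_sub, conjTranspose_one, hP, hQ]
      rw [decLoop, returnEntry_eq]
    have hPσ := (conjL_cp P).posSemidef hσ
    obtain ⟨h1, h2⟩ := ih (((conjL_cp (1 - P)).posSemidef hσ).add
      ((conjL_cp (1 - Q)).posSemidef hPσ))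
    refine ⟨?_, ?_⟩
    · rw [h]
      exact ((retEntry_cp i).posSemidef ((conjL_cp Q).posSemidef hPσ)).add h1
    · rw [h, Matrix.trace_add, Complex.add_re, h2, retEntry_tp, Matrix.trace_add, Complex.add_re,
        ← conjL_trace_add_of_proj hPP hP σ, ← conjL_trace_add_of_proj hQQ hQ (conjL P σ)]
      ring

end Bounds

section RunBounds

variable {S : QScheme} {D : Decomposition S} {R W : Type} [Fintype R] [DecidableEq R] [Nonempty R]
  [Fintype W] [DecidableEq W] [Nonempty S.M]

/-- Colliding salts are handled by the trivial bound 1 on the difference of the experiments, so the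
run must be a probability without any assumption on the salts. -/
theorem idealSaltedRun_mem {F : R → S.K} {effect : Op W} (he : effect.PosSemidef)
    (he' : (1 - effect).PosSemidef) (qs : List (Query S.M (R × S.C) W × R)) {j : ℕ}
    (r : Fin j → R × D.T) {ρ : Op (W × Mem S.M j)} (hρ : ρ.PosSemidef) :
    0 ≤ idealSaltedRun D F effect qs j r ρ ∧
      idealSaltedRun D F effect qs j r ρ ≤ ρ.trace.re := by
  induction qs generalizing j with
  | nil =>
    rw [idealSaltedRun, effectFn_trR, ← trR_trace ρ]
    exact ⟨(effectFn_pos he).re_nonneg (trR_cp.posSemidef hρ),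
      effectFn_subTr he' _ (trR_cp.posSemidef hρ)⟩
  | cons q qs ih =>
    obtain ⟨⟨pre, post⟩ | ⟨pre, post⟩, s⟩ := q
    · rw [idealSaltedRun]
      have key : ∀ t : D.T, (ampl post.map (Mem S.M (j + 1)) (idealEnc (D.withRandomFunction R) F
          (s, t) (ampl pre.map (Mem S.M j) ρ))).PosSemidef ∧
          (ampl post.map (Mem S.M (j + 1)) (idealEnc (D.withRandomFunction R) F
          (s, t) (ampl pre.map (Mem S.M j) ρ))).trace.re ≤ ρ.trace.re := by
        intro t
        -- Positivity and trace are inherited from `idealEncStep`, with the memory identified with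
        -- itself.
        have h := idealEncStep_eq (D := D) F (Equiv.refl (Mem S.M j)) s t pre post ρ
        have hid : reix (Prod.map id (Equiv.refl (Mem S.M j))) ρ = ρ := rfl
        rw [hid] at h
        set X : Op (W × Mem S.M (j + 1)) := ampl post.map (Mem S.M (j + 1))
          (idealEnc (D.withRandomFunction R) F (s, t) (ampl pre.map (Mem S.M j) ρ)) with hX
        have hp := (idealEncStep_cp pre post s (D.encR_cp (F s) t)).posSemidef hρ
        have ht := idealEncStep_tni pre post s (D.encR_cp (F s) t) (D.encR_tp (F s) t) ρ hρ
        have h' : idealEncStep pre post s (D.encR (F s) t) (Mem S.M j) ρ =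
          reix ((Equiv.refl W).prodCongr (snocMem (Equiv.refl (Mem S.M j)))) X := h
        rw [h'] at hp ht
        rw [reix_trace_equiv] at ht
        refine ⟨?_, ht⟩
        exact (Matrix.posSemidef_submatrix_equiv _).mp hp
      constructor
      · exact Finset.sum_nonneg fun t _ => mul_nonneg (D.p_nonneg _ _) (ih _ (key t).1).1
      · calc _ ≤ ∑ t, D.p (F s) t * ρ.trace.re := Finset.sum_le_sum fun t _ =>
              mul_le_mul_of_nonneg_left ((ih _ (key t).1).2.trans (key t).2) (D.p_nonneg _ _)
          _ = ρ.trace.re := by rw [← Finset.sum_mul, D.p_sum, one_mul]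
    · rw [idealSaltedRun]
      set D' := D.withRandomFunction R with hD'
      let V : Matrix (R × S.C) (S.M × (R × D.T)) ℂ := D'.V F
      have hco : V * Vᴴ = 1 := D'.V_coisometry F
      have hcp : IsCP (undoV V) := ⟨Unit, inferInstance, fun _ => Vᴴ, fun X => by
        rw [Finset.univ_unique, Finset.sum_singleton, conjTranspose_conjTranspose]
        rfl⟩
      let ψ : Fin j → R × D.T → ℂ := fun i => D'.ψ F (r i)
      have hψ : ∀ i, star (ψ i) ⬝ᵥ ψ i = 1 := fun i =>
        (D'.ψ_orthonormal F (r i) (r i)).trans (if_pos rfl)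
      have hσ := ((hcp.ampl W).ampl (Mem S.M j)).posSemidef
        ((pre.cp.ampl (Mem S.M j)).posSemidef hρ)
      obtain ⟨h1, h2⟩ := decLoop_posSemidef_trace hψ (List.finRange j) hσ
      rw [((undoV_tp hco).ampl W).ampl (Mem S.M j), pre.tp.ampl] at h2
      have h3 := ih r ((post.cp.ampl (Mem S.M j)).posSemidef h1)
      rw [post.tp.ampl, h2] at h3
      exact h3

end RunBounds

/-! ### Comparison of the two experiments -/

section Game

variable {S : QScheme} {D : Decomposition S} {R W : Type} [Fintype R] [DecidableEq R] [Nonempty R]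
  [Fintype W] [DecidableEq W] [Nonempty S.M] [Nonempty S.C]

theorem hybrid_sub_idealSaltedRun_le {μ : ℝ} (hμ : 0 < μ) (hμ1 : μ ≤ 1)
    (hQ : QCABound D (μ ^ 4)) (hM : 2 ≤ Fintype.card S.M)
    (hc : ∀ k, diamondNorm ((S.dec k).map ∘ₗ (S.enc k).map - embedBot S.M) ≤
      ENNReal.ofReal (μ ^ 4)) {effect ρ : Op W} (he : effect.PosSemidef)
    (he' : (1 - effect).PosSemidef) (hρ : ρ.PosSemidef) (hρ1 : ρ.trace = 1)
    (qs : List (Query S.M (R × S.C) W × R)) (hqs : (qs.map Prod.snd).Nodup) :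
    |(avg fun F : R → S.K => (hybrid D F (effectFn effect) 0 qs Unit
        (fun s => Handler.real (F s) Unit) (reix Prod.fst ρ)).re) -
      avg fun F : R → S.K => idealSaltedRun D F effect qs 0 Fin.elim0
        (ρ.submatrix Prod.fst Prod.fst)| ≤ 404 * ((qs.length : ℝ) + 1) ^ 4 * μ := by
  set q : ℝ := (qs.length : ℝ) with hq
  have hq0 : 0 ≤ q := Nat.cast_nonneg _
  have hf := effectFn_pos he
  have hf' := effectFn_subTr he'
  set σ : Op (W × Unit) := reix Prod.fst ρ with hσdef
  have hσ : σ.PosSemidef := (reix_cp _).posSemidef hρ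
  have hσ1 : σ.trace.re = 1 := by
    have : σ.trace = ρ.trace := reix_trace_equiv (Equiv.prodPUnit W) ρ
    rw [this, hρ1, Complex.one_re]
  have h1 := hybrid_real_sub_usedOnly_le hQ (by positivity) hM hf hf' qs (∅ : Finset R)
    (fun _ => σ) (fun _ => hσ) (fun _ _ _ _ => rfl)
  -- At the start no salt has been used, so rejecting unused salts means rejecting everything. This
  -- is the initial handler of all hybrids.
  have hnull : ∀ F : R → S.K, usedOnly Unit ∅ F = fun _ : R => Handler.null S Unit := fun F => by
    funext s
    simp [usedOnly]
  simp only [hnull, hσ1, avg_const, mul_one] at h1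
  have h2 : ∀ m : ℕ, |(avg fun F : R → S.K => (hybrid D F (effectFn effect) 0 qs Unit
      (fun _ => Handler.null S Unit) σ).re) - avg fun F : R → S.K =>
        (hybrid D F (effectFn effect) m qs Unit (fun _ => Handler.null S Unit) σ).re| ≤
      m * (400 * (q + 1) ^ 3 * μ) := by
    intro m
    induction m with
    | zero => simp
    | succ m ih =>
      have h := hybrid_sub_succ_le hμ hμ1 hQ hM hc hf hf' qs le_rfl hqs m Unit
        (fun _ _ => Handler.null S Unit) (fun _ => σ) (fun _ => hσ) (fun _ _ _ _ => rfl)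
        (fun _ _ _ _ => rfl)
      simp only [hσ1, avg_const, mul_one] at h
      refine (abs_sub_le _ _ _).trans ((add_le_add ih h).trans (le_of_eq ?_))
      push_cast
      ring
  -- After as many hybrids as there are queries every encryption is ideal, and the empty memory
  -- satisfies `TracksIdeal` trivially.
  have h3 : ∀ F : R → S.K, idealSaltedRun D F effect qs 0 Fin.elim0
      (ρ.submatrix Prod.fst Prod.fst) = (hybrid D F (effectFn effect) qs.length qs Unit
        (fun _ => Handler.null S Unit) σ).re := fun F =>
    idealSaltedRun_eq_hybrid effect qs hqs le_rfl (fun i => i.elim0) (fun i => i.elim0)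
      (e := Equiv.ofUnique Unit (Mem S.M 0)) (fun s Y => by simp) _
  simp only [h3]
  refine (abs_sub_le _ _ _).trans ((add_le_add h1 (h2 qs.length)).trans ?_)
  have hμ4 : μ ^ 4 ≤ μ := by
    have := pow_le_pow_of_le_one hμ.le hμ1 (show 1 ≤ 4 by norm_num)
    simpa using this
  have hq3 : q ≤ (q + 1) ^ 4 := by nlinarith [sq_nonneg q, sq_nonneg (q + 1), pow_nonneg hq0 3, pow_nonneg hq0 4]
  have hq4 : q * (q + 1) ^ 3 ≤ (q + 1) ^ 4 := by
    have : 0 ≤ (q + 1) ^ 3 := by positivity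
    nlinarith
  calc q * (4 * μ ^ 4) + q * (400 * (q + 1) ^ 3 * μ)
      ≤ (q + 1) ^ 4 * (4 * μ) + 400 * (q + 1) ^ 4 * μ := by
        have a1 : q * (4 * μ ^ 4) ≤ (q + 1) ^ 4 * (4 * μ) := by gcongr
        have a2 : q * (400 * (q + 1) ^ 3 * μ) = 400 * (q * (q + 1) ^ 3) * μ := by ring
        rw [a2]
        gcongr
    _ = 404 * (q + 1) ^ 4 * μ := by ring

/-- The averages over `F` and over the salts are exchanged: the hybrid argument needs fixed distinct
salts and a random `F`. -/
theorem abs_realRun_sub_idealRun_le {μ : ℝ} (hμ : 0 < μ) (hμ1 : μ ≤ 1)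
    (hQ : QCABound D (μ ^ 4)) (hM : 2 ≤ Fintype.card S.M)
    (hc : ∀ k, diamondNorm ((S.dec k).map ∘ₗ (S.enc k).map - embedBot S.M) ≤
      ENNReal.ofReal (μ ^ 4)) {effect ρ₀ : Op W} (he : effect.PosSemidef)
    (he' : (1 - effect).PosSemidef) (hρ₀ : ρ₀.PosSemidef) (hρ₀1 : ρ₀.trace = 1)
    (qs : List (Query S.M (R × S.C) W)) :
    |(avg fun F : R → S.K => realRun (S.withRandomFunction R) F effect qs ρ₀) -
      avg fun F : R → S.K => idealRun (D.withRandomFunction R) F effect qs 0 Fin.elim0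
        (ρ₀.submatrix Prod.fst Prod.fst)| ≤
      404 * ((qs.length : ℝ) + 1) ^ 4 * μ + (qs.length : ℝ) ^ 2 / Fintype.card R := by
  have e1 := (congrArg avg (funext fun F : R → S.K =>
    realRun_withRandomFunction D F effect qs ρ₀)).trans (avgSalts_avg qs _).symm
  have e2 := (congrArg avg (funext fun F : R → S.K => idealRun_withRandomFunction D F effect qs 0
    Fin.elim0 (ρ₀.submatrix Prod.fst Prod.fst))).trans (avgSalts_avg qs _).symm
  refine (congrArg abs (congrArg₂ (· - ·) e1 e2)).trans_le ?_
  have hρp : (ρ₀.submatrix (Prod.fst : W × Mem S.M 0 → W) Prod.fst).PosSemidef :=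
    hρ₀.submatrix _
  have hρt : (ρ₀.submatrix (Prod.fst : W × Mem S.M 0 → W) Prod.fst).trace.re = 1 := by
    have : (ρ₀.submatrix (Prod.fst : W × Mem S.M 0 → W) Prod.fst).trace = ρ₀.trace :=
      reix_trace_equiv (Equiv.prodUnique W (Mem S.M 0)) ρ₀
    rw [this, hρ₀1, Complex.one_re]
  have hσp : (reix (Prod.fst : W × Unit → W) ρ₀).PosSemidef := (reix_cp _).posSemidef hρ₀
  have hσt : (reix (Prod.fst : W × Unit → W) ρ₀).trace.re = 1 := by
    have : (reix (Prod.fst : W × Unit → W) ρ₀).trace = ρ₀.trace :=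
      reix_trace_equiv (Equiv.prodPUnit W) ρ₀
    rw [this, hρ₀1, Complex.one_re]
  refine abs_avgSalts_sub_le (by positivity) (fun l _ => ?_) fun l hl hn => ?_
  · rw [← avg_sub]
    refine (abs_avg_le _).trans ((avg_mono (h := fun _ => (1 : ℝ)) fun F => ?_).trans
      (avg_const _).le)
    have h1 := (hybrid_pos D (F := F) (effectFn_pos he) l 0 Unit
      (fun s => Handler.real (F s) Unit)).re_nonneg hσp
    have h2 := hybrid_subTr D (F := F) (effectFn_subTr he') l 0 Unit
      (fun s => Handler.real (F s) Unit) _ hσp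
    have h3 := idealSaltedRun_mem (D := D) (F := F) he he' l Fin.elim0 hρp
    rw [hρt] at h3
    rw [hσt] at h2
    rw [abs_le]
    constructor <;> linarith [h3.1, h3.2]
  · have hlen : l.length = qs.length := by rw [← hl, List.length_map]
    rw [← hlen]
    exact hybrid_sub_idealSaltedRun_le hμ hμ1 hQ hM hc he he' hρ₀ hρ₀1 l hn

theorem abs_qaeReal_sub_qaeIdeal_le {μ : ℝ} (hμ : 0 < μ) (hμ1 : μ ≤ 1)
    (hQ : QCABound D (μ ^ 4)) (hM : 2 ≤ Fintype.card S.M)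
    (hc : ∀ k, diamondNorm ((S.dec k).map ∘ₗ (S.enc k).map - embedBot S.M) ≤
      ENNReal.ofReal (μ ^ 4))
    (A : Adversary (S.withRandomFunction R).M (S.withRandomFunction R).C) :
    |qaeReal (S.withRandomFunction R) A - qaeIdeal (D.withRandomFunction R) A| ≤
      404 * ((A.queries.length : ℝ) + 1) ^ 4 * μ +
        (A.queries.length : ℝ) ^ 2 / Fintype.card R :=
  abs_realRun_sub_idealRun_le (R := R) hμ hμ1 hQ hM hc A.effect_pos A.effect_le A.init_pos
    A.init_trace A.queries

end Game

/-! ### Correctness of the salted scheme -/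

section Correctness

/-- For each `F` the error map is the average over `s` of the error maps for the keys `F s`, and the
norm is convex. -/
theorem diamondNorm_salted_le {S : QScheme} {R : Type} [Fintype R] [DecidableEq R] [Nonempty R]
    {ε : ℝ} (hε : ∀ k, diamondNorm ((S.dec k).map ∘ₗ (S.enc k).map - embedBot S.M) ≤
      ENNReal.ofReal ε) (F : R → S.K) :
    diamondNorm (((S.withRandomFunction R).dec F).map ∘ₗ ((S.withRandomFunction R).enc F).map -
      embedBot (S.withRandomFunction R).M) ≤ ENNReal.ofReal ε := by
  have hR : (Fintype.card R : ℂ) ≠ 0 := by exact_mod_cast Fintype.card_ne_zero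
  set Ψ : R → Op S.M →ₗ[ℂ] Op (Option S.M) := fun s =>
    (S.dec (F s)).map ∘ₗ (S.enc (F s)).map - embedBot S.M with hΨ
  have h : saltedDec (fun s => (S.dec (F s)).map) ∘ₗ saltedEnc (fun s => (S.enc (F s)).map) -
      embedBot S.M = (Fintype.card R : ℂ)⁻¹ • ∑ s, Ψ s := by
    ext1 X
    have h1 : ∀ s, (saltedEnc (fun s => (S.enc (F s)).map) X).submatrix (fun i => (s, i))
        (fun i => (s, i)) = (Fintype.card R : ℂ)⁻¹ • (S.enc (F s)).map X := by
      intro s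
      ext i i'
      simp [saltedEnc]
    have h2 : saltedDec (fun s => (S.dec (F s)).map)
        (saltedEnc (fun s => (S.enc (F s)).map) X) =
        (Fintype.card R : ℂ)⁻¹ • ∑ s, (S.dec (F s)).map ((S.enc (F s)).map X) := by
      simp only [saltedDec, LinearMap.coe_mk, AddHom.coe_mk, h1, map_smul, Finset.smul_sum]
    rw [LinearMap.sub_apply, LinearMap.comp_apply, h2, LinearMap.smul_apply, LinearMap.sum_apply]
    simp only [hΨ, LinearMap.sub_apply, LinearMap.comp_apply, Finset.sum_sub_distrib, smul_sub,
      Finset.sum_const, Finset.card_univ]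
    rw [← Nat.cast_smul_eq_nsmul ℂ, smul_smul, inv_mul_cancel₀ hR, one_smul]
  change diamondNorm (saltedDec (fun s => (S.dec (F s)).map) ∘ₗ
    saltedEnc (fun s => (S.enc (F s)).map) - embedBot S.M) ≤ _
  rw [h]
  refine iSup_le fun d => iSup_le fun X => iSup_le fun hX => ?_
  have hb : ∀ s, ENNReal.ofReal (traceNorm (ampl (Ψ s) (Fin d) X)) ≤ ENNReal.ofReal ε := fun s => by
    refine le_trans ?_ (hε (F s))
    exact le_iSup_of_le d (le_iSup_of_le X (le_iSup_of_le (ι := traceNorm X ≤ 1) hX le_rfl))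
  rw [ampl_smul, ampl_sum, LinearMap.smul_apply, LinearMap.sum_apply]
  -- Passing through the largest term avoids an assumption on the sign of `ε`.
  obtain ⟨s₀, -, hs₀⟩ := Finset.exists_max_image Finset.univ
    (fun s => traceNorm (ampl (Ψ s) (Fin d) X)) Finset.univ_nonempty
  refine (ENNReal.ofReal_le_ofReal ?_).trans (hb s₀)
  refine (traceNorm_smul_le _ _).trans ((mul_le_mul_of_nonneg_left ((traceNorm_sum_le _ _).trans
    (Finset.sum_le_card_nsmul _ _ _ hs₀)) (norm_nonneg _)).trans (le_of_eq ?_))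
  have hR' : (Fintype.card R : ℝ) ≠ 0 := by exact_mod_cast Fintype.card_ne_zero
  rw [nsmul_eq_mul, Finset.card_univ, norm_inv, Complex.norm_natCast, inv_mul_cancel_left₀ hR']

theorem IsCorrect.withRandomFunction {Pi : ℕ → QScheme} (h : IsCorrect Pi) (R : ℕ → Type)
    [∀ n, Fintype (R n)] [∀ n, DecidableEq (R n)] [∀ n, Nonempty (R n)] :
    IsCorrect fun n => (Pi n).withRandomFunction (R n) := by
  obtain ⟨ε, hε, H⟩ := h
  exact ⟨ε, hε, fun n F => diamondNorm_salted_le (H n) F⟩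

end Correctness

/-! ### A bound uniform in the attack -/

section Uniform

/-- A one-time attack on the ciphertexts of `S`. -/
structure Attack (S : QScheme) where
  B : Type
  B' : Type
  [fintypeB : Fintype B]
  [decEqB : DecidableEq B]
  [fintypeB' : Fintype B']
  [decEqB' : DecidableEq B']
  Λ : Channel (S.C × B) (S.C × B')

attribute [instance] Attack.fintypeB Attack.decEqB Attack.fintypeB' Attack.decEqB'

/-- The distance of the effective map of an attack from its simulators. -/
def Attack.dist {S : QScheme} (D : Decomposition S) (a : Attack S) : ℝ≥0∞ :=
  ⨅ (rej : Op a.B →ₗ[ℂ] Op a.B') (_ : IsCP rej ∧ IsTP (accMap D a.Λ.map + rej)),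
    diamondNorm (effectiveMap S a.Λ.map - simulator S.M (accMap D a.Λ.map) rej)

instance (S : QScheme) : Nonempty (Attack S) :=
  ⟨{ B := Unit, B' := Unit, Λ := ⟨LinearMap.id, IsCP.id, fun _ => rfl⟩ }⟩

/-- The supremum may be infinite. Truncated at 1, its half is strictly smaller than the supremum
unless that is zero, so some member exceeds it. -/
theorem exists_half_iSup_le {ι : Type*} [Nonempty ι] (g : ι → ℝ≥0∞) :
    ∃ i, min (⨆ i, g i) 1 / 2 ≤ g i := by
  by_cases h : (⨆ i, g i) = 0
  · exact ⟨Classical.arbitrary ι, by simp [h]⟩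
  · have hm : min (⨆ i, g i) 1 ≠ 0 := by
      simp [h]
    have hlt : min (⨆ i, g i) 1 / 2 < ⨆ i, g i :=
      (ENNReal.half_lt_self hm (ne_top_of_le_ne_top ENNReal.one_ne_top (min_le_right _ _))).trans_le
        (min_le_left _ _)
    obtain ⟨i, hi⟩ := lt_iSup_iff.mp hlt
    exact ⟨i, hi.le⟩

theorem negligible_two_inv_pow : Negligible fun n => (2 : ℝ)⁻¹ ^ n := fun k =>
  tendsto_pow_const_mul_const_pow_of_abs_lt_one k (by norm_num [abs_of_pos])

theorem Negligible.abs {f : ℕ → ℝ} (hf : Negligible f) : Negligible fun n => |f n| :=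
  SuperpolynomialDecay.trans_abs_le hf fun _ => (abs_abs _).le

/-- The bound of `IsQCA` can be chosen uniformly for all attacks. -/
theorem IsQCA.exists_bound {Pi : ℕ → QScheme} {D : ∀ n, Decomposition (Pi n)} (h : IsQCA Pi D) :
    ∃ ε : ℕ → ℝ, Negligible ε ∧ (∀ n, 0 < ε n) ∧ ∀ᶠ n in atTop, QCABound (D n) (ε n) := by
  -- A nearly worst attack is fixed for each `n`; QCA for this one family then controls all attacks.
  choose a ha using fun n => exists_half_iSup_le (Attack.dist (D n))
  obtain ⟨rej, hcp, htp, ε, hε, hd⟩ := h (fun n => (a n).B) (fun n => (a n).B') fun n => (a n).Λ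
  have hdist : ∀ n, (a n).dist (D n) ≤ ENNReal.ofReal (ε n) := fun n =>
    (iInf₂_le (rej n) ⟨hcp n, htp n⟩).trans (hd n)
  -- The factor 2 undoes the half in the choice of the attack. The summand `2⁻ⁿ` makes the bound
  -- strict, so that an actual `rej` lies below it and not only the infimum.
  refine ⟨fun n => |2 * ε n| + 2⁻¹ ^ n, ?_, fun n => by positivity, ?_⟩
  · exact (Negligible.abs (hε.const_mul 2)).add negligible_two_inv_pow
  -- Once `2ε < 1` the truncation at 1 has no effect, so the bound holds only eventually.
  · have hlim : Tendsto ε atTop (nhds 0) := by simpa using hε 0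
    filter_upwards [hlim.eventually (gt_mem_nhds (show (0 : ℝ) < 1 / 2 by norm_num))] with n hn
    have h1 : min (⨆ b, Attack.dist (D n) b) 1 ≤ ENNReal.ofReal (2 * ε n) := by
      have := (ha n).trans (hdist n)
      rw [ENNReal.div_le_iff (by norm_num) (by norm_num)] at this
      rwa [ENNReal.ofReal_mul (by norm_num), mul_comm, ENNReal.ofReal_ofNat]
    have h2 : (⨆ b, Attack.dist (D n) b) ≤ ENNReal.ofReal (2 * ε n) := by
      refine (min_le_iff.mp h1).resolve_right fun h3 => ?_
      rw [ENNReal.one_le_ofReal] at h3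
      linarith
    have h3 : ENNReal.ofReal (2 * ε n) < ENNReal.ofReal (|2 * ε n| + 2⁻¹ ^ n) := by
      rw [ENNReal.ofReal_lt_ofReal_iff (by positivity)]
      have := le_abs_self (2 * ε n)
      have : (0 : ℝ) < 2⁻¹ ^ n := by positivity
      linarith
    intro B B' _ _ _ _ Λ
    have h4 : Attack.dist (D n) ⟨B, B', Λ⟩ < ENNReal.ofReal (|2 * ε n| + 2⁻¹ ^ n) :=
      ((le_iSup (Attack.dist (D n)) _).trans h2).trans_lt h3
    obtain ⟨rej, hrej⟩ := iInf_lt_iff.mp h4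
    obtain ⟨-, hrej⟩ := iInf_lt_iff.mp hrej
    exact ⟨rej, hrej.le⟩

/-- Decay of `f` against `n^{2k}` gives decay of its root against `n^k`. -/
theorem Negligible.sqrt {f : ℕ → ℝ} (hf : Negligible f) : Negligible fun n => √(f n) := fun k => by
  have h := (Real.continuous_sqrt.tendsto 0).comp (hf (2 * k))
  rw [Real.sqrt_zero] at h
  refine h.congr fun n => ?_
  rw [Function.comp_apply, Real.sqrt_mul (by positivity), pow_mul, ← pow_mul, mul_comm 2 k, pow_mul,
    Real.sqrt_sq (by positivity)]

theorem Negligible.poly_mul {f : ℕ → ℝ} (hf : Negligible f) (q : Polynomial ℕ) :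
    Negligible fun n => ((q.eval n : ℕ) : ℝ) * f n := by
  have h := SuperpolynomialDecay.polynomial_mul (k := fun n : ℕ => (n : ℝ)) hf
    (q.map (Nat.castRingHom ℝ))
  refine h.congr fun n => ?_
  simp

end Uniform

/-! ### Asymptotic conclusion -/

theorem QScheme.nonempty_C (S : QScheme) [Nonempty S.M] : Nonempty S.C := by
  by_contra h
  rw [not_nonempty_iff] at h
  have := (S.enc (Classical.arbitrary S.K)).tp 1
  rw [Matrix.trace_one] at this
  simp only [Matrix.trace, Finset.univ_eq_empty, Finset.sum_empty] at this
  exact Fintype.card_ne_zero (α := S.M) (by exact_mod_cast this.symm)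

theorem IsQCA.isQAE_withRandomFunction {Pi : ℕ → QScheme} (hcorrect : IsCorrect Pi)
    (hM : ∀ᶠ n in atTop, 2 ≤ Fintype.card (Pi n).M)
    {D : ∀ n, Decomposition (Pi n)} (hQCA : IsQCA Pi D) :
    IsQAE (fun n => (Pi n).withRandomFunction (Fin n → Bool))
      (fun n => (D n).withRandomFunction (Fin n → Bool)) := by
  intro A ⟨q, hq⟩
  obtain ⟨ε, hε, hc⟩ := hcorrect
  obtain ⟨δ, hδ, hδ0, hQ⟩ := hQCA.exists_bound
  -- One positive negligible function bounds both the correctness error and the QCA error; its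
  -- fourth root is the parameter `μ` of the single-key theorem, and stays negligible.
  set η : ℕ → ℝ := fun n => |ε n| + δ n with hηdef
  have hη : Negligible η := hε.abs.add hδ
  have hη0 : ∀ n, 0 < η n := fun n => add_pos_of_nonneg_of_pos (abs_nonneg _) (hδ0 n)
  set μ : ℕ → ℝ := fun n => √√(η n) with hμdef
  have hμ : Negligible μ := hη.sqrt.sqrt
  have hμ0 : ∀ n, 0 < μ n := fun n => Real.sqrt_pos.mpr (Real.sqrt_pos.mpr (hη0 n))
  have hμ4 : ∀ n, μ n ^ 4 = η n := fun n => by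
    have : μ n ^ 4 = (√√(η n) ^ 2) ^ 2 := by rw [← pow_mul]
    rw [this, Real.sq_sqrt (Real.sqrt_nonneg _), Real.sq_sqrt (hη0 n).le]
  have hμlim : Tendsto μ atTop (nhds 0) := by simpa using hμ 0
  have hbound : Negligible fun n => (((404 * (q + 1) ^ 4 : Polynomial ℕ).eval n : ℕ) : ℝ) * μ n +
      (((q ^ 2 : Polynomial ℕ).eval n : ℕ) : ℝ) * 2⁻¹ ^ n :=
    (hμ.poly_mul _).add (negligible_two_inv_pow.poly_mul _)
  refine SuperpolynomialDecay.trans_eventually_abs_le hbound ?_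
  filter_upwards [hM, hQ, hμlim.eventually (gt_mem_nhds one_pos)] with n hMn hQn hμn
  have : Nonempty (Pi n).M := Fintype.card_pos_iff.mp (by omega)
  have := (Pi n).nonempty_C
  have hQ' : QCABound (D n) (μ n ^ 4) := by
    intro B B' _ _ _ _ Λ
    obtain ⟨rej, h⟩ := hQn B B' Λ
    refine ⟨rej, h.trans (ENNReal.ofReal_le_ofReal ?_)⟩
    rw [hμ4]
    exact le_add_of_nonneg_left (abs_nonneg _)
  have hc' : ∀ k, diamondNorm (((Pi n).dec k).map ∘ₗ ((Pi n).enc k).map - embedBot (Pi n).M) ≤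
      ENNReal.ofReal (μ n ^ 4) := fun k => (hc n k).trans (ENNReal.ofReal_le_ofReal (by
    rw [hμ4]
    exact (le_abs_self _).trans (le_add_of_nonneg_right (hδ0 n).le)))
  have hmain := abs_qaeReal_sub_qaeIdeal_le (R := Fin n → Bool) (hμ0 n) hμn.le hQ' hMn hc' (A n)
  have hqn : ((A n).queries.length : ℝ) ≤ (q.eval n : ℕ) := by exact_mod_cast hq n
  have hcard : (Fintype.card (Fin n → Bool) : ℝ) = 2 ^ n := by simp
  rw [hcard, div_eq_mul_inv, ← inv_pow] at hmain
  simp only [Function.comp_apply, abs_abs]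
  refine hmain.trans (le_trans ?_ (le_abs_self _))
  simp only [Polynomial.eval_mul, Polynomial.eval_pow, Polynomial.eval_add, Polynomial.eval_one,
    Polynomial.eval_ofNat, Nat.cast_mul, Nat.cast_pow, Nat.cast_add, Nat.cast_one, Nat.cast_ofNat]
  have := (hμ0 n).le
  gcongr

theorem mainTheorem1 (Pi : ℕ → QScheme) (hcorrect : IsCorrect Pi)
    (hM : ∀ᶠ n in Filter.atTop, 2 ≤ Fintype.card (Pi n).M)
    (D : ∀ n, Decomposition (Pi n)) (hQCA : IsQCA Pi D) :
    IsCorrect (fun n => (Pi n).withRandomFunction (Fin n → Bool)) ∧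
      IsQAE (fun n => (Pi n).withRandomFunction (Fin n → Bool))
        (fun n => (D n).withRandomFunction (Fin n → Bool)) :=
  ⟨hcorrect.withRandomFunction _, hQCA.isQAE_withRandomFunction hcorrect hM⟩

end
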